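/- Let $M\ge 1$ and let $\psi\in L^2(\mathbb R^M)$ be an arbitrary pure $M$-mode Gaussian state (a unit vector whose characteristic function, equivalently Wigner function, is Gaussian with some mean and covariance matrix). Consider one qubit and $M$ modes and, for a depth $L\ge1$ and an energy $E>0$, the random circuit $$U=\prod_{\ell=1}^{L}\prod_{j=1}^{M}U^{(j)}_{\rm ECD}\big(\beta^{(j)}_\ell\big)\,U_{\rm R}(\theta_{\ell,j},\phi_{\ell,j}),$$ in which the blocks act layer after layer and, within a layer, on the modes $j=1,\dots,M$ in turn (the block $(\ell,j)=(1,1)$ acts first). Here $U_{\rm R}(\theta,\phi)=\exp[-\tfrac{i\theta}{2}(\cos\phi\,\sigma^x+\sin\phi\,\sigma^y)]$ is a qubit rotation, and $U^{(j)}_{\rm ECD}(\beta)=D_j(\beta)\otimes|1\rangle\langle0|+D_j(-\beta)\otimes|0\rangle\langle1|$ with $D_j(\beta)=\exp(\beta m_j^\dagger-\beta^*m_j)$ the displacement operator of mode $j$. All parameters are independent, the angles $\theta_{\ell,j},\phi_{\ell,j}$ are uniform on $[0,2\pi)$, and each $\beta^{(j)}_\ell$ is complex Gaussian with mean $0$ and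 $\mathbb E|\beta^{(j)}_\ell|^2=E/L$ (real and imaginary parts independent, of variance $E/(2L)$ each). Let $$C=\langle\Psi|\big(|0\rangle\langle0|\otimes|\psi\rangle\langle\psi|\big)|\Psi\rangle,\qquad \Psi=U\,|0\rangle\otimes|{\rm vac}\rangle,$$ where $|{\rm vac}\rangle$ is the $M$-mode vacuum, and let $\partial_kC$ be the derivative of $C$ with respect to the rotation angle $\theta_k$ of any one block $k=(\ell,j)$. There are constants $c_1,c_2>0$ depending only on $M$ such that for every such $\psi$ the following holds. 1. (Zero mean.) For all $L\ge1$, $E>0$ and $k$, $C$ is differentiable in $\theta_k$, $\partial_kC$ is square-integrable, and $\mathbb E[\partial_kC]=0$. 2. (Shallow circuits, ${\rm Var}\sim1/E^{M}$.) There are $a,b,E_0>0$, depending only on $M$ and $\psi$, such that for all $E\ge E_0$, all $1\le L\le c_1\log E$ and all $k$, $$a\Big(\frac34\Big)^{ML}\frac1{E^M}\le{\rm Var}[\partial_kC]\le b\Big(\frac34\Big)^{ML}\frac1{E^M}.$$ In particular, for every fixed depth $L\ge 1$ and every $k$, ${\rm Var}[\partial_kC]=\Theta(1/E^M)$ as $E\to\infty$.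 3. (Deep circuits, ${\rm Var}\sim1/E^{2M}$.) There are $a,b,E_0>0$, depending only on $M$ and $\psi$, such that for all $E\ge E_0$, all $L\ge c_2\log E$ and all $k$, $$\frac{a}{E^{2M}}\le{\rm Var}[\partial_kC]\le\frac{b}{E^{2M}}.$$ -/

import Mathlib

open MeasureTheory ProbabilityTheory
open scoped ComplexConjugate

noncomputable section

namespace QumodeVQC

/-! ### One qubit and `M` modes in the position representation

Quadratures are normalized as `q = m + m†`, `p = i (m† - m)`, so `[q, p] = 2i`, `p = -2i d/dq`, and
the vacuum has covariance matrix `I`. -/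

/-- Wave functions of `M` modes, as functions of the position quadratures. -/
abbrev Wave (M : ℕ) : Type := (Fin M → ℝ) → ℂ

/-- Wave functions of one qubit and `M` modes: `Ψ a` is the component along the qubit state `|a⟩`. -/
abbrev QWave (M : ℕ) : Type := Fin 2 → Wave M

/-- The inner product `⟨f|g⟩` of `L²(ℝ^M)`, antilinear in the first argument. -/
def braket {M : ℕ} (f g : Wave M) : ℂ := ∫ q, conj (f q) * g q

/-- The vacuum `|0⟩ ⊗ ⋯ ⊗ |0⟩`, which every `m_j = (q_j + i p_j) / 2` annihilates. -/
def vacuum (M : ℕ) : Wave M :=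
  fun q => ∏ j, (((2 * Real.pi) ^ (-(1 / 4) : ℝ) * Real.exp (-(q j) ^ 2 / 4) : ℝ) : ℂ)

/-- The displacement operator `D(α) = exp (∑ j, (α_j m_j† - conj α_j m_j))`. Its exponent is
`∑ j, (i Im α_j q_j - 2 Re α_j d/dq_j)`, which exponentiates to a translation and a phase. -/
def displace {M : ℕ} (α : Fin M → ℂ) (f : Wave M) : Wave M :=
  fun q => Complex.exp (Complex.I * ((∑ j, (α j).im * (q j - (α j).re) : ℝ) : ℂ)) *
    f (fun j => q j - 2 * (α j).re)

/-! ### Pure Gaussian states -/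

/-- The coefficients of `α_j m_j† - conj α_j m_j = i (Im α_j q_j - Re α_j p_j)` along the
quadratures; the index `(j, 0)` stands for `q_j` and `(j, 1)` for `p_j`. -/
def phaseVector {M : ℕ} (α : Fin M → ℂ) : Fin M × Fin 2 → ℝ :=
  fun i => if i.2 = 0 then (α i.1).im else -(α i.1).re

/-- A pure `M`-mode Gaussian state: a unit vector of `L²(ℝ^M)` whose characteristic function
`α ↦ ⟨ψ|D(α)|ψ⟩`, the Fourier transform of its Wigner function, is Gaussian. Here `X` is the mean
and `V` the covariance matrix of the quadratures `(q_1, p_1, …, q_M, p_M)`. -/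
def IsPureGaussian {M : ℕ} (ψ : Wave M) : Prop :=
  MemLp ψ 2 volume ∧ braket ψ ψ = 1 ∧
    ∃ (X : Fin M × Fin 2 → ℝ) (V : Matrix (Fin M × Fin 2) (Fin M × Fin 2) ℝ), V.IsSymm ∧
      ∀ α : Fin M → ℂ, braket ψ (displace α ψ) =
        Complex.exp (Complex.I * ((phaseVector α ⬝ᵥ X : ℝ) : ℂ) -
          ((phaseVector α ⬝ᵥ V.mulVec (phaseVector α) / 2 : ℝ) : ℂ))

/-! ### The circuit -/

/-- The qubit rotation `U_R(θ, φ) = exp (-i θ/2 (cos φ σˣ + sin φ σʸ))`; the matrix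
`cos φ σˣ + sin φ σʸ` squares to `1`. -/
def qubitRotation (θ φ : ℝ) : Matrix (Fin 2) (Fin 2) ℂ :=
  (Real.cos (θ / 2) : ℂ) • (1 : Matrix (Fin 2) (Fin 2) ℂ) -
    (Complex.I * (Real.sin (θ / 2) : ℂ)) •
      ((Real.cos φ : ℂ) • !![0, 1; 1, 0] + (Real.sin φ : ℂ) • !![0, -Complex.I; Complex.I, 0])

/-- A qubit operator, acting trivially on the modes. -/
def onQubit {M : ℕ} (R : Matrix (Fin 2) (Fin 2) ℂ) (Ψ : QWave M) : QWave M :=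
  fun a q => ∑ b, R a b * Ψ b q

/-- The echoed conditional displacement of mode `j`,
`U_ECD(β) = D_j(β) ⊗ |1⟩⟨0| + D_j(-β) ⊗ |0⟩⟨1|`. -/
def ecd {M : ℕ} (j : Fin M) (β : ℂ) (Ψ : QWave M) : QWave M :=
  ![displace (Pi.single j (-β)) (Ψ 1), displace (Pi.single j β) (Ψ 0)]

/-- The blocks of an `M`-mode, `L`-layer circuit: `(l, j)` is the block of layer `l` on mode `j`. -/
abbrev Block (L M : ℕ) : Type := Fin L × Fin M

/-- The parameters `(θ, φ, β)` of every block. -/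
abbrev Params (L M : ℕ) : Type := Block L M → ℝ × ℝ × ℂ

/-- The output state of the circuit on `|0⟩ ⊗ vacuum`. The blocks act layer after layer, in each
layer from the first mode to the last, in each block the rotation before the ECD gate. -/
def output {L M : ℕ} (x : Params L M) : QWave M :=
  ((List.finRange L) ×ˢ (List.finRange M)).foldl
    (fun Ψ g => ecd g.2 (x g).2.2 (onQubit (qubitRotation (x g).1 (x g).2.1) Ψ))
    ![vacuum M, 0]

/-- The cost function: the expectation of `O = |0⟩⟨0| ⊗ |ψ⟩⟨ψ|` in the output state. -/
def cost {L M : ℕ} (ψ : Wave M) (x : Params L M) : ℝ :=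
  ‖braket ψ (output x 0)‖ ^ 2

/-- The cost as a function of the rotation angle `θ` of block `k`, the others being as in `x`. -/
def costAlong {L M : ℕ} (ψ : Wave M) (k : Block L M) (x : Params L M) (t : ℝ) : ℝ :=
  cost ψ (Function.update x k (t, (x k).2))

/-- The gradient `∂C/∂θ_k` at `x`. -/
def grad {L M : ℕ} (ψ : Wave M) (k : Block L M) (x : Params L M) : ℝ :=
  deriv (costAlong ψ k x) (x k).1

/-! ### The energy-regularized ensemble -/

/-- The uniform distribution on `[0, 2π)`. -/
def uniformAngle : Measure ℝ := cond volume (Set.Ico 0 (2 * Real.pi))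

/-- The complex Gaussian distribution of mean zero and variance `v`: the real and the imaginary part
are independent, of mean zero and variance `v / 2`. -/
def complexGaussian (v : ℝ) : Measure ℂ :=
  ((gaussianReal 0 (v / 2).toNNReal).prod (gaussianReal 0 (v / 2).toNNReal)).map
    (fun z : ℝ × ℝ => (⟨z.1, z.2⟩ : ℂ))

/-- The energy-regularized ensemble: all parameters are independent, the angles uniform on
`[0, 2π)` and the displacements complex Gaussian of variance `E / L`. -/
def ensemble (E : ℝ) (L M : ℕ) : Measure (Params L M) :=
  Measure.pi fun _ => uniformAngle.prod (uniformAngle.prod (complexGaussian (E / L)))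

end QumodeVQC

end

open QumodeVQC

noncomputable section

namespace QumodeVQC

open scoped NNReal

/-! ### Averages over the block parameters -/

/-! Reduction to `E[C²]`. In the angles of one block the amplitude is `cos(θ/2) w + sin(θ/2) (cos φ
u₀ + sin φ u₁)`, so the gradient is half the difference of the costs at `θ ± π/2`. Averaging over
`θ` gives mean zero and `Var ≤ E[C²]`. Conversely, Parseval in `φ` shows that the averaged squared
gradient controls `w`, `u₀` and `u₁` all together, whence `E[C²] ≤ 192 Var`
(`le_integral_rotGrad_sq`). It remains to estimate the fourth moment of the overlap with `ψ`.

Lower bounds (`le_average_braket`). The observable is pulled back through the circuit. Averaging one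
rotation keeps at least the fraction `3/4` of the sum of fourth powers of the overlaps with the two
qubit components, and all of the sum of squares; each random displacement widens a Gaussian. Fourth
powers give `(3/4)^(ML) / E^M`. Squares give `E[C] ≳ 1 / E^M`, and then `E[C²] ≥ E[C]²` gives `1 /
E^(2M)`. The only input on `ψ` is that its overlaps with coherent states lie between two Gaussians.

Upper bounds. Coherent states and Moyal's identity reduce `E[C²]` to averages of `χ(ξ) conj χ(ξ')`,
where `χ` is the characteristic function of the output. Averaging over a rotation leaves three
quadratic forms, mixed by the matrix `1 - u uᵀ / 4` with `u = (1, -1, -1)`. With centre `ζ = (ξ +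
ξ') / 2` and difference `η = ξ - ξ'`, a displacement of mode `j` with `v = E / L` multiplies the
first form by `exp(-v |η_j|²)` and the second by `exp(-4 v |ζ_j|²)`, and convolves the third with a
Gaussian in `ζ_j`. The difference `η` is conserved, and the forms remain combinations of explicit
Gaussians in `ζ` (`average_secondMoment`).

Shallow circuits. The evolution is expanded into words recording which form is occupied at each
block. The `3^M` words constant on each mode have weight at most `(3/4)^(ML)` and integral of order
`E^(-M)`. Every other word gains a factor `L² / E` on some mode, which beats the total weight
`(5/4)^(ML)` as long as `(5/3)^(ML) L² ≤ E`; this is the logarithmic depth condition.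

Deep circuits. The sum of the squared `L²` norms of the three forms never increases, and the second
and third forms are Fourier transforms of each other. A Nash inequality (`exists_energy_le_nash`)
brings this energy down to order `E^(-M)`. An uncertainty principle (`exists_energy_le_uncertainty`)
gives exponential decay at a rate set by `v` and `v |η|²`, because a function and its Fourier
transform cannot both be concentrated near the origin and nearly opposite. Each block being a
product of self-adjoint maps, the circuit can be cut in the middle and both halves estimated by
their energies. Integrating `E^(-2M) exp(-|η|²/2) + E^(-M) exp(-c E |η|²)` over `η` gives `E^(-2M)`.
-/

instance : IsProbabilityMeasure uniformAngle := by
  unfold uniformAngle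
  refine cond_isProbabilityMeasure_of_finite ?_ ?_
  · simp [Real.volume_Ico, Real.pi_pos]
  · rw [Real.volume_Ico]; exact ENNReal.ofReal_ne_top

theorem integral_uniformAngle {E : Type*} [NormedAddCommGroup E] [NormedSpace ℝ E] (f : ℝ → E) :
    ∫ t, f t ∂uniformAngle = (2 * Real.pi)⁻¹ • ∫ t in (0 : ℝ)..(2 * Real.pi), f t := by
  rw [intervalIntegral.integral_of_le (by positivity), ← integral_Ico_eq_integral_Ioc]
  unfold uniformAngle ProbabilityTheory.cond
  rw [integral_smul_measure]
  congr 1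
  rw [Real.volume_Ico, sub_zero, ENNReal.toReal_inv, ENNReal.toReal_ofReal (by positivity)]

theorem integrable_of_continuous_uniformAngle {E : Type*} [NormedAddCommGroup E]
    {f : ℝ → E} (hf : Continuous f) : Integrable f uniformAngle := by
  unfold uniformAngle ProbabilityTheory.cond
  refine Integrable.smul_measure ?_ (by simp [Real.volume_Ico, Real.pi_pos])
  exact (hf.integrableOn_Icc (a := 0) (b := 2 * Real.pi)).mono_set Set.Ico_subset_Icc_self

theorem integral_uniformAngle_add {E : Type*} [NormedAddCommGroup E] [NormedSpace ℝ E]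
    {f : ℝ → E} (hf : Function.Periodic f (2 * Real.pi)) (c : ℝ) :
    ∫ t, f (t + c) ∂uniformAngle = ∫ t, f t ∂uniformAngle := by
  rw [integral_uniformAngle, integral_uniformAngle]
  congr 1
  rw [intervalIntegral.integral_comp_add_right]
  have := hf.intervalIntegral_add_eq c 0
  simpa [add_comm] using this

theorem integral_uniformAngle_exp (n : ℤ) :
    ∫ t, Complex.exp (Complex.I * n * t) ∂uniformAngle = if n = 0 then 1 else 0 := by
  rw [integral_uniformAngle]
  split_ifs with h
  · subst h
    simp
    field_simp
  · have hc : Complex.I * (n : ℂ) ≠ 0 := by simp [h, Complex.I_ne_zero]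
    rw [integral_exp_mul_complex hc]
    have : Complex.I * (n : ℂ) * ((2 * Real.pi : ℝ) : ℂ) = n * (2 * Real.pi * Complex.I) := by
      push_cast; ring
    rw [this, Complex.exp_int_mul_two_pi_mul_I]
    simp

/-- Parseval for trigonometric polynomials of degree one. -/
theorem integral_uniformAngle_trig (a b c a' b' c' : ℂ) :
    ∫ t, (a + b * Complex.exp (Complex.I * (t : ℝ)) + c * Complex.exp (-(Complex.I * (t : ℝ)))) *
      conj (a' + b' * Complex.exp (Complex.I * (t : ℝ)) +
        c' * Complex.exp (-(Complex.I * (t : ℝ)))) ∂uniformAngle =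
    a * conj a' + b * conj b' + c * conj c' := by
  have key : ∀ t : ℝ, (a + b * Complex.exp (Complex.I * t) + c * Complex.exp (-(Complex.I * t))) *
      conj (a' + b' * Complex.exp (Complex.I * t) + c' * Complex.exp (-(Complex.I * t))) =
      (a * conj a' + b * conj b' + c * conj c') +
      ((b * conj a' + a * conj c') * Complex.exp (Complex.I * (1 : ℤ) * t) +
      (c * conj a' + a * conj b') * Complex.exp (Complex.I * (-1 : ℤ) * t) +
      (b * conj c') * Complex.exp (Complex.I * (2 : ℤ) * t) +
      (c * conj b') * Complex.exp (Complex.I * (-2 : ℤ) * t)) := by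
    intro t
    have e1 : conj (Complex.exp (Complex.I * t)) = Complex.exp (-(Complex.I * t)) := by
      rw [← Complex.exp_conj]; simp
    have e2 : conj (Complex.exp (-(Complex.I * t))) = Complex.exp (Complex.I * t) := by
      rw [← Complex.exp_conj]; simp
    have e3 : Complex.exp (Complex.I * (1 : ℤ) * t) = Complex.exp (Complex.I * t) := by simp
    have e4 : Complex.exp (Complex.I * (-1 : ℤ) * t) = Complex.exp (-(Complex.I * t)) := by
      congr 1; push_cast; ring
    have e5 : Complex.exp (Complex.I * (2 : ℤ) * t) = Complex.exp (Complex.I * t) ^ 2 := by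
      rw [← Complex.exp_nat_mul]; congr 1; push_cast; ring
    have e6 : Complex.exp (Complex.I * (-2 : ℤ) * t) = Complex.exp (-(Complex.I * t)) ^ 2 := by
      rw [← Complex.exp_nat_mul]; congr 1; push_cast; ring
    have e7 : Complex.exp (Complex.I * t) * Complex.exp (-(Complex.I * t)) = 1 := by
      rw [← Complex.exp_add]; simp
    rw [e3, e4, e5, e6]
    simp only [map_add, map_mul, e1, e2]
    linear_combination (b * conj b' + c * conj c') * e7
  simp_rw [key]
  rw [integral_add, integral_const, integral_add, integral_add, integral_add]
  · simp only [integral_const_mul, integral_uniformAngle_exp]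
    simp
  all_goals exact integrable_of_continuous_uniformAngle (by fun_prop)

/-- The average of a trigonometric polynomial of degree two. -/
theorem integral_uniformAngle_cos_sin (A B C D G : ℂ) :
    ∫ t : ℝ, (A + B * (Real.cos t : ℂ) + C * (Real.sin t : ℂ) + D * (Real.cos t : ℂ) ^ 2 +
      G * ((Real.sin t : ℂ) * (Real.cos t : ℂ))) ∂uniformAngle = A + D / 2 := by
  have key : ∀ t : ℝ, A + B * (Real.cos t : ℂ) + C * (Real.sin t : ℂ) + D * (Real.cos t : ℂ) ^ 2 +
      G * ((Real.sin t : ℂ) * (Real.cos t : ℂ)) = (A + D / 2) +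
      ((B / 2 - C * Complex.I / 2) * Complex.exp (Complex.I * (1 : ℤ) * t) +
      (B / 2 + C * Complex.I / 2) * Complex.exp (Complex.I * (-1 : ℤ) * t) +
      (D / 4 - G * Complex.I / 4) * Complex.exp (Complex.I * (2 : ℤ) * t) +
      (D / 4 + G * Complex.I / 4) * Complex.exp (Complex.I * (-2 : ℤ) * t)) := by
    intro t
    have e (n : ℤ) : Complex.exp (Complex.I * n * t) =
        Complex.cos (n * t) + Complex.sin (n * t) * Complex.I := by
      rw [← Complex.exp_mul_I]; congr 1; ring
    rw [e, e, e, e]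
    push_cast
    simp only [neg_mul, one_mul, Complex.cos_neg, Complex.sin_neg, Complex.cos_two_mul,
      Complex.sin_two_mul]
    have hI := Complex.I_sq
    linear_combination (C * Complex.sin t + G * Complex.sin t * Complex.cos t) * hI
  simp_rw [key]
  rw [integral_add, integral_const, integral_add, integral_add, integral_add]
  · simp only [integral_const_mul, integral_uniformAngle_exp]
    simp
  all_goals exact integrable_of_continuous_uniformAngle (by fun_prop)

theorem measurable_complex_mk : Measurable (fun z : ℝ × ℝ => (⟨z.1, z.2⟩ : ℂ)) :=
  Complex.measurableEquivRealProd.symm.measurable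

instance (v : ℝ) : IsProbabilityMeasure (complexGaussian v) :=
  Measure.isProbabilityMeasure_map measurable_complex_mk.aemeasurable

theorem integral_complexGaussian_prod {v : ℝ} (f g : ℝ → ℂ) :
    ∫ b : ℂ, f b.re * g b.im ∂(complexGaussian v) =
      (∫ x, f x ∂(gaussianReal 0 (v / 2).toNNReal)) *
        ∫ y, g y ∂(gaussianReal 0 (v / 2).toNNReal) := by
  rw [complexGaussian, ← integral_prod_mul]
  exact Complex.measurableEquivRealProd.symm.measurableEmbedding.integral_map _

theorem integral_complexGaussian_exp {v : ℝ} (hv : 0 ≤ v) (s t : ℝ) :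
    ∫ b : ℂ, Complex.exp (Complex.I * ((s * b.re + t * b.im : ℝ) : ℂ)) ∂(complexGaussian v) =
      Real.exp (-v * (s ^ 2 + t ^ 2) / 4) := by
  have h1 : ∀ b : ℂ, Complex.exp (Complex.I * ((s * b.re + t * b.im : ℝ) : ℂ)) =
      Complex.exp (s * b.re * Complex.I) * Complex.exp (t * b.im * Complex.I) := by
    intro b; rw [← Complex.exp_add]; congr 1; push_cast; ring
  simp_rw [h1]
  rw [integral_complexGaussian_prod (fun x => Complex.exp (s * x * Complex.I))
    (fun x => Complex.exp (t * x * Complex.I))]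
  have h2 : ∀ u : ℝ, ∫ x : ℝ, Complex.exp (u * x * Complex.I) ∂(gaussianReal 0 (v / 2).toNNReal) =
      Complex.exp (-v * u ^ 2 / 4) := by
    intro u
    have := charFun_gaussianReal (μ := 0) (v := (v / 2).toNNReal) u
    rw [charFun_apply_real] at this
    rw [this]
    congr 1
    rw [Real.coe_toNNReal _ (by positivity)]
    push_cast
    ring
  rw [h2, h2, ← Complex.exp_add]
  push_cast
  congr 1
  ring

theorem integral_gaussianReal_exp_sq {v a : ℝ} (hv : 0 < v) (ha : 0 ≤ a) (x t : ℝ) :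
    ∫ y : ℝ, Real.exp (-a * (x + t * y) ^ 2) ∂(gaussianReal 0 v.toNNReal) =
      (1 + 2 * a * t ^ 2 * v) ^ (-(1 / 2) : ℝ) *
        Real.exp (-(a / (1 + 2 * a * t ^ 2 * v)) * x ^ 2) := by
  have hv' : v.toNNReal ≠ 0 := by simpa using hv
  rw [integral_gaussianReal_eq_integral_smul hv']
  set w : ℝ := 1 + 2 * a * t ^ 2 * v with hw
  have hw0 : 0 < w := by positivity
  have hb : (0 : ℝ) < w / (2 * v) := by positivity
  -- Completing the square in `y`: the product is a Gaussian in `y` of variance `v / w` centred at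
  -- `-2 a x t v / w`, times the asserted function of `x`.
  have h1 : ∀ y : ℝ, gaussianPDFReal 0 v.toNNReal y • Real.exp (-a * (x + t * y) ^ 2) =
      ((2 * Real.pi * v) ^ (-(1 / 2) : ℝ) * Real.exp (-(a / w) * x ^ 2)) *
        Real.exp (-(w / (2 * v)) * (y + 2 * a * x * t * v / w) ^ 2) := by
    intro y
    rw [gaussianPDFReal, Real.coe_toNNReal _ hv.le, smul_eq_mul, mul_assoc, mul_assoc _ (Real.exp _),
      ← Real.exp_add, ← Real.exp_add]
    congr 1
    · rw [Real.sqrt_eq_rpow, Real.rpow_neg (by positivity)]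
    · congr 1
      field_simp
      rw [hw]
      ring
  simp_rw [h1]
  rw [integral_const_mul,
    integral_add_right_eq_self (fun y : ℝ => Real.exp (-(w / (2 * v)) * y ^ 2)),
    integral_gaussian, Real.sqrt_eq_rpow]
  have h2 : Real.pi / (w / (2 * v)) = (2 * Real.pi * v) * w⁻¹ := by field_simp
  rw [h2, Real.mul_rpow (x := 2 * Real.pi * v) (by positivity) (by positivity),
    Real.inv_rpow hw0.le, ← Real.rpow_neg hw0.le, Real.rpow_neg (by positivity : (0:ℝ) ≤ 2 * Real.pi * v)]
  have : (2 * Real.pi * v) ^ (1 / 2 : ℝ) ≠ 0 := by positivity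
  field_simp

theorem integral_complexGaussian_exp_sq {v a : ℝ} (hv : 0 < v) (ha : 0 ≤ a) (z : ℂ) (t : ℝ) :
    ∫ b : ℂ, Real.exp (-a * ‖z + t * b‖ ^ 2) ∂(complexGaussian v) =
      (1 + a * t ^ 2 * v)⁻¹ * Real.exp (-(a / (1 + a * t ^ 2 * v)) * ‖z‖ ^ 2) := by
  have hv2 : (0 : ℝ) < v / 2 := by positivity
  have hn : ∀ w : ℂ, ‖w‖ ^ 2 = w.re ^ 2 + w.im ^ 2 := fun w => by
    rw [← Complex.normSq_eq_norm_sq, Complex.normSq_apply]; ring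
  have h1 : ∀ b : ℂ, ((Real.exp (-a * ‖z + t * b‖ ^ 2) : ℝ) : ℂ) =
      ((Real.exp (-a * (z.re + t * b.re) ^ 2) : ℝ) : ℂ) *
        ((Real.exp (-a * (z.im + t * b.im) ^ 2) : ℝ) : ℂ) := by
    intro b
    rw [← Complex.ofReal_mul, ← Real.exp_add, hn]
    congr 2
    simp
    ring
  apply Complex.ofReal_injective
  rw [← integral_complex_ofReal]
  simp_rw [h1]
  rw [integral_complexGaussian_prod
    (fun x => ((Real.exp (-a * (z.re + t * x) ^ 2) : ℝ) : ℂ))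
    (fun x => ((Real.exp (-a * (z.im + t * x) ^ 2) : ℝ) : ℂ)), integral_complex_ofReal,
    integral_complex_ofReal, integral_gaussianReal_exp_sq hv2 ha, integral_gaussianReal_exp_sq hv2 ha,
    ← Complex.ofReal_mul]
  congr 1
  have e : 1 + 2 * a * t ^ 2 * (v / 2) = 1 + a * t ^ 2 * v := by ring
  rw [e]
  set w := 1 + a * t ^ 2 * v
  have hw : 0 < w := by positivity
  have : w⁻¹ = w ^ (-(1 / 2) : ℝ) * w ^ (-(1 / 2) : ℝ) := by
    rw [← Real.rpow_add hw]; norm_num [Real.rpow_neg_one]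
  rw [this, hn]
  have : Real.exp (-(a / w) * (z.re ^ 2 + z.im ^ 2)) =
      Real.exp (-(a / w) * z.re ^ 2) * Real.exp (-(a / w) * z.im ^ 2) := by
    rw [← Real.exp_add]; congr 1; ring
  rw [this]; ring

/-! ### Resampling one coordinate of a product measure -/

/-- Redrawing one coordinate independently leaves a product measure unchanged. This allows the
parameters of a single block to be averaged while all others stay frozen. -/
theorem measurePreserving_update {ι X : Type*} [Fintype ι] [DecidableEq ι] [MeasurableSpace X]
    (μ : ι → Measure X) [∀ i, IsProbabilityMeasure (μ i)] (k : ι) :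
    MeasurePreserving (fun z : (ι → X) × X => Function.update z.1 k z.2)
      ((Measure.pi μ).prod (μ k)) (Measure.pi μ) := by
  have hm : Measurable (fun z : (ι → X) × X => Function.update z.1 k z.2) := by
    rw [measurable_pi_iff]
    intro i
    by_cases h : i = k
    · subst h; simpa using measurable_snd
    · simp only [Function.update_apply, h, if_false]; fun_prop
  refine ⟨hm, (Measure.pi_eq fun s hs => ?_).symm⟩
  rw [Measure.map_apply hm (MeasurableSet.univ_pi hs)]
  have : (fun z : (ι → X) × X => Function.update z.1 k z.2) ⁻¹' Set.univ.pi s =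
      (Set.univ.pi (Function.update s k Set.univ)) ×ˢ s k := by
    ext z
    simp only [Set.mem_preimage, Set.mem_pi, Set.mem_univ, true_imp_iff, Set.mem_prod]
    constructor
    · intro h
      refine ⟨fun i => ?_, by simpa using h k⟩
      by_cases hi : i = k
      · subst hi; simp
      · simpa [Function.update_apply, hi] using h i
    · rintro ⟨h1, h2⟩ i
      by_cases hi : i = k
      · subst hi; simpa using h2
      · simpa [Function.update_apply, hi] using h1 i
  rw [this, Measure.prod_prod, Measure.pi_pi, ← Finset.mul_prod_erase _ _ (Finset.mem_univ k),
    ← Finset.mul_prod_erase (s := Finset.univ) (f := fun i => μ i (s i)) (a := k)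
      (Finset.mem_univ k)]
  simp only [Function.update_self, measure_univ, one_mul]
  rw [mul_comm]
  congr 1
  refine Finset.prod_congr rfl fun i hi => ?_
  rw [Function.update_of_ne (Finset.ne_of_mem_erase hi)]

theorem integral_pi_update {ι X E : Type*} [Fintype ι] [DecidableEq ι] [MeasurableSpace X]
    [NormedAddCommGroup E] [NormedSpace ℝ E]
    (μ : ι → Measure X) [∀ i, IsProbabilityMeasure (μ i)] (k : ι) {f : (ι → X) → E}
    (hf : AEStronglyMeasurable f (Measure.pi μ)) :
    ∫ x, f x ∂Measure.pi μ =
      ∫ z, f (Function.update z.1 k z.2) ∂((Measure.pi μ).prod (μ k)) := by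
  have h := measurePreserving_update μ k
  have h1 := integral_map h.measurable.aemeasurable (f := f) (by rwa [h.map_eq])
  rwa [h.map_eq] at h1

/-! ### The Weyl algebra of displacements -/

section Weyl

variable {M : ℕ}

/-- The squared Euclidean norm of a phase space point. -/
def normSqSum (z : Fin M → ℂ) : ℝ := ∑ j, ‖z j‖ ^ 2

theorem normSqSum_nonneg (z : Fin M → ℂ) : 0 ≤ normSqSum z :=
  Finset.sum_nonneg fun _ _ => by positivity

theorem normSqSum_eq (z : Fin M → ℂ) : normSqSum z = ∑ j, ((z j).re ^ 2 + (z j).im ^ 2) :=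
  Finset.sum_congr rfl fun j _ => by
    rw [← Complex.normSq_eq_norm_sq, Complex.normSq_apply]; ring

@[fun_prop]
theorem continuous_normSqSum : Continuous (normSqSum : (Fin M → ℂ) → ℝ) := by
  unfold normSqSum; fun_prop

/-- The symplectic form `∑ j, Im (a_j conj b_j)`. -/
def sympl (a b : Fin M → ℂ) : ℝ := ∑ j, ((a j).im * (b j).re - (a j).re * (b j).im)

@[fun_prop]
theorem Continuous.sympl {X : Type*} [TopologicalSpace X] {a b : X → Fin M → ℂ}
    (ha : Continuous a) (hb : Continuous b) : Continuous fun x => sympl (a x) (b x) := by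
  unfold QumodeVQC.sympl; fun_prop

theorem displace_displace (a b : Fin M → ℂ) (f : Wave M) :
    displace a (displace b f) =
      fun q => Complex.exp (Complex.I * (sympl a b : ℝ)) * displace (a + b) f q := by
  funext q
  simp only [displace, ← mul_assoc, ← Complex.exp_add]
  congr 1
  · congr 1
    rw [← mul_add, ← mul_add]
    congr 1
    rw [← Complex.ofReal_add, ← Complex.ofReal_add]
    congr 1
    simp only [sympl, ← Finset.sum_add_distrib]
    refine Finset.sum_congr rfl fun j _ => ?_
    simp
    ring
  · congr 1
    funext j
    simp
    ring

theorem displace_zero (f : Wave M) : displace 0 f = f := by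
  funext q; simp [displace]

theorem braket_displace_left (a : Fin M → ℂ) (f g : Wave M) :
    braket (displace a f) g = braket f (displace (-a) g) := by
  unfold braket
  rw [← integral_add_right_eq_self _ (fun j => 2 * (a j).re)]
  congr 1
  funext q
  have h1 : (fun j => (q + fun j => 2 * (a j).re) j - 2 * (a j).re) = q := by
    funext j; simp
  have h2 : (fun j => q j - 2 * ((-a) j).re) = q + fun j => 2 * (a j).re := by
    funext j; simp
  simp only [displace, h1, h2, map_mul]
  rw [mul_comm (conj (Complex.exp _)), mul_assoc]
  congr 2
  rw [← Complex.exp_conj]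
  congr 1
  rw [map_mul, Complex.conj_I, Complex.conj_ofReal, neg_mul, ← mul_neg]
  congr 1
  rw [← Complex.ofReal_neg]
  congr 1
  rw [← Finset.sum_neg_distrib]
  refine Finset.sum_congr rfl fun j _ => ?_
  simp only [Pi.add_apply, Pi.neg_apply, Complex.neg_im, Complex.neg_re]
  ring

theorem braket_mul_right (c : ℂ) (f g : Wave M) :
    braket f (fun q => c * g q) = c * braket f g := by
  simp only [braket, ← integral_const_mul]
  congr 1; funext q; ring

theorem braket_mul_left (c : ℂ) (f g : Wave M) :
    braket (fun q => c * f q) g = conj c * braket f g := by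
  simp only [braket, ← integral_const_mul]
  congr 1; funext q; simp; ring

theorem braket_conj_symm (f g : Wave M) : conj (braket f g) = braket g f := by
  simp only [braket, ← integral_conj]
  congr 1; funext q; simp [mul_comm]

theorem braket_congr {f f' g g' : Wave M} (hf : f =ᵐ[volume] f') (hg : g =ᵐ[volume] g') :
    braket f g = braket f' g' := by
  refine integral_congr_ae ?_
  filter_upwards [hf, hg] with q h1 h2
  rw [h1, h2]

theorem displace_congr (a : Fin M → ℂ) {f f' : Wave M} (hf : f =ᵐ[volume] f') :
    displace a f =ᵐ[volume] displace a f' := by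
  have := (measurePreserving_sub_right (volume : Measure (Fin M → ℝ))
    (fun j => 2 * (a j).re)).quasiMeasurePreserving.ae_eq_comp hf
  filter_upwards [this] with q hq
  simp only [displace]
  congr 1

theorem norm_displace (a : Fin M → ℂ) (f : Wave M) (q : Fin M → ℝ) :
    ‖displace a f q‖ = ‖f (fun j => q j - 2 * (a j).re)‖ := by
  rw [displace, norm_mul, mul_comm Complex.I, Complex.norm_exp_ofReal_mul_I, one_mul]

theorem MemLp.displace {f : Wave M} (hf : MemLp f 2 volume) (a : Fin M → ℂ) :
    MemLp (displace a f) 2 volume := by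
  have h := hf.comp_measurePreserving (measurePreserving_sub_right
    (volume : Measure (Fin M → ℝ)) (fun j => 2 * (a j).re))
  refine (memLp_congr_norm ?_ h.1 ?_).2 h
  · refine AEStronglyMeasurable.mul ?_ h.1
    exact Continuous.aestronglyMeasurable (by fun_prop)
  · exact Filter.Eventually.of_forall fun q => norm_displace a f q

theorem integrable_braket {f g : Wave M} (hf : MemLp f 2 volume) (hg : MemLp g 2 volume) :
    Integrable fun q => conj (f q) * g q := by
  have h := L2.integrable_inner (𝕜 := ℂ) (hf.toLp f) (hg.toLp g)
  refine h.congr ?_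
  filter_upwards [hf.coeFn_toLp, hg.coeFn_toLp] with q h1 h2
  rw [h1, h2]; simp [mul_comm]

theorem braket_eq_inner {f g : Wave M} (hf : MemLp f 2 volume) (hg : MemLp g 2 volume) :
    braket f g = inner ℂ (hf.toLp f) (hg.toLp g) := by
  rw [L2.inner_def]
  refine integral_congr_ae ?_
  filter_upwards [hf.coeFn_toLp, hg.coeFn_toLp] with q h1 h2
  rw [h1, h2]; simp [mul_comm]

theorem braket_self {f : Wave M} (hf : MemLp f 2 volume) :
    braket f f = ((braket f f).re : ℂ) ∧ 0 ≤ (braket f f).re := by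
  have h : braket f f = ((‖hf.toLp f‖ ^ 2 : ℝ) : ℂ) := by
    rw [braket_eq_inner hf hf, inner_self_eq_norm_sq_to_K]; norm_cast
  rw [h, Complex.ofReal_re]
  exact ⟨rfl, by positivity⟩

theorem norm_braket_sq_le {f g : Wave M} (hf : MemLp f 2 volume) (hg : MemLp g 2 volume) :
    ‖braket f g‖ ^ 2 ≤ (braket f f).re * (braket g g).re := by
  have h := norm_inner_le_norm (𝕜 := ℂ) (hf.toLp f) (hg.toLp g)
  have h1 : (braket f f).re = ‖hf.toLp f‖ ^ 2 := by
    rw [braket_eq_inner hf hf, inner_self_eq_norm_sq_to_K]; norm_cast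
  have h2 : (braket g g).re = ‖hg.toLp g‖ ^ 2 := by
    rw [braket_eq_inner hg hg, inner_self_eq_norm_sq_to_K]; norm_cast
  rw [← braket_eq_inner hf hg] at h
  rw [h1, h2, ← mul_pow]
  exact pow_le_pow_left₀ (norm_nonneg _) h 2

theorem braket_add_right {f g h : Wave M} (hf : MemLp f 2 volume) (hg : MemLp g 2 volume)
    (hh : MemLp h 2 volume) : braket f (fun q => g q + h q) = braket f g + braket f h := by
  rw [braket, braket, braket, ← integral_add (integrable_braket hf hg) (integrable_braket hf hh)]
  congr 1; funext q; ring

theorem braket_sum_right {ι : Type*} (s : Finset ι) {f : Wave M} {g : ι → Wave M} (c : ι → ℂ)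
    (hf : MemLp f 2 volume) (hg : ∀ i ∈ s, MemLp (g i) 2 volume) :
    braket f (fun q => ∑ i ∈ s, c i * g i q) = ∑ i ∈ s, c i * braket f (g i) := by
  simp only [braket, Finset.mul_sum]
  rw [integral_finsetSum]
  · refine Finset.sum_congr rfl fun i _ => ?_
    rw [← integral_const_mul]
    congr 1; funext q; ring
  · intro i hi
    refine ((integrable_braket hf (hg i hi)).const_mul (c i)).congr ?_
    exact Filter.Eventually.of_forall fun q => by simp only []; ring

theorem braket_sum_left {ι : Type*} (s : Finset ι) {f : Wave M} {g : ι → Wave M} (c : ι → ℂ)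
    (hf : MemLp f 2 volume) (hg : ∀ i ∈ s, MemLp (g i) 2 volume) :
    braket (fun q => ∑ i ∈ s, c i * g i q) f = ∑ i ∈ s, conj (c i) * braket (g i) f := by
  rw [← braket_conj_symm, braket_sum_right s c hf hg, map_sum]
  refine Finset.sum_congr rfl fun i _ => ?_
  rw [map_mul, braket_conj_symm]

/-! ### The vacuum -/

theorem vacuum_eq (q : Fin M → ℝ) :
    vacuum M q = ((((2 * Real.pi) ^ (-(1 / 4) : ℝ)) ^ M * Real.exp (-(∑ j, q j ^ 2) / 4) : ℝ) : ℂ) := by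
  rw [vacuum, ← Complex.ofReal_prod, Finset.prod_mul_distrib, Finset.prod_const, Finset.card_univ,
    Fintype.card_fin, ← Real.exp_sum, ← Finset.sum_div, Finset.sum_neg_distrib]

theorem continuous_vacuum : Continuous (vacuum M) := by
  unfold vacuum
  refine continuous_finsetProd _ fun j _ => ?_
  fun_prop

theorem vacuum_const_sq : (((2 * Real.pi) ^ (-(1 / 4) : ℝ)) ^ M) ^ 2 * (2 * Real.pi) ^ ((M : ℝ) / 2)
    = 1 := by
  rw [← pow_mul, ← Real.rpow_natCast, ← Real.rpow_mul (by positivity),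
    ← Real.rpow_add (by positivity)]
  push_cast
  rw [show -(1 / 4) * ((M : ℝ) * 2) + (M : ℝ) / 2 = 0 by ring, Real.rpow_zero]

theorem memLp_vacuum : MemLp (vacuum M) 2 volume := by
  rw [memLp_two_iff_integrable_sq_norm continuous_vacuum.aestronglyMeasurable]
  have h := (GaussianFourier.integrable_cexp_neg_mul_sum_add (ι := Fin M) (b := 1 / 2)
    (by norm_num) 0).norm
  refine (h.const_mul ((((2 * Real.pi) ^ (-(1 / 4) : ℝ)) ^ M) ^ 2)).congr ?_
  refine Filter.Eventually.of_forall fun q => ?_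
  simp only []
  rw [vacuum_eq, Complex.norm_real, Complex.norm_exp, Real.norm_eq_abs, sq_abs, mul_pow,
    ← Real.exp_nat_mul]
  congr 2
  have : (-(1 / 2 : ℂ) * ∑ i, ((q i : ℝ) : ℂ) ^ 2 + ∑ i, (0 : Fin M → ℂ) i * (q i : ℂ)) =
      ((-(1 / 2) * ∑ i, (q i) ^ 2 : ℝ) : ℂ) := by push_cast; simp
  rw [this, Complex.ofReal_re]
  push_cast
  ring

theorem braket_vacuum_displace (z : Fin M → ℂ) :
    braket (vacuum M) (displace z (vacuum M)) = Real.exp (-normSqSum z / 2) := by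
  -- The shift contributes `re z_j` and the phase contributes `i im z_j` to the linear coefficient
  -- of `q_j`, which is therefore `z_j` itself. The resulting `exp(z_j² / 2)` combines with the
  -- prefactor to `exp(-|z_j|² / 2)`.
  have h1 : ∀ q : Fin M → ℝ, conj (vacuum M q) * displace z (vacuum M) q =
      (((((2 * Real.pi) ^ (-(1 / 4) : ℝ)) ^ M) ^ 2 : ℝ) : ℂ) *
      Complex.exp (∑ j, (-((z j).re : ℂ) ^ 2 - Complex.I * ((z j).re * (z j).im : ℂ))) *
      Complex.exp (-(1 / 2 : ℂ) * ∑ j, (q j : ℂ) ^ 2 + ∑ j, z j * (q j : ℂ)) := by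
    intro q
    rw [displace, vacuum_eq, vacuum_eq, Complex.conj_ofReal]
    push_cast
    have : ∀ a b c d e g : ℂ, Complex.exp b * Complex.exp d * Complex.exp e =
      Complex.exp c * Complex.exp g →
      a * Complex.exp b * (Complex.exp e * (a * Complex.exp d)) =
        a ^ 2 * Complex.exp c * Complex.exp g := by
      intro a b c d e g h
      linear_combination a ^ 2 * h
    apply this
    rw [← Complex.exp_add, ← Complex.exp_add, ← Complex.exp_add]
    congr 1
    simp only [Finset.mul_sum, neg_div, Finset.sum_div, ← Finset.sum_neg_distrib,
      ← Finset.sum_add_distrib]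
    refine Finset.sum_congr rfl fun j _ => ?_
    simp
    linear_combination (q j : ℂ) * Complex.re_add_im (z j)
  unfold braket
  simp_rw [h1]
  rw [integral_const_mul, GaussianFourier.integral_cexp_neg_mul_sum_add (by norm_num)]
  have h2 : ((Real.pi : ℂ) / (1 / 2)) ^ ((Fintype.card (Fin M) : ℂ) / 2) =
      (((2 * Real.pi) ^ ((M : ℝ) / 2) : ℝ) : ℂ) := by
    rw [Complex.ofReal_cpow (by positivity), Fintype.card_fin]
    push_cast; congr 1; ring
  rw [h2]
  have h3 := congrArg (fun x : ℝ => (x : ℂ)) (vacuum_const_sq (M := M))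
  simp only [Complex.ofReal_mul, Complex.ofReal_one] at h3
  have : ∀ a b c d e : ℂ, a * d = 1 → Complex.exp b * Complex.exp e = Complex.exp c →
      a * Complex.exp b * (d * Complex.exp e) = Complex.exp c := by
    intro a b c d e h h'
    linear_combination Complex.exp b * Complex.exp e * h + h'
  rw [Complex.ofReal_exp]
  apply this _ _ _ _ _ h3
  rw [← Complex.exp_add]
  congr 1
  rw [normSqSum_eq]
  push_cast
  rw [neg_div, Finset.sum_div, Finset.sum_div, ← Finset.sum_add_distrib, ← Finset.sum_neg_distrib]
  refine Finset.sum_congr rfl fun j _ => ?_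
  have hz := Complex.re_add_im (z j)
  have hI := Complex.I_sq
  rw [show z j ^ 2 = ((z j).re + (z j).im * Complex.I) ^ 2 by rw [hz]]
  linear_combination (((z j).im : ℂ) ^ 2 / 2) * hI

/-- The matrix elements of displacements between coherent states. -/
theorem braket_coherent (a z b : Fin M → ℂ) :
    braket (displace a (vacuum M)) (displace z (displace b (vacuum M))) =
      Complex.exp (Complex.I * ((sympl z b + sympl (-a) (z + b) : ℝ) : ℂ)) *
        Real.exp (-normSqSum (z + b - a) / 2) := by
  rw [braket_displace_left, displace_displace z b]
  have h : displace (-a) (fun q => Complex.exp (Complex.I * (sympl z b : ℝ)) *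
      displace (z + b) (vacuum M) q) = fun q => Complex.exp (Complex.I * (sympl z b : ℝ)) *
      displace (-a) (displace (z + b) (vacuum M)) q := by
    funext q; simp only [displace]; ring
  rw [h, displace_displace, braket_mul_right, braket_mul_right, braket_vacuum_displace, ← mul_assoc,
    ← Complex.exp_add, show -a + (z + b) = z + b - a by abel]
  push_cast
  congr 2
  ring

end Weyl

/-! ### Moyal's identity: orthogonality relations for displacement operators -/

section Moyal

variable {M : ℕ}

/-- Real and imaginary parts of a phase space point. -/
def reImEquiv (M : ℕ) : (Fin M → ℂ) ≃ᵐ (Fin M → ℝ) × (Fin M → ℝ) :=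
  (MeasurableEquiv.piCongrRight fun _ => Complex.measurableEquivRealProd).trans
    (MeasurableEquiv.arrowProdEquivProdArrow ℝ ℝ (Fin M))

theorem measurePreserving_reImEquiv : MeasurePreserving (reImEquiv M) volume volume :=
  (volume_preserving_pi fun _ => Complex.volume_preserving_equiv_real_prod).trans
    (volume_measurePreserving_arrowProdEquivProdArrow ℝ ℝ (Fin M))

theorem integral_reIm {E : Type*} [NormedAddCommGroup E] [NormedSpace ℝ E]
    (G : (Fin M → ℝ) → (Fin M → ℝ) → E) :
    ∫ z : Fin M → ℂ, G (fun j => (z j).re) (fun j => (z j).im) =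
      ∫ w : (Fin M → ℝ) × (Fin M → ℝ), G w.1 w.2 :=
  (measurePreserving_reImEquiv (M := M)).integral_comp (reImEquiv M).measurableEmbedding
    (fun w => G w.1 w.2)

theorem integral_moyal_phase (q x : Fin M → ℝ) :
    ∫ y : Fin M → ℝ, Complex.exp (Complex.I * ((∑ j, y j * (q j - x j) : ℝ) : ℂ)) *
      ((Real.exp (-(∑ j, y j ^ 2) / 2) : ℝ) : ℂ) =
      (((2 * Real.pi) ^ ((M : ℝ) / 2) : ℝ) : ℂ) *
        ((Real.exp (-(∑ j, (q j - x j) ^ 2) / 2) : ℝ) : ℂ) := by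
  have h1 : ∀ y : Fin M → ℝ, Complex.exp (Complex.I * ((∑ j, y j * (q j - x j) : ℝ) : ℂ)) *
      ((Real.exp (-(∑ j, y j ^ 2) / 2) : ℝ) : ℂ) =
      Complex.exp (-(1 / 2 : ℂ) * ∑ j, (y j : ℂ) ^ 2 +
        ∑ j, (Complex.I * ((q j - x j : ℝ) : ℂ)) * (y j : ℂ)) := by
    intro y
    rw [Complex.ofReal_exp, ← Complex.exp_add]
    congr 1
    push_cast
    rw [add_comm, Finset.mul_sum Finset.univ _ Complex.I]
    congr 1
    · ring
    · exact Finset.sum_congr rfl fun j _ => by ring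
  simp_rw [h1]
  rw [GaussianFourier.integral_cexp_neg_mul_sum_add (by norm_num)]
  have h2 : ((Real.pi : ℂ) / (1 / 2)) ^ ((Fintype.card (Fin M) : ℂ) / 2) =
      (((2 * Real.pi) ^ ((M : ℝ) / 2) : ℝ) : ℂ) := by
    rw [Complex.ofReal_cpow (by positivity), Fintype.card_fin]
    push_cast; congr 1; ring
  rw [h2, Complex.ofReal_exp]
  congr 2
  push_cast
  simp only [mul_pow, Complex.I_sq, neg_mul, one_mul, Finset.sum_neg_distrib]
  ring

/-- The modulus of `conj f g` is at most the sum of the two squares. Each square times `c` is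
integrable, the second after a measure-preserving shear. This is the domination behind the
applications of Fubini's theorem in Moyal's identity. -/
theorem integrable_shear {f g : Wave M} (hf : StronglyMeasurable f) (hg : StronglyMeasurable g)
    (hf2 : MemLp f 2 volume) (hg2 : MemLp g 2 volume) {c : (Fin M → ℝ) → ℝ} (hc : Integrable c) :
    Integrable (fun w : (Fin M → ℝ) × (Fin M → ℝ) =>
      (c w.1 : ℂ) * (conj (f w.2) * g (fun j => w.2 j - 2 * w.1 j))) := by
  have hf' := (memLp_two_iff_integrable_sq_norm hf.aestronglyMeasurable).1 hf2
  have hg' := (memLp_two_iff_integrable_sq_norm hg.aestronglyMeasurable).1 hg2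
  have i1 : Integrable (fun w : (Fin M → ℝ) × (Fin M → ℝ) => c w.1 * ‖f w.2‖ ^ 2) :=
    hc.mul_prod hf'
  have i2 : Integrable (fun w : (Fin M → ℝ) × (Fin M → ℝ) =>
      c w.1 * ‖g (fun j => w.2 j - 2 * w.1 j)‖ ^ 2) := by
    have i3 : Integrable (fun w : (Fin M → ℝ) × (Fin M → ℝ) => c w.1 * ‖g w.2‖ ^ 2) :=
      hc.mul_prod hg'
    have mp : MeasurePreserving (fun w : (Fin M → ℝ) × (Fin M → ℝ) =>
        (w.1, fun j => w.2 j - 2 * w.1 j)) (volume.prod volume) (volume.prod volume) := by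
      refine MeasurePreserving.skew_product (f := id)
        (g := fun (x q : Fin M → ℝ) => fun j => q j - 2 * x j)
        (MeasurePreserving.id _) ?_ ?_
      · simp only [Function.uncurry_def]; fun_prop
      · refine Filter.Eventually.of_forall fun x => ?_
        exact (measurePreserving_sub_right (volume : Measure (Fin M → ℝ)) fun j => 2 * x j).map_eq
    exact mp.integrable_comp_of_integrable i3
  refine (i1.norm.add i2.norm).mono ?_ (Filter.Eventually.of_forall fun w => ?_)
  · have hm : Measurable (fun w : (Fin M → ℝ) × (Fin M → ℝ) => fun j => w.2 j - 2 * w.1 j) := by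
      fun_prop
    refine AEStronglyMeasurable.mul ?_ ?_
    · exact Complex.continuous_ofReal.comp_aestronglyMeasurable (hc.1.comp_fst)
    · refine AEStronglyMeasurable.mul ?_ ?_
      · exact (Complex.continuous_conj.comp_stronglyMeasurable
          (hf.comp_measurable measurable_snd)).aestronglyMeasurable
      · exact (hg.comp_measurable hm).aestronglyMeasurable
  · simp only [Pi.add_apply, norm_mul, Complex.norm_real, RCLike.norm_conj, norm_pow, norm_norm]
    refine le_trans ?_ (Real.le_norm_self _)
    rw [← mul_add]
    refine mul_le_mul_of_nonneg_left ?_ (norm_nonneg _)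
    nlinarith [sq_nonneg (‖f w.2‖ - ‖g (fun j => w.2 j - 2 * w.1 j)‖), norm_nonneg (f w.2),
      norm_nonneg (g (fun j => w.2 j - 2 * w.1 j)), sq_nonneg (‖f w.2‖),
      sq_nonneg (‖g (fun j => w.2 j - 2 * w.1 j)‖)]

theorem integrable_exp_sq_half : Integrable fun x : Fin M → ℝ => Real.exp (-(∑ j, x j ^ 2) / 2) := by
  have h := (GaussianFourier.integrable_cexp_neg_mul_sum_add (ι := Fin M) (b := 1 / 2)
    (by norm_num) 0).norm
  refine h.congr (Filter.Eventually.of_forall fun q => ?_)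
  simp only []
  rw [Complex.norm_exp]
  congr 1
  have : (-(1 / 2 : ℂ) * ∑ i, ((q i : ℝ) : ℂ) ^ 2 + ∑ i, (0 : Fin M → ℂ) i * (q i : ℂ)) =
      ((-(1 / 2) * ∑ i, (q i) ^ 2 : ℝ) : ℂ) := by push_cast; simp
  rw [this, Complex.ofReal_re]
  ring

/-- With `z = x + i y`, the `y`-integral of the phase against its Gaussian is a Gaussian in `q - x`.
Since `(q - x)² / 2 + x² / 2 = q² / 4 + (q - 2x)² / 4`, the total weight factors into the vacuum at
`q` and the vacuum at `q - 2x`, and the two remaining integrals separate into two overlaps. -/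
theorem integral_displace_gaussian_aux {f g : Wave M} (hf : StronglyMeasurable f)
    (hg : StronglyMeasurable g) (hf2 : MemLp f 2 volume) (hg2 : MemLp g 2 volume) :
    ∫ z : Fin M → ℂ, braket f (displace z g) * ((Real.exp (-normSqSum z / 2) : ℝ) : ℂ) =
      (Real.pi : ℂ) ^ M * (braket f (vacuum M) * braket (vacuum M) g) := by
  set X := Fin M → ℝ
  let c : X → ℝ := fun x => Real.exp (-(∑ j, x j ^ 2) / 2)
  have hc : Integrable c := integrable_exp_sq_half
  let ph : X → X → X → ℂ := fun x y q =>
    Complex.exp (Complex.I * ((∑ j, y j * (q j - x j) : ℝ) : ℂ))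
  let H : X → X → X → ℂ := fun x y q =>
    conj (f q) * g (fun j => q j - 2 * x j) * (ph x y q * (c y : ℂ)) * (c x : ℂ)
  have hH : Integrable (fun w : X × (X × X) => H w.1 w.2.1 w.2.2) := by
    have i1 := integrable_shear hf hg hf2 hg2 hc
    have i2 : Integrable (fun w : (X × X) × X => ((c w.1.1 : ℂ) *
        (conj (f w.1.2) * g (fun j => w.1.2 j - 2 * w.1.1 j))) * ((c w.2 : ℝ) : ℂ)) :=
      i1.mul_prod hc.ofReal
    have mp : MeasurePreserving (fun w : X × (X × X) => ((w.1, w.2.2), w.2.1))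
        (volume.prod (volume.prod volume)) ((volume.prod volume).prod volume) := by
      have e1 : MeasurePreserving (Prod.map id Prod.swap : X × (X × X) → X × (X × X))
          (volume.prod (volume.prod volume)) (volume.prod (volume.prod volume)) :=
        (MeasurePreserving.id volume).prod (Measure.measurePreserving_swap)
      exact (measurePreserving_prodAssoc volume volume volume).symm.comp e1
    have i3 := mp.integrable_comp_of_integrable i2
    refine i3.mono ?_ (Filter.Eventually.of_forall fun w => ?_)
    · have hm : Measurable (fun w : X × (X × X) => (fun j => w.2.2 j - 2 * w.1 j : X)) := by
        fun_prop
      refine AEStronglyMeasurable.mul (AEStronglyMeasurable.mul (AEStronglyMeasurable.mul ?_ ?_)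
        ?_) ?_
      · exact (Complex.continuous_conj.comp_stronglyMeasurable
          (hf.comp_measurable (measurable_snd.comp measurable_snd))).aestronglyMeasurable
      · exact (hg.comp_measurable hm).aestronglyMeasurable
      · exact Continuous.aestronglyMeasurable (by simp only [ph, c]; fun_prop)
      · exact Continuous.aestronglyMeasurable (by simp only [c]; fun_prop)
    · simp only [H, ph, norm_mul, Function.comp_apply]
      rw [mul_comm Complex.I, Complex.norm_exp_ofReal_mul_I]
      apply le_of_eq; ring
  have e1 : ∫ z : Fin M → ℂ, braket f (displace z g) * ((Real.exp (-normSqSum z / 2) : ℝ) : ℂ) =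
      ∫ w : X × X, (∫ q, H w.1 w.2 q) := by
    rw [← integral_reIm (fun x y => ∫ q, H x y q)]
    congr 1
    funext z
    rw [braket, ← integral_mul_const]
    congr 1
    funext q
    simp only [H, ph, c, displace]
    have : ((Real.exp (-normSqSum z / 2) : ℝ) : ℂ) =
        ((Real.exp (-(∑ j, (z j).im ^ 2) / 2) : ℝ) : ℂ) *
        ((Real.exp (-(∑ j, (z j).re ^ 2) / 2) : ℝ) : ℂ) := by
      rw [← Complex.ofReal_mul, ← Real.exp_add, normSqSum_eq, Finset.sum_add_distrib]
      congr 2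
      ring
    rw [this]
    ring
  have hH2 : Integrable (fun w : X × X => ∫ q, H w.1 w.2 q) := by
    have mp := (measurePreserving_prodAssoc (volume : Measure X) (volume : Measure X)
      (volume : Measure X))
    have := mp.integrable_comp_of_integrable hH
    exact this.integral_prod_left
  have e2 : ∫ w : X × X, (∫ q, H w.1 w.2 q) = ∫ x : X, ∫ q : X, ∫ y : X, H x y q := by
    rw [show (volume : Measure (X × X)) = (volume : Measure X).prod volume from rfl,
      integral_prod _ hH2]
    refine integral_congr_ae ?_
    filter_upwards [hH.prod_right_ae] with x hx
    exact integral_integral_swap hx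
  have e3 : ∀ x q : X, ∫ y : X, H x y q = (((2 * Real.pi) ^ ((M : ℝ) / 2) : ℝ) : ℂ) *
      (((Real.exp (-(∑ j, q j ^ 2) / 4) : ℝ) : ℂ) *
      ((Real.exp (-(∑ j, (q j - 2 * x j) ^ 2) / 4) : ℝ) : ℂ) * (conj (f q) *
        g (fun j => q j - 2 * x j))) := by
    intro x q
    simp only [H]
    rw [integral_mul_const, integral_const_mul]
    simp only [ph, c]
    rw [integral_moyal_phase]
    have : Real.exp (-(∑ j, (q j - x j) ^ 2) / 2) * Real.exp (-(∑ j, x j ^ 2) / 2) =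
        Real.exp (-(∑ j, q j ^ 2) / 4) * Real.exp (-(∑ j, (q j - 2 * x j) ^ 2) / 4) := by
      rw [← Real.exp_add, ← Real.exp_add]
      congr 1
      simp only [neg_div, Finset.sum_div, ← Finset.sum_neg_distrib, ← Finset.sum_add_distrib]
      exact Finset.sum_congr rfl fun j _ => by ring
    rw [← Complex.ofReal_mul (Real.exp _), ← this, Complex.ofReal_mul]
    ring
  set κ : ℝ := ((2 * Real.pi) ^ (-(1 / 4) : ℝ)) ^ M
  set P : ℝ := (2 * Real.pi) ^ ((M : ℝ) / 2)
  have hκP : κ ^ 2 * P = 1 := vacuum_const_sq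
  have hP : P ≠ 0 := by positivity
  have hκ : κ ≠ 0 := by positivity
  have e4 : ∀ x q : X, ∫ y : X, H x y q = ((P ^ 2 : ℝ) : ℂ) * ((conj (f q) * vacuum M q) *
      (conj (vacuum M (fun j => q j - 2 * x j)) * g (fun j => q j - 2 * x j))) := by
    intro x q
    have hv : ∀ u : X, vacuum M u = ((κ * Real.exp (-(∑ j, u j ^ 2) / 4) : ℝ) : ℂ) := vacuum_eq
    rw [e3, hv, hv, Complex.conj_ofReal]
    have : (P : ℂ) = ((P ^ 2 : ℝ) : ℂ) * (κ : ℂ) ^ 2 := by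
      have := congrArg (fun t : ℝ => (t : ℂ)) hκP
      push_cast at this ⊢
      linear_combination (-(P : ℂ)) * this
    rw [this]
    push_cast
    ring
  rw [e1, e2]
  have i5 : Integrable (fun w : X × X => ∫ y : X, H w.1 y w.2) := by
    have mp : MeasurePreserving (fun w : (X × X) × X => (w.1.1, (w.2, w.1.2)))
        ((volume.prod volume).prod volume) (volume.prod (volume.prod volume)) := by
      have e1 : MeasurePreserving (Prod.map id Prod.swap : X × (X × X) → X × (X × X))
          (volume.prod (volume.prod volume)) (volume.prod (volume.prod volume)) :=
        (MeasurePreserving.id volume).prod (Measure.measurePreserving_swap)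
      exact e1.comp (measurePreserving_prodAssoc volume volume volume)
    exact (mp.integrable_comp_of_integrable hH).integral_prod_left
  rw [integral_integral_swap i5]
  have e6 : ∀ q : X, ∫ x : X, ∫ y : X, H x y q = ((P ^ 2 : ℝ) : ℂ) *
      (((2 : ℝ) ^ M)⁻¹ : ℝ) * ((conj (f q) * vacuum M q) * braket (vacuum M) g) := by
    intro q
    simp_rw [e4]
    rw [integral_const_mul, integral_const_mul]
    have h1 : ∫ x : X, conj (vacuum M (fun j => q j - 2 * x j)) * g (fun j => q j - 2 * x j) =
        (((2 : ℝ) ^ M)⁻¹ : ℝ) • braket (vacuum M) g := by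
      -- The substitution `u = 2x` costs `2^(-M)`, which turns `(2π)^M` into `π^M`.
      have h2 := Measure.integral_comp_smul (volume : Measure X)
        (fun u : X => conj (vacuum M (q - u)) * g (q - u)) (2 : ℝ)
      have h3 := integral_sub_left_eq_self (fun u : X => conj (vacuum M u) * g u) volume q
      rw [h3] at h2
      have h4 : |((2 : ℝ) ^ Module.finrank ℝ X)⁻¹| = (((2 : ℝ) ^ M)⁻¹ : ℝ) := by
        rw [abs_of_pos (by positivity)]; simp [X]
      rw [h4] at h2
      rw [braket, ← h2]
      rfl
    rw [h1, Complex.real_smul]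
    ring
  simp_rw [e6]
  rw [integral_const_mul, integral_mul_const]
  have : P ^ 2 * ((2 : ℝ) ^ M)⁻¹ = Real.pi ^ M := by
    simp only [P]
    rw [← Real.rpow_natCast, ← Real.rpow_mul (by positivity)]
    rw [show (M : ℝ) / 2 * (2 : ℕ) = (M : ℝ) by push_cast; ring, Real.rpow_natCast, mul_pow]
    field_simp
  rw [← Complex.ofReal_mul, this]
  push_cast
  rfl

theorem integral_displace_gaussian {f g : Wave M} (hf : MemLp f 2 volume) (hg : MemLp g 2 volume) :
    ∫ z : Fin M → ℂ, braket f (displace z g) * ((Real.exp (-normSqSum z / 2) : ℝ) : ℂ) =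
      (Real.pi : ℂ) ^ M * (braket f (vacuum M) * braket (vacuum M) g) := by
  have hf' := hf.1.ae_eq_mk
  have hg' := hg.1.ae_eq_mk
  have h := integral_displace_gaussian_aux hf.1.stronglyMeasurable_mk hg.1.stronglyMeasurable_mk
    (hf.ae_eq hf') (hg.ae_eq hg')
  rw [braket_congr hf' (Filter.EventuallyEq.refl _ _),
    braket_congr (Filter.EventuallyEq.refl _ _) hg', ← h]
  congr 1
  funext z
  rw [braket_congr hf' (displace_congr z hg')]

/-- Orthogonality relations for displacements, against coherent states. -/
theorem integral_moyal {f g : Wave M} (hf : MemLp f 2 volume) (hg : MemLp g 2 volume)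
    (a b : Fin M → ℂ) :
    ∫ z : Fin M → ℂ, braket f (displace z g) *
        conj (braket (displace a (vacuum M)) (displace z (displace b (vacuum M)))) =
      (Real.pi : ℂ) ^ M * (braket f (displace a (vacuum M)) *
        braket (displace b (vacuum M)) g) := by
  have h := integral_displace_gaussian (MemLp.displace hf (-a)) (MemLp.displace hg (-b))
  have e1 : braket (displace (-a) f) (vacuum M) = braket f (displace a (vacuum M)) := by
    rw [braket_displace_left, neg_neg]
  have e2 : braket (vacuum M) (displace (-b) g) = braket (displace b (vacuum M)) g := by
    rw [braket_displace_left]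
  -- The shift by `a - b` recentres the coherent matrix element, whose modulus becomes the Gaussian
  -- of the preceding identity; the Weyl phases on both sides then agree by `h4`.
  rw [← e1, ← e2, ← h, ← integral_add_right_eq_self _ (a - b)]
  congr 1
  funext w
  rw [braket_coherent, braket_displace_left, neg_neg, displace_displace w]
  have h3 : displace a (fun q => Complex.exp (Complex.I * (sympl w (-b) : ℝ)) *
      displace (w + -b) g q) = fun q => Complex.exp (Complex.I * (sympl w (-b) : ℝ)) *
      displace a (displace (w + -b) g) q := by
    funext q; simp only [displace]; ring
  rw [h3, displace_displace, braket_mul_right, braket_mul_right, map_mul, ← Complex.exp_conj,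
    Complex.conj_ofReal, map_mul, Complex.conj_I, Complex.conj_ofReal,
    show a + (w + -b) = w + (a - b) by abel, show w + (a - b) + b - a = w by abel]
  have h4 : sympl w (-b) + sympl a (w + -b) =
      -(sympl (w + (a - b)) b + sympl (-a) (w + (a - b) + b)) := by
    simp only [sympl, ← Finset.sum_add_distrib, ← Finset.sum_neg_distrib]
    refine Finset.sum_congr rfl fun j _ => ?_
    simp
    ring
  have h5 : Complex.exp (-Complex.I *
      ((sympl (w + (a - b)) b + sympl (-a) (w + (a - b) + b) : ℝ) : ℂ)) =
      Complex.exp (Complex.I * (sympl w (-b) : ℝ)) *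
        Complex.exp (Complex.I * (sympl a (w + -b) : ℝ)) := by
    rw [← Complex.exp_add, ← mul_add, ← Complex.ofReal_add, h4]
    congr 1
    push_cast
    ring
  rw [h5]
  ring

end Moyal

/-! ### Overlaps of Gaussian states with coherent states -/

section Overlap

/-- Two-sided Gaussian bounds for the Fourier transform of an anisotropic Gaussian. -/
theorem gaussian_fourier_bounds {ι : Type*} [Fintype ι] [DecidableEq ι] (A : Matrix ι ι ℝ)
    (hA : A.IsSymm) (hpos : ∀ y : ι → ℝ, y ⬝ᵥ y ≤ y ⬝ᵥ A.mulVec y) :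
    ∃ k Λ : ℝ, 0 < k ∧ 0 < Λ ∧ ∀ s : ι → ℝ, ∃ r : ℝ,
      ∫ y : ι → ℝ, Complex.exp (Complex.I * ((y ⬝ᵥ s : ℝ) : ℂ) -
        ((y ⬝ᵥ A.mulVec y / 2 : ℝ) : ℂ)) = (r : ℂ) ∧
      k * Real.exp (-(s ⬝ᵥ s) / 2) ≤ r ∧ r ≤ k * Real.exp (-Λ * (s ⬝ᵥ s)) := by
  have hH : A.IsHermitian := by
    rw [Matrix.IsHermitian, Matrix.conjTranspose_eq_transpose_of_trivial]; exact hA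
  set b := hH.eigenvectorBasis
  set l := hH.eigenvalues
  have hAb : ∀ i, A.mulVec (⇑(b i)) = l i • (⇑(b i) : ι → ℝ) := hH.mulVec_eigenvectorBasis
  have hdot : ∀ v w : EuclideanSpace ℝ ι, inner ℝ v w = (⇑v : ι → ℝ) ⬝ᵥ ⇑w := by
    intro v w
    simp [PiLp.inner_apply, dotProduct, mul_comm]
  have horth : ∀ i k, (⇑(b i) : ι → ℝ) ⬝ᵥ ⇑(b k) = if i = k then 1 else 0 := by
    intro i k
    rw [← hdot, orthonormal_iff_ite.1 b.orthonormal]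
  have hl : ∀ i, 1 ≤ l i := by
    intro i
    have := hpos (⇑(b i))
    rw [hAb, dotProduct_smul, horth] at this
    simpa using this
  let Y : (ι → ℝ) → (ι → ℝ) := fun u => ∑ i, u i • (⇑(b i) : ι → ℝ)
  -- The change to an orthonormal eigenbasis preserves Lebesgue measure; the passage through
  -- `EuclideanSpace` makes it an isometry.
  have hint : ∀ F : (ι → ℝ) → ℂ, ∫ y, F y = ∫ u, F (Y u) := by
    intro F
    have h1 := (PiLp.volume_preserving_toLp ι).integral_comp
      (MeasurableEquiv.toLp 2 _).measurableEmbedding (fun v : EuclideanSpace ℝ ι => F ⇑v)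
    have h2 := (b.repr.symm.measurePreserving).integral_comp
      b.repr.symm.toHomeomorph.measurableEmbedding (fun v : EuclideanSpace ℝ ι => F ⇑v)
    have h3 := (PiLp.volume_preserving_toLp ι).integral_comp
      (MeasurableEquiv.toLp 2 _).measurableEmbedding
      (fun v : EuclideanSpace ℝ ι => F ⇑(b.repr.symm v))
    calc ∫ y, F y = ∫ v : EuclideanSpace ℝ ι, F ⇑v := h1
      _ = _ := h2.symm
      _ = _ := h3.symm
      _ = _ := by
        congr 1
        funext u
        congr 1
        rw [← b.sum_repr_symm]
        funext j
        simp [Y]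
  have hYs : ∀ u s, Y u ⬝ᵥ s = ∑ i, u i * ((⇑(b i) : ι → ℝ) ⬝ᵥ s) := by
    intro u s
    simp only [Y, sum_dotProduct, smul_dotProduct, smul_eq_mul]
  have hYA : ∀ u, Y u ⬝ᵥ A.mulVec (Y u) = ∑ i, l i * u i ^ 2 := by
    intro u
    rw [hYs]
    refine Finset.sum_congr rfl fun i _ => ?_
    simp only [Y, Matrix.mulVec_sum, Matrix.mulVec_smul, hAb, dotProduct_sum, dotProduct_smul,
      horth, smul_eq_mul]
    simp
    ring
  have hparseval : ∀ s : ι → ℝ, ∑ i, ((⇑(b i) : ι → ℝ) ⬝ᵥ s) ^ 2 = s ⬝ᵥ s := by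
    intro s
    have := b.sum_sq_norm_inner_right (WithLp.toLp 2 s)
    simp only [hdot, Real.norm_eq_abs, sq_abs] at this
    rw [← real_inner_self_eq_norm_sq, hdot] at this
    exact this
  -- A common upper bound for the eigenvalues; the summand `1` keeps it positive when `ι` is empty.
  set L : ℝ := 1 + ∑ i, l i
  have hlL : ∀ i, l i ≤ L := fun i => by
    have := Finset.single_le_sum (f := l) (fun j _ => zero_le_one.trans (hl j)) (Finset.mem_univ i)
    simp only [L]; linarith
  have hL : 0 < L := by
    have : 0 ≤ ∑ i, l i := Finset.sum_nonneg fun j _ => zero_le_one.trans (hl j)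
    simp only [L]; linarith
  refine ⟨∏ i, (2 * Real.pi / l i) ^ (1 / 2 : ℝ), 1 / (2 * L), ?_, by positivity, fun s => ?_⟩
  · exact Finset.prod_pos fun i _ => Real.rpow_pos_of_pos
      (div_pos (by positivity) (zero_lt_one.trans_le (hl i))) _
  refine ⟨(∏ i, (2 * Real.pi / l i) ^ (1 / 2 : ℝ)) *
    Real.exp (∑ i, -((⇑(b i) : ι → ℝ) ⬝ᵥ s) ^ 2 / (2 * l i)), ?_, ?_, ?_⟩
  · rw [hint]
    have h1 : ∀ u : ι → ℝ, Complex.exp (Complex.I * ((Y u ⬝ᵥ s : ℝ) : ℂ) -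
        ((Y u ⬝ᵥ A.mulVec (Y u) / 2 : ℝ) : ℂ)) =
        Complex.exp (-∑ i, ((l i / 2 : ℝ) : ℂ) * (u i : ℂ) ^ 2 +
          ∑ i, (Complex.I * (((⇑(b i) : ι → ℝ) ⬝ᵥ s : ℝ) : ℂ)) * (u i : ℂ)) := by
      intro u
      rw [hYs, hYA]
      congr 1
      push_cast
      rw [sub_eq_add_neg, add_comm, Finset.sum_div, Finset.mul_sum]
      congr 1
      · congr 1; exact Finset.sum_congr rfl fun i _ => by ring
      · exact Finset.sum_congr rfl fun i _ => by ring
    simp_rw [h1]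
    rw [GaussianFourier.integral_cexp_neg_sum_mul_add
      (fun i => by rw [Complex.ofReal_re]; linarith [hl i]),
      Real.exp_sum, ← Finset.prod_mul_distrib, Complex.ofReal_prod]
    refine Finset.prod_congr rfl fun i _ => ?_
    have hli := zero_lt_one.trans_le (hl i)
    rw [Complex.ofReal_mul, Complex.ofReal_cpow (by positivity), Complex.ofReal_exp]
    have : (l i : ℂ) ≠ 0 := by exact_mod_cast hli.ne'
    congr 1
    · push_cast; congr 1; field_simp
    · congr 1
      rw [mul_pow, Complex.I_sq]
      push_cast
      field_simp
      ring
  · refine mul_le_mul_of_nonneg_left (Real.exp_le_exp.2 ?_) (Finset.prod_nonneg fun i _ =>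
      Real.rpow_nonneg (div_nonneg (by positivity) (zero_le_one.trans (hl i))) _)
    rw [← hparseval, neg_div, Finset.sum_div, ← Finset.sum_neg_distrib]
    refine Finset.sum_le_sum fun i _ => ?_
    rw [neg_div, neg_le_neg_iff]
    exact div_le_div_of_nonneg_left (sq_nonneg _) (by norm_num) (by linarith [hl i])
  · refine mul_le_mul_of_nonneg_left (Real.exp_le_exp.2 ?_) (Finset.prod_nonneg fun i _ =>
      Real.rpow_nonneg (div_nonneg (by positivity) (zero_le_one.trans (hl i))) _)
    rw [← hparseval, neg_mul, Finset.mul_sum, ← Finset.sum_neg_distrib]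
    refine Finset.sum_le_sum fun i _ => ?_
    rw [neg_div, neg_le_neg_iff, div_mul_eq_mul_div, one_mul]
    exact div_le_div_of_nonneg_left (sq_nonneg _) (by linarith [hl i]) (by linarith [hlL i])

variable {M : ℕ}

/-- The linear equivalence underlying `phaseVector`. -/
def phaseEquiv (M : ℕ) : (Fin M → ℂ) ≃ₗ[ℝ] (Fin M × Fin 2 → ℝ) where
  toFun := phaseVector
  invFun y j := ⟨-y (j, 1), y (j, 0)⟩
  map_add' a b := by
    funext i
    simp only [phaseVector, Pi.add_apply, Complex.add_re, Complex.add_im]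
    split_ifs <;> ring
  map_smul' c a := by
    funext i
    simp only [phaseVector, Pi.smul_apply, Complex.real_smul, Complex.re_ofReal_mul,
      Complex.im_ofReal_mul, RingHom.id_apply, smul_eq_mul]
    split_ifs <;> ring
  left_inv a := by
    funext j
    apply Complex.ext <;> simp [phaseVector]
  right_inv y := by
    funext i
    obtain ⟨j, c⟩ := i
    fin_cases c <;> simp [phaseVector]

/-- Uniqueness of Haar measure up to scaling provides the Jacobian; only its positivity is needed.
-/
theorem exists_integral_phaseVector (M : ℕ) : ∃ c : ℝ, 0 < c ∧ ∀ G : (Fin M × Fin 2 → ℝ) → ℂ,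
    ∫ z : Fin M → ℂ, G (phaseVector z) = c * ∫ y, G y := by
  let e := (phaseEquiv M).toContinuousLinearEquiv
  obtain ⟨c, hc0, hc⟩ : ∃ c : NNReal, 0 < c ∧ (volume : Measure (Fin M → ℂ)).map e =
      c • (volume : Measure (Fin M × Fin 2 → ℝ)) :=
    ⟨_, Measure.addHaarScalarFactor_pos_of_isAddHaarMeasure _ _,
      Measure.isAddLeftInvariant_eq_smul _ _⟩
  refine ⟨c, NNReal.coe_pos.2 hc0, fun G => ?_⟩
  have h2 : ∫ z : Fin M → ℂ, G (phaseVector z) = ∫ y, G y ∂(volume.map e) :=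
    (e.toHomeomorph.measurableEmbedding.integral_map (μ := volume) G).symm
  rw [h2, hc, integral_smul_nnreal_measure, NNReal.smul_def, Complex.real_smul]

/-- Cauchy–Schwarz and unitarity of displacements. For a Gaussian characteristic function this bound
forces the covariance matrix to be positive semidefinite. -/
theorem norm_braket_displace_le {ψ : Wave M} (h2 : MemLp ψ 2 volume) (h1 : braket ψ ψ = 1)
    (α : Fin M → ℂ) : ‖braket ψ (displace α ψ)‖ ≤ 1 := by
  have h := norm_braket_sq_le h2 (MemLp.displace h2 α)
  rw [braket_displace_left α ψ, displace_displace, braket_mul_right] at h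
  have : sympl (-α) α = 0 := by simp [sympl, mul_comm]
  rw [this, neg_add_cancel, displace_zero, h1] at h
  simp at h
  exact h

theorem dotProduct_phaseVector_self (z : Fin M → ℂ) :
    phaseVector z ⬝ᵥ phaseVector z = normSqSum z := by
  rw [normSqSum_eq, dotProduct, Fintype.sum_prod_type]
  refine Finset.sum_congr rfl fun j _ => ?_
  simp [phaseVector]
  ring

/-- The vector dual to a displacement under the symplectic form. -/
def dualVector (α : Fin M → ℂ) : Fin M × Fin 2 → ℝ :=
  fun i => if i.2 = 0 then (α i.1).re else (α i.1).im

theorem dotProduct_dualVector (z α : Fin M → ℂ) :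
    phaseVector z ⬝ᵥ dualVector α = sympl z α := by
  rw [dotProduct, Fintype.sum_prod_type, sympl]
  refine Finset.sum_congr rfl fun j _ => ?_
  simp [phaseVector, dualVector]
  ring

theorem dotProduct_dualVector_self (α : Fin M → ℂ) :
    dualVector α ⬝ᵥ dualVector α = normSqSum α := by
  rw [normSqSum_eq, dotProduct, Fintype.sum_prod_type]
  refine Finset.sum_congr rfl fun j _ => ?_
  simp [dualVector]
  ring

theorem braket_coherent_self (a z : Fin M → ℂ) :
    braket (displace a (vacuum M)) (displace z (displace a (vacuum M))) =
      Complex.exp (Complex.I * ((2 * sympl z a : ℝ) : ℂ)) * Real.exp (-normSqSum z / 2) := by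
  rw [braket_coherent, add_sub_cancel_right]
  congr 4
  simp only [sympl, Finset.mul_sum, ← Finset.sum_add_distrib]
  refine Finset.sum_congr rfl fun j _ => ?_
  simp
  ring

/-- A pure Gaussian state has Gaussian overlaps with the coherent states. -/
theorem IsPureGaussian.overlap_bounds {ψ : Wave M} (hψ : IsPureGaussian ψ) :
    ∃ k K a A : ℝ, 0 < k ∧ 0 < K ∧ 0 < a ∧ 0 < A ∧ ∀ α : Fin M → ℂ,
      k * Real.exp (-A * normSqSum α) ≤ ‖braket ψ (displace α (vacuum M))‖ ^ 2 ∧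
      ‖braket ψ (displace α (vacuum M))‖ ^ 2 ≤ K * Real.exp (-a * normSqSum α) := by
  obtain ⟨h2, h1, X, V, hV, hχ⟩ := hψ
  -- Positivity of `V` is not part of the definition of a Gaussian state: an exponential of `-y·Vy /
  -- 2` can stay bounded by one only if the quadratic form is nonnegative.
  have hVpos : ∀ y : Fin M × Fin 2 → ℝ, 0 ≤ y ⬝ᵥ V.mulVec y := by
    intro y
    obtain ⟨α, rfl⟩ := (phaseEquiv M).surjective y
    have h := norm_braket_displace_le h2 h1 α
    rw [hχ, Complex.norm_exp] at h
    simp only [Complex.sub_re, Complex.mul_re, Complex.I_re, zero_mul, Complex.I_im, one_mul,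
      Complex.ofReal_im, sub_zero, zero_sub, Complex.ofReal_re, Real.exp_le_one_iff] at h
    change 0 ≤ phaseVector α ⬝ᵥ V.mulVec (phaseVector α)
    linarith
  obtain ⟨k, Λ, hk, hΛ, hF⟩ := gaussian_fourier_bounds (V + 1) (hV.add Matrix.isSymm_one)
    (fun y => by
      rw [Matrix.add_mulVec, Matrix.one_mulVec, dotProduct_add]
      linarith [hVpos y])
  obtain ⟨c, hc, hG⟩ := exists_integral_phaseVector M
  have hπ : (0 : ℝ) < Real.pi ^ M := by positivity
  have hK : ∀ α : Fin M → ℂ, ∃ r : ℝ,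
      Real.pi ^ M * ‖braket ψ (displace α (vacuum M))‖ ^ 2 = c * r ∧
      k * Real.exp (-((X - (2 : ℝ) • dualVector α) ⬝ᵥ (X - (2 : ℝ) • dualVector α)) / 2) ≤ r ∧
      r ≤ k * Real.exp (-Λ * ((X - (2 : ℝ) • dualVector α) ⬝ᵥ (X - (2 : ℝ) • dualVector α))) := by
    intro α
    obtain ⟨r, hr, hr1, hr2⟩ := hF (X - (2 : ℝ) • dualVector α)
    refine ⟨r, ?_, hr1, hr2⟩
    -- Moyal's identity with both states equal to `ψ` expresses the squared overlap as the Fourier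
    -- transform of a Gaussian with matrix `V + 1`, evaluated at the mean shifted by twice the dual
    -- vector of `α`. The summand `1` comes from the coherent state and bounds the matrix below.
    have hm := integral_moyal h2 h2 α α
    rw [← braket_conj_symm ψ (displace α (vacuum M)), Complex.mul_conj, Complex.normSq_eq_norm_sq]
      at hm
    have h3 : ∀ z : Fin M → ℂ, braket ψ (displace z ψ) *
        conj (braket (displace α (vacuum M)) (displace z (displace α (vacuum M)))) =
        (fun y => Complex.exp (Complex.I * ((y ⬝ᵥ (X - (2 : ℝ) • dualVector α) : ℝ) : ℂ) -
        ((y ⬝ᵥ (V + 1).mulVec y / 2 : ℝ) : ℂ))) (phaseVector z) := by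
      intro z
      beta_reduce
      rw [hχ, braket_coherent_self, map_mul, ← Complex.exp_conj, map_mul, Complex.conj_I,
        Complex.conj_ofReal, Complex.conj_ofReal, Complex.ofReal_exp, ← Complex.exp_add,
        ← Complex.exp_add, Matrix.add_mulVec, Matrix.one_mulVec, dotProduct_add,
        dotProduct_phaseVector_self, dotProduct_sub, dotProduct_smul, dotProduct_dualVector]
      congr 1
      push_cast [smul_eq_mul]
      ring
    have h4 := (integral_congr_ae (Filter.Eventually.of_forall h3)).symm.trans hm
    have h5 := (hG (fun y => Complex.exp (Complex.I *
        ((y ⬝ᵥ (X - (2 : ℝ) • dualVector α) : ℝ) : ℂ) -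
        ((y ⬝ᵥ (V + 1).mulVec y / 2 : ℝ) : ℂ)))).symm.trans h4
    beta_reduce at h5
    rw [hr] at h5
    exact_mod_cast h5.symm
  -- The mean `X` only affects constants: `|X - 2d|²` lies between `2|d|² - |X|²` and `2|X|² +
  -- 8|d|²`. Hence the exponents `2Λ` above and `8/2 = 4` below.
  have hX : ∀ α : Fin M → ℂ,
      (X - (2 : ℝ) • dualVector α) ⬝ᵥ (X - (2 : ℝ) • dualVector α) ≤
        2 * (X ⬝ᵥ X) + 8 * normSqSum α ∧
      2 * normSqSum α - X ⬝ᵥ X ≤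
        (X - (2 : ℝ) • dualVector α) ⬝ᵥ (X - (2 : ℝ) • dualVector α) := by
    intro α
    rw [← dotProduct_dualVector_self]
    simp only [dotProduct, Finset.mul_sum, ← Finset.sum_add_distrib, ← Finset.sum_sub_distrib]
    constructor <;> refine Finset.sum_le_sum fun i _ => ?_
    · simp only [Pi.sub_apply, Pi.smul_apply, smul_eq_mul]
      nlinarith [sq_nonneg (X i + 2 * dualVector α i)]
    · simp only [Pi.sub_apply, Pi.smul_apply, smul_eq_mul]
      nlinarith [sq_nonneg (2 * X i - 2 * dualVector α i), sq_nonneg (X i -  dualVector α i)]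
  refine ⟨c * k * Real.exp (-(X ⬝ᵥ X)) / Real.pi ^ M,
    c * k * Real.exp (Λ * (X ⬝ᵥ X)) / Real.pi ^ M, 2 * Λ, 4, by positivity, by positivity,
    by positivity, by norm_num, fun α => ?_⟩
  obtain ⟨r, hr, hr1, hr2⟩ := hK α
  have hr' : ‖braket ψ (displace α (vacuum M))‖ ^ 2 = c * r / Real.pi ^ M := by
    rw [← hr]; field_simp
  rw [hr', div_mul_eq_mul_div, div_mul_eq_mul_div, mul_assoc c, mul_assoc c, mul_assoc c,
    mul_assoc c, mul_assoc k, mul_assoc k, ← Real.exp_add, ← Real.exp_add]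
  constructor
  · gcongr
    refine le_trans ?_ hr1
    gcongr
    linarith [(hX α).1]
  · gcongr
    refine hr2.trans ?_
    gcongr
    nlinarith [(hX α).2]

end Overlap

/-! ### Families of superpositions of coherent states -/

section Families

variable {M : ℕ} {Y Y' : Type} [TopologicalSpace Y] [TopologicalSpace Y']

theorem displace_sum {ι : Type*} (s : Finset ι) (a : Fin M → ℂ) (c : ι → ℂ) (f : ι → Wave M) :
    displace a (fun q => ∑ i ∈ s, c i * f i q) = fun q => ∑ i ∈ s, c i * displace a (f i) q := by
  funext q
  simp only [displace, Finset.mul_sum]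
  exact Finset.sum_congr rfl fun i _ => by ring

/-- Finite superpositions of coherent states, with coefficients and displacements depending
continuously on a parameter. -/
def IsCoherentFamily (F : Y → Wave M) : Prop :=
  ∃ (κ : Type) (_ : Fintype κ) (c : κ → Y → ℂ) (α : κ → Y → Fin M → ℂ),
    (∀ i, Continuous (c i)) ∧ (∀ i, Continuous (α i)) ∧
      ∀ y, F y = fun q => ∑ i, c i y * displace (α i y) (vacuum M) q

theorem isCoherentFamily_zero : IsCoherentFamily (fun _ : Y => (0 : Wave M)) :=
  ⟨Empty, inferInstance, fun i => i.elim, fun i => i.elim, fun i => i.elim, fun i => i.elim,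
    fun _ => by funext q; simp⟩

theorem isCoherentFamily_vacuum : IsCoherentFamily (fun _ : Y => vacuum M) :=
  ⟨Unit, inferInstance, fun _ _ => 1, fun _ _ => 0, fun _ => continuous_const,
    fun _ => continuous_const, fun _ => by funext q; simp [displace_zero]⟩

theorem IsCoherentFamily.comp {F : Y → Wave M} (hF : IsCoherentFamily F) {g : Y' → Y}
    (hg : Continuous g) : IsCoherentFamily (fun y => F (g y)) := by
  obtain ⟨κ, _, c, α, hc, hα, h⟩ := hF
  exact ⟨κ, inferInstance, fun i y => c i (g y), fun i y => α i (g y), fun i => (hc i).comp hg,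
    fun i => (hα i).comp hg, fun y => h (g y)⟩

theorem IsCoherentFamily.add {F G : Y → Wave M} (hF : IsCoherentFamily F)
    (hG : IsCoherentFamily G) : IsCoherentFamily (fun y q => F y q + G y q) := by
  obtain ⟨κ, _, c, α, hc, hα, h⟩ := hF
  obtain ⟨κ', _, c', α', hc', hα', h'⟩ := hG
  refine ⟨κ ⊕ κ', inferInstance, Sum.elim c c', Sum.elim α α', ?_, ?_, fun y => ?_⟩
  · rintro (i | i) <;> simp [hc, hc']
  · rintro (i | i) <;> simp [hα, hα']
  · funext q
    simp only [h y, h' y, Fintype.sum_sum_type, Sum.elim_inl, Sum.elim_inr]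

theorem IsCoherentFamily.smul {F : Y → Wave M} (hF : IsCoherentFamily F) {r : Y → ℂ}
    (hr : Continuous r) : IsCoherentFamily (fun y q => r y * F y q) := by
  obtain ⟨κ, _, c, α, hc, hα, h⟩ := hF
  refine ⟨κ, inferInstance, fun i y => r y * c i y, α, fun i => hr.mul (hc i), hα, fun y => ?_⟩
  funext q
  simp only [h y, Finset.mul_sum, mul_assoc]

theorem IsCoherentFamily.displace {F : Y → Wave M} (hF : IsCoherentFamily F)
    {r : Y → Fin M → ℂ} (hr : Continuous r) :
    IsCoherentFamily (fun y => QumodeVQC.displace (r y) (F y)) := by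
  obtain ⟨κ, _, c, α, hc, hα, h⟩ := hF
  refine ⟨κ, inferInstance,
    fun i y => c i y * Complex.exp (Complex.I * (sympl (r y) (α i y) : ℝ)),
    fun i y => r y + α i y, fun i => ?_, fun i => hr.add (hα i), fun y => ?_⟩
  · have := hc i; have := hα i; fun_prop
  · beta_reduce
    rw [h y, displace_sum]
    funext q
    refine Finset.sum_congr rfl fun i _ => ?_
    rw [displace_displace, mul_assoc]

theorem IsCoherentFamily.memLp {F : Y → Wave M} (hF : IsCoherentFamily F) (y : Y) :
    MemLp (F y) 2 volume := by
  obtain ⟨κ, _, c, α, hc, hα, h⟩ := hF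
  rw [h y]
  exact memLp_finsetSum _ fun i _ => (MemLp.displace memLp_vacuum _).const_mul _

theorem IsCoherentFamily.continuous_braket {F G : Y → Wave M} (hF : IsCoherentFamily F)
    (hG : IsCoherentFamily G) : Continuous fun y => braket (F y) (G y) := by
  obtain ⟨κ, _, c, α, hc, hα, h⟩ := hF
  obtain ⟨κ', _, c', α', hc', hα', h'⟩ := hG
  have key : ∀ y, braket (F y) (G y) = ∑ i, conj (c i y) * ∑ k, c' k y *
      (Complex.exp (Complex.I * ((sympl 0 (α' k y) + sympl (-(α i y)) (0 + α' k y) : ℝ) : ℂ)) *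
        Real.exp (-normSqSum (0 + α' k y - α i y) / 2)) := by
    intro y
    have hm : ∀ a : Fin M → ℂ, MemLp (QumodeVQC.displace a (vacuum M)) 2 volume :=
      fun a => MemLp.displace memLp_vacuum a
    rw [h' y, h y, braket_sum_left _ _ ?_ fun i _ => hm _]
    · refine Finset.sum_congr rfl fun i _ => ?_
      rw [braket_sum_right _ _ (hm _) fun i _ => hm _]
      congr 1
      refine Finset.sum_congr rfl fun k _ => ?_
      rw [← braket_coherent, displace_zero]
    · exact memLp_finsetSum _ fun i _ => (hm _).const_mul _
  simp_rw [key]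
  refine continuous_finsetSum _ fun i _ => ?_
  have := hc i; have := hα i
  refine (Complex.continuous_conj.comp (hc i)).mul (continuous_finsetSum _ fun k _ => ?_)
  have := hc' k; have := hα' k
  fun_prop

/-- By Cauchy–Schwarz the increment is bounded through the norm of the difference `d b` of two
coherent states. That norm is continuous in `b`, being built from explicit coherent overlaps, and
vanishes at `b = a`. -/
theorem continuous_braket_displace_vacuum {f : Wave M} (hf : MemLp f 2 volume) :
    Continuous fun a : Fin M → ℂ => braket f (displace a (vacuum M)) := by
  rw [continuous_iff_continuousAt]
  intro a
  have hm : ∀ a : Fin M → ℂ, MemLp (displace a (vacuum M)) 2 volume :=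
    fun a => MemLp.displace memLp_vacuum a
  let d : (Fin M → ℂ) → Wave M := fun b q => displace b (vacuum M) q +
    (-1) * displace a (vacuum M) q
  have hd : IsCoherentFamily d := by
    have h := (isCoherentFamily_vacuum (M := M) (Y := Fin M → ℂ))
    exact (h.displace continuous_id).add ((h.displace continuous_const).smul continuous_const)
  have h0 : Filter.Tendsto (fun b => (braket f f).re * (braket (d b) (d b)).re) (nhds a)
      (nhds 0) := by
    have hc := (hd.continuous_braket hd).tendsto a
    have hda : d a = 0 := by funext q; simp [d]
    have := ((Complex.continuous_re.tendsto _).comp hc).const_mul (braket f f).re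
    rw [hda] at this
    simpa [braket] using this
  have h1 : Filter.Tendsto (fun b => ‖braket f (d b)‖ ^ 2) (nhds a) (nhds 0) :=
    squeeze_zero (fun _ => by positivity) (fun b => norm_braket_sq_le hf (hd.memLp b)) h0
  have h2 : Filter.Tendsto (fun b => ‖braket f (d b)‖) (nhds a) (nhds 0) := by
    have := h1.sqrt
    simpa using this
  have h3 : ∀ b, braket f (d b) = braket f (displace b (vacuum M)) -
      braket f (displace a (vacuum M)) := by
    intro b
    rw [braket_add_right hf (hm b) ((hm a).const_mul _), braket_mul_right]; ring
  have h4 := tendsto_zero_iff_norm_tendsto_zero.2 h2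
  simp_rw [h3] at h4
  simpa [ContinuousAt] using h4.add_const (braket f (displace a (vacuum M)))

theorem IsCoherentFamily.continuous_braket_left {F : Y → Wave M} (hF : IsCoherentFamily F)
    {f : Wave M} (hf : MemLp f 2 volume) : Continuous fun y => braket f (F y) := by
  obtain ⟨κ, _, c, α, hc, hα, h⟩ := hF
  have key : ∀ y, braket f (F y) =
      ∑ i, c i y * braket f (QumodeVQC.displace (α i y) (vacuum M)) := by
    intro y
    rw [h y, braket_sum_right _ _ hf fun i _ => MemLp.displace memLp_vacuum _]
  simp_rw [key]
  exact continuous_finsetSum _ fun i _ => (hc i).mul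
    ((continuous_braket_displace_vacuum hf).comp (hα i))

end Families

/-! ### States and observables -/

section States

variable {M : ℕ} {Y Y' : Type} [TopologicalSpace Y] [TopologicalSpace Y']

/-- Unit vectors of one qubit and `M` modes. -/
structure IsState (Ψ : QWave M) : Prop where
  memLp : ∀ a, MemLp (Ψ a) 2 volume
  norm_eq : braket (Ψ 0) (Ψ 0) + braket (Ψ 1) (Ψ 1) = 1

/-- Families of unit vectors whose components are coherent families. -/
structure IsStateFamily (Ψ : Y → QWave M) : Prop where
  coherent : ∀ a, IsCoherentFamily fun y => Ψ y a
  norm_eq : ∀ y, braket (Ψ y 0) (Ψ y 0) + braket (Ψ y 1) (Ψ y 1) = 1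

theorem IsStateFamily.isState {Ψ : Y → QWave M} (h : IsStateFamily Ψ) (y : Y) : IsState (Ψ y) :=
  ⟨fun a => (h.coherent a).memLp y, h.norm_eq y⟩

theorem IsStateFamily.comp {Ψ : Y → QWave M} (h : IsStateFamily Ψ) {g : Y' → Y}
    (hg : Continuous g) : IsStateFamily fun y => Ψ (g y) :=
  ⟨fun a => (h.coherent a).comp hg, fun y => h.norm_eq (g y)⟩

theorem IsState.braket_le_one {Ψ : QWave M} (h : IsState Ψ) (a : Fin 2) :
    (braket (Ψ a) (Ψ a)).re ≤ 1 := by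
  have h1 := congrArg Complex.re h.norm_eq
  have h2 := (braket_self (h.memLp 0)).2
  have h3 := (braket_self (h.memLp 1)).2
  rw [Complex.add_re, Complex.one_re] at h1
  fin_cases a <;> simp only [Fin.zero_eta, Fin.mk_one] <;> linarith

theorem braket_displace_displace {f g : Wave M} (a : Fin M → ℂ) :
    braket (displace a f) (displace a g) = braket f g := by
  rw [braket_displace_left, displace_displace, braket_mul_right]
  have : sympl (-a) a = 0 := by simp [sympl, mul_comm]
  simp [this, displace_zero]

/-- The components of the characteristic function of `|Ψ⟩⟨Ψ|`. -/
def charFn (Ψ : QWave M) (a b : Fin 2) (ξ : Fin M → ℂ) : ℂ := braket (Ψ b) (displace ξ (Ψ a))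

theorem IsState.norm_charFn_le {Ψ : QWave M} (h : IsState Ψ) (a b : Fin 2) (ξ : Fin M → ℂ) :
    ‖charFn Ψ a b ξ‖ ≤ 1 := by
  have h1 := norm_braket_sq_le (h.memLp b) (MemLp.displace (h.memLp a) ξ)
  rw [braket_displace_displace] at h1
  have h2 := h.braket_le_one a
  have h3 := h.braket_le_one b
  have h4 := (braket_self (h.memLp a)).2
  have h5 := (braket_self (h.memLp b)).2
  rw [charFn]
  nlinarith [norm_nonneg (braket (Ψ b) (displace ξ (Ψ a)))]

theorem IsStateFamily.continuous_charFn {Ψ : Y → QWave M} (h : IsStateFamily Ψ) (a b : Fin 2)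
    {ξ : Y → Fin M → ℂ} (hξ : Continuous ξ) : Continuous fun y => charFn (Ψ y) a b (ξ y) :=
  (h.coherent b).continuous_braket ((h.coherent a).displace hξ)

theorem charFn_onQubit (R : Matrix (Fin 2) (Fin 2) ℂ) {Ψ : QWave M}
    (h : ∀ a, MemLp (Ψ a) 2 volume) (a b : Fin 2) (ξ : Fin M → ℂ) :
    charFn (onQubit R Ψ) a b ξ = ∑ c, ∑ d, R a c * conj (R b d) * charFn Ψ c d ξ := by
  unfold charFn onQubit
  rw [displace_sum, braket_sum_left _ _ ?_ fun i _ => h i]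
  · simp_rw [braket_sum_right Finset.univ (fun c => R a c) (h _)
      fun i _ => MemLp.displace (h i) ξ, Finset.mul_sum]
    rw [Finset.sum_comm]
    exact Finset.sum_congr rfl fun c _ => Finset.sum_congr rfl fun d _ => by ring
  · exact memLp_finsetSum _ fun i _ => (MemLp.displace (h i) ξ).const_mul _

theorem qubitRotation_apply (θ φ : ℝ) : qubitRotation θ φ =
    !![(Real.cos (θ / 2) : ℂ),
        -Complex.I * Real.sin (θ / 2) * Complex.exp (-(Complex.I * φ));
      -Complex.I * Real.sin (θ / 2) * Complex.exp (Complex.I * φ), (Real.cos (θ / 2) : ℂ)] := by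
  have h1 : Complex.exp (Complex.I * φ) = Real.cos φ + Complex.I * Real.sin φ := by
    rw [mul_comm, Complex.exp_mul_I]; push_cast; ring
  have h2 : Complex.exp (-(Complex.I * φ)) = Real.cos φ - Complex.I * Real.sin φ := by
    rw [mul_comm, ← neg_mul, mul_comm, mul_neg, mul_comm Complex.I, ← neg_mul, Complex.exp_mul_I]
    push_cast
    simp; ring
  rw [h1, h2, qubitRotation]
  ext i k
  fin_cases i <;> fin_cases k <;> simp <;> ring_nf <;> simp

/-- In a diagonal component both vectors are displaced alike, and conjugating a displacement by a
displacement gives a phase. In an off-diagonal component they are displaced oppositely: the argument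
moves by `2β` and the Weyl phases cancel. The flip of the qubit exchanges the indices. -/
theorem charFn_ecd (j : Fin M) (β : ℂ) (Ψ : QWave M) (ξ : Fin M → ℂ) :
    charFn (ecd j β Ψ) 0 0 ξ = Complex.exp (Complex.I *
        ((2 * sympl ξ (Pi.single j (-β)) : ℝ) : ℂ)) * charFn Ψ 1 1 ξ ∧
    charFn (ecd j β Ψ) 1 1 ξ = Complex.exp (Complex.I *
        ((2 * sympl ξ (Pi.single j β) : ℝ) : ℂ)) * charFn Ψ 0 0 ξ ∧
    charFn (ecd j β Ψ) 0 1 ξ = charFn Ψ 1 0 (ξ - Pi.single j (2 * β)) ∧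
    charFn (ecd j β Ψ) 1 0 ξ = charFn Ψ 0 1 (ξ + Pi.single j (2 * β)) := by
  have key : ∀ (a b : Fin M → ℂ) (f g : Wave M),
      braket (displace a f) (displace ξ (displace b g)) =
      Complex.exp (Complex.I * ((sympl ξ b + sympl (-a) (ξ + b) : ℝ) : ℂ)) *
        braket f (displace (ξ + b - a) g) := by
    intro a b f g
    rw [braket_displace_left, displace_displace ξ b]
    have h : displace (-a) (fun q => Complex.exp (Complex.I * (sympl ξ b : ℝ)) *
        displace (ξ + b) g q) = fun q => Complex.exp (Complex.I * (sympl ξ b : ℝ)) *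
        displace (-a) (displace (ξ + b) g) q := by
      funext q; simp only [displace]; ring
    rw [h, displace_displace]
    simp only [← mul_assoc, ← Complex.exp_add]
    rw [braket_mul_right]
    congr 2
    · push_cast; ring
    · rw [neg_add_eq_sub]
  have hs : ∀ a b c : Fin M → ℂ, sympl a (b + c) = sympl a b + sympl a c := by
    intro a b c
    simp only [sympl, ← Finset.sum_add_distrib]
    exact Finset.sum_congr rfl fun i _ => by simp; ring
  have hn : ∀ a b : Fin M → ℂ, sympl (-a) b = sympl b a := by
    intro a b
    simp only [sympl]
    exact Finset.sum_congr rfl fun i _ => by simp; ring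
  have hn2 : ∀ a b : Fin M → ℂ, sympl a (-b) = - sympl a b := by
    intro a b
    simp only [sympl, ← Finset.sum_neg_distrib]
    exact Finset.sum_congr rfl fun i _ => by simp; ring
  have h0 : ∀ a : Fin M → ℂ, sympl a a = 0 := fun a => by simp [sympl, mul_comm]
  have hneg : (Pi.single j (-β) : Fin M → ℂ) = -Pi.single j β := Pi.single_neg (f := fun _ => ℂ) j β
  have h2 : (Pi.single j (2 * β) : Fin M → ℂ) = Pi.single j β + Pi.single j β := by
    rw [← Pi.single_add, two_mul]
  refine ⟨?_, ?_, ?_, ?_⟩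
  · change braket (displace (Pi.single j (-β)) (Ψ 1))
      (displace ξ (displace (Pi.single j (-β)) (Ψ 1))) = _
    rw [key, add_sub_cancel_right, hn, charFn, hneg]
    congr 4
    rw [hn2]
    simp only [sympl, ← Finset.sum_neg_distrib, Finset.mul_sum, ← Finset.sum_add_distrib]
    exact Finset.sum_congr rfl fun i _ => by simp; ring
  · change braket (displace (Pi.single j β) (Ψ 0))
      (displace ξ (displace (Pi.single j β) (Ψ 0))) = _
    rw [key, add_sub_cancel_right, hn, charFn]
    congr 4
    simp only [sympl, Finset.mul_sum, ← Finset.sum_add_distrib]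
    exact Finset.sum_congr rfl fun i _ => by simp; ring
  · change braket (displace (Pi.single j β) (Ψ 0))
      (displace ξ (displace (Pi.single j (-β)) (Ψ 1))) = _
    rw [key, hneg, hn2, hn, charFn, h2]
    have : -sympl ξ (Pi.single j β) + sympl (ξ + -Pi.single j β) (Pi.single j β) = 0 := by
      simp only [sympl, ← Finset.sum_neg_distrib, ← Finset.sum_add_distrib]
      exact Finset.sum_eq_zero fun i _ => by simp; ring
    rw [this]
    simp [sub_eq_add_neg, add_assoc]
  · change braket (displace (Pi.single j (-β)) (Ψ 1))
      (displace ξ (displace (Pi.single j β) (Ψ 0))) = _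
    rw [key, hneg, neg_neg, charFn, h2]
    have : sympl ξ (Pi.single j β) + sympl (Pi.single j β) (ξ + Pi.single j β) = 0 := by
      simp only [sympl, ← Finset.sum_add_distrib]
      exact Finset.sum_eq_zero fun i _ => by simp; ring
    rw [this]
    simp [add_assoc]

theorem normSq_qubitRotation (θ : ℝ) : (Real.cos (θ / 2) : ℂ) * Real.cos (θ / 2) +
    Real.sin (θ / 2) * Real.sin (θ / 2) = 1 := by
  have := Real.cos_sq_add_sin_sq (θ / 2)
  rw [← sq, ← sq]
  exact_mod_cast this

theorem conj_exp_I (φ : ℝ) : conj (Complex.exp (Complex.I * φ)) = Complex.exp (-(Complex.I * φ)) ∧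
    conj (Complex.exp (-(Complex.I * φ))) = Complex.exp (Complex.I * φ) := by
  constructor <;> rw [← Complex.exp_conj] <;> simp

/-- A rotation preserves the partial trace over the qubit. At `ξ = 0` this is conservation of the
norm, which is how it is used. -/
theorem trace_charFn_onQubit (θ φ : ℝ) {Ψ : QWave M}
    (h : ∀ a, MemLp (Ψ a) 2 volume) (ξ : Fin M → ℂ) :
    charFn (onQubit (qubitRotation θ φ) Ψ) 0 0 ξ + charFn (onQubit (qubitRotation θ φ) Ψ) 1 1 ξ =
      charFn Ψ 0 0 ξ + charFn Ψ 1 1 ξ := by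
  have he : Complex.exp (-(Complex.I * φ)) * Complex.exp (Complex.I * φ) = 1 := by
    rw [← Complex.exp_add]; simp
  have hs := normSq_qubitRotation θ
  rw [charFn_onQubit _ h, charFn_onQubit _ h, qubitRotation_apply]
  simp only [Fin.sum_univ_two, Matrix.of_apply, Matrix.cons_val', Matrix.cons_val_zero,
    Matrix.cons_val_one, Matrix.cons_val_fin_one, map_mul, map_neg, Complex.conj_I,
    Complex.conj_ofReal, (conj_exp_I φ).1, (conj_exp_I φ).2]
  generalize Complex.exp (-(Complex.I * φ)) = e at *
  generalize Complex.exp (Complex.I * φ) = e' at *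
  generalize (Real.cos (θ / 2) : ℂ) = c at *
  generalize (Real.sin (θ / 2) : ℂ) = s at *
  linear_combination (exp := 1) (charFn Ψ 0 0 ξ + charFn Ψ 1 1 ξ) * hs +
    s ^ 2 * (charFn Ψ 0 0 ξ + charFn Ψ 1 1 ξ) * he -
    s ^ 2 * e * e' * (charFn Ψ 0 0 ξ + charFn Ψ 1 1 ξ) * Complex.I_sq

end States

/-! ### Running a sequence of blocks -/

section Run

variable {M : ℕ} {Y Y' : Type} [TopologicalSpace Y] [TopologicalSpace Y'] {ι : Type}

/-- A rotation followed by an echoed conditional displacement. -/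
def blockStep (j : Fin M) (p : ℝ × ℝ × ℂ) (Ψ : QWave M) : QWave M :=
  ecd j p.2.2 (onQubit (qubitRotation p.1 p.2.1) Ψ)

/-- The blocks of the list `l`, the block `g` acting on the mode `m g`. -/
def runFrom (m : ι → Fin M) (l : List ι) (x : ι → ℝ × ℝ × ℂ) (Ψ : QWave M) : QWave M :=
  l.foldl (fun Ψ g => blockStep (m g) (x g) Ψ) Ψ

/-- The blocks of the list `l` applied to `|0⟩ ⊗ vacuum`. -/
def run (m : ι → Fin M) (l : List ι) (x : ι → ℝ × ℝ × ℂ) : QWave M :=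
  runFrom m l x ![vacuum M, 0]

theorem runFrom_concat (m : ι → Fin M) (l : List ι) (g : ι) (x : ι → ℝ × ℝ × ℂ) (Ψ : QWave M) :
    runFrom m (l ++ [g]) x Ψ = blockStep (m g) (x g) (runFrom m l x Ψ) := by
  simp [runFrom]

theorem run_concat (m : ι → Fin M) (l : List ι) (g : ι) (x : ι → ℝ × ℝ × ℂ) :
    run m (l ++ [g]) x = blockStep (m g) (x g) (run m l x) := runFrom_concat m l g x _

theorem runFrom_update [DecidableEq ι] (m : ι → Fin M) {l : List ι} {g : ι} (hg : g ∉ l)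
    (x : ι → ℝ × ℝ × ℂ) (p : ℝ × ℝ × ℂ) (Ψ : QWave M) :
    runFrom m l (Function.update x g p) Ψ = runFrom m l x Ψ := by
  unfold runFrom
  refine List.foldl_ext _ _ _ fun Φ k hk => ?_
  rw [Function.update_of_ne]
  rintro rfl
  exact hg hk

theorem IsStateFamily.blockStep {Ψ : Y → QWave M} (h : IsStateFamily Ψ) (j : Fin M)
    {p : Y → ℝ × ℝ × ℂ} (hp : Continuous p) :
    IsStateFamily fun y => QumodeVQC.blockStep j (p y) (Ψ y) := by
  have hR : ∀ a b, Continuous fun y => qubitRotation (p y).1 (p y).2.1 a b := by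
    intro a b
    simp_rw [qubitRotation_apply]
    fin_cases a <;> fin_cases b <;> simp <;> fun_prop
  have hrot : ∀ a, IsCoherentFamily fun y => onQubit (qubitRotation (p y).1 (p y).2.1) (Ψ y) a := by
    intro a
    unfold onQubit
    simp_rw [Fin.sum_univ_two]
    exact ((h.coherent 0).smul (hR a 0)).add ((h.coherent 1).smul (hR a 1))
  have hs : Continuous fun y => (Pi.single j (p y).2.2 : Fin M → ℂ) :=
    (continuous_single j).comp (by fun_prop)
  have hs' : Continuous fun y => (Pi.single j (-(p y).2.2) : Fin M → ℂ) :=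
    (continuous_single j).comp (by fun_prop)
  refine ⟨fun a => ?_, fun y => ?_⟩
  · fin_cases a
    · exact (hrot 1).displace hs'
    · exact (hrot 0).displace hs
  · have h1 := trace_charFn_onQubit (p y).1 (p y).2.1 (fun a => (h.coherent a).memLp y) 0
    simp only [charFn, displace_zero] at h1
    rw [← h.norm_eq y, ← h1, add_comm]
    unfold QumodeVQC.blockStep ecd
    simp only [Matrix.cons_val_zero, Matrix.cons_val_one, Matrix.cons_val_fin_one]
    rw [braket_displace_displace, braket_displace_displace]

theorem braket_vacuum_vacuum : braket (vacuum M) (vacuum M) = 1 := by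
  have := braket_vacuum_displace (0 : Fin M → ℂ)
  rw [displace_zero] at this
  rw [this]; simp [normSqSum]

theorem isStateFamily_initial : IsStateFamily fun _ : Y => (![vacuum M, 0] : QWave M) := by
  refine ⟨fun a => ?_, fun y => ?_⟩
  · fin_cases a
    · exact isCoherentFamily_vacuum
    · exact isCoherentFamily_zero
  · simp [braket_vacuum_vacuum]
    simp [braket]

theorem IsStateFamily.runFrom {Ψ : Y → QWave M} (h : IsStateFamily Ψ) (m : ι → Fin M)
    (l : List ι) {x : Y → ι → ℝ × ℝ × ℂ} (hx : Continuous x) :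
    IsStateFamily fun y => QumodeVQC.runFrom m l (x y) (Ψ y) := by
  induction l using List.reverseRecOn with
  | nil => exact h
  | append_singleton l g ih =>
    simp_rw [runFrom_concat]
    exact ih.blockStep (m g) (by fun_prop)

theorem isStateFamily_run (m : ι → Fin M) (l : List ι) : IsStateFamily fun x => run m l x :=
  isStateFamily_initial.runFrom m l continuous_id

/-- Bounded functions of the state that depend continuously on the parameters of any family. -/
structure IsObservable {E : Type*} [NormedAddCommGroup E] (H : QWave M → E) : Prop where
  continuous : ∀ {Y : Type} [TopologicalSpace Y] {Ψ : Y → QWave M}, IsStateFamily Ψ →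
    Continuous fun y => H (Ψ y)
  bounded : ∃ C, ∀ Ψ, IsState Ψ → ‖H Ψ‖ ≤ C

/-- The distribution of the parameters of one block. -/
abbrev paramMeasure (v : ℝ) : Measure (ℝ × ℝ × ℂ) :=
  uniformAngle.prod (uniformAngle.prod (complexGaussian v))

/-- Fubini in the order that the recursions need: the angles innermost, so that they can be averaged
in closed form at a fixed state, and the displacement outermost. -/
theorem integral_param {Y : Type} {E : Type*} [MeasurableSpace Y] [NormedAddCommGroup E]
    [NormedSpace ℝ E] (ν : Measure Y)
    [IsProbabilityMeasure ν] (v : ℝ) {F : Y × ℝ × ℝ × ℂ → E} (hF : StronglyMeasurable F)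
    {C : ℝ} (hC : ∀ z, ‖F z‖ ≤ C) :
    ∫ z, F z ∂(ν.prod (paramMeasure v)) =
      ∫ β, ∫ y, ∫ θ, ∫ φ, F (y, θ, φ, β) ∂uniformAngle ∂uniformAngle ∂ν ∂complexGaussian v := by
  have int : ∀ {Z : Type} [MeasurableSpace Z] (ρ : Measure Z) [IsProbabilityMeasure ρ]
      (G : Z → E), StronglyMeasurable G → (∀ z, ‖G z‖ ≤ C) → Integrable G ρ :=
    fun ρ _ G hG hb => Integrable.of_bound hG.aestronglyMeasurable C
      (Filter.Eventually.of_forall hb)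
  have bnd : ∀ {Z : Type} [MeasurableSpace Z] (ρ : Measure Z) [IsProbabilityMeasure ρ]
      (G : Z → E), (∀ z, ‖G z‖ ≤ C) → ‖∫ z, G z ∂ρ‖ ≤ C := by
    intro Z _ ρ _ G hb
    have := norm_integral_le_of_norm_le_const (μ := ρ) (Filter.Eventually.of_forall hb)
    simpa using this
  rw [integral_prod _ (int _ _ hF hC)]
  have h1 : ∀ y, ∫ p, F (y, p) ∂(paramMeasure v) =
      ∫ β, ∫ θ, ∫ φ, F (y, θ, φ, β) ∂uniformAngle ∂uniformAngle ∂complexGaussian v := by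
    intro y
    have hFy : StronglyMeasurable fun p => F (y, p) := hF.comp_measurable (by fun_prop)
    rw [integral_prod _ (int _ _ hFy fun _ => hC _)]
    have h2 : ∀ θ, ∫ q, F (y, θ, q) ∂(uniformAngle.prod (complexGaussian v)) =
        ∫ β, ∫ φ, F (y, θ, φ, β) ∂uniformAngle ∂complexGaussian v := fun θ =>
      integral_prod_symm _ (int _ _ (hF.comp_measurable (by fun_prop)) fun _ => hC _)
    simp_rw [h2]
    refine integral_integral_swap (int _ _ ?_ fun z => bnd _ _ fun _ => hC _)
    exact StronglyMeasurable.integral_prod_right'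
      (f := fun z : (ℝ × ℂ) × ℝ => F (y, z.1.1, z.2, z.1.2)) (hF.comp_measurable (by fun_prop))
  simp_rw [h1]
  refine integral_integral_swap (int _ _ ?_ fun z => bnd _ _ fun _ => bnd _ _ fun _ => hC _)
  refine StronglyMeasurable.integral_prod_right'
    (f := fun z : (Y × ℂ) × ℝ => ∫ φ, F (z.1.1, z.2, φ, z.1.2) ∂uniformAngle) ?_
  exact StronglyMeasurable.integral_prod_right'
    (f := fun z : ((Y × ℂ) × ℝ) × ℝ => F (z.1.1.1, z.1.2, z.2, z.1.1.2))
    (hF.comp_measurable (by fun_prop))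

variable [Fintype ι]

/-- The average of an observable over the parameters of the blocks of `l`. -/
def average {E : Type*} [NormedAddCommGroup E] [NormedSpace ℝ E] (v : ℝ) (m : ι → Fin M)
    (l : List ι) (H : QWave M → E) : E :=
  ∫ x, H (run m l x) ∂Measure.pi fun _ : ι => paramMeasure v

theorem average_nil {E : Type*} [NormedAddCommGroup E] [NormedSpace ℝ E] [CompleteSpace E]
    (v : ℝ) (m : ι → Fin M)
    (H : QWave M → E) : average v m [] H = H ![vacuum M, 0] := by
  simp [average, run, runFrom]

theorem IsObservable.integrable {E : Type*} [NormedAddCommGroup E]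
    [SecondCountableTopology E] {H : QWave M → E} (hH : IsObservable H) {Y : Type}
    [TopologicalSpace Y] [MeasurableSpace Y] [OpensMeasurableSpace Y] (ν : Measure Y)
    [IsFiniteMeasure ν] {Ψ : Y → QWave M} (hΨ : IsStateFamily Ψ) :
    Integrable (fun y => H (Ψ y)) ν := by
  obtain ⟨C, hC⟩ := hH.bounded
  exact Integrable.of_bound (hH.continuous hΨ).aestronglyMeasurable C
    (Filter.Eventually.of_forall fun y => hC _ (hΨ.isState y))

/-- The state reached before `g` does not depend on the parameters of `g`, because `g` does not
occur earlier; these may therefore be redrawn and averaged separately. -/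
theorem average_concat [DecidableEq ι] {E : Type*} [NormedAddCommGroup E] [NormedSpace ℝ E]
    [SecondCountableTopology E] (v : ℝ) (m : ι → Fin M)
    {l : List ι} {g : ι} (hg : g ∉ l) {H : QWave M → E} (hH : IsObservable H) :
    average v m (l ++ [g]) H = ∫ β, average v m l (fun Ψ => ∫ θ, ∫ φ,
      H (ecd (m g) β (onQubit (qubitRotation θ φ) Ψ)) ∂uniformAngle ∂uniformAngle)
        ∂complexGaussian v := by
  obtain ⟨C, hC⟩ := hH.bounded
  have hfam : IsStateFamily fun z : (ι → ℝ × ℝ × ℂ) × ℝ × ℝ × ℂ =>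
      blockStep (m g) z.2 (run m l z.1) :=
    ((isStateFamily_run m l).comp continuous_fst).blockStep (m g) continuous_snd
  unfold average
  rw [integral_pi_update _ g (hH.continuous (isStateFamily_run m _)).aestronglyMeasurable]
  have h1 : ∀ z : (ι → ℝ × ℝ × ℂ) × ℝ × ℝ × ℂ, run m (l ++ [g]) (Function.update z.1 g z.2) =
      blockStep (m g) z.2 (run m l z.1) := by
    intro z
    rw [run_concat, Function.update_self, run, runFrom_update m hg]; rfl
  simp_rw [h1]
  exact integral_param _ v (hH.continuous hfam).stronglyMeasurable
    (fun z => hC _ (hfam.isState z))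

end Run

/-! ### The gradient and the second moment of the cost -/

section Gradient

theorem integral_uniformAngle_two_mul {E : Type*} [NormedAddCommGroup E] [NormedSpace ℝ E]
    {f : ℝ → E} (hf : Function.Periodic f (2 * Real.pi)) (hc : Continuous f) :
    ∫ t, f (2 * t) ∂uniformAngle = ∫ t, f t ∂uniformAngle := by
  rw [integral_uniformAngle, integral_uniformAngle]
  congr 1
  have h1 : ∫ t in (0 : ℝ)..(2 * Real.pi), f (2 * t) =
      (2 : ℝ)⁻¹ • ∫ t in (2 * 0 : ℝ)..(2 * (2 * Real.pi)), f t :=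
    intervalIntegral.integral_comp_mul_left f two_ne_zero
  have h2 := hf.intervalIntegral_add_eq (2 * Real.pi) 0
  rw [zero_add] at h2
  rw [h1, mul_zero, ← intervalIntegral.integral_add_adjacent_intervals
    (hc.intervalIntegrable 0 (2 * Real.pi)) (hc.intervalIntegrable (2 * Real.pi) _), two_mul
    (2 * Real.pi), h2, ← two_smul ℝ, smul_smul]
  norm_num

theorem integral_norm_sq_trig_two (a b c : ℂ) :
    ∫ t : ℝ, ‖a + b * Complex.exp (Complex.I * ((2 * t : ℝ) : ℂ)) +
      c * Complex.exp (-(Complex.I * ((2 * t : ℝ) : ℂ)))‖ ^ 2 ∂uniformAngle =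
      ‖a‖ ^ 2 + ‖b‖ ^ 2 + ‖c‖ ^ 2 := by
  have h := integral_uniformAngle_trig a b c a b c
  have hper : Function.Periodic (fun t : ℝ => ‖a + b * Complex.exp (Complex.I * (t : ℂ)) +
      c * Complex.exp (-(Complex.I * (t : ℂ)))‖ ^ 2) (2 * Real.pi) := by
    intro t
    have h1 : Complex.exp (Complex.I * ((t + 2 * Real.pi : ℝ) : ℂ)) =
        Complex.exp (Complex.I * t) := by
      rw [Complex.ofReal_add, mul_add, Complex.exp_add]
      have : Complex.I * ((2 * Real.pi : ℝ) : ℂ) = 2 * Real.pi * Complex.I := by push_cast; ring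
      rw [this, Complex.exp_two_pi_mul_I, mul_one]
    simp only [Complex.exp_neg, h1]
  rw [integral_uniformAngle_two_mul hper (by fun_prop)]
  simp only [Complex.mul_conj, Complex.normSq_eq_norm_sq] at h
  rw [integral_complex_ofReal] at h
  exact_mod_cast h

/-- The amplitude as a function of the rotation angles. -/
def rotAmp (w u₀ u₁ : ℂ) (θ φ : ℝ) : ℂ :=
  Real.cos (θ / 2) * w + Real.sin (θ / 2) * (Real.cos φ * u₀ + Real.sin φ * u₁)

/-- The derivative of its squared modulus, by the parameter-shift rule. -/
def rotGrad (w u₀ u₁ : ℂ) (θ φ : ℝ) : ℝ :=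
  (‖rotAmp w u₀ u₁ (θ + Real.pi / 2) φ‖ ^ 2 - ‖rotAmp w u₀ u₁ (θ - Real.pi / 2) φ‖ ^ 2) / 2

theorem norm_sq_add_sq (w u : ℂ) : ‖w ^ 2 + u ^ 2‖ ^ 2 =
    (‖w‖ ^ 2 - ‖u‖ ^ 2) ^ 2 + 4 * (w * conj u).re ^ 2 := by
  simp only [← Complex.normSq_eq_norm_sq, Complex.normSq_apply]
  simp [sq]
  ring

theorem norm_sq_rotAmp (w u₀ u₁ : ℂ) (θ φ : ℝ) : ‖rotAmp w u₀ u₁ θ φ‖ ^ 2 =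
    (‖w‖ ^ 2 + ‖Real.cos φ * u₀ + Real.sin φ * u₁‖ ^ 2) / 2 +
    (‖w‖ ^ 2 - ‖Real.cos φ * u₀ + Real.sin φ * u₁‖ ^ 2) / 2 * Real.cos θ +
    (w * conj (Real.cos φ * u₀ + Real.sin φ * u₁)).re * Real.sin θ := by
  unfold rotAmp
  generalize (Real.cos φ * u₀ + Real.sin φ * u₁ : ℂ) = u
  have h1 : Real.cos θ = 2 * Real.cos (θ / 2) ^ 2 - 1 := by
    rw [← Real.cos_two_mul]; congr 1; ring
  have h2 : Real.sin θ = 2 * Real.sin (θ / 2) * Real.cos (θ / 2) := by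
    rw [← Real.sin_two_mul]; congr 1; ring
  have h3 : Real.sin (θ / 2) ^ 2 = 1 - Real.cos (θ / 2) ^ 2 := by
    rw [← Real.cos_sq_add_sin_sq (θ / 2)]; ring
  rw [h1, h2]
  generalize Real.cos (θ / 2) = c at *
  generalize Real.sin (θ / 2) = s at *
  simp only [← Complex.normSq_eq_norm_sq, Complex.normSq_apply]
  simp
  linear_combination (u.re ^ 2 + u.im ^ 2) * h3

theorem rotGrad_eq (w u₀ u₁ : ℂ) (θ φ : ℝ) : rotGrad w u₀ u₁ θ φ =
    -((‖w‖ ^ 2 - ‖Real.cos φ * u₀ + Real.sin φ * u₁‖ ^ 2) / 2) * Real.sin θ +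
    (w * conj (Real.cos φ * u₀ + Real.sin φ * u₁)).re * Real.cos θ := by
  rw [rotGrad, norm_sq_rotAmp, norm_sq_rotAmp, Real.cos_add_pi_div_two, Real.sin_add_pi_div_two,
    Real.cos_sub_pi_div_two, Real.sin_sub_pi_div_two]
  ring

theorem hasDerivAt_rotAmp (w u₀ u₁ : ℂ) (θ φ : ℝ) :
    HasDerivAt (fun t => ‖rotAmp w u₀ u₁ t φ‖ ^ 2) (rotGrad w u₀ u₁ θ φ) θ := by
  rw [rotGrad_eq]
  simp_rw [norm_sq_rotAmp]
  refine ((((Real.hasDerivAt_cos θ).const_mul _).const_add _).add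
    ((Real.hasDerivAt_sin θ).const_mul _)).congr_deriv ?_
  ring

@[fun_prop]
theorem continuous_rotAmp (w u₀ u₁ : ℂ) :
    Continuous (fun z : ℝ × ℝ => rotAmp w u₀ u₁ z.1 z.2) := by
  unfold rotAmp; fun_prop

theorem continuous_integral_uniformAngle {Y : Type*} [TopologicalSpace Y]
    [FirstCountableTopology Y] [LocallyCompactSpace Y] {E : Type*} [NormedAddCommGroup E]
    [NormedSpace ℝ E] {f : Y → ℝ → E}
    (hf : Continuous (Function.uncurry f)) : Continuous fun y => ∫ t, f y t ∂uniformAngle := by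
  simp_rw [integral_uniformAngle]
  exact (intervalIntegral.continuous_parametric_intervalIntegral_of_continuous'
    (μ := volume) hf 0 (2 * Real.pi)).const_smul (2 * Real.pi)⁻¹

theorem periodic_norm_rotAmp (w u₀ u₁ : ℂ) (φ : ℝ) :
    Function.Periodic (fun θ => ‖rotAmp w u₀ u₁ θ φ‖) (2 * Real.pi) := by
  intro θ
  have h : rotAmp w u₀ u₁ (θ + 2 * Real.pi) φ = - rotAmp w u₀ u₁ θ φ := by
    have h1 : (θ + 2 * Real.pi) / 2 = θ / 2 + Real.pi := by ring
    rw [rotAmp, rotAmp, h1, Real.cos_add_pi, Real.sin_add_pi]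
    push_cast; ring
  simp only [h, norm_neg]

/-- Both terms of the parameter-shift formula have the same average over `θ`, by periodicity. -/
theorem integral_rotGrad (w u₀ u₁ : ℂ) :
    ∫ θ, ∫ φ, rotGrad w u₀ u₁ θ φ ∂uniformAngle ∂uniformAngle = 0 := by
  let h : ℝ → ℝ := fun θ => ∫ φ, ‖rotAmp w u₀ u₁ θ φ‖ ^ 2 ∂uniformAngle
  have hc : Continuous h := continuous_integral_uniformAngle (by unfold Function.uncurry; fun_prop)
  have hp : Function.Periodic h (2 * Real.pi) := by
    intro θ
    simp only [h, periodic_norm_rotAmp w u₀ u₁ _ θ]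
  have h1 : ∀ θ, ∫ φ, rotGrad w u₀ u₁ θ φ ∂uniformAngle =
      (h (θ + Real.pi / 2) - h (θ - Real.pi / 2)) / 2 := by
    intro θ
    simp only [rotGrad, h]
    rw [integral_div, integral_sub] <;>
      exact integrable_of_continuous_uniformAngle (by unfold rotAmp; fun_prop)
  simp_rw [h1]
  rw [integral_div, integral_sub (integrable_of_continuous_uniformAngle (by fun_prop))
    (integrable_of_continuous_uniformAngle (by fun_prop)), integral_uniformAngle_add hp]
  simp_rw [sub_eq_add_neg _ (Real.pi / 2)]
  rw [integral_uniformAngle_add hp]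
  simp

/-- Pointwise `((a - b) / 2)² ≤ (a² + b²) / 2`, and the shifts by `±π/2` do not change the average
over `θ`. -/
theorem integral_rotGrad_sq_le (w u₀ u₁ : ℂ) :
    ∫ θ, ∫ φ, rotGrad w u₀ u₁ θ φ ^ 2 ∂uniformAngle ∂uniformAngle ≤
      ∫ θ, ∫ φ, (‖rotAmp w u₀ u₁ θ φ‖ ^ 2) ^ 2 ∂uniformAngle ∂uniformAngle := by
  let h : ℝ → ℝ := fun θ => ∫ φ, (‖rotAmp w u₀ u₁ θ φ‖ ^ 2) ^ 2 ∂uniformAngle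
  have hc : Continuous h := continuous_integral_uniformAngle (by unfold Function.uncurry; fun_prop)
  have hp : Function.Periodic h (2 * Real.pi) := by
    intro θ
    simp only [h, periodic_norm_rotAmp w u₀ u₁ _ θ]
  have h1 : ∀ θ, ∫ φ, rotGrad w u₀ u₁ θ φ ^ 2 ∂uniformAngle ≤
      (h (θ + Real.pi / 2) + h (θ - Real.pi / 2)) / 2 := by
    intro θ
    simp only [h]
    rw [← integral_add, ← integral_div]
    · refine integral_mono (integrable_of_continuous_uniformAngle ?_)
        (integrable_of_continuous_uniformAngle ?_) fun φ => ?_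
      · unfold rotGrad rotAmp; fun_prop
      · unfold rotAmp; fun_prop
      · simp only [rotGrad]
        nlinarith [sq_nonneg (‖rotAmp w u₀ u₁ (θ + Real.pi / 2) φ‖ ^ 2 +
          ‖rotAmp w u₀ u₁ (θ - Real.pi / 2) φ‖ ^ 2)]
    all_goals exact integrable_of_continuous_uniformAngle (by unfold rotAmp; fun_prop)
  have hcg : Continuous fun θ => ∫ φ, rotGrad w u₀ u₁ θ φ ^ 2 ∂uniformAngle :=
    continuous_integral_uniformAngle (by unfold Function.uncurry rotGrad; fun_prop)
  refine (integral_mono (integrable_of_continuous_uniformAngle hcg)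
    (integrable_of_continuous_uniformAngle (by fun_prop)) h1).trans (le_of_eq ?_)
  rw [integral_div, integral_add (integrable_of_continuous_uniformAngle (by fun_prop))
    (integrable_of_continuous_uniformAngle (by fun_prop)), integral_uniformAngle_add hp]
  simp_rw [sub_eq_add_neg _ (Real.pi / 2)]
  rw [integral_uniformAngle_add hp]
  simp [h]

/-- Adding the values at `θ` and `θ + π/2` replaces `sin²` and `cos²` by one and leaves `|w² + u²|²
/ 4`. The two values have the same average, which accounts for the remaining factor `1/2`. -/
theorem integral_rotGrad_sq (w u₀ u₁ : ℂ) :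
    ∫ θ, ∫ φ, rotGrad w u₀ u₁ θ φ ^ 2 ∂uniformAngle ∂uniformAngle =
      (∫ φ : ℝ, ‖w ^ 2 + (Real.cos φ * u₀ + Real.sin φ * u₁) ^ 2‖ ^ 2 ∂uniformAngle) / 8 := by
  let h : ℝ → ℝ := fun θ => ∫ φ, rotGrad w u₀ u₁ θ φ ^ 2 ∂uniformAngle
  have hc : Continuous h :=
    continuous_integral_uniformAngle (by unfold Function.uncurry rotGrad; fun_prop)
  have hp : Function.Periodic h (2 * Real.pi) := by
    intro θ
    simp only [h, rotGrad_eq, Real.sin_add_two_pi, Real.cos_add_two_pi]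
  have h1 : ∀ θ, h θ + h (θ + Real.pi / 2) =
      (∫ φ : ℝ, ‖w ^ 2 + (Real.cos φ * u₀ + Real.sin φ * u₁) ^ 2‖ ^ 2 ∂uniformAngle) / 4 := by
    intro θ
    simp only [h]
    rw [← integral_add, ← integral_div]
    · congr 1
      funext φ
      rw [rotGrad_eq, rotGrad_eq, norm_sq_add_sq, Real.sin_add_pi_div_two, Real.cos_add_pi_div_two]
      have := Real.cos_sq_add_sin_sq θ
      generalize (w * conj (Real.cos φ * u₀ + Real.sin φ * u₁ : ℂ)).re = B'
      generalize ‖w‖ ^ 2 - ‖(Real.cos φ * u₀ + Real.sin φ * u₁ : ℂ)‖ ^ 2 = B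
      linear_combination (B ^ 2 / 4 + B' ^ 2) * this
    all_goals exact integrable_of_continuous_uniformAngle (by unfold rotGrad rotAmp; fun_prop)
  have h2 : ∫ θ, (h θ + h (θ + Real.pi / 2)) ∂uniformAngle = 2 * ∫ θ, h θ ∂uniformAngle := by
    rw [integral_add (integrable_of_continuous_uniformAngle (by fun_prop))
    (integrable_of_continuous_uniformAngle (by fun_prop)), integral_uniformAngle_add hp]
    ring
  simp_rw [h1] at h2
  rw [integral_const, probReal_univ, one_smul] at h2
  simp only [h] at h2
  linarith

theorem norm_add_sq_le (z w : ℂ) : ‖z + w‖ ^ 2 ≤ 2 * ‖z‖ ^ 2 + 2 * ‖w‖ ^ 2 := by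
  have := norm_add_le z w
  nlinarith [sq_nonneg (‖z‖ - ‖w‖), norm_nonneg (z + w)]

/-- With `u = p e^{iφ} + q e^{-iφ}`, the function `w² + u²` is a trigonometric polynomial in `2φ`
with coefficients `w² + 2pq`, `p²`, `q²`. By Parseval none of the three can be large without the
averaged squared gradient being large, and together they bound the amplitude: there is no
cancellation that could make the gradient much smaller than the cost. -/
theorem le_integral_rotGrad_sq (w u₀ u₁ : ℂ) :
    ∫ θ, ∫ φ, (‖rotAmp w u₀ u₁ θ φ‖ ^ 2) ^ 2 ∂uniformAngle ∂uniformAngle ≤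
      192 * ∫ θ, ∫ φ, rotGrad w u₀ u₁ θ φ ^ 2 ∂uniformAngle ∂uniformAngle := by
  set p : ℂ := (u₀ - Complex.I * u₁) / 2 with hp
  set q : ℂ := (u₀ + Complex.I * u₁) / 2 with hq
  have hu : ∀ φ : ℝ, (Real.cos φ * u₀ + Real.sin φ * u₁ : ℂ) =
      p * Complex.exp (Complex.I * φ) + q * Complex.exp (-(Complex.I * φ)) := by
    intro φ
    have h1 : Complex.exp (Complex.I * φ) = Real.cos φ + Complex.I * Real.sin φ := by
      rw [mul_comm, Complex.exp_mul_I]; push_cast; ring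
    have h2 : Complex.exp (-(Complex.I * φ)) = Real.cos φ - Complex.I * Real.sin φ := by
      rw [← (conj_exp_I φ).1, h1]; simp only [map_add, map_mul, Complex.conj_I, Complex.conj_ofReal]
      ring
    rw [h1, h2, hp, hq]
    linear_combination (u₁ * Real.sin φ) * Complex.I_sq
  have hsq : ∀ φ : ℝ, w ^ 2 + (Real.cos φ * u₀ + Real.sin φ * u₁ : ℂ) ^ 2 =
      (w ^ 2 + 2 * p * q) + p ^ 2 * Complex.exp (Complex.I * ((2 * φ : ℝ) : ℂ)) +
        q ^ 2 * Complex.exp (-(Complex.I * ((2 * φ : ℝ) : ℂ))) := by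
    intro φ
    have h1 : Complex.exp (Complex.I * ((2 * φ : ℝ) : ℂ)) = Complex.exp (Complex.I * φ) ^ 2 := by
      rw [← Complex.exp_nat_mul]; congr 1; push_cast; ring
    have h2 : Complex.exp (-(Complex.I * ((2 * φ : ℝ) : ℂ))) =
        Complex.exp (-(Complex.I * φ)) ^ 2 := by
      rw [← Complex.exp_nat_mul]; congr 1; push_cast; ring
    have he : Complex.exp (-(Complex.I * φ)) * Complex.exp (Complex.I * φ) = 1 := by
      rw [← Complex.exp_add]; simp
    rw [hu, h1, h2]
    linear_combination (2 * p * q) * he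
  rw [integral_rotGrad_sq]
  simp_rw [hsq]
  rw [integral_norm_sq_trig_two]
  -- The squared amplitude is at most `a + 3(|p|² + |q|²)` with `a = |w² + 2pq|`, where `w` is
  -- recovered from `|w|² ≤ a + 2|p||q|`. Squaring gives the constant `24`, and `192 = 8 · 24`.
  have hb : ∀ θ φ, (‖rotAmp w u₀ u₁ θ φ‖ ^ 2) ^ 2 ≤
      24 * (‖w ^ 2 + 2 * p * q‖ ^ 2 + ‖p ^ 2‖ ^ 2 + ‖q ^ 2‖ ^ 2) := by
    intro θ φ
    have h1 : ‖(Real.cos φ * u₀ + Real.sin φ * u₁ : ℂ)‖ ^ 2 ≤ 2 * ‖p‖ ^ 2 + 2 * ‖q‖ ^ 2 := by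
      rw [hu]
      refine (norm_add_sq_le _ _).trans (le_of_eq ?_)
      rw [norm_mul, norm_mul, Complex.norm_exp, Complex.norm_exp]
      simp
    have h2 : ‖w‖ ^ 2 ≤ ‖w ^ 2 + 2 * p * q‖ + 2 * (‖p‖ * ‖q‖) := by
      have := norm_sub_le (w ^ 2 + 2 * p * q) (2 * p * q)
      rw [add_sub_cancel_right, norm_pow, norm_mul, norm_mul] at this
      simp at this
      linarith
    have h3 : ‖rotAmp w u₀ u₁ θ φ‖ ^ 2 ≤
        ‖w‖ ^ 2 + ‖(Real.cos φ * u₀ + Real.sin φ * u₁ : ℂ)‖ ^ 2 := by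
      unfold rotAmp
      generalize (Real.cos φ * u₀ + Real.sin φ * u₁ : ℂ) = u
      have ht : ‖(Real.cos (θ / 2) : ℂ) * w + Real.sin (θ / 2) * u‖ ≤
          |Real.cos (θ / 2)| * ‖w‖ + |Real.sin (θ / 2)| * ‖u‖ := by
        refine (norm_add_le _ _).trans (le_of_eq ?_)
        rw [norm_mul, norm_mul, Complex.norm_real, Complex.norm_real, Real.norm_eq_abs,
          Real.norm_eq_abs]
      have hcs : |Real.cos (θ / 2)| ^ 2 + |Real.sin (θ / 2)| ^ 2 = 1 := by
        rw [sq_abs, sq_abs]; exact Real.cos_sq_add_sin_sq _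
      have h0 := norm_nonneg ((Real.cos (θ / 2) : ℂ) * w + Real.sin (θ / 2) * u)
      calc _ ≤ (|Real.cos (θ / 2)| * ‖w‖ + |Real.sin (θ / 2)| * ‖u‖) ^ 2 := by gcongr
        _ ≤ (|Real.cos (θ / 2)| ^ 2 + |Real.sin (θ / 2)| ^ 2) * (‖w‖ ^ 2 + ‖u‖ ^ 2) := by
          nlinarith [sq_nonneg (|Real.cos (θ / 2)| * ‖u‖ - |Real.sin (θ / 2)| * ‖w‖)]
        _ = _ := by rw [hcs, one_mul]
    have h4 : ‖rotAmp w u₀ u₁ θ φ‖ ^ 2 ≤ ‖w ^ 2 + 2 * p * q‖ + 3 * (‖p‖ ^ 2 + ‖q‖ ^ 2) := by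
      nlinarith [sq_nonneg (‖p‖ - ‖q‖)]
    rw [norm_pow p, norm_pow q]
    have h5 : (‖rotAmp w u₀ u₁ θ φ‖ ^ 2) ^ 2 ≤
        (‖w ^ 2 + 2 * p * q‖ + 3 * (‖p‖ ^ 2 + ‖q‖ ^ 2)) ^ 2 := by gcongr
    nlinarith [sq_nonneg (‖w ^ 2 + 2 * p * q‖ * 3 - (‖p‖ ^ 2 + ‖q‖ ^ 2)),
      sq_nonneg (‖p‖ ^ 2 - ‖q‖ ^ 2)]
  have hmono : ∀ f : ℝ → ℝ, Continuous f → ∀ c, (∀ t, f t ≤ c) → ∫ t, f t ∂uniformAngle ≤ c := by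
    intro f hf c hfc
    have := integral_mono (integrable_of_continuous_uniformAngle hf) (integrable_const c) hfc
    simpa using this
  refine (hmono _ ?_ _ fun θ => hmono _ ?_ _ (hb θ)).trans (le_of_eq (by ring))
  · exact continuous_integral_uniformAngle (by unfold Function.uncurry; fun_prop)
  · unfold rotAmp; fun_prop

end Gradient

section GradientMoments

variable {M L : ℕ}

theorem onQubit_sum {κ : Type*} (s : Finset κ) (R : Matrix (Fin 2) (Fin 2) ℂ) (c : κ → ℂ)
    (Φ : κ → QWave M) : onQubit R (fun a q => ∑ i ∈ s, c i * Φ i a q) =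
      fun a q => ∑ i ∈ s, c i * onQubit R (Φ i) a q := by
  funext a q
  simp only [onQubit, Finset.mul_sum]
  rw [Finset.sum_comm]
  exact Finset.sum_congr rfl fun i _ => Finset.sum_congr rfl fun k _ => by ring

theorem ecd_sum {κ : Type*} (s : Finset κ) (j : Fin M) (β : ℂ) (c : κ → ℂ)
    (Φ : κ → QWave M) : ecd j β (fun a q => ∑ i ∈ s, c i * Φ i a q) =
      fun a q => ∑ i ∈ s, c i * ecd j β (Φ i) a q := by
  funext a
  fin_cases a
  · exact displace_sum s _ c fun i => Φ i 1
  · exact displace_sum s _ c fun i => Φ i 0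

theorem runFrom_sum {ι : Type} {κ : Type*} (s : Finset κ) (m : ι → Fin M) (l : List ι)
    (x : ι → ℝ × ℝ × ℂ) (c : κ → ℂ) (Φ : κ → QWave M) :
    runFrom m l x (fun a q => ∑ i ∈ s, c i * Φ i a q) =
      fun a q => ∑ i ∈ s, c i * runFrom m l x (Φ i) a q := by
  induction l generalizing Φ with
  | nil => rfl
  | cons g l ih =>
    simp only [runFrom, List.foldl_cons, blockStep]
    rw [onQubit_sum, ecd_sum]
    exact ih _

/-- The order in which the blocks act. -/
def blockList (L M : ℕ) : List (Block L M) := (List.finRange L) ×ˢ (List.finRange M)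

theorem output_eq_run (x : Params L M) : output x = run Prod.snd (blockList L M) x := rfl

theorem nodup_blockList : (blockList L M).Nodup :=
  (List.nodup_finRange L).product (List.nodup_finRange M)

theorem mem_blockList (k : Block L M) : k ∈ blockList L M :=
  List.mem_product.2 ⟨List.mem_finRange _, List.mem_finRange _⟩

/-- A rotation is the combination of `R(0,0)`, `R(π,0)` and `R(π,π/2)` with coefficients `cos(θ/2)`,
`sin(θ/2) cos φ` and `sin(θ/2) sin φ`, and all that follows it in the circuit is linear. The
dependence on the angles of one block is thus carried by three states in which these angles are
fixed. -/
theorem output_rotation (x : Params L M) (k : Block L M) (θ φ : ℝ) (β : ℂ) :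
    output (Function.update x k (θ, φ, β)) = fun a q =>
      ∑ i : Fin 3, (![(Real.cos (θ / 2) : ℂ), Real.sin (θ / 2) * Real.cos φ,
        Real.sin (θ / 2) * Real.sin φ] i) *
        (![output (Function.update x k (0, 0, β)), output (Function.update x k (Real.pi, 0, β)),
          output (Function.update x k (Real.pi, Real.pi / 2, β))] i) a q := by
  obtain ⟨l₁, l₂, hl⟩ := List.append_of_mem (mem_blockList k)
  have hnd := nodup_blockList (L := L) (M := M)
  rw [hl] at hnd
  have hk1 : k ∉ l₁ := fun h => (List.nodup_append.1 hnd).2.2 k h k (by simp) rfl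
  have hk2 : k ∉ l₂ := (List.nodup_cons.1 (List.nodup_append.1 hnd).2.1).1
  have hsplit : ∀ p, output (Function.update x k p) =
      runFrom Prod.snd l₂ x (ecd k.2 p.2.2 (onQubit (qubitRotation p.1 p.2.1)
        (run Prod.snd l₁ x))) := by
    intro p
    rw [output_eq_run, hl, run, runFrom, List.foldl_append, List.foldl_cons, Function.update_self]
    change runFrom Prod.snd l₂ _ (blockStep k.2 p (runFrom Prod.snd l₁ _ _)) = _
    rw [runFrom_update _ hk2, runFrom_update _ hk1]
    rfl
  have hrot : onQubit (qubitRotation θ φ) (run Prod.snd l₁ x) = fun a q =>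
      ∑ i : Fin 3, (![(Real.cos (θ / 2) : ℂ), Real.sin (θ / 2) * Real.cos φ,
        Real.sin (θ / 2) * Real.sin φ] i) *
        onQubit (![qubitRotation 0 0, qubitRotation Real.pi 0,
          qubitRotation Real.pi (Real.pi / 2)] i) (run Prod.snd l₁ x) a q := by
    funext a q
    simp only [onQubit, Fin.sum_univ_three, Fin.sum_univ_two, qubitRotation]
    fin_cases a <;> simp <;> ring_nf <;> rw [Complex.I_sq] <;> ring
  rw [hsplit]
  simp only
  rw [hrot, ecd_sum, runFrom_sum]
  funext a q
  refine Finset.sum_congr rfl fun i _ => ?_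
  congr 1
  fin_cases i <;> simp [hsplit]

variable {ψ : Wave M}

theorem isStateFamily_output : IsStateFamily (output : Params L M → QWave M) :=
  isStateFamily_run Prod.snd (blockList L M)

/-- The amplitude whose squared modulus is the cost. -/
def amplitude (ψ : Wave M) (x : Params L M) : ℂ := braket ψ (output x 0)

theorem cost_eq (ψ : Wave M) (x : Params L M) : cost ψ x = ‖amplitude ψ x‖ ^ 2 := rfl

theorem amplitude_rotation (hψ : MemLp ψ 2 volume) (x : Params L M) (k : Block L M) (θ φ : ℝ)
    (β : ℂ) : amplitude ψ (Function.update x k (θ, φ, β)) =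
      rotAmp (amplitude ψ (Function.update x k (0, 0, β)))
        (amplitude ψ (Function.update x k (Real.pi, 0, β)))
        (amplitude ψ (Function.update x k (Real.pi, Real.pi / 2, β))) θ φ := by
  have h := fun y : Params L M => (isStateFamily_output.coherent 0).memLp y
  rw [amplitude, output_rotation, braket_sum_right _ _ hψ]
  · simp [Fin.sum_univ_three, rotAmp, amplitude]
    ring
  · intro i _
    fin_cases i <;> exact h _

theorem continuous_amplitude (hψ : MemLp ψ 2 volume) :
    Continuous (amplitude ψ : Params L M → ℂ) :=
  (isStateFamily_output.coherent 0).continuous_braket_left hψ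

theorem cost_nonneg (x : Params L M) : 0 ≤ cost ψ x := by unfold cost; positivity

theorem cost_le_one (hψ : MemLp ψ 2 volume) (h1 : braket ψ ψ = 1) (x : Params L M) :
    cost ψ x ≤ 1 := by
  have h := norm_braket_sq_le hψ ((isStateFamily_output.isState x).memLp 0)
  rw [h1, Complex.one_re, one_mul] at h
  exact h.trans ((isStateFamily_output.isState x).braket_le_one 0)

theorem continuous_cost (hψ : MemLp ψ 2 volume) : Continuous (cost ψ : Params L M → ℝ) := by
  have := continuous_amplitude (L := L) hψ
  simp_rw [funext (cost_eq ψ)]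
  fun_prop

theorem hasDerivAt_costAlong (hψ : MemLp ψ 2 volume) (k : Block L M) (x : Params L M) (t : ℝ) :
    HasDerivAt (costAlong ψ k x)
      ((costAlong ψ k x (t + Real.pi / 2) - costAlong ψ k x (t - Real.pi / 2)) / 2) t := by
  have h : costAlong ψ k x = fun t => ‖rotAmp (amplitude ψ (Function.update x k (0, 0, (x k).2.2)))
      (amplitude ψ (Function.update x k (Real.pi, 0, (x k).2.2)))
      (amplitude ψ (Function.update x k (Real.pi, Real.pi / 2, (x k).2.2))) t (x k).2.1‖ ^ 2 := by
    funext t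
    rw [← amplitude_rotation hψ]
    rfl
  rw [h]
  exact hasDerivAt_rotAmp _ _ _ _ _

theorem grad_eq (hψ : MemLp ψ 2 volume) (k : Block L M) (x : Params L M) :
    grad ψ k x = (cost ψ (Function.update x k ((x k).1 + Real.pi / 2, (x k).2)) -
      cost ψ (Function.update x k ((x k).1 - Real.pi / 2, (x k).2))) / 2 :=
  (hasDerivAt_costAlong hψ k x _).deriv

theorem continuous_grad (hψ : MemLp ψ 2 volume) (k : Block L M) : Continuous (grad ψ k) := by
  have h := continuous_cost (L := L) hψ
  simp_rw [funext (grad_eq hψ k)]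
  refine (Continuous.sub (h.comp ?_) (h.comp ?_)).div_const _ <;>
    exact continuous_id.update k (by fun_prop)

theorem abs_grad_le (hψ : MemLp ψ 2 volume) (h1 : braket ψ ψ = 1) (k : Block L M)
    (x : Params L M) : |grad ψ k x| ≤ 1 := by
  rw [grad_eq hψ, abs_le]
  have a1 := cost_le_one (L := L) hψ h1 (Function.update x k ((x k).1 + Real.pi / 2, (x k).2))
  have a2 := cost_le_one (L := L) hψ h1 (Function.update x k ((x k).1 - Real.pi / 2, (x k).2))
  have a3 := cost_nonneg (ψ := ψ) (Function.update x k ((x k).1 + Real.pi / 2, (x k).2))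
  have a4 := cost_nonneg (ψ := ψ) (Function.update x k ((x k).1 - Real.pi / 2, (x k).2))
  constructor <;> linarith

theorem memLp_grad (hψ : MemLp ψ 2 volume) (h1 : braket ψ ψ = 1) (k : Block L M) (E : ℝ) :
    MemLp (grad ψ k) 2 (ensemble E L M) := by
  unfold ensemble
  exact MemLp.of_bound (continuous_grad hψ k).aestronglyMeasurable 1
    (Filter.Eventually.of_forall fun x => abs_grad_le hψ h1 k x)

theorem integral_ensemble (k : Block L M) (E : ℝ) {F : Params L M → ℝ} (hF : Continuous F)
    {C : ℝ} (hC : ∀ x, |F x| ≤ C) : ∫ x, F x ∂(ensemble E L M) =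
      ∫ β, ∫ x, ∫ θ, ∫ φ, F (Function.update x k (θ, φ, β)) ∂uniformAngle ∂uniformAngle
        ∂(ensemble E L M) ∂complexGaussian (E / L) := by
  unfold ensemble
  rw [integral_pi_update _ k hF.aestronglyMeasurable]
  exact integral_param (F := fun z : Params L M × ℝ × ℝ × ℂ => F (Function.update z.1 k z.2)) _ _
    (hF.comp (continuous_fst.update k continuous_snd)).stronglyMeasurable fun z => hC _

theorem grad_rotation (hψ : MemLp ψ 2 volume) (x : Params L M) (k : Block L M) (θ φ : ℝ)
    (β : ℂ) : grad ψ k (Function.update x k (θ, φ, β)) =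
      rotGrad (amplitude ψ (Function.update x k (0, 0, β)))
        (amplitude ψ (Function.update x k (Real.pi, 0, β)))
        (amplitude ψ (Function.update x k (Real.pi, Real.pi / 2, β))) θ φ := by
  rw [grad_eq hψ, Function.update_self, Function.update_idem, Function.update_idem, rotGrad,
    ← amplitude_rotation hψ, ← amplitude_rotation hψ]
  rfl

theorem cost_rotation (hψ : MemLp ψ 2 volume) (x : Params L M) (k : Block L M) (θ φ : ℝ)
    (β : ℂ) : cost ψ (Function.update x k (θ, φ, β)) =
      ‖rotAmp (amplitude ψ (Function.update x k (0, 0, β)))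
        (amplitude ψ (Function.update x k (Real.pi, 0, β)))
        (amplitude ψ (Function.update x k (Real.pi, Real.pi / 2, β))) θ φ‖ ^ 2 := by
  rw [cost_eq, ← amplitude_rotation hψ]

theorem integral_grad (hψ : MemLp ψ 2 volume) (h1 : braket ψ ψ = 1) (k : Block L M) (E : ℝ) :
    ∫ x, grad ψ k x ∂(ensemble E L M) = 0 := by
  rw [integral_ensemble k E (continuous_grad hψ k) (abs_grad_le hψ h1 k)]
  simp_rw [grad_rotation hψ, integral_rotGrad]
  simp

theorem integral_uniformAngle_le {F : ℝ → ℝ} {C : ℝ} (hC : ∀ t, |F t| ≤ C) :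
    |∫ t, F t ∂uniformAngle| ≤ C := by
  have := norm_integral_le_of_norm_le_const (μ := uniformAngle) (f := F) (C := C)
    (Filter.Eventually.of_forall hC)
  simpa using this

/-- Comparison of averages through a comparison of the averages over the angles of one block. -/
theorem integral_ensemble_mono (k : Block L M) (E : ℝ) {F G : Params L M → ℝ}
    (hF : Continuous F) (hG : Continuous G) {C : ℝ} (hFC : ∀ x, |F x| ≤ C) (hGC : ∀ x, |G x| ≤ C)
    (h : ∀ x β, ∫ θ, ∫ φ, F (Function.update x k (θ, φ, β)) ∂uniformAngle ∂uniformAngle ≤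
      ∫ θ, ∫ φ, G (Function.update x k (θ, φ, β)) ∂uniformAngle ∂uniformAngle) :
    ∫ x, F x ∂(ensemble E L M) ≤ ∫ x, G x ∂(ensemble E L M) := by
  have key : ∀ {F : Params L M → ℝ}, Continuous F → (∀ x, |F x| ≤ C) →
      Integrable (fun z : Params L M × ℂ => ∫ θ, ∫ φ, F (Function.update z.1 k (θ, φ, z.2))
        ∂uniformAngle ∂uniformAngle) ((ensemble E L M).prod (complexGaussian (E / L))) := by
    intro F hF hC
    unfold ensemble
    have hc : Continuous fun z : Params L M × ℂ => ∫ θ, ∫ φ, F (Function.update z.1 k (θ, φ, z.2))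
        ∂uniformAngle ∂uniformAngle := by
      refine continuous_integral_uniformAngle (f := fun (z : Params L M × ℂ) θ => ∫ φ,
        F (Function.update z.1 k (θ, φ, z.2)) ∂uniformAngle) ?_
      refine continuous_integral_uniformAngle (f := fun (z : (Params L M × ℂ) × ℝ) φ =>
        F (Function.update z.1.1 k (z.2, φ, z.1.2))) ?_
      exact hF.comp ((by fun_prop : Continuous fun z : ((Params L M × ℂ) × ℝ) × ℝ =>
        z.1.1.1).update k (by fun_prop))
    refine Integrable.of_bound hc.aestronglyMeasurable C (Filter.Eventually.of_forall fun z => ?_)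
    have hb : ∀ θ, |∫ φ, F (Function.update z.1 k (θ, φ, z.2)) ∂uniformAngle| ≤ C := fun θ =>
      integral_uniformAngle_le fun _ => hC _
    exact integral_uniformAngle_le hb
  rw [integral_ensemble k E hF hFC, integral_ensemble k E hG hGC]
  have e : ∀ {F : Params L M → ℝ}, Continuous F → (∀ x, |F x| ≤ C) →
      ∫ β, ∫ x, ∫ θ, ∫ φ, F (Function.update x k (θ, φ, β)) ∂uniformAngle ∂uniformAngle
        ∂(ensemble E L M) ∂complexGaussian (E / L) = ∫ z : Params L M × ℂ, ∫ θ, ∫ φ,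
        F (Function.update z.1 k (θ, φ, z.2)) ∂uniformAngle ∂uniformAngle
          ∂((ensemble E L M).prod (complexGaussian (E / L))) := by
    intro F hF hC
    have h := key hF hC
    unfold ensemble at h ⊢
    exact (integral_prod_symm _ h).symm
  rw [e hF hFC, e hG hGC]
  exact integral_mono (key hF hFC) (key hG hGC) fun z => h z.1 z.2

theorem abs_sq_le_one {a : ℝ} (h : |a| ≤ 1) : |a ^ 2| ≤ 1 := by
  rw [abs_pow]; exact pow_le_one₀ (abs_nonneg a) h

theorem variance_grad (hψ : MemLp ψ 2 volume) (h1 : braket ψ ψ = 1) (k : Block L M) (E : ℝ) :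
    variance (grad ψ k) (ensemble E L M) = ∫ x, grad ψ k x ^ 2 ∂(ensemble E L M) := by
  rw [variance_of_integral_eq_zero (memLp_grad hψ h1 k E).1.aemeasurable (integral_grad hψ h1 k E)]

theorem variance_grad_le (hψ : MemLp ψ 2 volume) (h1 : braket ψ ψ = 1) (k : Block L M) (E : ℝ) :
    variance (grad ψ k) (ensemble E L M) ≤ ∫ x, cost ψ x ^ 2 ∂(ensemble E L M) := by
  rw [variance_grad hψ h1]
  have hb : ∀ x : Params L M, |cost ψ x| ≤ 1 := fun x => by
    rw [abs_of_nonneg (cost_nonneg x)]; exact cost_le_one hψ h1 x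
  refine integral_ensemble_mono k E ((continuous_grad hψ k).pow 2) ((continuous_cost hψ).pow 2)
    (fun x => abs_sq_le_one (abs_grad_le hψ h1 k x)) (fun x => abs_sq_le_one (hb x)) fun x β => ?_
  simp_rw [grad_rotation hψ, cost_rotation hψ]
  exact integral_rotGrad_sq_le _ _ _

theorem integral_cost_sq_le (hψ : MemLp ψ 2 volume) (h1 : braket ψ ψ = 1) (k : Block L M)
    (E : ℝ) : ∫ x, cost ψ x ^ 2 ∂(ensemble E L M) ≤
      192 * variance (grad ψ k) (ensemble E L M) := by
  rw [variance_grad hψ h1, ← integral_const_mul]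
  have hb : ∀ x : Params L M, |cost ψ x| ≤ 1 := fun x => by
    rw [abs_of_nonneg (cost_nonneg x)]; exact cost_le_one hψ h1 x
  have hg := continuous_grad hψ k
  refine integral_ensemble_mono k E ((continuous_cost hψ).pow 2) (C := 192) (by fun_prop)
    (fun x => (abs_sq_le_one (hb x)).trans (by norm_num)) (fun x => ?_) fun x β => ?_
  · rw [abs_mul]
    have := abs_sq_le_one (abs_grad_le hψ h1 k x)
    norm_num at this ⊢
    linarith
  simp_rw [grad_rotation hψ, cost_rotation hψ, integral_const_mul]
  exact le_integral_rotGrad_sq _ _ _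

end GradientMoments

/-! ### Lower bounds on the moments of the cost -/

section Lower

variable {M : ℕ} {ι : Type}

theorem IsObservable.continuous_angle_average {E : Type*} [NormedAddCommGroup E] [NormedSpace ℝ E]
    {H : QWave M → E} (hH : IsObservable H) {Y : Type} [TopologicalSpace Y]
    [FirstCountableTopology Y] [LocallyCompactSpace Y] {Ψ : Y → QWave M} (hΨ : IsStateFamily Ψ)
    (j : Fin M) {β : Y → ℂ} (hβ : Continuous β) :
    Continuous fun y => ∫ θ, ∫ φ, H (ecd j (β y) (onQubit (qubitRotation θ φ) (Ψ y)))
      ∂uniformAngle ∂uniformAngle := by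
  refine continuous_integral_uniformAngle (f := fun y θ => ∫ φ,
    H (ecd j (β y) (onQubit (qubitRotation θ φ) (Ψ y))) ∂uniformAngle) ?_
  refine continuous_integral_uniformAngle (f := fun (z : Y × ℝ) φ =>
    H (ecd j (β z.1) (onQubit (qubitRotation z.2 φ) (Ψ z.1)))) ?_
  exact hH.continuous (Ψ := fun z : (Y × ℝ) × ℝ => blockStep j (z.1.2, z.2, β z.1.1) (Ψ z.1.1))
    ((hΨ.comp (by fun_prop : Continuous fun z : (Y × ℝ) × ℝ => z.1.1)).blockStep j (by fun_prop))

theorem norm_integral_le_of_norm_le {E Y : Type*} [NormedAddCommGroup E] [NormedSpace ℝ E]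
    [MeasurableSpace Y] (μ : Measure Y) [IsProbabilityMeasure μ] {f : Y → E} {C : ℝ}
    (h : ∀ y, ‖f y‖ ≤ C) : ‖∫ y, f y ∂μ‖ ≤ C := by
  have := norm_integral_le_of_norm_le_const (μ := μ) (Filter.Eventually.of_forall h)
  simpa using this

theorem IsState.blockStep {Ψ : QWave M} (h : IsState Ψ) (j : Fin M) (p : ℝ × ℝ × ℂ) :
    IsState (blockStep j p Ψ) := by
  have hm : ∀ a, MemLp (onQubit (qubitRotation p.1 p.2.1) Ψ a) 2 volume := fun a =>
    memLp_finsetSum _ fun i _ => (h.memLp i).const_mul _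
  refine ⟨fun a => ?_, ?_⟩
  · fin_cases a <;> exact MemLp.displace (hm _) _
  · have h1 := trace_charFn_onQubit p.1 p.2.1 h.memLp 0
    simp only [charFn, displace_zero] at h1
    rw [← h.norm_eq, ← h1, add_comm]
    unfold QumodeVQC.blockStep ecd
    simp only [Matrix.cons_val_zero, Matrix.cons_val_one, Matrix.cons_val_fin_one]
    rw [braket_displace_displace, braket_displace_displace]

theorem IsObservable.integrable_angle_average [Fintype ι] {E : Type*} [NormedAddCommGroup E]
    [NormedSpace ℝ E] [SecondCountableTopology E] {H : QWave M → E} (hH : IsObservable H)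
    {Y : Type} [TopologicalSpace Y] [MeasurableSpace Y] [OpensMeasurableSpace Y]
    [FirstCountableTopology Y] [LocallyCompactSpace Y] (ν : Measure Y) [IsProbabilityMeasure ν]
    {Ψ : Y → QWave M} (hΨ : IsStateFamily Ψ) (j : Fin M) {β : Y → ℂ} (hβ : Continuous β) :
    Integrable (fun y => ∫ θ, ∫ φ, H (ecd j (β y) (onQubit (qubitRotation θ φ) (Ψ y)))
      ∂uniformAngle ∂uniformAngle) ν := by
  obtain ⟨C, hC⟩ := hH.bounded
  refine Integrable.of_bound (hH.continuous_angle_average hΨ j hβ).aestronglyMeasurable C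
    (Filter.Eventually.of_forall fun y => ?_)
  exact norm_integral_le_of_norm_le _ fun θ => norm_integral_le_of_norm_le _ fun φ =>
    hC _ ((hΨ.isState y).blockStep j (θ, φ, β y))

/-- To bound an average from below it suffices to bound the average over the angles of the last
block. -/
theorem le_average_concat [Fintype ι] [DecidableEq ι] (v : ℝ) (m : ι → Fin M) {l : List ι} {g : ι}
    (hg : g ∉ l) {H : QWave M → ℝ} (hH : IsObservable H) {G : ℂ → QWave M → ℝ}
    (hG : ∀ β Ψ, 0 ≤ G β Ψ)
    (h : ∀ β Ψ, IsState Ψ → G β Ψ ≤ ∫ θ, ∫ φ, H (ecd (m g) β (onQubit (qubitRotation θ φ) Ψ))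
      ∂uniformAngle ∂uniformAngle) {b : ℂ → ℝ} (hb0 : ∀ β, 0 ≤ b β)
    (hb : ∀ β, b β ≤ average v m l (G β)) :
    ∫ β, b β ∂complexGaussian v ≤ average v m (l ++ [g]) H := by
  rw [average_concat v m hg hH]
  have hf := isStateFamily_run m l
  refine integral_mono_of_nonneg (Filter.Eventually.of_forall hb0) ?_
    (Filter.Eventually.of_forall fun β => (hb β).trans ?_)
  · have := hH.integrable_angle_average (ι := ι)
      ((complexGaussian v).prod (Measure.pi fun _ : ι => paramMeasure v))
      (hf.comp continuous_snd) (m g) continuous_fst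
    exact this.integral_prod_left
  · refine integral_mono_of_nonneg (Filter.Eventually.of_forall fun x => hG _ _) ?_
      (Filter.Eventually.of_forall fun x => h β _ (hf.isState x))
    exact hH.integrable_angle_average (ι := ι) _ hf (m g) continuous_const

theorem isObservable_braket {f : Wave M} (hf : MemLp f 2 volume) (a : Fin 2) (n : ℕ) :
    IsObservable fun Ψ : QWave M => ‖braket f (Ψ a)‖ ^ n := by
  refine ⟨fun {Y _ Ψ} hΨ => ?_, max 1 (braket f f).re ^ n, fun Ψ hΨ => ?_⟩
  · have := (hΨ.coherent a).continuous_braket_left hf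
    fun_prop
  · rw [norm_pow, norm_norm]
    have h1 := norm_braket_sq_le hf (hΨ.memLp a)
    have h2 := hΨ.braket_le_one a
    have h3 := (braket_self hf).2
    gcongr
    refine abs_le_of_sq_le_sq' ?_ (by positivity) |>.2
    have h4 := le_max_left 1 (braket f f).re
    have h5 := le_max_right 1 (braket f f).re
    nlinarith

theorem braket_onQubit {f : Wave M} (hf : MemLp f 2 volume) {Ψ : QWave M}
    (hΨ : ∀ a, MemLp (Ψ a) 2 volume) (θ φ : ℝ) :
    braket f (onQubit (qubitRotation θ φ) Ψ 0) =
      rotAmp (braket f (Ψ 0)) (-Complex.I * braket f (Ψ 1)) (-braket f (Ψ 1)) θ φ ∧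
    braket f (onQubit (qubitRotation θ φ) Ψ 1) =
      rotAmp (braket f (Ψ 1)) (-Complex.I * braket f (Ψ 0)) (braket f (Ψ 0)) θ φ := by
  unfold onQubit
  rw [braket_sum_right _ _ hf fun i _ => hΨ i, braket_sum_right _ _ hf fun i _ => hΨ i]
  simp only [qubitRotation, Fin.sum_univ_two, rotAmp]
  constructor <;> simp <;> ring_nf <;> rw [Complex.I_sq] <;> ring

theorem integral_uniformAngle_cos (A B D : ℝ) :
    ∫ t : ℝ, (A + B * Real.cos t + D * Real.cos t ^ 2) ∂uniformAngle = A + D / 2 := by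
  have h := integral_uniformAngle_cos_sin A B 0 D 0
  rw [← Complex.ofReal_inj, ← integral_complex_ofReal]
  push_cast at h ⊢
  simpa using h

/-- The cross terms change sign under `φ ↦ φ + π` and cancel. The sign `ε` covers both components of
the rotated state. -/
theorem norm_sq_rotAmp_add_pi (A B : ℂ) (ε θ φ : ℝ) (hε : ε ^ 2 = 1) :
    ‖rotAmp B (-Complex.I * A) (ε * A) θ φ‖ ^ 2 + ‖rotAmp B (-Complex.I * A) (ε * A) θ
      (φ + Real.pi)‖ ^ 2 =
      2 * (Real.cos (θ / 2) ^ 2 * ‖B‖ ^ 2 + Real.sin (θ / 2) ^ 2 * ‖A‖ ^ 2) := by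
  unfold rotAmp
  rw [Real.cos_add_pi, Real.sin_add_pi]
  have := Real.cos_sq_add_sin_sq φ
  generalize Real.cos φ = c at *
  generalize Real.sin φ = s at *
  generalize Real.cos (θ / 2) = c' at *
  generalize Real.sin (θ / 2) = s' at *
  simp only [← Complex.normSq_eq_norm_sq, Complex.normSq_apply]
  simp
  linear_combination 2 * s' ^ 2 * (A.re ^ 2 + A.im ^ 2) * this +
    2 * s' ^ 2 * s ^ 2 * (A.re ^ 2 + A.im ^ 2) * hε

theorem le_integral_norm_rotAmp_sq (A B : ℂ) (ε : ℝ) (hε : ε ^ 2 = 1) :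
    1 / 2 * (‖A‖ ^ 2 + ‖B‖ ^ 2) ≤
      ∫ θ, ∫ φ, ‖rotAmp B (-Complex.I * A) (ε * A) θ φ‖ ^ 2 ∂uniformAngle ∂uniformAngle := by
  have h1 : ∀ θ, ∫ φ, ‖rotAmp B (-Complex.I * A) (ε * A) θ φ‖ ^ 2 ∂uniformAngle =
      (‖A‖ ^ 2 + ‖B‖ ^ 2) / 2 + (‖B‖ ^ 2 - ‖A‖ ^ 2) / 2 * Real.cos θ + 0 * Real.cos θ ^ 2 := by
    intro θ
    have hp : Function.Periodic (fun φ => ‖rotAmp B (-Complex.I * A) (ε * A) θ φ‖ ^ 2)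
        (2 * Real.pi) := fun φ => by simp only [rotAmp, Real.cos_add_two_pi, Real.sin_add_two_pi]
    have hi : ∀ s : ℝ, Integrable (fun φ => ‖rotAmp B (-Complex.I * A) (ε * A) θ (φ + s)‖ ^ 2)
        uniformAngle := fun s =>
      integrable_of_continuous_uniformAngle (by unfold rotAmp; fun_prop)
    have h2 := integral_uniformAngle_add hp Real.pi
    have h3 := integral_add (hi 0) (hi Real.pi)
    simp only [add_zero] at h3
    simp_rw [norm_sq_rotAmp_add_pi A B ε θ _ hε] at h3
    rw [integral_const, probReal_univ, one_smul, h2] at h3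
    have h4 : Real.cos θ = 2 * Real.cos (θ / 2) ^ 2 - 1 := by
      rw [← Real.cos_two_mul]; congr 1; ring
    have h5 : Real.sin (θ / 2) ^ 2 = 1 - Real.cos (θ / 2) ^ 2 := by
      rw [← Real.cos_sq_add_sin_sq (θ / 2)]; ring
    rw [h5] at h3
    rw [h4]
    linarith
  simp_rw [h1, integral_uniformAngle_cos]
  linarith

/-- Jensen's inequality over the pair `φ`, `φ + π` bounds the average over `φ` below by the square
of `cos² |B|² + sin² |A|²`. The nonnegative cross term is dropped, and `cos⁴` and `sin⁴` of the half
angle average to `3/8`. -/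
theorem le_integral_norm_rotAmp_pow_four (A B : ℂ) (ε : ℝ) (hε : ε ^ 2 = 1) :
    3 / 4 / 2 * (‖A‖ ^ 4 + ‖B‖ ^ 4) ≤
      ∫ θ, ∫ φ, ‖rotAmp B (-Complex.I * A) (ε * A) θ φ‖ ^ 4 ∂uniformAngle ∂uniformAngle := by
  have h1 : ∀ θ, (‖A‖ ^ 4 + ‖B‖ ^ 4) / 4 + (‖B‖ ^ 4 - ‖A‖ ^ 4) / 2 * Real.cos θ +
      (‖A‖ ^ 4 + ‖B‖ ^ 4) / 4 * Real.cos θ ^ 2 ≤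
      ∫ φ, ‖rotAmp B (-Complex.I * A) (ε * A) θ φ‖ ^ 4 ∂uniformAngle := by
    intro θ
    have hp : Function.Periodic (fun φ => ‖rotAmp B (-Complex.I * A) (ε * A) θ φ‖ ^ 4)
        (2 * Real.pi) := fun φ => by simp only [rotAmp, Real.cos_add_two_pi, Real.sin_add_two_pi]
    have hi : ∀ s : ℝ, Integrable (fun φ => ‖rotAmp B (-Complex.I * A) (ε * A) θ (φ + s)‖ ^ 4)
        uniformAngle := fun s =>
      integrable_of_continuous_uniformAngle (by unfold rotAmp; fun_prop)
    have h2 := integral_uniformAngle_add hp Real.pi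
    have h3 := integral_add (hi 0) (hi Real.pi)
    simp only [add_zero] at h3
    set P := Real.cos (θ / 2) ^ 2 * ‖B‖ ^ 2 + Real.sin (θ / 2) ^ 2 * ‖A‖ ^ 2 with hP
    have h6 : 2 * P ^ 2 ≤ ∫ φ, (‖rotAmp B (-Complex.I * A) (ε * A) θ φ‖ ^ 4 +
        ‖rotAmp B (-Complex.I * A) (ε * A) θ (φ + Real.pi)‖ ^ 4) ∂uniformAngle := by
      have h7 := integral_mono (μ := uniformAngle) (integrable_const (2 * P ^ 2))
        (g := fun φ => ‖rotAmp B (-Complex.I * A) (ε * A) θ φ‖ ^ 4 +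
          ‖rotAmp B (-Complex.I * A) (ε * A) θ (φ + Real.pi)‖ ^ 4)
        (integrable_of_continuous_uniformAngle (by unfold rotAmp; fun_prop)) (fun φ => ?_)
      · rwa [integral_const, probReal_univ, one_smul] at h7
      · beta_reduce
        have h8 := norm_sq_rotAmp_add_pi A B ε θ φ hε
        rw [← hP] at h8
        nlinarith [sq_nonneg (‖rotAmp B (-Complex.I * A) (ε * A) θ φ‖ ^ 2 -
          ‖rotAmp B (-Complex.I * A) (ε * A) θ (φ + Real.pi)‖ ^ 2)]
    rw [h3, h2] at h6
    have h4 : Real.cos θ = 2 * Real.cos (θ / 2) ^ 2 - 1 := by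
      rw [← Real.cos_two_mul]; congr 1; ring
    have h5 : Real.sin (θ / 2) ^ 2 = 1 - Real.cos (θ / 2) ^ 2 := by
      rw [← Real.cos_sq_add_sin_sq (θ / 2)]; ring
    have h9 : (Real.cos (θ / 2) ^ 2) ^ 2 * ‖B‖ ^ 4 + (1 - Real.cos (θ / 2) ^ 2) ^ 2 * ‖A‖ ^ 4 ≤
        P ^ 2 := by
      rw [hP, ← h5]
      have : 0 ≤ Real.cos (θ / 2) ^ 2 * ‖B‖ ^ 2 * (Real.sin (θ / 2) ^ 2 * ‖A‖ ^ 2) := by positivity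
      linarith
    rw [h4]
    linarith
  have hc : Continuous fun θ => ∫ φ, ‖rotAmp B (-Complex.I * A) (ε * A) θ φ‖ ^ 4
      ∂uniformAngle := continuous_integral_uniformAngle (by unfold Function.uncurry; fun_prop)
  refine le_trans (le_of_eq ?_) (integral_mono (integrable_of_continuous_uniformAngle
    (by fun_prop)) (integrable_of_continuous_uniformAngle hc) h1)
  rw [integral_uniformAngle_cos]
  ring

/-- The average of a Gaussian of exponent `a` over `n` displacements. -/
def gaussianFactor (a v : ℝ) (n : ℕ) (z : ℂ) : ℝ :=
  (1 + a * n * v)⁻¹ * Real.exp (-(a / (1 + a * n * v)) * ‖z‖ ^ 2)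

theorem gaussianFactor_nonneg {a v : ℝ} (ha : 0 ≤ a) (hv : 0 ≤ v) (n : ℕ) (z : ℂ) :
    0 ≤ gaussianFactor a v n z := by
  unfold gaussianFactor; positivity

/-- Semigroup property of Gaussian convolution: one further displacement of mode `j`, of either
sign, raises its count by one. -/
theorem integral_prod_gaussianFactor {a v : ℝ} (ha : 0 ≤ a) (hv : 0 < v) (n : Fin M → ℕ)
    (j : Fin M) (α : Fin M → ℂ) (t : ℝ) (ht : t ^ 2 = 1) :
    ∫ β : ℂ, ∏ i, gaussianFactor a v (n i) ((α + Pi.single j (t * β) : Fin M → ℂ) i) ∂complexGaussian v =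
      ∏ i, gaussianFactor a v ((n + Pi.single j 1 : Fin M → ℕ) i) (α i) := by
  have h1 : ∀ β : ℂ, ∏ i, gaussianFactor a v (n i) ((α + Pi.single j (t * β) : Fin M → ℂ) i) =
      gaussianFactor a v (n j) (α j + t * β) *
        ∏ i ∈ Finset.univ.erase j, gaussianFactor a v (n i) (α i) := by
    intro β
    rw [← Finset.mul_prod_erase _ _ (Finset.mem_univ j)]
    congr 1
    · simp
    · refine Finset.prod_congr rfl fun i hi => ?_
      simp [Finset.ne_of_mem_erase hi]
  simp_rw [h1]
  rw [integral_mul_const, ← Finset.mul_prod_erase _ _ (Finset.mem_univ j)]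
  congr 1
  · unfold gaussianFactor
    rw [integral_const_mul, integral_complexGaussian_exp_sq hv (by positivity), ht]
    have h0 : 0 < 1 + a * n j * v := by positivity
    have h2 : 0 < 1 + a * (n j + 1) * v := by positivity
    have h3 : 1 + a / (1 + a * n j * v) * 1 * v = (1 + a * (n j + 1) * v) / (1 + a * n j * v) := by
      field_simp; ring
    rw [h3]
    simp only [Pi.add_apply, Pi.single_eq_same]
    push_cast
    rw [← mul_assoc]
    congr 1
    · field_simp
    · congr 2
      field_simp
  · refine Finset.prod_congr rfl fun i hi => ?_
    simp [Finset.ne_of_mem_erase hi]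

theorem count_blockList (L : ℕ) (i : Fin M) : ((blockList L M).map Prod.snd).count i = L := by
  have h : ∀ l : List (Fin L), ((l ×ˢ List.finRange M).map Prod.snd).count i = l.length := by
    intro l
    induction l with
    | nil => rfl
    | cons g l ih =>
      rw [List.product_cons, List.map_append, List.count_append, ih, List.map_map]
      have : (Prod.snd ∘ fun b : Fin M => (g, b)) = id := rfl
      rw [this, List.map_id, List.count_eq_one_of_mem (List.nodup_finRange M)
        (List.mem_finRange i), List.length_cons, add_comm]
  rw [blockList, h, List.length_finRange]

/-- The sum of the `n`-th powers of the overlaps with the two components. -/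
def pairMoment (n : ℕ) (f : Wave M) (Ψ : QWave M) : ℝ :=
  ‖braket f (Ψ 0)‖ ^ n + ‖braket f (Ψ 1)‖ ^ n

variable [Fintype ι] [DecidableEq ι]

/-- Lower bounds on moments of the overlap with displaced copies of `ψ`. -/
theorem le_average_braket {ψ : Wave M} (hψ : MemLp ψ 2 volume) {n : ℕ} {r : ℝ}
    (hr : 0 ≤ r) (hrot : ∀ (A B : ℂ) (ε : ℝ), ε ^ 2 = 1 → r / 2 * (‖A‖ ^ n + ‖B‖ ^ n) ≤
      ∫ θ, ∫ φ, ‖rotAmp B (-Complex.I * A) (ε * A) θ φ‖ ^ n ∂uniformAngle ∂uniformAngle)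
    {k a v : ℝ} (hk : 0 ≤ k) (ha : 0 ≤ a) (hv : 0 < v)
    (hov : ∀ α, k * Real.exp (-a * normSqSum α) ≤ ‖braket ψ (displace α (vacuum M))‖ ^ n)
    (m : ι → Fin M) (l : List ι) (hl : l.Nodup) :
    (∀ α, k * r ^ l.length * ∏ i, gaussianFactor a v ((l.map m).count i) (α i) ≤
      average v m l (pairMoment n (displace α ψ))) ∧
    (l ≠ [] → k / 2 * r ^ l.length * ∏ i, gaussianFactor a v ((l.map m).count i) 0 ≤
      average v m l fun Ψ => ‖braket ψ (Ψ 0)‖ ^ n) := by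
  induction l using List.reverseRecOn with
  | nil =>
    refine ⟨fun α => ?_, fun h => absurd rfl h⟩
    rw [average_nil]
    have h := hov (-α)
    rw [← braket_displace_left] at h
    have h2 : normSqSum (-α) = normSqSum α := by simp [normSqSum]
    have h3 : ∏ i, gaussianFactor a v 0 (α i) = Real.exp (-a * normSqSum α) := by
      simp only [gaussianFactor, normSqSum, Finset.mul_sum, Real.exp_sum]
      simp
    simp only [List.map_nil, List.count_nil, List.length_nil, pow_zero, mul_one, h3]
    rw [h2] at h
    refine h.trans ?_
    simp only [pairMoment, Matrix.cons_val_zero, Matrix.cons_val_one]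
    exact le_add_of_nonneg_right (by positivity)
  | append_singleton l g ih =>
    have hg : g ∉ l := fun h => (List.nodup_append.1 hl).2.2 g h g (by simp) rfl
    have ih := (ih (List.nodup_append.1 hl).1).1
    have hcount : ∀ i, ((l ++ [g]).map m).count i =
        ((fun i => (l.map m).count i) + Pi.single (m g) 1 : Fin M → ℕ) i := by
      intro i
      rw [List.map_append, List.count_append, Pi.add_apply]
      congr 1
      by_cases h : i = m g
      · subst h; simp
      · rw [Pi.single_eq_of_ne h]; simp [Ne.symm h]
    -- One block in the Heisenberg picture. The angle average replaces `H` by `r/2` times the pair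
    -- moment of a copy of `ψ` displaced by `±β`; the induction hypothesis applies to that copy, and
    -- the integral over `β` advances the Gaussian factor of the mode.
    have hmain : ∀ (α : Fin M → ℂ) (ε : ℝ) (γ : ℂ → Fin M → ℂ), ε ^ 2 = 1 →
        (∀ β, γ β = α + Pi.single (m g) ((ε : ℂ) * β)) → ∀ H : QWave M → ℝ, IsObservable H →
        (∀ (β : ℂ) Ψ, IsState Ψ →
          r / 2 * pairMoment n (displace (γ β) ψ) Ψ ≤
          ∫ θ, ∫ φ, H (ecd (m g) β (onQubit (qubitRotation θ φ) Ψ)) ∂uniformAngle ∂uniformAngle) →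
        k / 2 * r ^ (l ++ [g]).length *
          ∏ i, gaussianFactor a v (((l ++ [g]).map m).count i) (α i) ≤
          average v m (l ++ [g]) H := by
      intro α ε γ hε hγ H hH hH2
      have h := le_average_concat v m hg hH (G := fun (β : ℂ) Ψ => r / 2 *
          pairMoment n (displace (γ β) ψ) Ψ)
        (b := fun (β : ℂ) => r / 2 * (k * r ^ l.length * ∏ i, gaussianFactor a v ((l.map m).count i)
          (γ β i)))
        (fun β Ψ => by unfold pairMoment; positivity) hH2
        (fun β => mul_nonneg (by positivity) (mul_nonneg (by positivity)
          (Finset.prod_nonneg fun i _ => gaussianFactor_nonneg ha hv.le _ _))) (fun β => ?_)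
      · simp_rw [hγ] at h
        rw [integral_const_mul, integral_const_mul,
          integral_prod_gaussianFactor ha hv (fun i => (l.map m).count i) (m g) α ε hε] at h
        simp_rw [hcount]
        refine le_trans (le_of_eq ?_) h
        simp
        ring
      · have := mul_le_mul_of_nonneg_left (ih (γ β))
          (by positivity : 0 ≤ r / 2)
        refine this.trans (le_of_eq ?_)
        simp only [average, integral_const_mul]
    have hcomp : ∀ (f : Wave M), MemLp f 2 volume → ∀ (β : ℂ) (Ψ : QWave M), IsState Ψ →
        r / 2 * pairMoment n (displace (Pi.single (m g) β) f) Ψ ≤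
        ∫ θ, ∫ φ, ‖braket f (ecd (m g) β (onQubit (qubitRotation θ φ) Ψ) 0)‖ ^ n
          ∂uniformAngle ∂uniformAngle ∧
        r / 2 * pairMoment n (displace (Pi.single (m g) (-β)) f) Ψ ≤
        ∫ θ, ∫ φ, ‖braket f (ecd (m g) β (onQubit (qubitRotation θ φ) Ψ) 1)‖ ^ n
          ∂uniformAngle ∂uniformAngle := by
      intro f hf β Ψ hΨ
      have hneg : ∀ β : ℂ, (Pi.single (m g) (-β) : Fin M → ℂ) = -Pi.single (m g) β :=
        fun β => Pi.single_neg (f := fun _ => ℂ) _ β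
      have e0 : ∀ θ φ, braket f (ecd (m g) β (onQubit (qubitRotation θ φ) Ψ) 0) =
          braket (displace (Pi.single (m g) β) f) (onQubit (qubitRotation θ φ) Ψ 1) := by
        intro θ φ
        rw [braket_displace_left, ← hneg]; rfl
      have e1 : ∀ θ φ, braket f (ecd (m g) β (onQubit (qubitRotation θ φ) Ψ) 1) =
          braket (displace (Pi.single (m g) (-β)) f) (onQubit (qubitRotation θ φ) Ψ 0) := by
        intro θ φ
        rw [braket_displace_left, ← hneg, neg_neg]; rfl
      simp_rw [e0, e1, (braket_onQubit (MemLp.displace hf _) hΨ.memLp _ _).1,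
        (braket_onQubit (MemLp.displace hf _) hΨ.memLp _ _).2]
      unfold pairMoment
      constructor
      · simpa using hrot (braket (displace (Pi.single (m g) β) f) (Ψ 0))
          (braket (displace (Pi.single (m g) β) f) (Ψ 1)) 1 (by norm_num)
      · have := hrot (braket (displace (Pi.single (m g) (-β)) f) (Ψ 1))
          (braket (displace (Pi.single (m g) (-β)) f) (Ψ 0)) (-1) (by norm_num)
        rw [add_comm] at this
        simpa using this
    have hphase : ∀ (α γ : Fin M → ℂ) (Φ : QWave M),
        pairMoment n (displace γ (displace α ψ)) Φ = pairMoment n (displace (α + γ) ψ) Φ := by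
      intro α γ Φ
      have h : ∀ a, ‖braket (displace γ (displace α ψ)) (Φ a)‖ =
          ‖braket (displace (α + γ) ψ) (Φ a)‖ := by
        intro a
        rw [displace_displace, braket_mul_left, norm_mul, RCLike.norm_conj, mul_comm Complex.I,
          Complex.norm_exp_ofReal_mul_I, one_mul, add_comm]
      rw [pairMoment, h, h, pairMoment]
    -- Each component yields `r/2`, so the pair moment loses a factor `r` per block. Only the final
    -- projection on `|0⟩` costs the additional factor `1/2`.
    refine ⟨fun α => ?_, fun _ => ?_⟩
    · have hα := MemLp.displace hψ α
      have h0 := hmain α 1 (fun β => α + Pi.single (m g) β) (by norm_num) (by simp) _ (isObservable_braket hα 0 n) (fun β Ψ hΨ => by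
        have := (hcomp _ hα β Ψ hΨ).1
        simp only [hphase] at this
        simpa using this)
      have h1 := hmain α (-1) (fun β => α + Pi.single (m g) (-β)) (by norm_num) (by simp) _ (isObservable_braket hα 1 n) (fun β Ψ hΨ => by
        have := (hcomp _ hα β Ψ hΨ).2
        simp only [hphase] at this
        simpa using this)
      have h2 : average v m (l ++ [g]) (pairMoment n (displace α ψ)) =
          (average v m (l ++ [g]) fun Ψ => ‖braket (displace α ψ) (Ψ 0)‖ ^ n) +
          average v m (l ++ [g]) fun Ψ => ‖braket (displace α ψ) (Ψ 1)‖ ^ n :=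
        integral_add ((isObservable_braket hα 0 n).integrable _ (isStateFamily_run m _))
          ((isObservable_braket hα 1 n).integrable _ (isStateFamily_run m _))
      rw [h2]
      refine le_trans (le_of_eq ?_) (add_le_add h0 h1)
      ring
    · have h0 := hmain 0 1 (fun β => Pi.single (m g) β) (by norm_num) (by simp) _ (isObservable_braket hψ 0 n) (fun β Ψ hΨ => by
        have := (hcomp _ hψ β Ψ hΨ).1
        simpa using this)
      simpa using h0

/-- Lower bounds on the second moment of the cost. -/
theorem IsPureGaussian.le_integral_cost_sq {ψ : Wave M} (hψ : IsPureGaussian ψ) (hM : 1 ≤ M) :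
    ∃ c a : ℝ, 0 < c ∧ 0 < a ∧ ∀ (L : ℕ) (E : ℝ), 1 ≤ L → 0 < E →
      c * (3 / 4) ^ (M * L) * ((1 + a * E)⁻¹) ^ M ≤
        ∫ x : Params L M, cost ψ x ^ 2 ∂(ensemble E L M) ∧
      c * ((1 + a * E)⁻¹) ^ (2 * M) ≤ ∫ x : Params L M, cost ψ x ^ 2 ∂(ensemble E L M) := by
  obtain ⟨k, _, _, A, hk, _, _, hA, hov⟩ := hψ.overlap_bounds
  have hψ2 := hψ.1
  refine ⟨min (k ^ 2 / 2) ((k / 2) ^ 2), 2 * A, by positivity, by positivity,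
    fun L E hL hE => ?_⟩
  have hL0 : (0 : ℝ) < L := by exact_mod_cast hL
  have hv : 0 < E / L := by positivity
  have hne : blockList L M ≠ [] :=
    List.ne_nil_of_mem (mem_blockList (⟨0, hL⟩, ⟨0, hM⟩))
  have hlen : (blockList L M).length = M * L := by
    simp [blockList, List.length_product, mul_comm]
  have hfac : ∀ b : ℝ, gaussianFactor b (E / L) L 0 = (1 + b * E)⁻¹ := by
    intro b
    simp only [gaussianFactor, norm_zero]
    simp
    field_simp
  -- Fourth powers: the squared overlap bound has constants `k²` and `2A`, and each block costs
  -- `3/4`.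
  have h4 := (le_average_braket hψ2 (by norm_num : (0 : ℝ) ≤ 3 / 4)
    (le_integral_norm_rotAmp_pow_four) (k := k ^ 2) (a := 2 * A) (by positivity) (by positivity) hv
    (fun α => by
      have := hov α
      calc k ^ 2 * Real.exp (-(2 * A) * normSqSum α) = (k * Real.exp (-A * normSqSum α)) ^ 2 := by
            rw [mul_pow, ← Real.exp_nat_mul]; congr 2; push_cast; ring
        _ ≤ (‖braket ψ (displace α (vacuum M))‖ ^ 2) ^ 2 := by gcongr; exact this.1
        _ = _ := by ring) Prod.snd (blockList L M) nodup_blockList).2 hne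
  -- Squares: nothing is lost per block, so the bound on the mean cost does not depend on the depth.
  -- Nonnegativity of the variance of the cost then bounds its second moment below.
  have h2 := (le_average_braket hψ2 zero_le_one (le_integral_norm_rotAmp_sq) (k := k) (a := A)
    hk.le hA.le hv (fun α => (hov α).1) Prod.snd (blockList L M) nodup_blockList).2 hne
  simp only [count_blockList, hfac, hlen, Finset.prod_const, Finset.card_univ, Fintype.card_fin,
    one_pow, mul_one] at h2 h4
  have e4 : (average (E / L) Prod.snd (blockList L M) fun Ψ => ‖braket ψ (Ψ 0)‖ ^ 4) =
      ∫ x : Params L M, cost ψ x ^ 2 ∂(ensemble E L M) := by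
    unfold average ensemble
    congr 1
    funext x
    rw [← output_eq_run, cost]
    ring
  have e2 : (average (E / L) Prod.snd (blockList L M) fun Ψ => ‖braket ψ (Ψ 0)‖ ^ 2) =
      ∫ x : Params L M, cost ψ x ∂(ensemble E L M) := rfl
  rw [e4] at h4
  rw [e2] at h2
  have hEpos : 0 < (1 + 2 * A * E)⁻¹ := by positivity
  have hmono : (1 + 2 * A * E)⁻¹ ≤ (1 + A * E)⁻¹ := by
    refine inv_anti₀ (by positivity) ?_
    nlinarith [mul_pos hA hE]
  refine ⟨le_trans ?_ h4, ?_⟩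
  · gcongr
    exact min_le_left _ _
  · have hvar := variance_nonneg (cost ψ) (ensemble E L M)
    have hm : MemLp (cost ψ) 2 (ensemble E L M) := by
      unfold ensemble
      refine MemLp.of_bound (continuous_cost hψ2).aestronglyMeasurable 1
        (Filter.Eventually.of_forall fun x => ?_)
      rw [Real.norm_eq_abs, abs_of_nonneg (cost_nonneg x)]
      exact cost_le_one hψ2 hψ.2.1 x
    have : IsProbabilityMeasure (ensemble E L M) := by unfold ensemble; infer_instance
    rw [variance_eq_sub hm] at hvar
    have h5 : (k / 2 * ((1 + A * E)⁻¹) ^ M) ^ 2 ≤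
        (∫ x : Params L M, cost ψ x ∂(ensemble E L M)) ^ 2 := by gcongr
    have h6 : min (k ^ 2 / 2) ((k / 2) ^ 2) * (1 + 2 * A * E)⁻¹ ^ (2 * M) ≤
        (k / 2 * ((1 + A * E)⁻¹) ^ M) ^ 2 := by
      rw [mul_pow, ← pow_mul, mul_comm M 2]
      gcongr
      exact min_le_right _ _
    have h7 : ∫ x, (cost ψ ^ 2) x ∂(ensemble E L M) = ∫ x, cost ψ x ^ 2 ∂(ensemble E L M) := rfl
    linarith

end Lower

/-! ### The average of the second moment over one rotation -/

section RotationAverage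

/-- Conjugation of a two-by-two matrix by a rotation. -/
def rotConj (θ φ : ℝ) (x : Fin 2 → Fin 2 → ℂ) (a b : Fin 2) : ℂ :=
  ∑ c, ∑ d, qubitRotation θ φ a c * conj (qubitRotation θ φ b d) * x c d

/-- Up to a unimodular factor every entry is a trigonometric polynomial of degree one in `φ`, so
that the average over `φ` of a product of two entries is an instance of Parseval. -/
theorem rotConj_eq (θ φ : ℝ) (x : Fin 2 → Fin 2 → ℂ) :
    rotConj θ φ x 0 0 = (Real.cos (θ / 2) ^ 2 * x 0 0 + Real.sin (θ / 2) ^ 2 * x 1 1) +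
      (Complex.I * Real.sin (θ / 2) * Real.cos (θ / 2) * x 0 1) * Complex.exp (Complex.I * φ) +
      (-(Complex.I * Real.sin (θ / 2) * Real.cos (θ / 2) * x 1 0)) *
        Complex.exp (-(Complex.I * φ)) ∧
    rotConj θ φ x 1 1 = (Real.sin (θ / 2) ^ 2 * x 0 0 + Real.cos (θ / 2) ^ 2 * x 1 1) +
      (-(Complex.I * Real.sin (θ / 2) * Real.cos (θ / 2) * x 0 1)) * Complex.exp (Complex.I * φ) +
      (Complex.I * Real.sin (θ / 2) * Real.cos (θ / 2) * x 1 0) *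
        Complex.exp (-(Complex.I * φ)) ∧
    rotConj θ φ x 0 1 = Complex.exp (-(Complex.I * φ)) *
      (Complex.I * Real.sin (θ / 2) * Real.cos (θ / 2) * (x 0 0 - x 1 1) +
      (Real.cos (θ / 2) ^ 2 * x 0 1) * Complex.exp (Complex.I * φ) +
      (Real.sin (θ / 2) ^ 2 * x 1 0) * Complex.exp (-(Complex.I * φ))) ∧
    rotConj θ φ x 1 0 = Complex.exp (Complex.I * φ) *
      (-(Complex.I * Real.sin (θ / 2) * Real.cos (θ / 2) * (x 0 0 - x 1 1)) +
      (Real.sin (θ / 2) ^ 2 * x 0 1) * Complex.exp (Complex.I * φ) +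
      (Real.cos (θ / 2) ^ 2 * x 1 0) * Complex.exp (-(Complex.I * φ))) := by
  have he : Complex.exp (-(Complex.I * φ)) * Complex.exp (Complex.I * φ) = 1 := by
    rw [← Complex.exp_add]; simp
  have hI := Complex.I_sq
  simp only [rotConj, qubitRotation_apply, Fin.sum_univ_two, Matrix.of_apply, Matrix.cons_val',
    Matrix.cons_val_zero, Matrix.cons_val_one, Matrix.cons_val_fin_one, map_mul, map_neg,
    Complex.conj_I, Complex.conj_ofReal, (conj_exp_I φ).1, (conj_exp_I φ).2]
  generalize Complex.exp (-(Complex.I * φ)) = e at *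
  generalize Complex.exp (Complex.I * φ) = e' at *
  generalize (Real.cos (θ / 2) : ℂ) = c at *
  generalize (Real.sin (θ / 2) : ℂ) = s at *
  refine ⟨?_, ?_, ?_, ?_⟩
  · linear_combination (s ^ 2 * x 1 1) * he - s ^ 2 * e * e' * x 1 1 * hI
  · linear_combination (s ^ 2 * x 0 0) * he - s ^ 2 * e * e' * x 0 0 * hI
  · linear_combination (-(c ^ 2 * x 0 1)) * he - s ^ 2 * e ^ 2 * x 1 0 * hI
  · linear_combination (-(c ^ 2 * x 1 0)) * he - s ^ 2 * e' ^ 2 * x 0 1 * hI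

theorem integral_uniformAngle_half (a b c : ℂ) :
    ∫ θ : ℝ, (a * (Real.cos (θ / 2) ^ 2) ^ 2 + b * (Real.sin (θ / 2) ^ 2) ^ 2 +
      c * ((Real.cos (θ / 2) ^ 2) * Real.sin (θ / 2) ^ 2) : ℂ) ∂uniformAngle =
      3 / 8 * a + 3 / 8 * b + 1 / 8 * c := by
  have h : ∀ θ : ℝ, (a * (Real.cos (θ / 2) ^ 2) ^ 2 + b * (Real.sin (θ / 2) ^ 2) ^ 2 +
      c * ((Real.cos (θ / 2) ^ 2) * Real.sin (θ / 2) ^ 2) : ℂ) =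
      (a + b + c) / 4 + (a - b) / 2 * (Real.cos θ : ℂ) + 0 * (Real.sin θ : ℂ) +
      (a + b - c) / 4 * (Real.cos θ : ℂ) ^ 2 + 0 * ((Real.sin θ : ℂ) * (Real.cos θ : ℂ)) := by
    intro θ
    have h4 : Real.cos θ = 2 * Real.cos (θ / 2) ^ 2 - 1 := by
      rw [← Real.cos_two_mul]; congr 1; ring
    have h5 : Real.sin (θ / 2) ^ 2 = 1 - Real.cos (θ / 2) ^ 2 := by
      rw [← Real.cos_sq_add_sin_sq (θ / 2)]; ring
    have h5' : (Real.sin (θ / 2) : ℂ) ^ 2 = 1 - Real.cos (θ / 2) ^ 2 := by exact_mod_cast h5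
    rw [h5', h4]
    push_cast
    ring
  simp_rw [h]
  rw [integral_uniformAngle_cos_sin]
  ring

variable (x y : Fin 2 → Fin 2 → ℂ)

/-- Averaging over `φ` keeps only products of entries carrying the same phase. The same three
bilinear forms therefore appear on the right in every case, and they close under rotations. -/
theorem integral_rotConj_diag :
    ∫ θ, ∫ φ, rotConj θ φ x 0 0 * conj (rotConj θ φ y 0 0) ∂uniformAngle ∂uniformAngle =
      (3 * (x 0 0 * conj (y 0 0) + x 1 1 * conj (y 1 1)) +
        (x 0 0 * conj (y 1 1) + x 1 1 * conj (y 0 0)) +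
        (x 0 1 * conj (y 0 1) + x 1 0 * conj (y 1 0))) / 8 ∧
    ∫ θ, ∫ φ, rotConj θ φ x 1 1 * conj (rotConj θ φ y 1 1) ∂uniformAngle ∂uniformAngle =
      (3 * (x 0 0 * conj (y 0 0) + x 1 1 * conj (y 1 1)) +
        (x 0 0 * conj (y 1 1) + x 1 1 * conj (y 0 0)) +
        (x 0 1 * conj (y 0 1) + x 1 0 * conj (y 1 0))) / 8 ∧
    ∫ θ, ∫ φ, rotConj θ φ x 0 0 * conj (rotConj θ φ y 1 1) ∂uniformAngle ∂uniformAngle =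
      ((x 0 0 * conj (y 0 0) + x 1 1 * conj (y 1 1)) +
        3 * (x 0 0 * conj (y 1 1) + x 1 1 * conj (y 0 0)) -
        (x 0 1 * conj (y 0 1) + x 1 0 * conj (y 1 0))) / 8 ∧
    ∫ θ, ∫ φ, rotConj θ φ x 1 1 * conj (rotConj θ φ y 0 0) ∂uniformAngle ∂uniformAngle =
      ((x 0 0 * conj (y 0 0) + x 1 1 * conj (y 1 1)) +
        3 * (x 0 0 * conj (y 1 1) + x 1 1 * conj (y 0 0)) -
        (x 0 1 * conj (y 0 1) + x 1 0 * conj (y 1 0))) / 8 := by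
  have hI := Complex.I_sq
  simp_rw [(rotConj_eq _ _ _).1, (rotConj_eq _ _ _).2.1, integral_uniformAngle_trig]
  refine ⟨?_, ?_, ?_, ?_⟩
  · refine Eq.trans ?_ ((integral_uniformAngle_half (x 0 0 * conj (y 0 0)) (x 1 1 * conj (y 1 1))
      ((x 0 0 * conj (y 1 1) + x 1 1 * conj (y 0 0)) +
      (x 0 1 * conj (y 0 1) + x 1 0 * conj (y 1 0)))).trans (by ring))
    congr 1; funext θ
    simp only [map_add, map_mul, map_neg, map_pow, Complex.conj_I, Complex.conj_ofReal]
    linear_combination (-(Real.sin (θ / 2) : ℂ) ^ 2 * Real.cos (θ / 2) ^ 2 *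
      (x 0 1 * conj (y 0 1) + x 1 0 * conj (y 1 0))) * hI
  · refine Eq.trans ?_ ((integral_uniformAngle_half (x 1 1 * conj (y 1 1)) (x 0 0 * conj (y 0 0))
      ((x 0 0 * conj (y 1 1) + x 1 1 * conj (y 0 0)) +
      (x 0 1 * conj (y 0 1) + x 1 0 * conj (y 1 0)))).trans (by ring))
    congr 1; funext θ
    simp only [map_add, map_mul, map_neg, map_pow, Complex.conj_I, Complex.conj_ofReal]
    linear_combination (-(Real.sin (θ / 2) : ℂ) ^ 2 * Real.cos (θ / 2) ^ 2 *
      (x 0 1 * conj (y 0 1) + x 1 0 * conj (y 1 0))) * hI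
  · refine Eq.trans ?_ ((integral_uniformAngle_half (x 0 0 * conj (y 1 1)) (x 1 1 * conj (y 0 0))
      ((x 0 0 * conj (y 0 0) + x 1 1 * conj (y 1 1)) -
      (x 0 1 * conj (y 0 1) + x 1 0 * conj (y 1 0)))).trans (by ring))
    congr 1; funext θ
    simp only [map_add, map_mul, map_neg, map_pow, Complex.conj_I, Complex.conj_ofReal]
    linear_combination ((Real.sin (θ / 2) : ℂ) ^ 2 * Real.cos (θ / 2) ^ 2 *
      (x 0 1 * conj (y 0 1) + x 1 0 * conj (y 1 0))) * hI
  · refine Eq.trans ?_ ((integral_uniformAngle_half (x 1 1 * conj (y 0 0)) (x 0 0 * conj (y 1 1))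
      ((x 0 0 * conj (y 0 0) + x 1 1 * conj (y 1 1)) -
      (x 0 1 * conj (y 0 1) + x 1 0 * conj (y 1 0)))).trans (by ring))
    congr 1; funext θ
    simp only [map_add, map_mul, map_neg, map_pow, Complex.conj_I, Complex.conj_ofReal]
    linear_combination ((Real.sin (θ / 2) : ℂ) ^ 2 * Real.cos (θ / 2) ^ 2 *
      (x 0 1 * conj (y 0 1) + x 1 0 * conj (y 1 0))) * hI

theorem integral_rotConj_offdiag :
    ∫ θ, ∫ φ, rotConj θ φ x 0 1 * conj (rotConj θ φ y 0 1) ∂uniformAngle ∂uniformAngle =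
      ((x 0 0 * conj (y 0 0) + x 1 1 * conj (y 1 1)) -
        (x 0 0 * conj (y 1 1) + x 1 1 * conj (y 0 0)) +
        3 * (x 0 1 * conj (y 0 1) + x 1 0 * conj (y 1 0))) / 8 ∧
    ∫ θ, ∫ φ, rotConj θ φ x 1 0 * conj (rotConj θ φ y 1 0) ∂uniformAngle ∂uniformAngle =
      ((x 0 0 * conj (y 0 0) + x 1 1 * conj (y 1 1)) -
        (x 0 0 * conj (y 1 1) + x 1 1 * conj (y 0 0)) +
        3 * (x 0 1 * conj (y 0 1) + x 1 0 * conj (y 1 0))) / 8 := by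
  have hI := Complex.I_sq
  have h1 : ∀ (φ : ℝ) (z w : ℂ), Complex.exp (-(Complex.I * φ)) * z *
      conj (Complex.exp (-(Complex.I * φ)) * w) = z * conj w := by
    intro φ z w
    have he : Complex.exp (-(Complex.I * φ)) * Complex.exp (Complex.I * φ) = 1 := by
      rw [← Complex.exp_add]; simp
    rw [map_mul, (conj_exp_I φ).2]
    linear_combination (z * conj w) * he
  have h2 : ∀ (φ : ℝ) (z w : ℂ), Complex.exp (Complex.I * φ) * z *
      conj (Complex.exp (Complex.I * φ) * w) = z * conj w := by
    intro φ z w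
    have he : Complex.exp (-(Complex.I * φ)) * Complex.exp (Complex.I * φ) = 1 := by
      rw [← Complex.exp_add]; simp
    rw [map_mul, (conj_exp_I φ).1]
    linear_combination (z * conj w) * he
  simp_rw [(rotConj_eq _ _ _).2.2.1, (rotConj_eq _ _ _).2.2.2, h1, h2, integral_uniformAngle_trig]
  refine ⟨?_, ?_⟩
  · refine Eq.trans ?_ ((integral_uniformAngle_half (x 0 1 * conj (y 0 1)) (x 1 0 * conj (y 1 0))
      ((x 0 0 * conj (y 0 0) + x 1 1 * conj (y 1 1)) -
      (x 0 0 * conj (y 1 1) + x 1 1 * conj (y 0 0)))).trans (by ring))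
    congr 1; funext θ
    simp only [map_sub, map_mul, map_pow, Complex.conj_I, Complex.conj_ofReal]
    linear_combination (-(Real.sin (θ / 2) : ℂ) ^ 2 * Real.cos (θ / 2) ^ 2 *
      (x 0 0 - x 1 1) * (conj (y 0 0) - conj (y 1 1))) * hI
  · refine Eq.trans ?_ ((integral_uniformAngle_half (x 1 0 * conj (y 1 0)) (x 0 1 * conj (y 0 1))
      ((x 0 0 * conj (y 0 0) + x 1 1 * conj (y 1 1)) -
      (x 0 0 * conj (y 1 1) + x 1 1 * conj (y 0 0)))).trans (by ring))
    congr 1; funext θ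
    simp only [map_sub, map_mul, map_neg, map_pow, Complex.conj_I, Complex.conj_ofReal]
    linear_combination (-(Real.sin (θ / 2) : ℂ) ^ 2 * Real.cos (θ / 2) ^ 2 *
      (x 0 0 - x 1 1) * (conj (y 0 0) - conj (y 1 1))) * hI

end RotationAverage

/-! ### Recursion for the second moment of the characteristic function -/

section Recursion

variable {M : ℕ} {ι : Type}

/-- The three quadratic forms in the characteristic function that evolve among themselves. -/
def secondMoment (c : Fin 3) (ξ ξ' : Fin M → ℂ) (Ψ : QWave M) : ℂ :=
  ![charFn Ψ 0 0 ξ * conj (charFn Ψ 0 0 ξ') + charFn Ψ 1 1 ξ * conj (charFn Ψ 1 1 ξ'),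
    charFn Ψ 0 0 ξ * conj (charFn Ψ 1 1 ξ') + charFn Ψ 1 1 ξ * conj (charFn Ψ 0 0 ξ'),
    charFn Ψ 0 1 ξ * conj (charFn Ψ 0 1 ξ') + charFn Ψ 1 0 ξ * conj (charFn Ψ 1 0 ξ')] c

/-- The average action of a rotation on the three quadratic forms. -/
def rotationMatrix : Matrix (Fin 3) (Fin 3) ℝ := !![3 / 4, 1 / 4, 1 / 4; 1 / 4, 3 / 4, -1 / 4;
  1 / 4, -1 / 4, 3 / 4]

theorem IsState.norm_secondMoment_le {Ψ : QWave M} (h : IsState Ψ) (c : Fin 3)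
    (ξ ξ' : Fin M → ℂ) : ‖secondMoment c ξ ξ' Ψ‖ ≤ 2 := by
  have key : ∀ a b a' b', ‖charFn Ψ a b ξ * conj (charFn Ψ a' b' ξ')‖ ≤ 1 := by
    intro a b a' b'
    rw [norm_mul, RCLike.norm_conj]
    exact mul_le_one₀ (h.norm_charFn_le _ _ _) (norm_nonneg _) (h.norm_charFn_le _ _ _)
  fin_cases c <;>
  · refine (norm_add_le _ _).trans ?_
    have h1 := key 0 0 0 0
    have h2 := key 1 1 1 1
    have h3 := key 0 0 1 1
    have h4 := key 1 1 0 0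
    have h5 := key 0 1 0 1
    have h6 := key 1 0 1 0
    linarith

theorem isObservable_secondMoment (c : Fin 3) (ξ ξ' : Fin M → ℂ) :
    IsObservable (secondMoment c ξ ξ') := by
  refine ⟨fun {Y _ Ψ} hΨ => ?_, 2, fun Ψ hΨ => hΨ.norm_secondMoment_le c ξ ξ'⟩
  have h : ∀ a b ξ, Continuous fun y => charFn (Ψ y) a b ξ := fun a b ξ =>
    hΨ.continuous_charFn a b continuous_const
  have h' : ∀ a b ξ, Continuous fun y => conj (charFn (Ψ y) a b ξ) := fun a b ξ =>
    Complex.continuous_conj.comp (h a b ξ)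
  fin_cases c
  · exact ((h 0 0 ξ).mul (h' 0 0 ξ')).add ((h 1 1 ξ).mul (h' 1 1 ξ'))
  · exact ((h 0 0 ξ).mul (h' 1 1 ξ')).add ((h 1 1 ξ).mul (h' 0 0 ξ'))
  · exact ((h 0 1 ξ).mul (h' 0 1 ξ')).add ((h 1 0 ξ).mul (h' 1 0 ξ'))

/-- The second moment after the rotation of a block. -/
def rotated (c : Fin 3) (ξ ξ' : Fin M → ℂ) (Ψ : QWave M) : ℂ :=
  ∑ c', (rotationMatrix c c' : ℂ) * secondMoment c' ξ ξ' Ψ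

theorem charFn_onQubit_eq {Ψ : QWave M} (h : IsState Ψ) (θ φ : ℝ) (a b : Fin 2) (ξ : Fin M → ℂ) :
    charFn (onQubit (qubitRotation θ φ) Ψ) a b ξ =
      rotConj θ φ (fun c d => charFn Ψ c d ξ) a b := charFn_onQubit _ h.memLp a b ξ

theorem continuous_rotConj (x : Fin 2 → Fin 2 → ℂ) (a b : Fin 2) :
    Continuous fun z : ℝ × ℝ => rotConj z.1 z.2 x a b := by
  have hR : ∀ a b, Continuous fun z : ℝ × ℝ => qubitRotation z.1 z.2 a b := by
    intro a b
    simp_rw [qubitRotation_apply]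
    fin_cases a <;> fin_cases b <;> simp <;> fun_prop
  unfold rotConj
  refine continuous_finsetSum _ fun c _ => continuous_finsetSum _ fun d _ => ?_
  exact ((hR a c).mul (Complex.continuous_conj.comp (hR b d))).mul continuous_const

theorem integral_angles_add {f g : ℝ → ℝ → ℂ} (hf : Continuous fun z : ℝ × ℝ => f z.1 z.2)
    (hg : Continuous fun z : ℝ × ℝ => g z.1 z.2) (p q : ℂ) :
    ∫ θ, ∫ φ, (p * f θ φ + q * g θ φ) ∂uniformAngle ∂uniformAngle =
      p * (∫ θ, ∫ φ, f θ φ ∂uniformAngle ∂uniformAngle) +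
      q * ∫ θ, ∫ φ, g θ φ ∂uniformAngle ∂uniformAngle := by
  have h1 : ∀ {h : ℝ → ℝ → ℂ}, (Continuous fun z : ℝ × ℝ => h z.1 z.2) → ∀ θ,
      Integrable (fun φ => h θ φ) uniformAngle := fun hh θ =>
    integrable_of_continuous_uniformAngle (hh.comp (by fun_prop : Continuous fun φ : ℝ => (θ, φ)))
  have h2 : ∀ {h : ℝ → ℝ → ℂ}, (Continuous fun z : ℝ × ℝ => h z.1 z.2) →
      Integrable (fun θ => ∫ φ, h θ φ ∂uniformAngle) uniformAngle := fun hh =>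
    integrable_of_continuous_uniformAngle (continuous_integral_uniformAngle hh)
  have h3 : ∀ θ, ∫ φ, (p * f θ φ + q * g θ φ) ∂uniformAngle =
      p * (∫ φ, f θ φ ∂uniformAngle) + q * ∫ φ, g θ φ ∂uniformAngle := by
    intro θ
    rw [integral_add ((h1 hf θ).const_mul p) ((h1 hg θ).const_mul q), integral_const_mul,
      integral_const_mul]
  simp_rw [h3]
  rw [integral_add ((h2 hf).const_mul p) ((h2 hg).const_mul q), integral_const_mul,
    integral_const_mul]

/-- The phase picked up by the characteristic function under a displacement of mode `j`. -/
def displacePhase (j : Fin M) (z : Fin M → ℂ) (β : ℂ) : ℂ :=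
  Complex.exp (Complex.I * ((2 * sympl z (Pi.single j β) : ℝ) : ℂ))

theorem sympl_single (z : Fin M → ℂ) (j : Fin M) (β : ℂ) :
    sympl z (Pi.single j β) = (z j).im * β.re - (z j).re * β.im := by
  rw [sympl, Finset.sum_eq_single j]
  · simp
  · intro i _ hi
    simp [hi]
  · simp

theorem displacePhase_mul_conj (j : Fin M) (z w : Fin M → ℂ) (β : ℂ) :
    displacePhase j z β * conj (displacePhase j w β) = displacePhase j (z - w) β ∧
    displacePhase j z (-β) * conj (displacePhase j w β) = displacePhase j (z + w) (-β) ∧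
    displacePhase j z β * conj (displacePhase j w (-β)) = displacePhase j (z + w) β := by
  simp only [displacePhase, ← Complex.exp_conj, map_mul, Complex.conj_I, Complex.conj_ofReal,
    ← Complex.exp_add, sympl_single, Pi.sub_apply, Pi.add_apply, Complex.sub_re, Complex.sub_im,
    Complex.add_re, Complex.add_im, Complex.neg_re, Complex.neg_im]
  refine ⟨?_, ?_, ?_⟩ <;> congr 1 <;> push_cast <;> ring

theorem integral_displacePhase {v : ℝ} (hv : 0 ≤ v) (j : Fin M) (z : Fin M → ℂ) :
    ∫ β, displacePhase j z β ∂complexGaussian v = Real.exp (-v * ‖z j‖ ^ 2) ∧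
    ∫ β, displacePhase j z (-β) ∂complexGaussian v = Real.exp (-v * ‖z j‖ ^ 2) := by
  have h1 := integral_complexGaussian_exp hv (2 * (z j).im) (-2 * (z j).re)
  have h2 := integral_complexGaussian_exp hv (-2 * (z j).im) (2 * (z j).re)
  have h3 : ‖z j‖ ^ 2 = (z j).re ^ 2 + (z j).im ^ 2 := by
    rw [← Complex.normSq_eq_norm_sq, Complex.normSq_apply]; ring
  unfold displacePhase
  constructor
  · rw [h3, (by ring : -v * ((z j).re ^ 2 + (z j).im ^ 2) =
      -v * ((2 * (z j).im) ^ 2 + (-2 * (z j).re) ^ 2) / 4), ← h1]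
    congr 1; funext β
    rw [sympl_single]
    congr 3
    ring
  · rw [h3, (by ring : -v * ((z j).re ^ 2 + (z j).im ^ 2) =
      -v * ((-2 * (z j).im) ^ 2 + (2 * (z j).re) ^ 2) / 4), ← h2]
    congr 1; funext β
    rw [sympl_single]
    congr 3
    simp; ring

/-- For the two diagonal forms the displacement phases multiply to one that depends on `ξ - ξ'` or
on `ξ + ξ'` only. The off-diagonal form has both arguments moved by the same amount, so `ξ - ξ'` is
never changed by a block. -/
theorem integral_angles_secondMoment {Ψ : QWave M} (h : IsState Ψ) (j : Fin M) (β : ℂ)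
    (ξ ξ' : Fin M → ℂ) :
    ∫ θ, ∫ φ, secondMoment 0 ξ ξ' (ecd j β (onQubit (qubitRotation θ φ) Ψ))
      ∂uniformAngle ∂uniformAngle = (displacePhase j (ξ - ξ') (-β) +
        displacePhase j (ξ - ξ') β) / 2 * rotated 0 ξ ξ' Ψ ∧
    ∫ θ, ∫ φ, secondMoment 1 ξ ξ' (ecd j β (onQubit (qubitRotation θ φ) Ψ))
      ∂uniformAngle ∂uniformAngle = (displacePhase j (ξ + ξ') (-β) +
        displacePhase j (ξ + ξ') β) / 2 * rotated 1 ξ ξ' Ψ ∧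
    ∫ θ, ∫ φ, secondMoment 2 ξ ξ' (ecd j β (onQubit (qubitRotation θ φ) Ψ))
      ∂uniformAngle ∂uniformAngle =
        (rotated 2 (ξ - Pi.single j (2 * β)) (ξ' - Pi.single j (2 * β)) Ψ +
        rotated 2 (ξ + Pi.single j (2 * β)) (ξ' + Pi.single j (2 * β)) Ψ) / 2 := by
  have hc : ∀ (x y : Fin 2 → Fin 2 → ℂ) (a b a' b' : Fin 2), Continuous fun z : ℝ × ℝ =>
      rotConj z.1 z.2 x a b * conj (rotConj z.1 z.2 y a' b') := fun x y a b a' b' =>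
    (continuous_rotConj x a b).mul (Complex.continuous_conj.comp (continuous_rotConj y a' b'))
  have e0 : ∀ θ φ, secondMoment 0 ξ ξ' (ecd j β (onQubit (qubitRotation θ φ) Ψ)) =
      displacePhase j (ξ - ξ') (-β) * (rotConj θ φ (fun c d => charFn Ψ c d ξ) 1 1 *
        conj (rotConj θ φ (fun c d => charFn Ψ c d ξ') 1 1)) +
      displacePhase j (ξ - ξ') β * (rotConj θ φ (fun c d => charFn Ψ c d ξ) 0 0 *
        conj (rotConj θ φ (fun c d => charFn Ψ c d ξ') 0 0)) := by
    intro θ φ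
    simp only [secondMoment, Matrix.cons_val_zero, (charFn_ecd _ _ _ _).1,
      (charFn_ecd _ _ _ _).2.1, charFn_onQubit_eq h, map_mul]
    rw [← (displacePhase_mul_conj j ξ ξ' β).1, ← (displacePhase_mul_conj j ξ ξ' (-β)).1]
    simp only [displacePhase]
    ring
  have e1 : ∀ θ φ, secondMoment 1 ξ ξ' (ecd j β (onQubit (qubitRotation θ φ) Ψ)) =
      displacePhase j (ξ + ξ') (-β) * (rotConj θ φ (fun c d => charFn Ψ c d ξ) 1 1 *
        conj (rotConj θ φ (fun c d => charFn Ψ c d ξ') 0 0)) +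
      displacePhase j (ξ + ξ') β * (rotConj θ φ (fun c d => charFn Ψ c d ξ) 0 0 *
        conj (rotConj θ φ (fun c d => charFn Ψ c d ξ') 1 1)) := by
    intro θ φ
    simp only [secondMoment, Matrix.cons_val_one, Matrix.cons_val_zero, (charFn_ecd _ _ _ _).1,
      (charFn_ecd _ _ _ _).2.1, charFn_onQubit_eq h, map_mul]
    rw [← (displacePhase_mul_conj j ξ ξ' β).2.1, ← (displacePhase_mul_conj j ξ ξ' β).2.2]
    simp only [displacePhase]
    ring
  have e2 : ∀ θ φ, secondMoment 2 ξ ξ' (ecd j β (onQubit (qubitRotation θ φ) Ψ)) =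
      1 * (rotConj θ φ (fun c d => charFn Ψ c d (ξ - Pi.single j (2 * β))) 1 0 *
        conj (rotConj θ φ (fun c d => charFn Ψ c d (ξ' - Pi.single j (2 * β))) 1 0)) +
      1 * (rotConj θ φ (fun c d => charFn Ψ c d (ξ + Pi.single j (2 * β))) 0 1 *
        conj (rotConj θ φ (fun c d => charFn Ψ c d (ξ' + Pi.single j (2 * β))) 0 1)) := by
    intro θ φ
    simp only [secondMoment, Matrix.cons_val, (charFn_ecd _ _ _ _).2.2.1,
      (charFn_ecd _ _ _ _).2.2.2, charFn_onQubit_eq h, one_mul]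
  have hadd : ∀ (x y x' y' : Fin 2 → Fin 2 → ℂ) (a b a' b' c d c' d' : Fin 2) (p q : ℂ),
      ∫ θ, ∫ φ, (p * (rotConj θ φ x a b * conj (rotConj θ φ y a' b')) +
        q * (rotConj θ φ x' c d * conj (rotConj θ φ y' c' d'))) ∂uniformAngle ∂uniformAngle =
      p * (∫ θ, ∫ φ, rotConj θ φ x a b * conj (rotConj θ φ y a' b') ∂uniformAngle ∂uniformAngle) +
      q * ∫ θ, ∫ φ, rotConj θ φ x' c d * conj (rotConj θ φ y' c' d') ∂uniformAngle ∂uniformAngle :=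
    fun x y x' y' a b a' b' c d c' d' p q => integral_angles_add
      (f := fun θ φ => rotConj θ φ x a b * conj (rotConj θ φ y a' b'))
      (g := fun θ φ => rotConj θ φ x' c d * conj (rotConj θ φ y' c' d'))
      (hc _ _ _ _ _ _) (hc _ _ _ _ _ _) p q
  simp_rw [e0, e1, e2, hadd,
    (integral_rotConj_diag _ _).1, (integral_rotConj_diag _ _).2.1,
    (integral_rotConj_diag _ _).2.2.1, (integral_rotConj_diag _ _).2.2.2,
    (integral_rotConj_offdiag _ _).1, (integral_rotConj_offdiag _ _).2]
  simp only [rotated, Fin.sum_univ_three, secondMoment, rotationMatrix, Matrix.of_apply,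
    Matrix.cons_val', Matrix.cons_val, Matrix.cons_val_fin_one]
  push_cast
  refine ⟨?_, ?_, ?_⟩ <;> ring

end Recursion

/-! ### One-block recursion for the averaged second moments -/

section Averages

variable {M : ℕ} {ι : Type} [Fintype ι]

theorem average_rotated (v : ℝ) (m : ι → Fin M) (l : List ι) (c : Fin 3) (ξ ξ' : Fin M → ℂ) :
    average v m l (rotated c ξ ξ') =
      ∑ c', (rotationMatrix c c' : ℂ) * average v m l (secondMoment c' ξ ξ') := by
  unfold average rotated
  rw [integral_finsetSum]
  · simp_rw [integral_const_mul]
  · exact fun c' _ => ((isObservable_secondMoment c' ξ ξ').integrable _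
      (isStateFamily_run m l)).const_mul _

theorem integrable_rotated (v : ℝ) (m : ι → Fin M) (l : List ι) (c : Fin 3) (ξ ξ' : Fin M → ℂ) :
    Integrable (fun x => rotated c ξ ξ' (run m l x)) (Measure.pi fun _ : ι => paramMeasure v) :=
  integrable_finsetSum _ fun c' _ => ((isObservable_secondMoment c' ξ ξ').integrable _
      (isStateFamily_run m l)).const_mul _

theorem integrable_displacePhase (v : ℝ) (j : Fin M) (z : Fin M → ℂ) :
    Integrable (fun β => displacePhase j z β) (complexGaussian v) ∧
    Integrable (fun β => displacePhase j z (-β)) (complexGaussian v) := by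
  have h : ∀ β, ‖displacePhase j z β‖ ≤ 1 := fun β => by
    rw [displacePhase, mul_comm, Complex.norm_exp_ofReal_mul_I]
  have hc : Continuous fun β => displacePhase j z β := by
    unfold displacePhase
    simp_rw [sympl_single]
    fun_prop
  exact ⟨Integrable.of_bound hc.aestronglyMeasurable 1 (Filter.Eventually.of_forall h),
    Integrable.of_bound (hc.comp continuous_neg).aestronglyMeasurable 1
      (Filter.Eventually.of_forall fun β => h (-β))⟩

theorem average_secondMoment_concat [DecidableEq ι] {v : ℝ} (hv : 0 ≤ v) (m : ι → Fin M) {l : List ι} {g : ι}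
    (hg : g ∉ l) (ξ ξ' : Fin M → ℂ) :
    average v m (l ++ [g]) (secondMoment 0 ξ ξ') =
      (Real.exp (-v * ‖ξ (m g) - ξ' (m g)‖ ^ 2) : ℝ) * average v m l (rotated 0 ξ ξ') ∧
    average v m (l ++ [g]) (secondMoment 1 ξ ξ') =
      (Real.exp (-v * ‖ξ (m g) + ξ' (m g)‖ ^ 2) : ℝ) * average v m l (rotated 1 ξ ξ') ∧
    average v m (l ++ [g]) (secondMoment 2 ξ ξ') = ∫ β,
      (average v m l (rotated 2 (ξ - Pi.single (m g) (2 * β)) (ξ' - Pi.single (m g) (2 * β))) +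
      average v m l (rotated 2 (ξ + Pi.single (m g) (2 * β)) (ξ' + Pi.single (m g) (2 * β)))) / 2
        ∂complexGaussian v := by
  have hst := fun x => (isStateFamily_run m l).isState x
  refine ⟨?_, ?_, ?_⟩
  · rw [average_concat v m hg (isObservable_secondMoment 0 ξ ξ')]
    simp_rw [average, (integral_angles_secondMoment (hst _) _ _ ξ ξ').1, integral_const_mul]
    rw [integral_mul_const, integral_div, integral_add (integrable_displacePhase v _ _).2
      (integrable_displacePhase v _ _).1, (integral_displacePhase hv _ _).1,
      (integral_displacePhase hv _ _).2, Pi.sub_apply]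
    ring
  · rw [average_concat v m hg (isObservable_secondMoment 1 ξ ξ')]
    simp_rw [average, (integral_angles_secondMoment (hst _) _ _ ξ ξ').2.1, integral_const_mul]
    rw [integral_mul_const, integral_div, integral_add (integrable_displacePhase v _ _).2
      (integrable_displacePhase v _ _).1, (integral_displacePhase hv _ _).1,
      (integral_displacePhase hv _ _).2, Pi.add_apply]
    ring
  · rw [average_concat v m hg (isObservable_secondMoment 2 ξ ξ')]
    simp_rw [average, (integral_angles_secondMoment (hst _) _ _ ξ ξ').2.2]
    congr 1; funext β
    rw [integral_div, integral_add (integrable_rotated v m l 2 _ _)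
      (integrable_rotated v m l 2 _ _)]

end Averages

/-! ### Formal combinations of Gaussians -/

section Formal

variable {M : ℕ}


/-- Indices of centred Gaussians on phase space: mode `j` has the parameters
`p = 1 + (i j).1` and `r = 1 + (i j).2`. -/
abbrev GIdx (M : ℕ) : Type := Fin M → ℝ≥0 × ℝ≥0

/-- Formal combinations of Gaussians. -/
abbrev GSpace (M : ℕ) : Type := GIdx M →₀ ℝ

/-- One factor of a Gaussian. -/
def gaussFactor (a : ℝ≥0 × ℝ≥0) (z : ℂ) : ℝ :=
  (1 + a.1 : ℝ)⁻¹ * Real.exp (-((1 + a.2 : ℝ) / (1 + a.1)) * ‖z‖ ^ 2)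

/-- The Gaussian with index `i`. -/
def gauss (i : GIdx M) (ζ : Fin M → ℂ) : ℝ := ∏ j, gaussFactor (i j) (ζ j)

/-- The function given by a formal combination of Gaussians. -/
def ev (ζ : Fin M → ℂ) : GSpace M →ₗ[ℝ] ℝ := Finsupp.linearCombination ℝ fun i => gauss i ζ

@[simp]
theorem ev_single (ζ : Fin M → ℂ) (i : GIdx M) (c : ℝ) :
    ev ζ (Finsupp.single i c) = c * gauss i ζ := by
  simp [ev]

/-- Multiplication by `exp (-4 v |ζ_j|²)`. -/
def multIdx (v : ℝ≥0) (j : Fin M) (i : GIdx M) : GIdx M :=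
  Function.update i j ((i j).1, (i j).2 + 4 * v * (1 + (i j).1))

/-- Convolution with the distribution of `2 β e_j`. -/
def convIdx (v : ℝ≥0) (j : Fin M) (i : GIdx M) : GIdx M :=
  Function.update i j ((i j).1 + 4 * v * (1 + (i j).2), (i j).2)

/-- The symplectic Fourier transform exchanges the two parameters. -/
def swapIdx (i : GIdx M) : GIdx M := fun j => (i j).swap

def mult (v : ℝ≥0) (j : Fin M) : GSpace M →ₗ[ℝ] GSpace M := Finsupp.lmapDomain ℝ ℝ (multIdx v j)

def conv (v : ℝ≥0) (j : Fin M) : GSpace M →ₗ[ℝ] GSpace M := Finsupp.lmapDomain ℝ ℝ (convIdx v j)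

/-- On indices the transform is a relabelling, so its involutivity and its exchange of
multiplication and convolution are algebraic; `ev_fourier` identifies it with the integral
transform. -/
def fourier : GSpace M →ₗ[ℝ] GSpace M := Finsupp.lmapDomain ℝ ℝ swapIdx

@[simp]
theorem mult_single (v : ℝ≥0) (j : Fin M) (i : GIdx M) (c : ℝ) :
    mult v j (Finsupp.single i c) = Finsupp.single (multIdx v j i) c := by
  simp [mult]

@[simp]
theorem conv_single (v : ℝ≥0) (j : Fin M) (i : GIdx M) (c : ℝ) :
    conv v j (Finsupp.single i c) = Finsupp.single (convIdx v j i) c := by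
  simp [conv]

@[simp]
theorem fourier_single (i : GIdx M) (c : ℝ) :
    fourier (Finsupp.single i c) = Finsupp.single (swapIdx i) c := by
  simp [fourier]

theorem gaussFactor_nonneg (a : ℝ≥0 × ℝ≥0) (z : ℂ) : 0 ≤ gaussFactor a z := by
  unfold gaussFactor; positivity

theorem gaussFactor_le_one (a : ℝ≥0 × ℝ≥0) (z : ℂ) : gaussFactor a z ≤ 1 := by
  unfold gaussFactor
  refine mul_le_one₀ (inv_le_one_of_one_le₀ (by simp)) (Real.exp_nonneg _) ?_
  rw [Real.exp_le_one_iff, neg_mul]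
  exact neg_nonpos.2 (by positivity)

theorem gauss_nonneg (i : GIdx M) (ζ : Fin M → ℂ) : 0 ≤ gauss i ζ :=
  Finset.prod_nonneg fun _ _ => gaussFactor_nonneg _ _

theorem gauss_le_one (i : GIdx M) (ζ : Fin M → ℂ) : gauss i ζ ≤ 1 :=
  Finset.prod_le_one (fun _ _ => gaussFactor_nonneg _ _) fun _ _ => gaussFactor_le_one _ _

@[fun_prop]
theorem continuous_gauss (i : GIdx M) : Continuous (gauss i) := by
  unfold gauss gaussFactor
  exact continuous_finsetProd _ fun j _ => by fun_prop

@[fun_prop]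
theorem continuous_ev (f : GSpace M) : Continuous fun ζ => ev ζ f := by
  induction f using Finsupp.induction_linear with
  | zero => simpa using continuous_const
  | add f g hf hg => simp only [map_add]; fun_prop
  | single i c => simp only [ev_single]; fun_prop

theorem exists_abs_ev_le (f : GSpace M) : ∃ C, ∀ ζ, |ev ζ f| ≤ C := by
  induction f using Finsupp.induction_linear with
  | zero => exact ⟨0, fun ζ => by simp⟩
  | add f g hf hg =>
    obtain ⟨C, hC⟩ := hf
    obtain ⟨D, hD⟩ := hg
    exact ⟨C + D, fun ζ => by
      rw [map_add]; exact (abs_add_le _ _).trans (add_le_add (hC ζ) (hD ζ))⟩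
  | single i c =>
    refine ⟨|c|, fun ζ => ?_⟩
    rw [ev_single, abs_mul, abs_of_nonneg (gauss_nonneg i ζ)]
    exact mul_le_of_le_one_right (abs_nonneg _) (gauss_le_one _ _)

theorem gauss_update (i : GIdx M) (j : Fin M) (a : ℝ≥0 × ℝ≥0) (ζ : Fin M → ℂ) (z : ℂ) :
    gauss (Function.update i j a) (ζ + Pi.single j z) =
      gaussFactor a (ζ j + z) * ∏ k ∈ Finset.univ.erase j, gaussFactor (i k) (ζ k) := by
  rw [gauss, ← Finset.mul_prod_erase _ _ (Finset.mem_univ j)]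
  congr 1
  · simp
  · refine Finset.prod_congr rfl fun k hk => ?_
    have := Finset.ne_of_mem_erase hk
    simp [this]

theorem gauss_update_zero (i : GIdx M) (j : Fin M) (a : ℝ≥0 × ℝ≥0) (ζ : Fin M → ℂ) :
    gauss (Function.update i j a) ζ =
      gaussFactor a (ζ j) * ∏ k ∈ Finset.univ.erase j, gaussFactor (i k) (ζ k) := by
  simpa using gauss_update i j a ζ 0

theorem ev_mult (v : ℝ≥0) (j : Fin M) (f : GSpace M) (ζ : Fin M → ℂ) :
    ev ζ (mult v j f) = Real.exp (-(4 * v) * ‖ζ j‖ ^ 2) * ev ζ f := by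
  induction f using Finsupp.induction_linear with
  | zero => simp
  | add f g hf hg => rw [map_add, map_add, map_add, hf, hg]; ring
  | single i c =>
    rw [mult_single, ev_single, ev_single, multIdx, gauss_update_zero]
    have h := gauss_update_zero i j (i j) ζ
    rw [Function.update_eq_self] at h
    rw [h]
    have : gaussFactor ((i j).1, (i j).2 + 4 * v * (1 + (i j).1)) (ζ j) =
        Real.exp (-(4 * v) * ‖ζ j‖ ^ 2) * gaussFactor (i j) (ζ j) := by
      simp only [gaussFactor]
      rw [mul_left_comm, ← Real.exp_add]
      congr 2
      push_cast
      have : (1 + (i j).1 : ℝ) ≠ 0 := by positivity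
      field_simp
      ring
    rw [this]
    ring

/-- Convolving the factor with exponent `(1 + r) / (1 + p)` replaces `1 + p` by `1 + p + 4v(1 + r)`
both in the exponent and in the prefactor, so that only `p` changes. The two values `t = ±2` are the
two directions of the displacement. -/
theorem integral_ev_conv {v : ℝ≥0} (hv : 0 < v) (j : Fin M) (f : GSpace M) (ζ : Fin M → ℂ)
    (t : ℝ) (ht : t ^ 2 = 4) :
    ∫ β : ℂ, ev (ζ + Pi.single j (t * β)) f ∂complexGaussian v = ev ζ (conv v j f) := by
  have hint : ∀ f : GSpace M, Integrable (fun β : ℂ => ev (ζ + Pi.single j (t * β)) f)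
      (complexGaussian v) := by
    intro f
    obtain ⟨C, hC⟩ := exists_abs_ev_le f
    refine Integrable.of_bound (Continuous.aestronglyMeasurable ?_) C
      (Filter.Eventually.of_forall fun β => hC _)
    exact (continuous_ev f).comp (continuous_const.add ((continuous_single j).comp (by fun_prop)))
  induction f using Finsupp.induction_linear with
  | zero => simp
  | add f g hf hg =>
    simp_rw [map_add]
    rw [integral_add (hint f) (hint g), hf, hg]
  | single i c =>
    rw [conv_single, ev_single, convIdx, gauss_update_zero]
    have h := fun z => gauss_update i j (i j) ζ z
    simp_rw [Function.update_eq_self] at h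
    simp_rw [ev_single, h]
    rw [integral_const_mul, integral_mul_const]
    congr 2
    simp only [gaussFactor]
    rw [integral_const_mul, integral_complexGaussian_exp_sq (by exact_mod_cast hv) (by positivity),
      ht, ← mul_assoc]
    have h1 : (1 + (i j).1 : ℝ) ≠ 0 := by positivity
    have h3 : (1 + (1 + (i j).2 : ℝ) / (1 + (i j).1) * 4 * v) =
      (1 + ((i j).1 + 4 * v * (1 + (i j).2))) / (1 + (i j).1) := by field_simp; ring
    rw [h3]
    have h2 : (1 + ((i j).1 + 4 * v * (1 + (i j).2)) : ℝ) ≠ 0 := by positivity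
    push_cast
    congr 1
    · field_simp
    · congr 2
      field_simp

/-- One block: the rotation mixes the three components and the displacement damps them. -/
def damp (v : ℝ≥0) (η : Fin M → ℂ) (j : Fin M) (F : Fin 3 → GSpace M) : Fin 3 → GSpace M :=
  ![Real.exp (-v * ‖η j‖ ^ 2) • F 0, mult v j (F 1), conv v j (F 2)]

def rotate (F : Fin 3 → GSpace M) : Fin 3 → GSpace M :=
  fun c => ∑ c', rotationMatrix c c' • F c'

/-- The blocks on the modes of the list `l`, the first acting first. -/
def evolve (v : ℝ≥0) (η : Fin M → ℂ) (l : List (Fin M)) (F : Fin 3 → GSpace M) :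
    Fin 3 → GSpace M :=
  l.foldl (fun F j => damp v η j (rotate F)) F

/-- The second moments of the characteristic function of the vacuum. -/
def initial (η : Fin M → ℂ) : Fin 3 → GSpace M :=
  ![Finsupp.single 0 (Real.exp (-normSqSum η / 4)), 0, 0]

theorem evolve_concat (v : ℝ≥0) (η : Fin M → ℂ) (l : List (Fin M)) (j : Fin M)
    (F : Fin 3 → GSpace M) :
    evolve v η (l ++ [j]) F = damp v η j (rotate (evolve v η l F)) := by
  simp [evolve]

theorem ev_rotate (ζ : Fin M → ℂ) (F : Fin 3 → GSpace M) (c : Fin 3) :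
    ev ζ (rotate F c) = ∑ c', rotationMatrix c c' * ev ζ (F c') := by
  simp [rotate, map_sum]

variable {ι : Type} [Fintype ι] [DecidableEq ι]

/-- The averaged second moments of the characteristic function are given by the formal
evolution. -/
theorem average_secondMoment {v : ℝ≥0} (hv : 0 < v) (m : ι → Fin M) (l : List ι) (hl : l.Nodup)
    (η : Fin M → ℂ) (c : Fin 3) (ζ ξ ξ' : Fin M → ℂ) (hξ : ξ + ξ' = ζ + ζ) (hη : ξ - ξ' = η) :
    average v m l (secondMoment c ξ ξ') =
      (ev ζ (evolve v η (l.map m) (initial η) c) : ℝ) := by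
  induction l using List.reverseRecOn generalizing c ζ ξ ξ' with
  | nil =>
    rw [average_nil]
    have h0 : ∀ f : Wave M, braket f 0 = 0 := fun f => by simp [braket]
    have h0' : ∀ f : Wave M, braket 0 f = 0 := fun f => by simp [braket]
    have hd : ∀ ξ : Fin M → ℂ, displace ξ (0 : Wave M) = 0 := fun ξ => by
      funext q; simp [displace]
    have hv : charFn ![vacuum M, 0] 0 0 ξ * conj (charFn ![vacuum M, 0] 0 0 ξ') =
        ((Real.exp (-normSqSum η / 4) * gauss 0 ζ : ℝ) : ℂ) := by
      have e1 : charFn ![vacuum M, 0] 0 0 ξ = Real.exp (-normSqSum ξ / 2) :=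
        braket_vacuum_displace ξ
      have e2 : charFn ![vacuum M, 0] 0 0 ξ' = Real.exp (-normSqSum ξ' / 2) :=
        braket_vacuum_displace ξ'
      have e3 : gauss 0 ζ = Real.exp (-normSqSum ζ) := by
        simp only [gauss, gaussFactor, normSqSum, ← Finset.sum_neg_distrib, Real.exp_sum]
        simp
      rw [e1, e2, e3, Complex.conj_ofReal, ← Complex.ofReal_mul, ← Real.exp_add, ← Real.exp_add]
      congr 2
      -- Parallelogram law: `|ξ|² / 2 + |ξ'|² / 2 = |ζ|² + |η|² / 4`, which separates the vacuum
      -- into a Gaussian in `ζ` and a constant depending on `η`.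
      have e4 : ζ = fun j => (ξ j + ξ' j) / 2 := by
        funext j
        have := congrFun hξ j
        simp only [Pi.add_apply] at this
        rw [this]; ring
      rw [e4, ← hη, normSqSum_eq, normSqSum_eq, normSqSum_eq, normSqSum_eq]
      simp only [neg_div, Finset.sum_div, ← Finset.sum_neg_distrib, ← Finset.sum_add_distrib]
      refine Finset.sum_congr rfl fun j _ => ?_
      simp
      ring
    fin_cases c
    · simp only [secondMoment, Fin.zero_eta, Matrix.cons_val_zero, hv]
      simp [charFn, hd, h0, evolve, initial]
    · simp [secondMoment, charFn, hd, h0, evolve, initial]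
    · simp [secondMoment, charFn, hd, h0, h0', evolve, initial]
  | append_singleton l g ih =>
    have hg : g ∉ l := fun h => (List.nodup_append.1 hl).2.2 g h g (by simp) rfl
    have ih := ih (List.nodup_append.1 hl).1
    have hrot : ∀ (c : Fin 3) (ζ ξ ξ' : Fin M → ℂ), ξ + ξ' = ζ + ζ → ξ - ξ' = η →
        average v m l (rotated c ξ ξ') =
          (ev ζ (rotate (evolve v η (l.map m) (initial η)) c) : ℝ) := by
      intro c ζ ξ ξ' hξ hη
      rw [average_rotated, ev_rotate]
      push_cast
      exact Finset.sum_congr rfl fun c' _ => by rw [ih c' ζ ξ ξ' hξ hη]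
    have hcat := average_secondMoment_concat (v := v) v.2 m hg ξ ξ'
    rw [List.map_append, List.map_singleton, evolve_concat]
    fin_cases c
    · refine hcat.1.trans ?_
      rw [hrot 0 ζ ξ ξ' hξ hη]
      simp [damp, ← hη]
    · refine hcat.2.1.trans ?_
      rw [hrot 1 ζ ξ ξ' hξ hη]
      have e : ‖ξ (m g) + ξ' (m g)‖ ^ 2 = 4 * ‖ζ (m g)‖ ^ 2 := by
        have := congrFun hξ (m g)
        simp only [Pi.add_apply] at this
        rw [this, ← two_mul, norm_mul, mul_pow]
        norm_num
      simp only [damp, Fin.mk_one, Matrix.cons_val_one, Matrix.cons_val_zero, ev_mult]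
      rw [e]
      push_cast
      ring_nf
    · refine hcat.2.2.trans ?_
      set G := rotate (evolve v η (l.map m) (initial η)) 2 with hG
      -- Moving `ξ` and `ξ'` by the same vector moves the centre `ζ` by it and keeps `η`, so the
      -- induction hypothesis applies with the shifted centre.
      have e : ∀ β : ℂ, (average v m l (rotated 2 (ξ - Pi.single (m g) (2 * β))
          (ξ' - Pi.single (m g) (2 * β))) + average v m l (rotated 2 (ξ + Pi.single (m g) (2 * β))
          (ξ' + Pi.single (m g) (2 * β)))) / 2 =
          (((ev (ζ + Pi.single (m g) (((-2 : ℝ) : ℂ) * β)) G +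
            ev (ζ + Pi.single (m g) (((2 : ℝ) : ℂ) * β)) G) / 2 : ℝ) : ℂ) := by
        intro β
        have hneg : (Pi.single (m g) (((-2 : ℝ) : ℂ) * β) : Fin M → ℂ) =
            -Pi.single (m g) (2 * β) := by
          rw [← Pi.single_neg (f := fun _ => ℂ)]; push_cast; rw [neg_mul]
        rw [hrot 2 (ζ + Pi.single (m g) (((-2 : ℝ) : ℂ) * β)) _ _ ?_ ?_,
          hrot 2 (ζ + Pi.single (m g) (((2 : ℝ) : ℂ) * β)) _ _ ?_ ?_]
        · push_cast; rfl
        · push_cast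
          rw [add_add_add_comm, hξ]; abel
        · rw [add_sub_add_right_eq_sub, hη]
        · rw [hneg, sub_add_sub_comm, hξ]; abel
        · rw [sub_sub_sub_cancel_right, hη]
      simp_rw [e]
      have hint : ∀ t : ℝ, Integrable (fun β : ℂ => ev (ζ + Pi.single (m g) (t * β)) G)
          (complexGaussian v) := by
        intro t
        obtain ⟨C, hC⟩ := exists_abs_ev_le G
        refine Integrable.of_bound (Continuous.aestronglyMeasurable ?_) C
          (Filter.Eventually.of_forall fun β => hC _)
        exact (continuous_ev G).comp
          (continuous_const.add ((continuous_single (m g)).comp (by fun_prop)))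
      rw [integral_complex_ofReal, integral_div, integral_add (hint _) (hint _),
        integral_ev_conv hv _ _ _ _ (by norm_num), integral_ev_conv hv _ _ _ _ (by norm_num)]
      simp [damp, hG]

/-- The formal combinations represent averages over genuine states, whose characteristic functions
are bounded by one. Summing absolute coefficients would give a bound growing with the depth; the
uniform bound is what the Nash inequality uses. -/
theorem abs_ev_evolve_le {v : ℝ≥0} (hv : 0 < v) (Q : List (Fin M)) (η ζ : Fin M → ℂ) (c : Fin 3) :
    |ev ζ (evolve v η Q (initial η) c)| ≤ 2 := by
  have h := average_secondMoment hv Q.get (List.finRange Q.length) (List.nodup_finRange _) η c ζ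
    (fun j => ζ j + η j / 2) (fun j => ζ j - η j / 2) (by funext j; simp) (by funext j; simp)
  rw [List.map_get_finRange] at h
  have hb : ‖average v Q.get (List.finRange Q.length)
      (secondMoment c (fun j => ζ j + η j / 2) (fun j => ζ j - η j / 2))‖ ≤ 2 :=
    norm_integral_le_of_norm_le _ fun x =>
      ((isStateFamily_run _ _).isState x).norm_secondMoment_le _ _ _
  rw [h, Complex.norm_real] at hb
  exact hb

end Formal

/-! ### From overlaps to second moments -/

section GaussianIntegrals

variable {M : ℕ}

theorem integral_exp_neg_mul_norm_sq_complex {a : ℝ} (ha : 0 < a) :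
    ∫ z : ℂ, Real.exp (-a * ‖z‖ ^ 2) = Real.pi / a := by
  have h := GaussianFourier.integral_rexp_neg_mul_sq_norm (V := ℂ) ha
  rw [h]
  simp

/-- The integral of a nonintegrable function is zero by convention, and this one is positive. -/
theorem integrable_exp_neg_mul_norm_sq_complex {a : ℝ} (ha : 0 < a) :
    Integrable fun z : ℂ => Real.exp (-a * ‖z‖ ^ 2) := by
  by_contra h
  have h1 := integral_undef h
  rw [integral_exp_neg_mul_norm_sq_complex ha] at h1
  have : 0 < Real.pi / a := by positivity
  linarith

theorem integral_prod_exp {a : Fin M → ℝ} (ha : ∀ j, 0 < a j) :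
    ∫ z : Fin M → ℂ, ∏ j, Real.exp (-a j * ‖z j‖ ^ 2) = ∏ j, Real.pi / a j := by
  rw [integral_fintype_prod_volume_eq_prod (fun j (z : ℂ) => Real.exp (-a j * ‖z‖ ^ 2))]
  exact Finset.prod_congr rfl fun j _ => integral_exp_neg_mul_norm_sq_complex (ha j)

theorem integrable_prod_exp {a : Fin M → ℝ} (ha : ∀ j, 0 < a j) :
    Integrable fun z : Fin M → ℂ => ∏ j, Real.exp (-a j * ‖z j‖ ^ 2) :=
  Integrable.fintype_prod fun j => integrable_exp_neg_mul_norm_sq_complex (ha j)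

theorem exp_neg_mul_normSqSum (a : ℝ) (z : Fin M → ℂ) :
    Real.exp (-a * normSqSum z) = ∏ j, Real.exp (-a * ‖z j‖ ^ 2) := by
  rw [← Real.exp_sum, normSqSum, Finset.mul_sum]

theorem integrable_exp_neg_mul_normSqSum {a : ℝ} (ha : 0 < a) :
    Integrable fun z : Fin M → ℂ => Real.exp (-a * normSqSum z) := by
  simp_rw [exp_neg_mul_normSqSum]
  exact integrable_prod_exp fun _ => ha

theorem integral_exp_neg_mul_normSqSum {a : ℝ} (ha : 0 < a) :
    ∫ z : Fin M → ℂ, Real.exp (-a * normSqSum z) = (Real.pi / a) ^ M := by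
  simp_rw [exp_neg_mul_normSqSum]
  rw [integral_prod_exp fun _ => ha]
  simp [div_pow]

end GaussianIntegrals

/-! ### Husimi amplitudes and the resolution of the identity -/

section Overlap

variable {M : ℕ}

/-- The overlap of `f` with the coherent state of amplitude `z`. -/
def husimi (f : Wave M) (z : Fin M → ℂ) : ℂ := braket (displace z (vacuum M)) f

theorem norm_husimi_le_one {Ψ : QWave M} (h : IsState Ψ) (a : Fin 2) (z : Fin M → ℂ) :
    ‖husimi (Ψ a) z‖ ≤ 1 := by
  have h1 := norm_braket_sq_le (MemLp.displace memLp_vacuum z) (h.memLp a)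
  have h2 : braket (displace z (vacuum M)) (displace z (vacuum M)) = 1 := by
    have := braket_coherent_self z 0
    rw [displace_zero] at this
    rw [this]; simp [sympl, normSqSum]
  rw [h2] at h1
  have h3 := h.braket_le_one a
  have h5 : ‖husimi (Ψ a) z‖ ^ 2 ≤ 1 := by
    refine h1.trans ?_
    simpa using h3
  exact (sq_le_one_iff₀ (norm_nonneg _)).1 h5

theorem continuous_husimi {Y : Type} [TopologicalSpace Y] {F : Y → Wave M}
    (hF : IsCoherentFamily F) :
    Continuous fun p : Y × (Fin M → ℂ) => husimi (F p.1) p.2 :=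
  (isCoherentFamily_vacuum.displace continuous_snd).continuous_braket (hF.comp continuous_fst)

theorem continuous_husimi_right {Y : Type} [TopologicalSpace Y] {F : Y → Wave M}
    (hF : IsCoherentFamily F) (y : Y) : Continuous (husimi (F y)) :=
  (isCoherentFamily_vacuum.displace continuous_id).continuous_braket
    (hF.comp (continuous_const (y := y)))

/-- Moyal's identity against the vacuum is the resolution of the identity on coherent states; it
extends by linearity to their finite superpositions. -/
theorem integral_resolution {Y : Type} [TopologicalSpace Y] {ψ : Wave M}
    (hψ : MemLp ψ 2 volume) (hint : Integrable fun z => braket ψ (displace z (vacuum M)))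
    {F : Y → Wave M} (hF : IsCoherentFamily F) (y : Y) :
    ∫ z, braket ψ (displace z (vacuum M)) * husimi (F y) z = (Real.pi : ℂ) ^ M * braket ψ (F y) := by
  obtain ⟨κ, _, c, α, -, -, h⟩ := hF
  have hm : ∀ a, MemLp (displace a (vacuum M)) 2 volume := fun a => MemLp.displace memLp_vacuum a
  have key : ∀ a, ∫ z, braket ψ (displace z (vacuum M)) * husimi (displace a (vacuum M)) z =
      (Real.pi : ℂ) ^ M * braket ψ (displace a (vacuum M)) := by
    intro a
    have := integral_moyal hψ memLp_vacuum a 0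
    rw [displace_zero, braket_vacuum_vacuum, mul_one] at this
    simp_rw [braket_conj_symm] at this
    exact this
  have hi : ∀ a, Integrable fun z => braket ψ (displace z (vacuum M)) *
      husimi (displace a (vacuum M)) z := by
    intro a
    refine hint.mul_bdd (c := 1) (Continuous.aestronglyMeasurable ?_)
      (Filter.Eventually.of_forall fun z => ?_)
    · exact (isCoherentFamily_vacuum.displace continuous_id).continuous_braket
        (isCoherentFamily_vacuum.displace continuous_const)
    · rw [husimi]
      have h0 := braket_coherent z 0 a
      rw [displace_zero] at h0
      rw [h0, norm_mul, mul_comm Complex.I, Complex.norm_exp_ofReal_mul_I, one_mul,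
        Complex.norm_real, Real.norm_of_nonneg (Real.exp_nonneg _), Real.exp_le_one_iff]
      have := normSqSum_nonneg (0 + a - z)
      linarith
  rw [h y, braket_sum_right _ _ hψ fun i _ => hm _, Finset.mul_sum]
  have e : ∀ z, braket ψ (displace z (vacuum M)) *
      husimi (fun q => ∑ i, c i y * displace (α i y) (vacuum M) q) z =
      ∑ i, c i y * (braket ψ (displace z (vacuum M)) * husimi (displace (α i y) (vacuum M)) z) := by
    intro z
    rw [husimi, braket_sum_right _ _ (hm z) fun i _ => hm _, Finset.mul_sum]
    exact Finset.sum_congr rfl fun i _ => by rw [husimi]; ring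
  simp_rw [e]
  rw [integral_finsetSum _ fun i _ => (hi _).const_mul _]
  refine Finset.sum_congr rfl fun i _ => ?_
  rw [integral_const_mul, key]
  ring

/-- Jensen's inequality for the fourth power and a weight of finite mass. -/
theorem pow_four_integral_le {Z : Type*} [MeasurableSpace Z] {μ : Measure Z} {k y : Z → ℝ}
    (hk : Integrable k μ) (hk0 : ∀ z, 0 ≤ k z) (hpos : 0 < ∫ z, k z ∂μ)
    (h1 : Integrable (fun z => k z * y z) μ) (h4 : Integrable (fun z => k z * y z ^ 4) μ) :
    (∫ z, k z * y z ∂μ) ^ 4 ≤ (∫ z, k z ∂μ) ^ 3 * ∫ z, k z * y z ^ 4 ∂μ := by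
  set κ := ∫ z, k z ∂μ
  set I := ∫ z, k z * y z ∂μ
  set t := I / κ
  -- The fourth power lies above its tangent at the mean `t`: the difference is `(y - t)² ((y + t)²
  -- + 2t²)`.
  have h : 0 ≤ ∫ z, (k z * y z ^ 4 - 4 * t ^ 3 * (k z * y z) + 3 * t ^ 4 * k z) ∂μ := by
    refine integral_nonneg fun z => ?_
    have : k z * y z ^ 4 - 4 * t ^ 3 * (k z * y z) + 3 * t ^ 4 * k z =
        k z * ((y z - t) ^ 2 * ((y z + t) ^ 2 + 2 * t ^ 2)) := by ring
    simp only [Pi.zero_apply, this]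
    exact mul_nonneg (hk0 z) (by positivity)
  rw [integral_add (f := fun z => k z * y z ^ 4 - 4 * t ^ 3 * (k z * y z))
    (h4.sub (h1.const_mul _)) (hk.const_mul _), integral_sub h4 (h1.const_mul _),
    integral_const_mul, integral_const_mul] at h
  have hI : I = t * κ := by simp only [t]; field_simp
  change 0 ≤ _ - 4 * t ^ 3 * I + 3 * t ^ 4 * κ at h
  have h' := mul_le_mul_of_nonneg_left h (by positivity : 0 ≤ κ ^ 3)
  rw [hI] at h' ⊢
  nlinarith

theorem IsPureGaussian.exists_overlap_le {ψ : Wave M} (hψ : IsPureGaussian ψ) :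
    ∃ k : (Fin M → ℂ) → ℝ, Continuous k ∧ Integrable k ∧ (∀ z, 0 ≤ k z) ∧ 0 < ∫ z, k z ∧
      ∀ z, ‖braket ψ (displace z (vacuum M))‖ ≤ k z := by
  obtain ⟨_, K, a, _, _, hK, ha, _, hb⟩ := hψ.overlap_bounds
  refine ⟨fun z => √K * Real.exp (-(a / 2) * normSqSum z), by fun_prop,
    (integrable_exp_neg_mul_normSqSum (by positivity)).const_mul _, fun z => by positivity, ?_,
    fun z => ?_⟩
  · rw [integral_const_mul, integral_exp_neg_mul_normSqSum (by positivity)]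
    positivity
  · refine (pow_le_pow_iff_left₀ (norm_nonneg _) (by positivity) two_ne_zero).1
      ((hb z).2.trans_eq ?_)
    rw [mul_pow, Real.sq_sqrt hK.le, ← Real.exp_nat_mul]
    congr 2; push_cast; ring

theorem integrable_mul_husimi_pow {k : (Fin M → ℂ) → ℝ} (hk : Integrable k) {Ψ : QWave M}
    (hΨ : IsState Ψ) (hc : Continuous (husimi (Ψ 0))) (n : ℕ) :
    Integrable fun z => k z * ‖husimi (Ψ 0) z‖ ^ n := by
  refine hk.mul_bdd (c := 1) (Continuous.aestronglyMeasurable (by fun_prop))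
    (Filter.Eventually.of_forall fun z => ?_)
  rw [norm_pow, norm_norm]
  exact pow_le_one₀ (norm_nonneg _) (norm_husimi_le_one hΨ 0 z)

/-- Inserting the resolution of the identity and bounding the overlaps of `ψ` with coherent states
by `k`, Jensen's inequality trades `ψ` for a superposition of coherent states with weights
independent of the circuit. -/
theorem norm_braket_pow_four_le {ψ : Wave M} (hψ : MemLp ψ 2 volume) {k : (Fin M → ℂ) → ℝ}
    (hk : Integrable k) (hk0 : ∀ z, 0 ≤ k z) (hpos : 0 < ∫ z, k z)
    (hkb : ∀ z, ‖braket ψ (displace z (vacuum M))‖ ≤ k z)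
    {Y : Type} [TopologicalSpace Y] {Ψ : Y → QWave M} (hΨ : IsStateFamily Ψ) (y : Y) :
    (Real.pi ^ M * ‖braket ψ (Ψ y 0)‖) ^ 4 ≤
      (∫ z, k z) ^ 3 * ∫ z, k z * ‖husimi (Ψ y 0) z‖ ^ 4 := by
  have hint : Integrable fun z => braket ψ (displace z (vacuum M)) :=
    hk.mono' (continuous_braket_displace_vacuum hψ).aestronglyMeasurable
      (Filter.Eventually.of_forall hkb)
  have hp := integrable_mul_husimi_pow hk (hΨ.isState y)
    (continuous_husimi_right (hΨ.coherent 0) y)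
  have hp1 : Integrable fun z => k z * ‖husimi (Ψ y 0) z‖ := by simpa only [pow_one] using hp 1
  have h2 : ‖∫ z, braket ψ (displace z (vacuum M)) * husimi (Ψ y 0) z‖ ≤
      ∫ z, k z * ‖husimi (Ψ y 0) z‖ := by
    refine MeasureTheory.norm_integral_le_of_norm_le hp1 (Filter.Eventually.of_forall fun z => ?_)
    rw [norm_mul]
    exact mul_le_mul_of_nonneg_right (hkb z) (norm_nonneg _)
  rw [integral_resolution hψ hint (hΨ.coherent 0) y, norm_mul, norm_pow, Complex.norm_real,
    Real.norm_of_nonneg Real.pi_pos.le] at h2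
  exact (pow_le_pow_left₀ (by positivity) h2 4).trans
    (pow_four_integral_le hk hk0 hpos hp1 (hp 4))

end Overlap

/-! ### The mean squared cost in terms of second moments of the characteristic function -/

section SecondMomentBound

variable {M : ℕ}

/-- The characteristic function of the coherent state of amplitude `z`. -/
def coherentChar (z y : Fin M → ℂ) : ℂ :=
  Complex.exp (Complex.I * ((2 * sympl y z : ℝ) : ℂ)) * Real.exp (-normSqSum y / 2)

theorem norm_coherentChar (z y : Fin M → ℂ) :
    ‖coherentChar z y‖ = Real.exp (-(1 / 2) * normSqSum y) := by
  rw [coherentChar, norm_mul, mul_comm Complex.I, Complex.norm_exp_ofReal_mul_I, one_mul,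
    Complex.norm_real, Real.norm_of_nonneg (Real.exp_nonneg _)]
  congr 1; ring

theorem continuous_coherentChar (z : Fin M → ℂ) : Continuous (coherentChar z) := by
  unfold coherentChar; fun_prop

/-- By Moyal's identity the squared Husimi amplitude is linear in the characteristic function; its
square is then a quadratic form of the kind that obeys the recursion. -/
theorem integral_charFn_coherentChar {Ψ : QWave M} (h : IsState Ψ) (a : Fin 2) (z : Fin M → ℂ) :
    ∫ y, charFn Ψ a a y * conj (coherentChar z y) =
      ((Real.pi ^ M * ‖husimi (Ψ a) z‖ ^ 2 : ℝ) : ℂ) := by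
  have h1 := integral_moyal (h.memLp a) (h.memLp a) z z
  simp_rw [braket_coherent_self] at h1
  refine Eq.trans h1 ?_
  rw [← braket_conj_symm, ← husimi, mul_comm (conj _), Complex.mul_conj, Complex.normSq_eq_norm_sq]
  push_cast
  rfl

/-- The weight with which second moments enter a Husimi function squared. -/
def pairWeight (z : Fin M → ℂ) (p : (Fin M → ℂ) × (Fin M → ℂ)) : ℂ :=
  conj (coherentChar z p.1) * coherentChar z p.2

theorem continuous_pairWeight (z : Fin M → ℂ) : Continuous (pairWeight z) := by
  have := continuous_coherentChar z
  unfold pairWeight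
  exact (Complex.continuous_conj.comp (this.comp continuous_fst)).mul (this.comp continuous_snd)

theorem integrable_pairWeight (z : Fin M → ℂ) : Integrable (pairWeight z) := by
  have h : Integrable fun y : Fin M → ℂ => Real.exp (-(1 / 2) * normSqSum y) :=
    integrable_exp_neg_mul_normSqSum (by norm_num)
  refine (h.mul_prod h).mono' (continuous_pairWeight z).aestronglyMeasurable
    (Filter.Eventually.of_forall fun p => ?_)
  rw [pairWeight, norm_mul, RCLike.norm_conj, norm_coherentChar, norm_coherentChar]

variable {Y : Type} [TopologicalSpace Y] {Ψ : Y → QWave M}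

theorem continuous_secondMoment_zero (hΨ : IsStateFamily Ψ) :
    Continuous fun p : Y × (Fin M → ℂ) × (Fin M → ℂ) => secondMoment 0 p.2.1 p.2.2 (Ψ p.1) := by
  have hc : ∀ a, Continuous fun p : Y × (Fin M → ℂ) => charFn (Ψ p.1) a a p.2 := fun a =>
    (hΨ.comp continuous_fst).continuous_charFn a a continuous_snd
  have h1 : ∀ a, Continuous fun p : Y × (Fin M → ℂ) × (Fin M → ℂ) =>
      charFn (Ψ p.1) a a p.2.1 := fun a =>
    (hc a).comp (g := fun p : Y × (Fin M → ℂ) => charFn (Ψ p.1) a a p.2)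
      (f := fun p : Y × (Fin M → ℂ) × (Fin M → ℂ) => (p.1, p.2.1)) (by fun_prop)
  have h2 : ∀ a, Continuous fun p : Y × (Fin M → ℂ) × (Fin M → ℂ) =>
      conj (charFn (Ψ p.1) a a p.2.2) := fun a => Complex.continuous_conj.comp <|
    (hc a).comp (g := fun p : Y × (Fin M → ℂ) => charFn (Ψ p.1) a a p.2)
      (f := fun p : Y × (Fin M → ℂ) × (Fin M → ℂ) => (p.1, p.2.2)) (by fun_prop)
  exact ((h1 0).mul (h2 0)).add ((h1 1).mul (h2 1))

/-- Only the sum over both qubit components is the form `secondMoment 0`; the contribution of `|1⟩`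
is nonnegative and is discarded when an upper bound for `|0⟩` is sought. -/
theorem sum_husimi_pow_four (hΨ : IsStateFamily Ψ) (y : Y) (z : Fin M → ℂ) :
    (((Real.pi ^ M) ^ 2 * (‖husimi (Ψ y 0) z‖ ^ 4 + ‖husimi (Ψ y 1) z‖ ^ 4) : ℝ) : ℂ) =
      ∫ p, secondMoment 0 p.1 p.2 (Ψ y) * pairWeight z p := by
  have hst := hΨ.isState y
  have h : ∀ a, ((((Real.pi ^ M) ^ 2 * ‖husimi (Ψ y a) z‖ ^ 4 : ℝ)) : ℂ) =
      ∫ p : (Fin M → ℂ) × (Fin M → ℂ), (charFn (Ψ y) a a p.1 * conj (coherentChar z p.1)) *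
        conj (charFn (Ψ y) a a p.2 * conj (coherentChar z p.2)) := by
    intro a
    rw [Measure.volume_eq_prod, integral_prod_mul (μ := volume) (ν := volume)
      (fun p => charFn (Ψ y) a a p * conj (coherentChar z p))
      (fun p => conj (charFn (Ψ y) a a p * conj (coherentChar z p))), integral_conj,
      integral_charFn_coherentChar hst, Complex.conj_ofReal, ← Complex.ofReal_mul]
    congr 1; ring
  have hint : ∀ a, Integrable fun p : (Fin M → ℂ) × (Fin M → ℂ) =>
      (charFn (Ψ y) a a p.1 * conj (coherentChar z p.1)) *
        conj (charFn (Ψ y) a a p.2 * conj (coherentChar z p.2)) := by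
    intro a
    have hc : Continuous fun p => charFn (Ψ y) a a p :=
      (hΨ.comp (continuous_const (y := y))).continuous_charFn a a continuous_id
    have hw := continuous_coherentChar z
    have h0 : Integrable fun p => charFn (Ψ y) a a p * conj (coherentChar z p) := by
      have hg : Integrable fun y : Fin M → ℂ => Real.exp (-(1 / 2) * normSqSum y) :=
        integrable_exp_neg_mul_normSqSum (by norm_num)
      refine hg.mono' (hc.mul (Complex.continuous_conj.comp hw)).aestronglyMeasurable
        (Filter.Eventually.of_forall fun p => ?_)
      rw [norm_mul, RCLike.norm_conj, norm_coherentChar]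
      exact mul_le_of_le_one_left (Real.exp_nonneg _) (hst.norm_charFn_le _ _ _)
    have h1 : Integrable fun p => conj (charFn (Ψ y) a a p * conj (coherentChar z p)) := by
      refine (h0.norm).mono' ?_ (Filter.Eventually.of_forall fun p => ?_)
      · exact (Complex.continuous_conj.comp
          (hc.mul (Complex.continuous_conj.comp hw))).aestronglyMeasurable
      · rw [RCLike.norm_conj]
    exact h0.mul_prod h1
  rw [mul_add, Complex.ofReal_add, h 0, h 1, ← integral_add (hint 0) (hint 1)]
  congr 1; funext p
  simp only [secondMoment, pairWeight, map_mul, Complex.conj_conj, Matrix.cons_val_zero]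
  ring

/-- Half-sum and difference coordinates preserve the volume. -/
theorem measurePreserving_halfSum :
    MeasurePreserving (fun p : (Fin M → ℂ) × (Fin M → ℂ) =>
      (p.2 + (1 / 2 : ℂ) • p.1, p.2 - (1 / 2 : ℂ) • p.1)) volume volume := by
  have h1 : MeasurePreserving (fun p : (Fin M → ℂ) × (Fin M → ℂ) =>
      (p.1, p.2 - (1 / 2 : ℂ) • p.1)) (volume.prod volume) (volume.prod volume) :=
    (MeasurePreserving.id volume).skew_product (g := fun x y : Fin M → ℂ => y - (1 / 2 : ℂ) • x)
      (by fun_prop)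
      (Filter.Eventually.of_forall fun x =>
        (measurePreserving_sub_right (volume : Measure (Fin M → ℂ)) _).map_eq)
  have h2 := (measurePreserving_add_prod volume volume).comp h1
  have e : (fun p : (Fin M → ℂ) × (Fin M → ℂ) =>
      (p.2 + (1 / 2 : ℂ) • p.1, p.2 - (1 / 2 : ℂ) • p.1)) =
      (fun z : (Fin M → ℂ) × (Fin M → ℂ) => (z.1 + z.2, z.2)) ∘
        fun p => (p.1, p.2 - (1 / 2 : ℂ) • p.1) := by
    funext p
    refine Prod.ext (funext fun j => ?_) rfl
    simp
    ring
  rw [e]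
  exact h2

/-- In centre and difference coordinates the amplitude `z` enters through a phase only, and the rest
is the initial Gaussian of the evolution. Bounds on correlations with the initial triple are
therefore uniform in `z`. -/
theorem pairWeight_halfSum (z η ζ : Fin M → ℂ) :
    pairWeight z (ζ + (1 / 2 : ℂ) • η, ζ - (1 / 2 : ℂ) • η) =
      Complex.exp (-(Complex.I * ((2 * sympl η z : ℝ) : ℂ))) * (ev ζ (initial η 0) : ℝ) := by
  have h1 : ev ζ (initial η 0) = Real.exp (-normSqSum η / 4 - normSqSum ζ) := by
    have e3 : gauss 0 ζ = Real.exp (-normSqSum ζ) := by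
      simp only [gauss, gaussFactor, normSqSum, ← Finset.sum_neg_distrib, Real.exp_sum]
      simp
    rw [initial, Matrix.cons_val_zero, ev_single, e3, ← Real.exp_add]
    congr 1
  have h2 : normSqSum (ζ + (1 / 2 : ℂ) • η) + normSqSum (ζ - (1 / 2 : ℂ) • η) =
      2 * normSqSum ζ + normSqSum η / 2 := by
    simp only [normSqSum_eq, Finset.mul_sum, Finset.sum_div, ← Finset.sum_add_distrib]
    refine Finset.sum_congr rfl fun j _ => ?_
    simp
    ring
  have h3 : sympl (ζ + (1 / 2 : ℂ) • η) z - sympl (ζ - (1 / 2 : ℂ) • η) z = sympl η z := by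
    simp only [sympl, ← Finset.sum_sub_distrib]
    refine Finset.sum_congr rfl fun j _ => ?_
    simp
    ring
  rw [h1]
  have h4 : ∀ y : Fin M → ℂ, conj (coherentChar z y) =
      Complex.exp (-(Complex.I * ((2 * sympl y z : ℝ) : ℂ))) * Real.exp (-normSqSum y / 2) := by
    intro y
    rw [coherentChar, map_mul, ← Complex.exp_conj, map_mul, Complex.conj_I, Complex.conj_ofReal,
      Complex.conj_ofReal, neg_mul]
  simp only [pairWeight, h4]
  simp only [coherentChar, Complex.ofReal_exp, ← Complex.exp_add]
  congr 1
  have h2' := congrArg (Complex.ofReal) h2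
  have h3' := congrArg (Complex.ofReal) h3
  push_cast at h2' h3' ⊢
  linear_combination (-1 / 2 : ℂ) * h2' - 2 * Complex.I * h3'

variable {ι : Type} [Fintype ι] [DecidableEq ι]

theorem integral_average_pairWeight {v : ℝ≥0} (hv : 0 < v) (m : ι → Fin M) (l : List ι)
    (hl : l.Nodup) (z : Fin M → ℂ) {H : (Fin M → ℂ) × (Fin M → ℂ) → ℂ}
    (hH : ∀ p, H p = average v m l (secondMoment 0 p.1 p.2) * pairWeight z p)
    (hHi : Integrable H) :
    ∫ p, H p = ∫ η, Complex.exp (-(Complex.I * ((2 * sympl η z : ℝ) : ℂ))) *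
      ((∫ ζ, ev ζ (initial η 0) * ev ζ (evolve v η (l.map m) (initial η) 0) : ℝ) : ℂ) := by
  have hT := measurePreserving_halfSum (M := M)
  have hi := hT.integrable_comp_of_integrable hHi
  have e : ∫ p, H p = ∫ p, H ((p : (Fin M → ℂ) × (Fin M → ℂ)).2 + (1 / 2 : ℂ) • p.1,
      p.2 - (1 / 2 : ℂ) • p.1) := by
    have h := integral_map (μ := volume) hT.measurable.aemeasurable (f := H)
      (by rw [hT.map_eq]; exact hHi.aestronglyMeasurable)
    rw [hT.map_eq] at h
    exact h
  rw [e, Measure.volume_eq_prod, integral_prod (fun p : (Fin M → ℂ) × (Fin M → ℂ) =>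
    H (p.2 + (1 / 2 : ℂ) • p.1, p.2 - (1 / 2 : ℂ) • p.1)) hi]
  congr 1; funext η
  rw [← integral_complex_ofReal, ← integral_const_mul]
  congr 1; funext ζ
  simp only []
  rw [hH, pairWeight_halfSum, average_secondMoment hv m l hl η 0 ζ]
  · push_cast; ring
  · simp
  · rw [add_sub_sub_cancel, ← add_smul]
    norm_num

theorem average_husimi_le {v : ℝ≥0} (hv : 0 < v) (m : ι → Fin M) (l : List ι) (hl : l.Nodup)
    {B : (Fin M → ℂ) → ℝ} (hB : Integrable B)
    (h : ∀ η, |∫ ζ, ev ζ (initial η 0) * ev ζ (evolve v η (l.map m) (initial η) 0)| ≤ B η)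
    (z : Fin M → ℂ) :
    (Real.pi ^ M) ^ 2 * average v m l (fun Ψ => ‖husimi (Ψ 0) z‖ ^ 4) ≤ ∫ η, B η := by
  set μ : Measure (ι → ℝ × ℝ × ℂ) := Measure.pi fun _ : ι => paramMeasure v
  have hfam := isStateFamily_run (M := M) m l
  have hint : Integrable (fun q : (ι → ℝ × ℝ × ℂ) × (Fin M → ℂ) × (Fin M → ℂ) =>
      secondMoment 0 q.2.1 q.2.2 (run m l q.1) * pairWeight z q.2) (μ.prod volume) := by
    refine ((integrable_pairWeight z).comp_snd μ).bdd_mul (c := 2)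
      (continuous_secondMoment_zero hfam).aestronglyMeasurable
      (Filter.Eventually.of_forall fun q => (hfam.isState q.1).norm_secondMoment_le _ _ _)
  have h1 : (((Real.pi ^ M) ^ 2 * ∫ x, (‖husimi (run m l x 0) z‖ ^ 4 +
      ‖husimi (run m l x 1) z‖ ^ 4) ∂μ : ℝ) : ℂ) =
      ∫ p, ∫ x, secondMoment 0 p.1 p.2 (run m l x) * pairWeight z p ∂μ := by
    rw [← integral_integral_swap hint, ← integral_const_mul, ← integral_complex_ofReal]
    congr 1; funext x
    exact sum_husimi_pow_four hfam x z
  have h2 := integral_average_pairWeight hv m l hl z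
    (H := fun p => ∫ x, secondMoment 0 p.1 p.2 (run m l x) * pairWeight z p ∂μ)
    (fun p => by rw [integral_mul_const]; rfl) hint.integral_prod_right
  rw [← h1] at h2
  have h3 : ‖∫ η, Complex.exp (-(Complex.I * ((2 * sympl η z : ℝ) : ℂ))) *
      ((∫ ζ, ev ζ (initial η 0) * ev ζ (evolve v η (l.map m) (initial η) 0) : ℝ) : ℂ)‖ ≤
      ∫ η, B η := by
    refine MeasureTheory.norm_integral_le_of_norm_le hB (Filter.Eventually.of_forall fun η => ?_)
    rw [norm_mul, ← mul_neg, ← Complex.ofReal_neg, mul_comm Complex.I,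
      Complex.norm_exp_ofReal_mul_I, one_mul, Complex.norm_real]
    exact h η
  rw [← h2, Complex.norm_real] at h3
  have hi : ∀ a, Integrable (fun x => ‖husimi (run m l x a) z‖ ^ 4) μ := by
    intro a
    have hc : Continuous fun x => husimi (run m l x a) z :=
      (isCoherentFamily_vacuum.displace (continuous_const (y := z))).continuous_braket
        (hfam.coherent a)
    refine Integrable.of_bound (Continuous.aestronglyMeasurable (by fun_prop)) 1
      (Filter.Eventually.of_forall fun x => ?_)
    rw [norm_pow, norm_norm]
    exact pow_le_one₀ (norm_nonneg _) (norm_husimi_le_one (hfam.isState x) a z)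
  refine (mul_le_mul_of_nonneg_left ?_ (by positivity)).trans ((le_abs_self _).trans h3)
  exact integral_mono (hi 0) ((hi 0).add (hi 1)) fun x => le_add_of_nonneg_right (by positivity)

/-- The mean squared overlap is bounded by an integral of correlations of the formal evolution. -/
theorem IsPureGaussian.average_overlap_le {ψ : Wave M} (hψ : IsPureGaussian ψ) :
    ∃ C : ℝ, 0 < C ∧ ∀ {ι : Type} [Fintype ι] [DecidableEq ι] {v : ℝ≥0}, 0 < v →
      ∀ (m : ι → Fin M) (l : List ι), l.Nodup → ∀ {B : (Fin M → ℂ) → ℝ}, Integrable B →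
      (∀ η, |∫ ζ, ev ζ (initial η 0) * ev ζ (evolve v η (l.map m) (initial η) 0)| ≤ B η) →
      average v m l (fun Ψ => ‖braket ψ (Ψ 0)‖ ^ 4) ≤ C * ∫ η, B η := by
  obtain ⟨k, hkc, hk, hk0, hpos, hkb⟩ := hψ.exists_overlap_le
  have hπ : (0 : ℝ) < Real.pi ^ M := by positivity
  -- Four powers of `π^M` come from the resolution of the identity and two from the fourth power of
  -- the Husimi amplitude. The mass of `k` occurs three times in Jensen's inequality and once more
  -- in the final integration over `z`.
  refine ⟨(∫ z, k z) ^ 4 / (Real.pi ^ M) ^ 6, by positivity,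
    fun {ι _ _ v} hv m l hl {B} hB h => ?_⟩
  set μ : Measure (ι → ℝ × ℝ × ℂ) := Measure.pi fun _ : ι => paramMeasure v
  have hfam := isStateFamily_run (M := M) m l
  have hint : Integrable (fun q : (ι → ℝ × ℝ × ℂ) × (Fin M → ℂ) =>
      k q.2 * ‖husimi (run m l q.1 0) q.2‖ ^ 4) (μ.prod volume) := by
    have hc := continuous_husimi (hfam.coherent 0)
    refine (hk.comp_snd μ).mul_bdd (c := 1) (Continuous.aestronglyMeasurable (by fun_prop))
      (Filter.Eventually.of_forall fun q => ?_)
    rw [norm_pow, norm_norm]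
    exact pow_le_one₀ (norm_nonneg _) (norm_husimi_le_one (hfam.isState q.1) 0 _)
  have h1 : (Real.pi ^ M) ^ 4 * average v m l (fun Ψ => ‖braket ψ (Ψ 0)‖ ^ 4) ≤
      (∫ z, k z) ^ 3 * ∫ z, k z * average v m l (fun Ψ => ‖husimi (Ψ 0) z‖ ^ 4) := by
    have e : ∫ z, k z * average v m l (fun Ψ => ‖husimi (Ψ 0) z‖ ^ 4) =
        ∫ x, (∫ z, k z * ‖husimi (run m l x 0) z‖ ^ 4) ∂μ := by
      rw [integral_integral_swap hint]
      congr 1; funext z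
      rw [integral_const_mul]; rfl
    rw [e, average, ← integral_const_mul, ← integral_const_mul]
    refine integral_mono_of_nonneg (Filter.Eventually.of_forall fun x => by positivity)
      (hint.integral_prod_left.const_mul _) (Filter.Eventually.of_forall fun x => ?_)
    simp only []
    rw [← mul_pow]
    exact norm_braket_pow_four_le hψ.1 hk hk0 hpos hkb hfam x
  have h2 : ∫ z, k z * average v m l (fun Ψ => ‖husimi (Ψ 0) z‖ ^ 4) ≤
      (∫ z, k z) * ((∫ η, B η) / (Real.pi ^ M) ^ 2) := by
    rw [← integral_mul_const]
    refine integral_mono_of_nonneg (Filter.Eventually.of_forall fun z => ?_)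
      (hk.mul_const _) (Filter.Eventually.of_forall fun z => ?_)
    · exact mul_nonneg (hk0 z) (integral_nonneg fun x => by positivity)
    · refine mul_le_mul_of_nonneg_left ?_ (hk0 z)
      rw [le_div_iff₀' (by positivity)]
      exact average_husimi_le hv m l hl hB h z
  have h3 := h1.trans (mul_le_mul_of_nonneg_left h2 (by positivity))
  rw [div_mul_eq_mul_div, le_div_iff₀ (by positivity)]
  have h4 := mul_le_mul_of_nonneg_right h3 (by positivity : 0 ≤ (Real.pi ^ M) ^ 2)
  have e : (∫ z, k z) ^ 3 * ((∫ z, k z) * ((∫ η, B η) / (Real.pi ^ M) ^ 2)) * (Real.pi ^ M) ^ 2 =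
      (∫ z, k z) ^ 4 * ∫ η, B η := by
    field_simp
  rw [e] at h4
  refine Eq.trans_le ?_ h4
  ring

end SecondMomentBound

/-! ### Expansion of the formal evolution into words -/

/-- Extension of a word by a letter. -/
def consEmbedding : Fin 3 × List (Fin 3) ↪ List (Fin 3) where
  toFun p := p.1 :: p.2
  inj' _ _ h := Prod.ext (List.cons.inj h).1 (List.cons.inj h).2

/-- The words of length `n` in the letters `0, 1, 2`. -/
def words : ℕ → Finset (List (Fin 3))
  | 0 => {[]}
  | n + 1 => (Finset.univ ×ˢ words n).map consEmbedding

theorem sum_words_succ {E : Type*} [AddCommMonoid E] (n : ℕ) (f : List (Fin 3) → E) :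
    ∑ w ∈ words (n + 1), f w = ∑ c, ∑ w ∈ words n, f (c :: w) := by
  rw [words, Finset.sum_map, Finset.sum_product]
  rfl

theorem length_of_mem_words {n : ℕ} {w : List (Fin 3)} (hw : w ∈ words n) : w.length = n := by
  induction n generalizing w with
  | zero => simp [words] at hw; simp [hw]
  | succ n ih =>
    simp only [words, Finset.mem_map, Finset.mem_product, Finset.mem_univ, true_and,
      Prod.exists] at hw
    obtain ⟨c, u, hu, rfl⟩ := hw
    change (c :: u).length = n + 1
    simp [ih hu]

variable {M : ℕ}

/-- The damping of the component `c` in a block on mode `j`. -/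
def dampMap (v : ℝ≥0) (η : Fin M → ℂ) (j : Fin M) : Fin 3 → GSpace M →ₗ[ℝ] GSpace M :=
  ![Real.exp (-v * ‖η j‖ ^ 2) • LinearMap.id, mult v j, conv v j]

theorem damp_apply (v : ℝ≥0) (η : Fin M → ℂ) (j : Fin M) (F : Fin 3 → GSpace M) (c : Fin 3) :
    damp v η j F c = dampMap v η j c (F c) := by
  fin_cases c <;> rfl

/-- The coefficient of a word, the letter of the last block first. -/
def wordCoeff : List (Fin 3) → ℝ
  | [] => 1
  | c :: w => rotationMatrix c (w.headD 0) * wordCoeff w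

/-- The Gaussian to which a word leads. -/
def wordIdx (v : ℝ≥0) : List (Fin M) → List (Fin 3) → GIdx M
  | j :: l, c :: w => ![id, multIdx v j, convIdx v j] c (wordIdx v l w)
  | _, _ => 0

/-- The number of blocks on mode `j` with letter `c`. -/
def wordCount (l : List (Fin M)) (w : List (Fin 3)) (j : Fin M) (c : Fin 3) : ℕ :=
  (l.zip w).count (j, c)

/-- The contribution of a word. -/
def wordTerm (v : ℝ≥0) (η : Fin M → ℂ) (l : List (Fin M)) (w : List (Fin 3)) : GSpace M :=
  Finsupp.single (wordIdx v l w) (wordCoeff w *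
    Real.exp (-normSqSum η / 4 - v * ∑ j, wordCount l w j 0 * ‖η j‖ ^ 2))

theorem wordCount_cons (k : Fin M) (l : List (Fin M)) (d : Fin 3) (w : List (Fin 3)) (j : Fin M)
    (c : Fin 3) : wordCount (k :: l) (d :: w) j c =
      wordCount l w j c + if k = j ∧ d = c then 1 else 0 := by
  rw [wordCount, List.zip_cons_cons, List.count_cons, wordCount]
  congr 1
  simp

theorem wordTerm_cons (v : ℝ≥0) (η : Fin M → ℂ) (j : Fin M) (l : List (Fin M)) (c : Fin 3)
    (w : List (Fin 3)) : wordTerm v η (j :: l) (c :: w) =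
      dampMap v η j c (rotationMatrix c (w.headD 0) • wordTerm v η l w) := by
  have hcount : ∀ c, ∑ k, (wordCount (j :: l) (c :: w) k 0 : ℝ) * ‖η k‖ ^ 2 =
      ∑ k, (wordCount l w k 0 : ℝ) * ‖η k‖ ^ 2 + if c = 0 then ‖η j‖ ^ 2 else 0 := by
    intro c
    simp only [wordCount_cons, Nat.cast_add, add_mul, Finset.sum_add_distrib]
    congr 1
    rw [Finset.sum_eq_single j]
    · by_cases h : c = 0 <;> simp [h]
    · intro k _ hk
      simp [hk.symm]
    · simp
  rw [map_smul, wordTerm, wordTerm, hcount, wordCoeff]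
  fin_cases c
  · simp only [wordIdx, dampMap, Fin.zero_eta, Matrix.cons_val_zero, id, LinearMap.smul_apply,
      LinearMap.id_coe, Finsupp.smul_single, smul_eq_mul, if_true]
    congr 1
    rw [mul_add, sub_add_eq_sub_sub, Real.exp_sub _ (v * ‖η j‖ ^ 2), div_eq_mul_inv, ← Real.exp_neg,
      neg_mul]
    ring
  · simp [wordIdx, dampMap, mul_assoc, -Finsupp.single_mul]
  · simp [wordIdx, dampMap, mul_assoc, -Finsupp.single_mul]

/-- The first letter of a word belongs to the last block, hence the reversed list. The default
letter `0` of an exhausted word says that the initial triple has only its component `0`. -/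
theorem evolve_reverse_eq_sum (v : ℝ≥0) (η : Fin M → ℂ) (l : List (Fin M)) (c : Fin 3) :
    evolve v η l.reverse (initial η) c =
      ∑ w ∈ words l.length, if w.headD 0 = c then wordTerm v η l w else 0 := by
  induction l generalizing c with
  | nil =>
    fin_cases c <;> simp [evolve, words, initial, wordTerm, wordIdx, wordCoeff, wordCount,
      -Finsupp.single_mul]
  | cons j l ih =>
    rw [List.reverse_cons, evolve_concat, damp_apply, List.length_cons, sum_words_succ]
    have h1 : ∀ d : Fin 3, ∑ w ∈ words l.length,
        (if (d :: w).headD 0 = c then wordTerm v η (j :: l) (d :: w) else 0) =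
        if d = c then ∑ w ∈ words l.length, wordTerm v η (j :: l) (d :: w) else 0 := by
      intro d
      by_cases h : d = c <;> simp [h]
    simp_rw [h1]
    rw [Finset.sum_ite_eq' Finset.univ c, if_pos (Finset.mem_univ _)]
    simp_rw [wordTerm_cons, ← map_sum]
    congr 1
    simp only [rotate, ih, Finset.smul_sum]
    rw [Finset.sum_comm]
    refine Finset.sum_congr rfl fun w _ => ?_
    simp

/-! #### Coefficients -/

theorem abs_rotationMatrix_le (c c' : Fin 3) : |rotationMatrix c c'| ≤ 3 / 4 := by
  fin_cases c <;> fin_cases c' <;> simp [rotationMatrix] <;> norm_num [abs_of_pos]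

theorem sum_abs_rotationMatrix (c' : Fin 3) : ∑ c, |rotationMatrix c c'| = 5 / 4 := by
  fin_cases c' <;> simp [rotationMatrix, Fin.sum_univ_three, abs_div] <;> norm_num [abs_of_pos]

theorem abs_wordCoeff_le (w : List (Fin 3)) : |wordCoeff w| ≤ (3 / 4) ^ w.length := by
  induction w with
  | nil => simp [wordCoeff]
  | cons c w ih =>
    rw [wordCoeff, abs_mul, List.length_cons, pow_succ']
    exact mul_le_mul (abs_rotationMatrix_le _ _) ih (abs_nonneg _) (by norm_num)

/-- Ignoring the signs of the rotation matrix, each of its columns has sum `5/4`. The resulting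
growth is affordable only at logarithmic depth. -/
theorem sum_abs_wordCoeff (n : ℕ) : ∑ w ∈ words n, |wordCoeff w| = (5 / 4) ^ n := by
  induction n with
  | zero => simp [words, wordCoeff]
  | succ n ih =>
    rw [sum_words_succ, Finset.sum_comm, pow_succ', ← ih, Finset.mul_sum]
    refine Finset.sum_congr rfl fun w _ => ?_
    simp only [wordCoeff, abs_mul]
    rw [← Finset.sum_mul, sum_abs_rotationMatrix]

/-! #### The parameters of the Gaussian of a word -/

theorem sum_wordCount {l : List (Fin M)} {w : List (Fin 3)} (h : w.length = l.length) (j : Fin M) :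
    ∑ c, wordCount l w j c = l.count j := by
  induction l generalizing w with
  | nil => simp [wordCount]
  | cons k l ih =>
    obtain _ | ⟨d, w⟩ := w
    · simp at h
    · simp only [wordCount_cons, Finset.sum_add_distrib, ih (by simpa using h), List.count_cons]
      congr 1
      by_cases hk : k = j <;> simp [hk]

/-- Letter `1` adds `4v(1 + p)` to `r` and letter `2` adds `4v(1 + r)` to `p`. When the second kind
of letter arrives, the other parameter is already at least `4v`, whence the term `16 v²`. -/
theorem le_wordIdx (v : ℝ≥0) (l : List (Fin M)) (w : List (Fin 3)) (j : Fin M) :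
    4 * v * wordCount l w j 2 ≤ (wordIdx v l w j).1 ∧
    4 * v * wordCount l w j 1 ≤ (wordIdx v l w j).2 ∧
    (0 < wordCount l w j 1 → 0 < wordCount l w j 2 →
      16 * v ^ 2 ≤ (wordIdx v l w j).1 + (wordIdx v l w j).2) := by
  induction l generalizing w with
  | nil => simp [wordCount, wordIdx]
  | cons k l ih =>
    obtain _ | ⟨d, w⟩ := w
    · simp [wordCount, wordIdx]
    obtain ⟨h1, h2, h3⟩ := ih w
    simp only [wordCount_cons, ← NNReal.coe_le_coe] at h1 h2 h3 ⊢
    push_cast at h1 h2 h3 ⊢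
    generalize wordCount l w j 1 = n1 at *
    generalize wordCount l w j 2 = n2 at *
    have hv := v.2
    by_cases hk : k = j
    · subst hk
      fin_cases d
      · simpa [wordIdx] using ⟨h1, h2, h3⟩
      · have e : wordIdx v (k :: l) (1 :: w) k = ((wordIdx v l w k).1,
            (wordIdx v l w k).2 + 4 * v * (1 + (wordIdx v l w k).1)) := by
          simp [wordIdx, multIdx]
        simp [e]
        set p : ℝ := ((wordIdx v l w k).1 : ℝ)
        set r : ℝ := ((wordIdx v l w k).2 : ℝ)
        have hp : 0 ≤ p := NNReal.coe_nonneg _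
        have hvp := mul_nonneg hv hp
        refine ⟨h1, by nlinarith, fun hn => ?_⟩
        have : (1 : ℝ) ≤ n2 := by exact_mod_cast hn
        have h4 : 4 * (v : ℝ) ≤ p := by nlinarith
        have hr : 0 ≤ r := NNReal.coe_nonneg _
        nlinarith
      · have e : wordIdx v (k :: l) (2 :: w) k = ((wordIdx v l w k).1 +
            4 * v * (1 + (wordIdx v l w k).2), (wordIdx v l w k).2) := by
          simp [wordIdx, convIdx]
        simp [e]
        set p : ℝ := ((wordIdx v l w k).1 : ℝ)
        set r : ℝ := ((wordIdx v l w k).2 : ℝ)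
        have hr : 0 ≤ r := NNReal.coe_nonneg _
        have hp : 0 ≤ p := NNReal.coe_nonneg _
        have hvp := mul_nonneg hv hr
        refine ⟨by nlinarith, h2, fun hn => ?_⟩
        have : (1 : ℝ) ≤ n1 := by exact_mod_cast hn
        have h4 : 4 * (v : ℝ) ≤ r := by nlinarith
        nlinarith
    · have : wordIdx v (k :: l) (d :: w) j = wordIdx v l w j := by
        fin_cases d <;> simp [wordIdx, multIdx, convIdx, Function.update_of_ne (Ne.symm hk)]
      rw [this]
      simpa [hk] using ⟨h1, h2, h3⟩

/-- A word that is not constant on each mode has two different letters on some mode. -/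
theorem exists_mixed {l : List (Fin M)} {w : List (Fin 3)} (h : w.length = l.length)
    (hw : ∀ f : Fin M → Fin 3, w ≠ l.map f) :
    ∃ j c c', c ≠ c' ∧ 0 < wordCount l w j c ∧ 0 < wordCount l w j c' := by
  by_contra! hc
  simp only [wordCount, List.count_pos_iff, Nat.le_zero, List.count_eq_zero] at hc
  classical
  refine hw (fun j => if h : ∃ c, (j, c) ∈ l.zip w then h.choose else 0) ?_
  refine List.ext_getElem (by simpa using h) fun i h1 h2 => ?_
  rw [List.getElem_map]
  have hi : i < l.length := by simpa using h2
  have hm : (l[i], w[i]) ∈ l.zip w := by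
    rw [← List.getElem_zip (i := i) (h := by simp [hi, h])]
    exact List.getElem_mem _
  have hex : ∃ c, (l[i], c) ∈ l.zip w := ⟨_, hm⟩
  rw [dif_pos hex]
  by_contra hne
  exact hc _ _ _ hne hm hex.choose_spec

/-! ### Shallow circuits: summation over words -/

section Shallow

variable {M : ℕ}

theorem gauss_zero_mul (i : GIdx M) (ζ : Fin M → ℂ) : gauss 0 ζ * gauss i ζ =
    (∏ j, (1 + (i j).1 : ℝ)⁻¹) *
      ∏ j, Real.exp (-(1 + (1 + (i j).2 : ℝ) / (1 + (i j).1)) * ‖ζ j‖ ^ 2) := by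
  simp only [gauss, ← Finset.prod_mul_distrib]
  refine Finset.prod_congr rfl fun j _ => ?_
  simp only [gaussFactor, Pi.zero_apply, Prod.fst_zero, Prod.snd_zero, NNReal.coe_zero]
  rw [mul_mul_mul_comm, ← Real.exp_add]
  congr 1
  · simp
  · congr 1; ring

theorem integral_gauss_zero_mul (i : GIdx M) :
    ∫ ζ, gauss 0 ζ * gauss i ζ = ∏ j, Real.pi / (2 + (i j).1 + (i j).2) := by
  simp_rw [gauss_zero_mul]
  rw [integral_const_mul, integral_prod_exp fun j => by positivity, ← Finset.prod_mul_distrib]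
  refine Finset.prod_congr rfl fun j _ => ?_
  have : (1 + (i j).1 : ℝ) ≠ 0 := by positivity
  have : (2 + (i j).1 + (i j).2 : ℝ) ≠ 0 := by positivity
  have e : (1 + (1 + (i j).2 : ℝ) / (1 + (i j).1)) = (2 + (i j).1 + (i j).2) / (1 + (i j).1) := by
    field_simp; ring
  rw [e]
  field_simp

theorem integrable_gauss_zero_mul (i : GIdx M) : Integrable fun ζ => gauss 0 ζ * gauss i ζ := by
  simp_rw [gauss_zero_mul]
  exact (integrable_prod_exp fun j => by positivity).const_mul _

/-- The correlation of the initial Gaussian with the contribution of a word. -/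
def wordBound (v : ℝ≥0) (l : List (Fin M)) (w : List (Fin 3)) (η : Fin M → ℂ) : ℝ :=
  |wordCoeff w| * ((∏ j, Real.pi / (2 + (wordIdx v l w j).1 + (wordIdx v l w j).2)) *
    ∏ j, Real.exp (-(1 / 2 + v * wordCount l w j 0) * ‖η j‖ ^ 2))

theorem abs_integral_wordTerm (v : ℝ≥0) (η : Fin M → ℂ) (l : List (Fin M)) (w : List (Fin 3)) :
    |∫ ζ, ev ζ (initial η 0) * ev ζ (wordTerm v η l w)| = wordBound v l w η ∧
    Integrable fun ζ => ev ζ (initial η 0) * ev ζ (wordTerm v η l w) := by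
  have e : ∀ ζ, ev ζ (initial η 0) * ev ζ (wordTerm v η l w) = wordCoeff w *
      (∏ j, Real.exp (-(1 / 2 + v * wordCount l w j 0) * ‖η j‖ ^ 2)) *
        (gauss 0 ζ * gauss (wordIdx v l w) ζ) := by
    intro ζ
    rw [initial, Matrix.cons_val_zero, wordTerm, ev_single, ev_single, ← Real.exp_sum]
    have : ∑ j, -(1 / 2 + v * wordCount l w j 0) * ‖η j‖ ^ 2 = -normSqSum η / 4 +
        (-normSqSum η / 4 - v * ∑ j, wordCount l w j 0 * ‖η j‖ ^ 2) := by
      have e2 : ∑ j, -(1 / 2 + v * wordCount l w j 0) * ‖η j‖ ^ 2 =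
          ∑ j, (-(1 / 2) * ‖η j‖ ^ 2 - v * (wordCount l w j 0 * ‖η j‖ ^ 2)) :=
        Finset.sum_congr rfl fun j _ => by ring
      rw [e2, Finset.sum_sub_distrib, ← Finset.mul_sum, ← Finset.mul_sum, ← normSqSum]
      ring
    rw [this, Real.exp_add]
    ring
  simp_rw [e]
  refine ⟨?_, (integrable_gauss_zero_mul _).const_mul _⟩
  have h1 : 0 ≤ ∏ j, Real.exp (-(1 / 2 + v * wordCount l w j 0) * ‖η j‖ ^ 2) :=
    Finset.prod_nonneg fun j _ => (Real.exp_nonneg _)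
  have h2 : 0 ≤ ∏ j, Real.pi / (2 + (wordIdx v l w j).1 + (wordIdx v l w j).2) :=
    Finset.prod_nonneg fun j _ => by positivity
  rw [integral_const_mul, integral_gauss_zero_mul, wordBound, abs_mul, abs_mul,
    abs_of_nonneg h1, abs_of_nonneg h2]
  ring

theorem abs_integral_evolve_le (v : ℝ≥0) (η : Fin M → ℂ) (l : List (Fin M)) :
    |∫ ζ, ev ζ (initial η 0) * ev ζ (evolve v η l.reverse (initial η) 0)| ≤
      ∑ w ∈ words l.length, wordBound v l w η := by
  rw [evolve_reverse_eq_sum]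
  simp_rw [map_sum, Finset.mul_sum]
  rw [integral_finsetSum]
  · refine (Finset.abs_sum_le_sum_abs _ _).trans (Finset.sum_le_sum fun w _ => ?_)
    rw [← (abs_integral_wordTerm v η l w).1]
    split_ifs
    · exact le_rfl
    · simp
  · intro w _
    split_ifs
    · exact (abs_integral_wordTerm v η l w).2
    · simp

/-- The factor of mode `j` in the integral of `wordBound`. -/
def wordFactor (v : ℝ≥0) (l : List (Fin M)) (w : List (Fin 3)) (j : Fin M) : ℝ :=
  Real.pi ^ 2 / ((2 + (wordIdx v l w j).1 + (wordIdx v l w j).2) *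
    (1 / 2 + v * wordCount l w j 0))

theorem integral_wordBound (v : ℝ≥0) (l : List (Fin M)) (w : List (Fin 3)) :
    ∫ η, wordBound v l w η = |wordCoeff w| * ∏ j, wordFactor v l w j ∧
    Integrable (wordBound v l w) := by
  unfold wordBound
  refine ⟨?_, ((integrable_prod_exp fun j => by positivity).const_mul _).const_mul _⟩
  rw [integral_const_mul, integral_const_mul, integral_prod_exp fun j => by positivity,
    ← Finset.prod_mul_distrib]
  congr 1
  refine Finset.prod_congr rfl fun j _ => ?_
  rw [wordFactor, div_mul_div_comm, sq]

theorem wordFactor_nonneg (v : ℝ≥0) (l : List (Fin M)) (w : List (Fin 3)) (j : Fin M) :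
    0 ≤ wordFactor v l w j := by
  unfold wordFactor; positivity

/-- Each of the `L` blocks on the mode increases at least one of the two denominators: letter `0`
the one from the integral over `η`, letters `1` and `2` the one from the integral over `ζ`. The
constants `2` and `1/2` let each increase survive in the product. -/
theorem wordFactor_le {v : ℝ≥0} (hv : 0 < v) {l : List (Fin M)} {w : List (Fin 3)}
    (h : w.length = l.length) {L : ℕ} (hL : 1 ≤ L) (j : Fin M) (hj : l.count j = L) :
    wordFactor v l w j ≤ Real.pi ^ 2 / (v * L) := by
  have h1 := sum_wordCount h j
  rw [hj, Fin.sum_univ_three] at h1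
  obtain ⟨h2, h3, -⟩ := le_wordIdx v l w j
  simp only [← NNReal.coe_le_coe] at h2 h3
  push_cast at h2 h3
  have hv' : (0 : ℝ) < v := by exact_mod_cast hv
  have hL' : (0 : ℝ) < L := by exact_mod_cast hL
  refine div_le_div_of_nonneg_left (by positivity) (by positivity) ?_
  rw [← h1]
  push_cast
  have hp : (0 : ℝ) ≤ (wordIdx v l w j).1 := NNReal.coe_nonneg _
  have hr : (0 : ℝ) ≤ (wordIdx v l w j).2 := NNReal.coe_nonneg _
  have ha := mul_nonneg hv'.le (Nat.cast_nonneg (α := ℝ) (wordCount l w j 0))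
  have hb := mul_nonneg hv'.le (Nat.cast_nonneg (α := ℝ) (wordCount l w j 1))
  have hc := mul_nonneg hv'.le (Nat.cast_nonneg (α := ℝ) (wordCount l w j 2))
  have := mul_nonneg (add_nonneg hp hr) ha
  nlinarith

/-- Two different letters contribute two powers of `v`: letters `1` and `2` through the quadratic
growth of `p + r`, and letter `0` with either of them because both denominators are of order `v`. -/
theorem wordFactor_le_of_mixed {v : ℝ≥0} (hv : 0 < v) {l : List (Fin M)} {w : List (Fin 3)}
    {j : Fin M} {c c' : Fin 3} (hc : c ≠ c') (h : 0 < wordCount l w j c)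
    (h' : 0 < wordCount l w j c') : wordFactor v l w j ≤ Real.pi ^ 2 / v ^ 2 := by
  have hv' : (0 : ℝ) < v := by exact_mod_cast hv
  obtain ⟨h2, h3, h4⟩ := le_wordIdx v l w j
  simp only [← NNReal.coe_le_coe] at h2 h3 h4
  push_cast at h2 h3 h4
  refine div_le_div_of_nonneg_left (by positivity) (by positivity) ?_
  have hp : (0 : ℝ) ≤ (wordIdx v l w j).1 := NNReal.coe_nonneg _
  have hr : (0 : ℝ) ≤ (wordIdx v l w j).2 := NNReal.coe_nonneg _
  generalize ((wordIdx v l w j).1 : ℝ) = p at *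
  generalize ((wordIdx v l w j).2 : ℝ) = r at *
  have key : ∀ c : Fin 3, 0 < wordCount l w j c → (1 : ℝ) ≤ wordCount l w j c := fun c h => by
    exact_mod_cast h
  have a0 : (0 : ℝ) ≤ wordCount l w j 0 := Nat.cast_nonneg _
  by_cases h12 : 0 < wordCount l w j 1 ∧ 0 < wordCount l w j 2
  · have := h4 h12.1 h12.2
    have hva := mul_nonneg hv'.le a0
    nlinarith
  · have h0 : 0 < wordCount l w j 0 ∧ (0 < wordCount l w j 1 ∨ 0 < wordCount l w j 2) := by
      fin_cases c <;> fin_cases c' <;> simp at hc h h' <;> tauto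
    have k0 := key 0 h0.1
    have k3 : (v : ℝ) ≤ v * wordCount l w j 0 := le_mul_of_one_le_right hv'.le k0
    have k4 : 4 * (v : ℝ) ≤ p + r := by
      rcases h0.2 with h | h
      · have := key 1 h; nlinarith
      · have := key 2 h; nlinarith
    nlinarith

/-- Words that are constant on each mode are few, and each has the smallest available coefficient
bound. All others gain the factor `L / v` on one mode, so the crude sum of absolute coefficients
suffices for them. -/
theorem sum_integral_wordBound_le (hM : 1 ≤ M) {v : ℝ≥0} (hv : 0 < v) {l : List (Fin M)} {L : ℕ}
    (hL : 1 ≤ L) (hl : ∀ j, l.count j = L) :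
    ∑ w ∈ words l.length, |wordCoeff w| * ∏ j, wordFactor v l w j ≤
      (Real.pi ^ 2 / (v * L)) ^ M * (3 ^ M * (3 / 4) ^ l.length +
        (5 / 4) ^ l.length * (L / v)) := by
  classical
  have hv' : (0 : ℝ) < v := by exact_mod_cast hv
  have hL' : (0 : ℝ) < L := by exact_mod_cast hL
  set D : ℝ := Real.pi ^ 2 / (v * L)
  have hD : 0 < D := by positivity
  have h1 : ∀ w ∈ words l.length, |wordCoeff w| * ∏ j, wordFactor v l w j ≤
      D ^ M * ((∑ f : Fin M → Fin 3, if w = l.map f then (3 / 4 : ℝ) ^ l.length else 0) +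
        |wordCoeff w| * (L / v)) := by
    intro w hw
    have hw := length_of_mem_words hw
    have hall : ∀ j, wordFactor v l w j ≤ D := fun j => wordFactor_le hv hw hL j (hl j)
    have hsum : (0 : ℝ) ≤ ∑ f : Fin M → Fin 3, if w = l.map f then (3 / 4 : ℝ) ^ l.length else 0 :=
      Finset.sum_nonneg fun f _ => by split_ifs <;> positivity
    by_cases hf : ∃ f : Fin M → Fin 3, w = l.map f
    · obtain ⟨f, hf⟩ := hf
      have h2 : ∏ j, wordFactor v l w j ≤ D ^ M := by
        refine (Finset.prod_le_prod (fun j _ => wordFactor_nonneg v l w j)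
          fun j _ => hall j).trans_eq (by simp)
      have h3 : (3 / 4 : ℝ) ^ l.length ≤
          ∑ f : Fin M → Fin 3, if w = l.map f then (3 / 4 : ℝ) ^ l.length else 0 := by
        have := Finset.single_le_sum (f := fun f : Fin M → Fin 3 =>
          if w = l.map f then (3 / 4 : ℝ) ^ l.length else 0)
          (fun f _ => by split_ifs <;> positivity) (Finset.mem_univ f)
        simpa [hf] using this
      have h4 := abs_wordCoeff_le w
      rw [hw] at h4
      rw [mul_comm]
      refine mul_le_mul h2 ?_ (abs_nonneg _) (by positivity)
      have : 0 ≤ |wordCoeff w| * (L / v) := by positivity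
      linarith
    · push Not at hf
      obtain ⟨j, c, c', hc, hj, hj'⟩ := exists_mixed hw hf
      have h2 := wordFactor_le_of_mixed hv hc hj hj'
      have h3 : ∏ j, wordFactor v l w j ≤ D ^ M * (L / v) := by
        rw [← Finset.mul_prod_erase _ _ (Finset.mem_univ j)]
        have h5 : ∏ i ∈ Finset.univ.erase j, wordFactor v l w i ≤ D ^ (M - 1) :=
          (Finset.prod_le_prod (fun j _ => wordFactor_nonneg v l w j)
            fun j _ => hall j).trans_eq (by simp)
        refine (mul_le_mul h2 h5 (Finset.prod_nonneg fun j _ => wordFactor_nonneg v l w j)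
          (by positivity)).trans_eq ?_
        have e : Real.pi ^ 2 / (v : ℝ) ^ 2 = D * (L / v) := by
          simp only [D]; field_simp
        obtain ⟨m, rfl⟩ : ∃ m, M = m + 1 := ⟨M - 1, by omega⟩
        rw [e, Nat.add_sub_cancel]
        ring
      calc |wordCoeff w| * ∏ j, wordFactor v l w j ≤ |wordCoeff w| * (D ^ M * (L / v)) :=
            mul_le_mul_of_nonneg_left h3 (abs_nonneg _)
        _ = D ^ M * (0 + |wordCoeff w| * (L / v)) := by ring
        _ ≤ _ := by gcongr
  refine (Finset.sum_le_sum h1).trans ?_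
  rw [← Finset.mul_sum, Finset.sum_add_distrib, ← Finset.sum_mul, sum_abs_wordCoeff,
    Finset.sum_comm]
  refine mul_le_mul_of_nonneg_left (add_le_add ?_ le_rfl) (by positivity)
  refine (Finset.sum_le_sum (g := fun _ => (3 / 4 : ℝ) ^ l.length) fun f _ => ?_).trans_eq
    (by simp)
  rw [Finset.sum_ite_eq']
  split_ifs
  · exact le_rfl
  · positivity

end Shallow

/-! ### The upper bound for shallow circuits -/

section Circuit

variable {M : ℕ}

/-- The modes on which the blocks act. -/
def modeList (L M : ℕ) : List (Fin M) := (blockList L M).map Prod.snd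

theorem length_modeList (L M : ℕ) : (modeList L M).length = M * L := by
  simp [modeList, blockList, List.length_product, mul_comm]

theorem IsPureGaussian.integral_cost_sq_le {ψ : Wave M} (hψ : IsPureGaussian ψ) :
    ∃ C : ℝ, 0 < C ∧ ∀ (L : ℕ) (v : ℝ≥0), 1 ≤ L → 0 < v → ∀ {B : (Fin M → ℂ) → ℝ}, Integrable B →
      (∀ η, |∫ ζ, ev ζ (initial η 0) * ev ζ (evolve v η (modeList L M) (initial η) 0)| ≤ B η) →
      ∫ x : Params L M, cost ψ x ^ 2 ∂(ensemble (v * L) L M) ≤ C * ∫ η, B η := by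
  obtain ⟨C, hC, h⟩ := hψ.average_overlap_le
  refine ⟨C, hC, fun L v hL hv B hB hb => ?_⟩
  refine Eq.trans_le ?_ (h hv Prod.snd (blockList L M) nodup_blockList hB hb)
  have hL' : (L : ℝ) ≠ 0 := by positivity
  unfold average ensemble
  rw [mul_div_cancel_right₀ _ hL']
  congr 1
  funext x
  rw [← output_eq_run, cost]
  ring

/-- The upper bound for shallow circuits. -/
theorem IsPureGaussian.integral_cost_sq_le_shallow {ψ : Wave M} (hψ : IsPureGaussian ψ)
    (hM : 1 ≤ M) : ∃ b : ℝ, 0 < b ∧ ∀ (L : ℕ) (E : ℝ), 1 ≤ L → 1 ≤ E →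
      (M + 2) * (L : ℝ) ≤ Real.log E →
      ∫ x : Params L M, cost ψ x ^ 2 ∂(ensemble E L M) ≤ b * (3 / 4) ^ (M * L) / E ^ M := by
  obtain ⟨C, hC, h⟩ := hψ.integral_cost_sq_le
  refine ⟨C * ((Real.pi ^ 2) ^ M * (3 ^ M + 1)), by positivity, fun L E hL hE hlog => ?_⟩
  have hE0 : 0 < E := by linarith
  have hL' : (0 : ℝ) < L := by exact_mod_cast hL
  have hv0 : 0 < E / L := by positivity
  obtain ⟨v, hv⟩ : ∃ v : ℝ≥0, (v : ℝ) = E / L := ⟨⟨E / L, hv0.le⟩, rfl⟩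
  have hvpos : 0 < v := by rw [← NNReal.coe_pos, hv]; exact hv0
  have hvL : v * (L : ℝ) = E := by rw [hv]; field_simp
  set l := (modeList L M).reverse
  have hlen : l.length = M * L := by simp [l, length_modeList]
  have h1 := h L v hL hvpos (B := fun η => ∑ w ∈ words l.length, wordBound v l w η)
    (integrable_finsetSum _ fun w _ => (integral_wordBound v l w).2)
    (fun η => by
      have := abs_integral_evolve_le v η l
      rwa [List.reverse_reverse] at this)
  rw [hvL, integral_finsetSum _ fun w _ => (integral_wordBound v l w).2] at h1
  simp_rw [fun w => (integral_wordBound v l w).1] at h1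
  have h2 := sum_integral_wordBound_le hM hvpos (l := l) hL fun j => by
    simp only [l, List.count_reverse]
    exact count_blockList L j
  rw [hvL, hlen, hv] at h2
  rw [hlen] at h1
  refine h1.trans ((mul_le_mul_of_nonneg_left h2 hC.le).trans ?_)
  -- The mixed words must not exceed `(3/4)^(ML)`; the quotient of the two weights is `(5/4) / (3/4)
  -- = 5/3 ≤ e`. Together with `L ≤ e^L` this requires `(M + 2) L ≤ log E`, which is the origin of
  -- the constant `1 / (M + 2)`.
  have key : (5 / 3 : ℝ) ^ (M * L) * L ^ 2 ≤ E := by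
    have e1 : (5 / 3 : ℝ) ^ (M * L) ≤ Real.exp (M * L) := by
      have : (5 / 3 : ℝ) ≤ Real.exp 1 := by
        have := Real.add_one_le_exp (1 : ℝ); linarith
      refine (pow_le_pow_left₀ (by norm_num) this _).trans_eq ?_
      rw [← Real.exp_nat_mul]; push_cast; ring_nf
    have e2 : (L : ℝ) ^ 2 ≤ Real.exp (2 * L) := by
      have : (L : ℝ) ≤ Real.exp L := by
        have := Real.add_one_le_exp (L : ℝ); linarith
      refine (pow_le_pow_left₀ hL'.le this 2).trans_eq ?_
      rw [← Real.exp_nat_mul]; push_cast; rfl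
    calc (5 / 3 : ℝ) ^ (M * L) * L ^ 2 ≤ Real.exp (M * L) * Real.exp (2 * L) := by gcongr
      _ = Real.exp ((M + 2) * L) := by rw [← Real.exp_add]; ring_nf
      _ ≤ E := by rwa [← Real.le_log_iff_exp_le hE0]
  have key2 : (5 / 4 : ℝ) ^ (M * L) * (L / (E / L)) ≤ (3 / 4) ^ (M * L) := by
    have e : (5 / 4 : ℝ) ^ (M * L) = (3 / 4) ^ (M * L) * (5 / 3) ^ (M * L) := by
      rw [← mul_pow]; norm_num
    rw [e, mul_assoc]
    refine mul_le_of_le_one_right (by positivity) ?_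
    have e2 : (5 / 3 : ℝ) ^ (M * L) * (L / (E / L)) = (5 / 3 : ℝ) ^ (M * L) * L ^ 2 / E := by
      field_simp
    rw [e2, div_le_one hE0]
    exact key
  rw [mul_div_assoc, mul_assoc C]
  refine mul_le_mul_of_nonneg_left ?_ hC.le
  calc (Real.pi ^ 2 / E) ^ M * (3 ^ M * (3 / 4) ^ (M * L) + (5 / 4) ^ (M * L) * (L / (E / L))) ≤
      (Real.pi ^ 2 / E) ^ M * (3 ^ M * (3 / 4) ^ (M * L) + (3 / 4) ^ (M * L)) := by gcongr
    _ = _ := by rw [div_pow]; ring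

end Circuit

/-! ### Quadratic forms on combinations of Gaussians -/

section Quadratic

variable {M : ℕ}

theorem integrable_gauss (i : GIdx M) : Integrable (gauss i) := by
  unfold gauss gaussFactor
  simp_rw [Finset.prod_mul_distrib]
  exact (integrable_prod_exp fun j => by positivity).const_mul _

theorem integrable_ev (f : GSpace M) : Integrable fun ζ => ev ζ f := by
  induction f using Finsupp.induction_linear with
  | zero => simp
  | add f g hf hg => simp only [map_add]; exact hf.add hg
  | single i c => simp only [ev_single]; exact (integrable_gauss i).const_mul c

theorem integrable_ev_mul_ev (f g : GSpace M) : Integrable fun ζ => ev ζ f * ev ζ g := by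
  obtain ⟨C, hC⟩ := exists_abs_ev_le g
  exact (integrable_ev f).mul_bdd (continuous_ev g).aestronglyMeasurable
    (Filter.Eventually.of_forall hC)

/-- The inner product of `L²`. -/
def ip (f g : GSpace M) : ℝ := ∫ ζ, ev ζ f * ev ζ g

theorem ip_comm (f g : GSpace M) : ip f g = ip g f := by
  simp only [ip, mul_comm]

theorem ip_add_left (f g h : GSpace M) : ip (f + g) h = ip f h + ip g h := by
  simp only [ip, map_add, add_mul]
  exact integral_add (integrable_ev_mul_ev f h) (integrable_ev_mul_ev g h)

theorem ip_smul_left (c : ℝ) (f g : GSpace M) : ip (c • f) g = c * ip f g := by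
  simp only [ip, map_smul, smul_eq_mul, mul_assoc]
  exact integral_const_mul _ _

theorem ip_add_right (f g h : GSpace M) : ip f (g + h) = ip f g + ip f h := by
  rw [ip_comm, ip_add_left, ip_comm g, ip_comm h]

theorem ip_smul_right (c : ℝ) (f g : GSpace M) : ip f (c • g) = c * ip f g := by
  rw [ip_comm, ip_smul_left, ip_comm]

theorem ip_zero_left (g : GSpace M) : ip 0 g = 0 := by simp [ip]

theorem ip_single_single (i k : GIdx M) (a b : ℝ) :
    ip (Finsupp.single i a) (Finsupp.single k b) = a * b * ∏ j, Real.pi /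
      ((1 + (i j).2) * (1 + (k j).1) + (1 + (k j).2) * (1 + (i j).1)) := by
  have e : ∀ ζ, ev ζ (Finsupp.single i a) * ev ζ (Finsupp.single k b) = a * b *
      (∏ j, (1 + (i j).1 : ℝ)⁻¹ * (1 + (k j).1 : ℝ)⁻¹) * ∏ j, Real.exp (-((1 + (i j).2 : ℝ) /
        (1 + (i j).1) + (1 + (k j).2 : ℝ) / (1 + (k j).1)) * ‖ζ j‖ ^ 2) := by
    intro ζ
    rw [ev_single, ev_single, mul_mul_mul_comm, mul_assoc (a * b)]
    congr 1
    simp only [gauss, ← Finset.prod_mul_distrib]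
    refine Finset.prod_congr rfl fun j _ => ?_
    rw [gaussFactor, gaussFactor, mul_mul_mul_comm, ← Real.exp_add]
    congr 2; ring
  simp_rw [ip, e]
  rw [integral_const_mul, integral_prod_exp fun j => by positivity, mul_assoc,
    ← Finset.prod_mul_distrib]
  congr 1
  refine Finset.prod_congr rfl fun j _ => ?_
  have h1 : (1 + (i j).1 : ℝ) ≠ 0 := by positivity
  have h2 : (1 + (k j).1 : ℝ) ≠ 0 := by positivity
  have e2 : ((1 + (i j).2 : ℝ) / (1 + (i j).1) + (1 + (k j).2 : ℝ) / (1 + (k j).1)) =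
      ((1 + (i j).2) * (1 + (k j).1) + (1 + (k j).2) * (1 + (i j).1)) /
        ((1 + (i j).1) * (1 + (k j).1)) := by
    field_simp
  rw [e2]
  have h3 : ((1 + (i j).2) * (1 + (k j).1) + (1 + (k j).2) * (1 + (i j).1) : ℝ) ≠ 0 := by positivity
  field_simp

/-- Plancherel's identity: the inner product of two Gaussians is symmetric under exchanging the
parameters `p` and `r` of both. -/
theorem ip_fourier_fourier (f g : GSpace M) : ip (fourier f) (fourier g) = ip f g := by
  induction f using Finsupp.induction_linear with
  | zero => simp [ip_zero_left]
  | add f f' hf hf' => rw [map_add, ip_add_left, ip_add_left, hf, hf']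
  | single i a =>
    induction g using Finsupp.induction_linear with
    | zero => rw [map_zero, ip_comm, ip_zero_left, ip_comm, ip_zero_left]
    | add g g' hg hg' => rw [map_add, ip_add_right, ip_add_right, hg, hg']
    | single k b =>
      rw [fourier_single, fourier_single, ip_single_single, ip_single_single]
      congr 1
      refine Finset.prod_congr rfl fun j _ => ?_
      simp only [swapIdx, Prod.fst_swap, Prod.snd_swap]
      congr 1; ring

theorem fourier_fourier (f : GSpace M) : fourier (fourier f) = f := by
  induction f using Finsupp.induction_linear with
  | zero => simp
  | add f g hf hg => rw [map_add, map_add, hf, hg]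
  | single i c => rw [fourier_single, fourier_single]; rfl

theorem fourier_mult (v : ℝ≥0) (j : Fin M) (f : GSpace M) :
    fourier (mult v j f) = conv v j (fourier f) := by
  induction f using Finsupp.induction_linear with
  | zero => simp
  | add f g hf hg => rw [map_add, map_add, map_add, map_add, hf, hg]
  | single i c =>
    rw [mult_single, fourier_single, fourier_single, conv_single]
    congr 1
    funext k
    by_cases h : k = j
    · subst h; simp [swapIdx, multIdx, convIdx]
    · simp [swapIdx, multIdx, convIdx, h]

theorem ip_fourier_left (f g : GSpace M) : ip (fourier f) g = ip f (fourier g) := by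
  rw [← ip_fourier_fourier, fourier_fourier]

theorem ip_mult_left (v : ℝ≥0) (j : Fin M) (f g : GSpace M) :
    ip (mult v j f) g = ip f (mult v j g) := by
  simp only [ip, ev_mult]
  congr 1; funext ζ; ring

theorem ip_conv_left (v : ℝ≥0) (j : Fin M) (f g : GSpace M) :
    ip (conv v j f) g = ip f (conv v j g) := by
  rw [← fourier_fourier f, ← fourier_fourier g, ← fourier_mult, ← fourier_mult,
    ip_fourier_fourier, ip_fourier_fourier, ip_mult_left]

/-- Continuous weights with values in the unit interval. -/
structure IsWeight (w : (Fin M → ℂ) → ℝ) : Prop where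
  continuous : Continuous w
  nonneg : ∀ ζ, 0 ≤ w ζ
  le_one : ∀ ζ, w ζ ≤ 1

theorem isWeight_one : IsWeight fun _ : Fin M → ℂ => (1 : ℝ) :=
  ⟨continuous_const, fun _ => zero_le_one, fun _ => le_rfl⟩

/-- A weighted quadratic form. -/
def quad (w : (Fin M → ℂ) → ℝ) (f : GSpace M) : ℝ := ∫ ζ, w ζ * ev ζ f ^ 2

/-- The square of the norm of `L²`. -/
def nsq (f : GSpace M) : ℝ := ∫ ζ, ev ζ f ^ 2

theorem quad_one (f : GSpace M) : quad (fun _ => 1) f = nsq f := by simp [quad, nsq]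

theorem nsq_eq_ip (f : GSpace M) : nsq f = ip f f := by simp only [nsq, ip, sq]

variable {w w' : (Fin M → ℂ) → ℝ}

theorem IsWeight.integrable (hw : IsWeight w) (f : GSpace M) :
    Integrable fun ζ => w ζ * ev ζ f ^ 2 := by
  have h := integrable_ev_mul_ev f f
  simp_rw [← sq] at h
  exact h.bdd_mul (c := 1) hw.continuous.aestronglyMeasurable
    (Filter.Eventually.of_forall fun ζ => by
      rw [Real.norm_of_nonneg (hw.nonneg ζ)]; exact hw.le_one ζ)

theorem integrable_ev_sq (f : GSpace M) : Integrable fun ζ => ev ζ f ^ 2 := by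
  simpa using isWeight_one.integrable f

theorem IsWeight.quad_nonneg (hw : IsWeight w) (f : GSpace M) : 0 ≤ quad w f :=
  integral_nonneg fun ζ => mul_nonneg (hw.nonneg ζ) (sq_nonneg _)

theorem nsq_nonneg (f : GSpace M) : 0 ≤ nsq f := integral_nonneg fun _ => sq_nonneg _

theorem quad_mono (hw : IsWeight w) (hw' : IsWeight w') (h : ∀ ζ, w ζ ≤ w' ζ) (f : GSpace M) :
    quad w f ≤ quad w' f :=
  integral_mono (hw.integrable f) (hw'.integrable f) fun ζ =>
    mul_le_mul_of_nonneg_right (h ζ) (sq_nonneg _)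

theorem IsWeight.quad_le_nsq (hw : IsWeight w) (f : GSpace M) : quad w f ≤ nsq f := by
  rw [← quad_one]
  exact quad_mono hw isWeight_one hw.le_one f

theorem quad_smul (w : (Fin M → ℂ) → ℝ) (c : ℝ) (f : GSpace M) :
    quad w (c • f) = c ^ 2 * quad w f := by
  simp only [quad, map_smul, smul_eq_mul, ← integral_const_mul]
  congr 1; funext ζ; ring

theorem IsWeight.quad_add_le (hw : IsWeight w) (f g : GSpace M) :
    quad w (f + g) ≤ 2 * quad w f + 2 * quad w g := by
  simp only [quad, ← integral_const_mul]
  rw [← integral_add ((hw.integrable f).const_mul 2) ((hw.integrable g).const_mul 2)]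
  refine integral_mono (hw.integrable (f + g))
    (((hw.integrable f).const_mul 2).add ((hw.integrable g).const_mul 2)) fun ζ => ?_
  simp only [map_add]
  have := mul_nonneg (hw.nonneg ζ) (sq_nonneg (ev ζ f - ev ζ g))
  nlinarith

theorem nsq_smul (c : ℝ) (f : GSpace M) : nsq (c • f) = c ^ 2 * nsq f := by
  rw [← quad_one, quad_smul, quad_one]

theorem nsq_add_le (f g : GSpace M) : nsq (f + g) ≤ 2 * nsq f + 2 * nsq g := by
  simpa only [quad_one] using isWeight_one.quad_add_le f g

theorem nsq_add (f g : GSpace M) : nsq (f + g) = nsq f + 2 * ip f g + nsq g := by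
  simp only [nsq_eq_ip, ip_add_left, ip_add_right, ip_comm g f]; ring

theorem nsq_fourier (f : GSpace M) : nsq (fourier f) = nsq f := by
  rw [nsq_eq_ip, ip_fourier_fourier, nsq_eq_ip]

theorem abs_ip_le (f g : GSpace M) : |ip f g| ≤ (nsq f + nsq g) / 2 := by
  have h1 := nsq_nonneg (f + g)
  have h2 := nsq_nonneg (f + (-1 : ℝ) • g)
  rw [nsq_add] at h1
  rw [nsq_add, nsq_smul, ip_smul_right] at h2
  rw [abs_le]
  constructor <;> linarith

/-- The fraction of a density lost in mode `j` in one damping. -/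
def lossWeight (v : ℝ≥0) (j : Fin M) (ζ : Fin M → ℂ) : ℝ := 1 - Real.exp (-(8 * v) * ‖ζ j‖ ^ 2)

theorem isWeight_lossWeight (v : ℝ≥0) (j : Fin M) : IsWeight (lossWeight v j) := by
  refine ⟨by unfold lossWeight; fun_prop, fun ζ => ?_, fun ζ => ?_⟩
  · have : Real.exp (-(8 * v) * ‖ζ j‖ ^ 2) ≤ 1 := by
      rw [Real.exp_le_one_iff, neg_mul]; exact neg_nonpos.2 (by positivity)
    unfold lossWeight; linarith
  · have := Real.exp_nonneg (-(8 * v) * ‖ζ j‖ ^ 2)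
    unfold lossWeight; linarith

/-- For `0 ≤ t ≤ 1` one has `(1 - t)² ≤ 1 - t²`: the change caused by a damping is controlled by the
norm lost in it. -/
theorem nsq_mult (v : ℝ≥0) (j : Fin M) (f : GSpace M) :
    nsq (mult v j f) = nsq f - quad (lossWeight v j) f ∧
    nsq (f + (-1 : ℝ) • mult v j f) ≤ quad (lossWeight v j) f := by
  have hw := isWeight_lossWeight v j
  have he : ∀ ζ : Fin M → ℂ, Real.exp (-(4 * v) * ‖ζ j‖ ^ 2) ^ 2 =
      Real.exp (-(8 * v) * ‖ζ j‖ ^ 2) := fun ζ => by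
    rw [← Real.exp_nat_mul]; congr 1; push_cast; ring
  constructor
  · rw [nsq, nsq, quad, ← integral_sub (integrable_ev_sq f) (hw.integrable f)]
    congr 1; funext ζ
    rw [ev_mult, mul_pow, he, lossWeight]; ring
  · refine integral_mono (integrable_ev_sq _) (hw.integrable f) fun ζ => ?_
    simp only [map_add, map_smul, ev_mult, smul_eq_mul, lossWeight, ← he]
    have h1 : Real.exp (-(4 * v) * ‖ζ j‖ ^ 2) ≤ 1 := by
      rw [Real.exp_le_one_iff, neg_mul]; exact neg_nonpos.2 (by positivity)
    have h0 := Real.exp_nonneg (-(4 * v) * ‖ζ j‖ ^ 2)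
    generalize Real.exp (-(4 * v) * ‖ζ j‖ ^ 2) = t at *
    have := mul_nonneg (mul_nonneg h0 (sub_nonneg.2 h1)) (sq_nonneg (ev ζ f))
    nlinarith

/-! #### The energy of a triple -/

/-- The combination that a rotation damps. -/
def defect (F : Fin 3 → GSpace M) : GSpace M := F 0 + (-1 : ℝ) • F 1 + (-1 : ℝ) • F 2

/-- The rotation matrix is `1 - u uᵀ / 4` with `u = (1, -1, -1)`: the identity on the plane
orthogonal to `u` and a contraction along `u`. -/
theorem rotate_eq (F : Fin 3 → GSpace M) :
    rotate F 0 = F 0 + (-(1 / 4) : ℝ) • defect F ∧ rotate F 1 = F 1 + (1 / 4 : ℝ) • defect F ∧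
    rotate F 2 = F 2 + (1 / 4 : ℝ) • defect F := by
  simp only [rotate, defect, Fin.sum_univ_three, rotationMatrix]
  refine ⟨?_, ?_, ?_⟩ <;> simp <;> module

/-- The sum of the squared norms. -/
def energy (F : Fin 3 → GSpace M) : ℝ := nsq (F 0) + nsq (F 1) + nsq (F 2)

theorem energy_nonneg (F : Fin 3 → GSpace M) : 0 ≤ energy F := by
  have h0 := nsq_nonneg (F 0)
  have h1 := nsq_nonneg (F 1)
  have h2 := nsq_nonneg (F 2)
  unfold energy; linarith

/-- Expanding the squares, the cross terms give `-2/4` and the three quadratic terms `3/16` of the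
squared norm of the defect. -/
theorem energy_rotate (F : Fin 3 → GSpace M) :
    energy (rotate F) = energy F - 5 / 16 * nsq (defect F) := by
  obtain ⟨h0, h1, h2⟩ := rotate_eq F
  have h : nsq (defect F) = ip (F 0) (defect F) - ip (F 1) (defect F) - ip (F 2) (defect F) := by
    rw [nsq_eq_ip]
    nth_rw 1 [defect]
    rw [ip_add_left, ip_add_left, ip_smul_left, ip_smul_left]; ring
  simp only [energy, h0, h1, h2, nsq_add, nsq_smul, ip_smul_right]
  linarith

/-- Triples whose components correspond to each other under the Fourier transform. -/
def IsFourierSymm (F : Fin 3 → GSpace M) : Prop := fourier (F 0) = F 0 ∧ fourier (F 1) = F 2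

theorem IsFourierSymm.rotate {F : Fin 3 → GSpace M} (h : IsFourierSymm F) :
    IsFourierSymm (rotate F) := by
  obtain ⟨h0, h1, h2⟩ := rotate_eq F
  have h3 : fourier (F 2) = F 1 := by rw [← h.2, fourier_fourier]
  have hd : fourier (defect F) = defect F := by
    simp only [defect, map_add, map_smul, h.1, h.2, h3]; abel
  constructor
  · rw [h0, map_add, map_smul, hd, h.1]
  · rw [h1, h2, map_add, map_smul, hd, h.2]

theorem IsFourierSymm.damp {F : Fin 3 → GSpace M} (h : IsFourierSymm F) (v : ℝ≥0)
    (η : Fin M → ℂ) (j : Fin M) : IsFourierSymm (damp v η j F) := by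
  constructor
  · simp [QumodeVQC.damp, h.1]
  · simp [QumodeVQC.damp, fourier_mult, h.2]

theorem isFourierSymm_initial (η : Fin M → ℂ) : IsFourierSymm (initial η) := by
  constructor
  · simp only [initial, Matrix.cons_val_zero, fourier_single]
    rfl
  · simp [initial]

theorem IsFourierSymm.evolve {F : Fin 3 → GSpace M} (h : IsFourierSymm F) (v : ℝ≥0)
    (η : Fin M → ℂ) (l : List (Fin M)) : IsFourierSymm (evolve v η l F) := by
  induction l using List.reverseRecOn with
  | nil => exact h
  | append_singleton l j ih => rw [evolve_concat]; exact ih.rotate.damp v η j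

/-- Convolution on the third component is the Fourier image of multiplication on the second, so both
lose the same amount; hence the factor `2`. -/
theorem energy_damp {F : Fin 3 → GSpace M} (h : IsFourierSymm F) (v : ℝ≥0) (η : Fin M → ℂ)
    (j : Fin M) : energy F - energy (damp v η j F) =
      (1 - Real.exp (-(2 * v) * ‖η j‖ ^ 2)) * nsq (F 0) + 2 * quad (lossWeight v j) (F 1) := by
  have h1 : Real.exp (-v * ‖η j‖ ^ 2) ^ 2 = Real.exp (-(2 * v) * ‖η j‖ ^ 2) := by
    rw [← Real.exp_nat_mul]; congr 1; push_cast; ring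
  have h2 : nsq (F 2) = nsq (F 1) := by rw [← h.2, nsq_fourier]
  have h3 : nsq (conv v j (F 2)) = nsq (mult v j (F 1)) := by
    rw [← h.2, ← fourier_mult, nsq_fourier]
  have e : energy (damp v η j F) = nsq (Real.exp (-v * ‖η j‖ ^ 2) • F 0) + nsq (mult v j (F 1)) +
    nsq (conv v j (F 2)) := rfl
  rw [e, energy, h3, h2, nsq_smul, h1, (nsq_mult v j (F 1)).1]
  ring

end Quadratic

/-! ### Loss of energy within one layer -/

section Layers

variable {M : ℕ}

theorem evolve_cons (v : ℝ≥0) (η : Fin M → ℂ) (j : Fin M) (l : List (Fin M))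
    (F : Fin 3 → GSpace M) : evolve v η (j :: l) F = evolve v η l (damp v η j (rotate F)) := rfl

theorem evolve_append (v : ℝ≥0) (η : Fin M → ℂ) (l l' : List (Fin M)) (F : Fin 3 → GSpace M) :
    evolve v η (l ++ l') F = evolve v η l' (evolve v η l F) := by
  simp [evolve]

theorem energy_block {F : Fin 3 → GSpace M} (h : IsFourierSymm F) (v : ℝ≥0) (η : Fin M → ℂ)
    (j : Fin M) : energy F - energy (damp v η j (rotate F)) = 5 / 16 * nsq (defect F) +
      (1 - Real.exp (-(2 * v) * ‖η j‖ ^ 2)) * nsq (rotate F 0) +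
        2 * quad (lossWeight v j) (rotate F 1) := by
  have h1 := energy_damp h.rotate v η j
  rw [energy_rotate] at h1
  linarith

theorem one_sub_exp_mem (v : ℝ≥0) (x : ℝ) :
    0 ≤ 1 - Real.exp (-(2 * v) * x ^ 2) ∧ 1 - Real.exp (-(2 * v) * x ^ 2) ≤ 1 := by
  have h1 : Real.exp (-(2 * v) * x ^ 2) ≤ 1 := by
    rw [Real.exp_le_one_iff, neg_mul]; exact neg_nonpos.2 (by positivity)
  have h2 := Real.exp_nonneg (-(2 * v) * x ^ 2)
  constructor <;> linarith

/-- What the components of a triple lose in a sequence of blocks is controlled by the drop of the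
energy. -/
theorem layer_bounds (v : ℝ≥0) (η : Fin M → ℂ) (l : List (Fin M)) {F : Fin 3 → GSpace M}
    (h : IsFourierSymm F) :
    energy (evolve v η l F) ≤ energy F ∧
    (l ≠ [] → 5 / 16 * nsq (defect F) ≤ energy F - energy (evolve v η l F)) ∧
    ∀ k ∈ l, quad (lossWeight v k) (F 1) ≤
        2 ^ l.length * (energy F - energy (evolve v η l F)) ∧
      (1 - Real.exp (-(2 * v) * ‖η k‖ ^ 2)) * nsq (F 0) ≤
        2 ^ l.length * (energy F - energy (evolve v η l F)) := by
  induction l generalizing F with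
  | nil => simp [evolve]
  | cons j l ih =>
    have hdrop := energy_block h v η j
    obtain ⟨h0, h1, -⟩ := rotate_eq F
    obtain ⟨ih1, -, ih3⟩ := ih (h.rotate.damp v η j)
    rw [evolve_cons]
    set H := damp v η j (rotate F)
    set e := Real.exp (-v * ‖η j‖ ^ 2)
    have he2 : e ^ 2 = Real.exp (-(2 * v) * ‖η j‖ ^ 2) := by
      rw [← Real.exp_nat_mul]; congr 1; push_cast; ring
    have he0 : 0 ≤ e := Real.exp_nonneg _
    have he1 : e ≤ 1 := by
      rw [Real.exp_le_one_iff, neg_mul]; exact neg_nonpos.2 (by positivity)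
    set q := defect F
    set G0 := rotate F 0
    set G1 := rotate F 1
    have hH0 : H 0 = e • G0 := rfl
    have hH1 : H 1 = mult v j G1 := rfl
    have hq := nsq_nonneg q
    have hG0 := nsq_nonneg G0
    have hw := isWeight_lossWeight v j
    have hG1 := hw.quad_nonneg G1
    have hmem := one_sub_exp_mem v ‖η j‖
    have hprod := mul_nonneg hmem.1 hG0
    set δ := energy F - energy H
    set δ' := energy H - energy (evolve v η l H)
    have hδ' : 0 ≤ δ' := by simp only [δ']; linarith
    have hδ : 0 ≤ δ := by linarith
    have hsum : energy F - energy (evolve v η l H) = δ + δ' := by simp only [δ, δ']; ring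
    rw [hsum]
    have hF0 : F 0 = G0 + (1 / 4 : ℝ) • q := by rw [h0]; module
    have hF1 : F 1 = G1 + (-(1 / 4) : ℝ) • q := by rw [h1]; module
    refine ⟨by linarith, fun _ => by linarith, fun k hk => ?_⟩
    have hpow : (1 : ℝ) ≤ 2 ^ l.length := one_le_pow₀ (by norm_num)
    rw [List.length_cons, pow_succ]
    -- If the first block acts on mode `k`, the rotated component loses the weighted mass directly
    -- and differs from `F` by a quarter of the defect, itself charged to the drop. Otherwise the
    -- estimate for the later blocks is carried back through the first one, and `‖x + y‖² ≤ 2‖x‖² +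
    -- 2‖y‖²` doubles the constant; hence `2 ^ l.length`.
    rcases List.mem_cons.1 hk with rfl | hk
    · constructor
      · have := hw.quad_add_le G1 ((-(1 / 4) : ℝ) • q)
        rw [← hF1, quad_smul] at this
        have h3 := hw.quad_le_nsq q
        have : quad (lossWeight v k) (F 1) ≤ 2 * δ := by linarith
        nlinarith
      · have := nsq_add_le G0 ((1 / 4 : ℝ) • q)
        rw [← hF0, nsq_smul] at this
        have h3 := mul_le_mul_of_nonneg_left this hmem.1
        have h4 := mul_le_mul_of_nonneg_right hmem.2 hq
        have : (1 - Real.exp (-(2 * v) * ‖η k‖ ^ 2)) * nsq (F 0) ≤ 2 * δ := by linarith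
        nlinarith
    · have hlen : (2 : ℝ) ≤ 2 ^ l.length := by
        have : 1 ≤ l.length := List.length_pos_of_mem hk
        calc (2 : ℝ) = 2 ^ 1 := by norm_num
          _ ≤ _ := pow_le_pow_right₀ (by norm_num) this
      obtain ⟨ih4, ih5⟩ := ih3 k hk
      constructor
      · have e1 : F 1 = H 1 + ((-(1 / 4) : ℝ) • q + (G1 + (-1 : ℝ) • mult v j G1)) := by
          rw [hF1, hH1]; module
        have e2 := (isWeight_lossWeight v k).quad_add_le (H 1)
          ((-(1 / 4) : ℝ) • q + (G1 + (-1 : ℝ) • mult v j G1))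
        rw [← e1] at e2
        have e3 := (isWeight_lossWeight v k).quad_le_nsq
          ((-(1 / 4) : ℝ) • q + (G1 + (-1 : ℝ) • mult v j G1))
        have e4 := nsq_add_le ((-(1 / 4) : ℝ) • q) (G1 + (-1 : ℝ) • mult v j G1)
        rw [nsq_smul] at e4
        have e5 := (nsq_mult v j G1).2
        have : quad (lossWeight v k) (F 1) ≤ 2 * (2 ^ l.length * δ') + 2 * δ := by linarith
        nlinarith
      · have e1 : F 0 = H 0 + ((1 / 4 : ℝ) • q + (1 - e) • G0) := by
          rw [hF0, hH0]; module
        have e2 := nsq_add_le (H 0) ((1 / 4 : ℝ) • q + (1 - e) • G0)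
        rw [← e1] at e2
        have e4 := nsq_add_le ((1 / 4 : ℝ) • q) ((1 - e) • G0)
        rw [nsq_smul, nsq_smul] at e4
        have e5 : (1 - e) ^ 2 * nsq G0 ≤ (1 - Real.exp (-(2 * v) * ‖η j‖ ^ 2)) * nsq G0 := by
          refine mul_le_mul_of_nonneg_right ?_ hG0
          rw [← he2]; nlinarith
        have hk' := one_sub_exp_mem v ‖η k‖
        have e6 : nsq (F 0) ≤ 2 * nsq (H 0) + 4 * δ := by linarith
        have e7 := mul_le_mul_of_nonneg_left e6 hk'.1
        have e8 := mul_le_mul_of_nonneg_right hk'.2 hδ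
        have : (1 - Real.exp (-(2 * v) * ‖η k‖ ^ 2)) * nsq (F 0) ≤
            2 * (2 ^ l.length * δ') + 4 * δ := by linarith
        nlinarith

end Layers

/-! ### The Nash inequality -/

section Nash

variable {M : ℕ}

theorem half_min_le_one_sub_exp {x : ℝ} (hx : 0 ≤ x) : min 1 x / 2 ≤ 1 - Real.exp (-x) := by
  have h1 : Real.exp (-x) ≤ Real.exp (-(min 1 x)) := Real.exp_le_exp.2 (by simp)
  set y := min 1 x
  have hy0 : 0 ≤ y := le_min zero_le_one hx
  have hy1 : y ≤ 1 := min_le_left _ _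
  have h2 := Real.add_one_le_exp y
  have h3 : Real.exp (-y) * (1 + y) ≤ 1 := by
    rw [Real.exp_neg, inv_mul_le_iff₀ (Real.exp_pos y)]; linarith
  have h4 := Real.exp_nonneg (-y)
  nlinarith

/-- The component `0` is the defect plus the other two, which have equal norms. -/
theorem energy_le_of_isFourierSymm {F : Fin 3 → GSpace M} (h : IsFourierSymm F) :
    energy F ≤ 2 * nsq (defect F) + 10 * nsq (F 1) := by
  have e : F 0 = defect F + (F 1 + F 2) := by rw [defect]; module
  have h1 := nsq_add_le (defect F) (F 1 + F 2)
  have h2 := nsq_add_le (F 1) (F 2)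
  have h3 : nsq (F 2) = nsq (F 1) := by rw [← h.2, nsq_fourier]
  rw [← e] at h1
  unfold energy
  linarith

/-- Phase space is split at `|ζ_j|² ≤ ρ` for all `j`. Inside, the uniform bound `2` times a volume
of order `ρ^M` suffices; the indicator of this region is replaced by the larger `e^M exp(-|ζ|² /
ρ)`, which has a closed integral. Outside, some mode loses at least the fraction `min 1 (v ρ) / 2`.
-/
theorem nsq_le_nash {v : ℝ≥0} (hv : 0 < v) {f : GSpace M} (hf : ∀ ζ, |ev ζ f| ≤ 2) {ρ : ℝ}
    (hρ : 0 < ρ) : nsq f ≤ 4 * (Real.exp 1 * Real.pi * ρ) ^ M +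
      2 / min 1 (v * ρ) * ∑ j, quad (lossWeight v j) f := by
  have hv' : (0 : ℝ) < v := by exact_mod_cast hv
  have hm : 0 < min 1 (v * ρ) := lt_min one_pos (by positivity)
  have hpt : ∀ ζ : Fin M → ℂ, ev ζ f ^ 2 ≤ 4 * Real.exp 1 ^ M *
      Real.exp (-(1 / ρ) * normSqSum ζ) +
        2 / min 1 (v * ρ) * ∑ j, lossWeight v j ζ * ev ζ f ^ 2 := by
    intro ζ
    have hs : ∀ j, 0 ≤ lossWeight v j ζ * ev ζ f ^ 2 := fun j =>
      mul_nonneg ((isWeight_lossWeight v j).nonneg ζ) (sq_nonneg _)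
    have hS : 0 ≤ ∑ j, lossWeight v j ζ * ev ζ f ^ 2 := Finset.sum_nonneg fun j _ => hs j
    by_cases hb : ∀ j, ‖ζ j‖ ^ 2 ≤ ρ
    · have h1 : normSqSum ζ ≤ M * ρ := by
        refine (Finset.sum_le_sum fun j _ => hb j).trans_eq (by simp)
      have h2 : 1 ≤ Real.exp 1 ^ M * Real.exp (-(1 / ρ) * normSqSum ζ) := by
        rw [← Real.exp_nat_mul, ← Real.exp_add, Real.one_le_exp_iff]
        have : 1 / ρ * normSqSum ζ ≤ M := by
          rw [one_div_mul_eq_div, div_le_iff₀ hρ]; exact h1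
        linarith
      have h3 : ev ζ f ^ 2 ≤ 4 := by
        have := pow_le_pow_left₀ (abs_nonneg _) (hf ζ) 2
        rw [sq_abs] at this; linarith
      have h4 : 0 ≤ 2 / min 1 (v * ρ) * ∑ j, lossWeight v j ζ * ev ζ f ^ 2 := by positivity
      nlinarith
    · push Not at hb
      obtain ⟨j, hj⟩ := hb
      have h1 : min 1 (v * ρ) / 2 ≤ lossWeight v j ζ := by
        refine le_trans ?_ ((half_min_le_one_sub_exp (by positivity : 0 ≤ 8 * v * ‖ζ j‖ ^ 2)).trans_eq ?_)
        · refine div_le_div_of_nonneg_right (min_le_min le_rfl ?_) (by norm_num)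
          nlinarith
        · rw [lossWeight]; congr 2; ring
      have h2 : ev ζ f ^ 2 ≤ 2 / min 1 (v * ρ) * (lossWeight v j ζ * ev ζ f ^ 2) := by
        rw [← mul_assoc]
        refine le_mul_of_one_le_left (sq_nonneg _) ?_
        rw [div_mul_eq_mul_div, le_div_iff₀ hm]; linarith
      have h3 := Finset.single_le_sum (fun i _ => hs i) (Finset.mem_univ j)
      refine h2.trans ((mul_le_mul_of_nonneg_left h3 (by positivity)).trans ?_)
      exact le_add_of_nonneg_left (by positivity)
  have i1 : Integrable fun ζ : Fin M → ℂ => 4 * Real.exp 1 ^ M *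
      Real.exp (-(1 / ρ) * normSqSum ζ) :=
    (integrable_exp_neg_mul_normSqSum (by positivity)).const_mul _
  have i2 : Integrable fun ζ => ∑ j, lossWeight v j ζ * ev ζ f ^ 2 :=
    integrable_finsetSum _ fun j _ => (isWeight_lossWeight v j).integrable f
  refine (integral_mono (integrable_ev_sq f) (i1.add (i2.const_mul _)) hpt).trans_eq ?_
  rw [integral_add' i1 (i2.const_mul _), integral_const_mul, integral_const_mul,
    integral_finsetSum _ fun j _ => (isWeight_lossWeight v j).integrable f,
    integral_exp_neg_mul_normSqSum (by positivity)]
  simp only [quad]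
  congr 1
  rw [mul_assoc, ← mul_pow]
  congr 2
  field_simp

/-- A Nash inequality: the energy drops in every layer unless it is small. -/
theorem exists_energy_le_nash (M : ℕ) : ∃ C : ℝ, 1 ≤ C ∧ ∀ {v : ℝ≥0}, 0 < v →
    ∀ (η : Fin M → ℂ) (l : List (Fin M)), l ≠ [] → (∀ j, j ∈ l) → l.length = M →
    ∀ {F : Fin 3 → GSpace M}, IsFourierSymm F → (∀ ζ, |ev ζ (F 1)| ≤ 2) → ∀ {ρ : ℝ}, 0 < ρ →
    energy F ≤ C * (ρ ^ M + (energy F - energy (evolve v η l F)) / min 1 (v * ρ)) := by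
  -- The energy is at most `2` defects plus `10` times the norm of `F 1`. The latter gives `10 · 4`
  -- and `10 · 2 · M 2^M`; the former gives `2 · 16/5 ≤ 7`.
  refine ⟨40 * (Real.exp 1 * Real.pi) ^ M + (7 + 20 * (M * 2 ^ M)), ?_, ?_⟩
  · have : 0 ≤ 40 * (Real.exp 1 * Real.pi) ^ M := by positivity
    have : (0 : ℝ) ≤ 20 * (M * 2 ^ M) := by positivity
    linarith
  intro v hv η l hne hall hlen F hF hb ρ hρ
  obtain ⟨h1, h2, h3⟩ := layer_bounds v η l hF
  have hv' : (0 : ℝ) < v := by exact_mod_cast hv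
  have hm : 0 < min 1 (v * ρ) := lt_min one_pos (by positivity)
  have hm1 : min 1 (v * ρ) ≤ 1 := min_le_left _ _
  have h4 := nsq_le_nash hv hb hρ
  set δ := energy F - energy (evolve v η l F)
  have hδ : 0 ≤ δ := sub_nonneg.2 h1
  have h5 : ∑ j, quad (lossWeight v j) (F 1) ≤ M * (2 ^ M * δ) := by
    refine (Finset.sum_le_sum fun j _ => ?_).trans_eq (b := ∑ j : Fin M, 2 ^ M * δ) (by simp)
    have := (h3 j (hall j)).1
    rwa [hlen] at this
  have h6 := mul_le_mul_of_nonneg_left h5 (by positivity : 0 ≤ 2 / min 1 (v * ρ))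
  have h7 : δ ≤ δ / min 1 (v * ρ) := le_div_self hδ hm hm1
  have h8 := energy_le_of_isFourierSymm hF
  have h9 := h2 hne
  have e1 : 2 / min 1 (v * ρ) * (M * (2 ^ M * δ)) = 2 * (M * 2 ^ M) * (δ / min 1 (v * ρ)) := by
    ring
  have e2 : (Real.exp 1 * Real.pi * ρ) ^ M = (Real.exp 1 * Real.pi) ^ M * ρ ^ M := by
    rw [mul_pow]
  rw [e1] at h6
  rw [e2] at h4
  have hx : 0 ≤ δ / min 1 (v * ρ) := by positivity
  have hy : 0 ≤ ρ ^ M := by positivity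
  have hz : 0 ≤ (Real.exp 1 * Real.pi) ^ M := by positivity
  have hw : (0 : ℝ) ≤ M * 2 ^ M := by positivity
  generalize δ / min 1 (v * ρ) = x at *
  generalize ρ ^ M = y at *
  generalize (Real.exp 1 * Real.pi) ^ M = z at *
  generalize (M * 2 ^ M : ℝ) = w at *
  nlinarith [mul_nonneg hz hx, mul_nonneg hw hy]

end Nash

/-! ### The uncertainty principle and exponential decay -/

section Uncertainty

variable {M : ℕ}

/-- The kernel of the Fourier transform, restricted to functions that are even in each mode. -/
def fourierKernel (x y : ℂ) : ℂ := Complex.exp (2 * Complex.I * (inner ℝ x y : ℝ))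

theorem integral_fourierKernel_gaussFactor (a : ℝ≥0 × ℝ≥0) (x : ℂ) :
    ∫ y : ℂ, fourierKernel x y * (gaussFactor a y : ℂ) = Real.pi * (gaussFactor a.swap x : ℂ) := by
  have hp : (0 : ℝ) < 1 + a.1 := by positivity
  have hr : (0 : ℝ) < 1 + a.2 := by positivity
  have hb : 0 < (((1 + a.2 : ℝ) / (1 + a.1) : ℝ) : ℂ).re := by
    rw [Complex.ofReal_re]; positivity
  have h := GaussianFourier.integral_cexp_neg_mul_sq_norm_add (V := ℂ) hb (2 * Complex.I) x
  have e : ∀ y : ℂ, fourierKernel x y * (gaussFactor a y : ℂ) = ((1 + a.1 : ℝ) : ℂ)⁻¹ *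
      Complex.exp (-(((1 + a.2 : ℝ) / (1 + a.1) : ℝ) : ℂ) * ‖y‖ ^ 2 +
        2 * Complex.I * (inner ℝ x y : ℝ)) := by
    intro y
    rw [fourierKernel, gaussFactor, Complex.exp_add]
    push_cast
    ring
  simp_rw [e]
  rw [integral_const_mul]
  refine (congrArg _ h).trans ?_
  rw [Complex.finrank_real_complex, gaussFactor, mul_pow, Complex.I_sq]
  simp only [Prod.fst_swap, Prod.snd_swap]
  have e2 : ((2 : ℕ) : ℂ) / 2 = 1 := by norm_num
  rw [e2, Complex.cpow_one]
  push_cast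
  have hp' : (1 + a.1 : ℂ) ≠ 0 := by exact_mod_cast hp.ne'
  have hr' : (1 + a.2 : ℂ) ≠ 0 := by exact_mod_cast hr.ne'
  rw [← mul_assoc, ← mul_assoc]
  congr 1
  · field_simp
  · congr 1
    field_simp
    ring

theorem norm_fourierKernel (x y : ℂ) : ‖fourierKernel x y‖ = 1 := by
  have e : (2 : ℂ) * Complex.I * ((inner ℝ x y : ℝ) : ℂ) =
    ((2 * inner ℝ x y : ℝ) : ℂ) * Complex.I := by push_cast; ring
  rw [fourierKernel, e, Complex.norm_exp_ofReal_mul_I]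

/-- Identifies the exchange of parameters with a genuine Fourier integral. It is needed for one
consequence only: the transform is bounded by the `L¹` norm. -/
theorem ev_fourier (f : GSpace M) (x : Fin M → ℂ) :
    (Real.pi : ℂ) ^ M * (ev x (fourier f) : ℂ) =
      ∫ y : Fin M → ℂ, (∏ j, fourierKernel (x j) (y j)) * (ev y f : ℂ) := by
  have hint : ∀ f : GSpace M, Integrable fun y : Fin M → ℂ =>
      (∏ j, fourierKernel (x j) (y j)) * (ev y f : ℂ) := by
    intro f
    refine (integrable_ev f).ofReal.bdd_mul (c := 1) (Continuous.aestronglyMeasurable ?_)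
      (Filter.Eventually.of_forall fun y => ?_)
    · unfold fourierKernel
      exact continuous_finsetProd _ fun j _ => by fun_prop
    · simp [norm_prod, norm_fourierKernel]
  induction f using Finsupp.induction_linear with
  | zero => simp
  | add f g hf hg =>
    simp only [map_add, Complex.ofReal_add, mul_add] at *
    rw [integral_add (hint f) (hint g), hf, hg]
  | single i c =>
    rw [fourier_single, ev_single]
    have e : ∀ y : Fin M → ℂ, (∏ j, fourierKernel (x j) (y j)) *
        (ev y (Finsupp.single i c) : ℂ) =
        c * ∏ j, (fourierKernel (x j) (y j) * (gaussFactor (i j) (y j) : ℂ)) := by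
      intro y
      rw [ev_single, gauss, Finset.prod_mul_distrib]
      push_cast
      ring
    simp_rw [e]
    rw [integral_const_mul, integral_fintype_prod_volume_eq_prod
      (fun j (y : ℂ) => fourierKernel (x j) y * (gaussFactor (i j) y : ℂ))]
    simp_rw [integral_fourierKernel_gaussFactor]
    rw [Finset.prod_mul_distrib, gauss]
    push_cast
    simp only [swapIdx, Finset.prod_const, Finset.card_univ, Fintype.card_fin]
    ring

theorem abs_ev_fourier_le (f : GSpace M) (x : Fin M → ℂ) :
    Real.pi ^ M * |ev x (fourier f)| ≤ ∫ y, |ev y f| := by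
  have h := norm_integral_le_integral_norm (μ := volume)
    fun y : Fin M → ℂ => (∏ j, fourierKernel (x j) (y j)) * (ev y f : ℂ)
  rw [← ev_fourier, norm_mul, norm_pow, Complex.norm_real, Complex.norm_real,
    Real.norm_of_nonneg Real.pi_pos.le, Real.norm_eq_abs] at h
  refine h.trans_eq ?_
  congr 1; funext y
  simp [norm_prod, norm_fourierKernel]

theorem abs_ip_fourier_le (f : GSpace M) :
    Real.pi ^ M * |ip f (fourier f)| ≤ (∫ y, |ev y f|) ^ 2 := by
  have h1 : |ip f (fourier f)| ≤ ∫ x, |ev x f| * |ev x (fourier f)| := by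
    rw [ip]
    refine (abs_integral_le_integral_abs).trans_eq ?_
    simp only [abs_mul]
  have h2 : Real.pi ^ M * ∫ x, |ev x f| * |ev x (fourier f)| ≤
      ∫ x, |ev x f| * ∫ y, |ev y f| := by
    rw [← integral_const_mul]
    refine integral_mono ?_ ((integrable_ev f).abs.mul_const _) fun x => ?_
    · have := (integrable_ev_mul_ev f (fourier f)).abs
      simp only [abs_mul] at this
      exact this.const_mul _
    · simp only []
      rw [mul_left_comm]
      exact mul_le_mul_of_nonneg_left (abs_ev_fourier_le f x) (abs_nonneg _)
  rw [integral_mul_const, ← sq] at h2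
  exact (mul_le_mul_of_nonneg_left h1 (by positivity)).trans h2

/-- Multiplication by the Gaussian `exp (-|ζ|²)`. -/
def localize (f : GSpace M) : GSpace M :=
  (List.finRange M).foldr (fun j g => mult (1 / 4) j g) f

theorem ev_localize (f : GSpace M) (ζ : Fin M → ℂ) :
    ev ζ (localize f) = Real.exp (-normSqSum ζ) * ev ζ f := by
  have h : ∀ l : List (Fin M), ev ζ (l.foldr (fun j g => mult (1 / 4) j g) f) =
      Real.exp (-(l.map fun j => ‖ζ j‖ ^ 2).sum) * ev ζ f := by
    intro l
    induction l with
    | nil => simp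
    | cons j l ih =>
      rw [List.foldr_cons, ev_mult, ih, List.map_cons, List.sum_cons, neg_add, Real.exp_add]
      push_cast
      rw [← mul_assoc]
      congr 3
      ring
  rw [localize, h, normSqSum, ← List.ofFn_eq_map, List.sum_ofFn]

/-- The fraction of a density outside the unit ball. -/
def tailWeight (ζ : Fin M → ℂ) : ℝ := 1 - Real.exp (-2 * normSqSum ζ)

theorem isWeight_tailWeight : IsWeight (tailWeight (M := M)) := by
  refine ⟨by unfold tailWeight; fun_prop, fun ζ => ?_, fun ζ => ?_⟩
  · have : Real.exp (-2 * normSqSum ζ) ≤ 1 := by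
      have := normSqSum_nonneg ζ
      rw [Real.exp_le_one_iff]; linarith
    unfold tailWeight; linarith
  · have := Real.exp_nonneg (-2 * normSqSum ζ)
    unfold tailWeight; linarith

theorem nsq_localize (f : GSpace M) : nsq (localize f) ≤ nsq f ∧
    nsq (f + (-1 : ℝ) • localize f) ≤ quad tailWeight f := by
  have key : ∀ ζ : Fin M → ℂ, 0 ≤ Real.exp (-normSqSum ζ) ∧ Real.exp (-normSqSum ζ) ≤ 1 :=
    fun ζ => ⟨Real.exp_nonneg _, by
      have := normSqSum_nonneg ζ
      rw [Real.exp_le_one_iff]; linarith⟩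
  constructor
  · refine integral_mono (integrable_ev_sq _) (integrable_ev_sq _) fun ζ => ?_
    simp only []
    rw [ev_localize, mul_pow]
    exact mul_le_of_le_one_left (sq_nonneg _) (pow_le_one₀ (key ζ).1 (key ζ).2)
  · refine integral_mono (integrable_ev_sq _) (isWeight_tailWeight.integrable f) fun ζ => ?_
    have h2 : Real.exp (-2 * normSqSum ζ) = Real.exp (-normSqSum ζ) ^ 2 := by
      rw [← Real.exp_nat_mul]; congr 1; push_cast; ring
    simp only [map_add, map_smul, ev_localize, smul_eq_mul, tailWeight, h2]
    obtain ⟨h0, h1⟩ := key ζ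
    generalize Real.exp (-normSqSum ζ) = t at *
    have := mul_nonneg (mul_nonneg h0 (sub_nonneg.2 h1)) (sq_nonneg (ev ζ f))
    nlinarith

/-- The squared `L¹` norm of the localized function is at most `(π/2)^M` times the squared `L²`
norm, by Cauchy–Schwarz against the Gaussian. The bound of the transform by the `L¹` norm carries
`π^(-M)`, so the factor `2^(-M) ≤ 1/2` remains since `M ≥ 1`. -/
theorem abs_ip_localize_le (hM : 1 ≤ M) (f : GSpace M) :
    |ip (localize f) (fourier (localize f))| ≤ nsq f / 2 := by
  have h1 := abs_ip_fourier_le (localize f)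
  have h2 : (∫ y, |ev y (localize f)|) ^ 2 ≤ (Real.pi / 2) ^ M * nsq f := by
    have hi : Integrable fun y : Fin M → ℂ => Real.exp (-2 * normSqSum y) :=
      integrable_exp_neg_mul_normSqSum (by norm_num)
    have hI := integral_exp_neg_mul_normSqSum (M := M) (a := 2) (by norm_num)
    have hf := nsq_nonneg f
    set A : ℝ := (Real.pi / 2) ^ M
    have hA : 0 < A := by positivity
    set I := ∫ y, |ev y (localize f)|
    have hI0 : 0 ≤ I := integral_nonneg fun y => abs_nonneg _
    -- Cauchy–Schwarz in quadratic form; the optimal value is `t = I / A`.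
    have h3 : ∀ t : ℝ, 2 * t * I ≤ t ^ 2 * A + nsq f := by
      intro t
      rw [← hI, nsq, ← integral_const_mul, ← integral_const_mul, ← integral_add
        (hi.const_mul _) (integrable_ev_sq f)]
      refine integral_mono ((integrable_ev _).abs.const_mul _)
        ((hi.const_mul _).add (integrable_ev_sq f)) fun y => ?_
      have h2 : Real.exp (-2 * normSqSum y) = Real.exp (-normSqSum y) ^ 2 := by
        rw [← Real.exp_nat_mul]; congr 1; push_cast; ring
      rw [h2, ev_localize, abs_mul, abs_of_nonneg (Real.exp_nonneg _), ← sq_abs (ev y f)]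
      nlinarith [sq_nonneg (t * Real.exp (-normSqSum y) - |ev y f|)]
    have h4 := h3 (I / A)
    have e1 : 2 * (I / A) * I = 2 * (I ^ 2 / A) := by ring
    have e2 : (I / A) ^ 2 * A = I ^ 2 / A := by field_simp
    rw [e1, e2] at h4
    have h5 : I ^ 2 / A ≤ nsq f := by linarith
    rwa [div_le_iff₀' hA] at h5
  have hpi : (0 : ℝ) < Real.pi ^ M := by positivity
  have h3 := h1.trans h2
  rw [div_pow, div_mul_eq_mul_div, mul_div_assoc] at h3
  have h4 := le_of_mul_le_mul_left h3 hpi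
  refine h4.trans (div_le_div_of_nonneg_left (nsq_nonneg f) (by norm_num) ?_)
  calc (2 : ℝ) = 2 ^ 1 := by norm_num
    _ ≤ 2 ^ M := pow_le_pow_right₀ (by norm_num) hM

/-- Two mutually Fourier transformed functions cannot both be concentrated and nearly opposite. -/
theorem nsq_le_uncertainty (hM : 1 ≤ M) {F : Fin 3 → GSpace M} (h : IsFourierSymm F) :
    nsq (F 1) ≤ 4 * nsq (F 0) + 4 * nsq (defect F) + 16 * quad tailWeight (F 1) := by
  set d := F 1
  have hd2 : F 2 = fourier d := h.2.symm
  have h1 : nsq (d + fourier d) ≤ 2 * nsq (F 0) + 2 * nsq (defect F) := by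
    have e : d + fourier d = F 0 + (-1 : ℝ) • defect F := by rw [defect, hd2]; module
    have := nsq_add_le (F 0) ((-1 : ℝ) • defect F)
    rw [nsq_smul, ← e] at this
    linarith
  rw [nsq_add, nsq_fourier] at h1
  set m := localize d
  set t := d + (-1 : ℝ) • m
  have ed : d = m + t := by simp only [t]; module
  -- If `d + fourier d` is small, the inner product of `d` with its transform is close to `-nsq d`.
  -- The localized part can contribute at most half of that, so the remaining part `t`, controlled
  -- by the tail, cannot be small.
  have e2 : ip d (fourier d) = ip m (fourier m) + ip m (fourier t) + ip t (fourier d) := by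
    nth_rw 1 [ed]
    rw [ip_add_left]
    congr 1
    rw [← ip_add_right, ← map_add, ← ed]
  have h3 := abs_ip_localize_le hM d
  obtain ⟨h4, h5⟩ := nsq_localize d
  -- The weights `1/8` and `2` leave the two cross terms a total of `1/4` of `nsq d`; with the `1/2`
  -- from the localized part this is `3/4`, and the missing quarter gives the constants `4`, `4` and
  -- `16`.
  have key : ∀ f g : GSpace M, |ip f (fourier g)| ≤ nsq f / 8 + 2 * nsq g := by
    intro f g
    have := abs_ip_le ((1 / 2 : ℝ) • f) ((2 : ℝ) • fourier g)
    rw [ip_smul_left, ip_smul_right, nsq_smul, nsq_smul, nsq_fourier] at this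
    have e : (1 / 2 : ℝ) * (2 * ip f (fourier g)) = ip f (fourier g) := by ring
    rw [e] at this
    linarith
  have h6 := abs_le.1 (key m t)
  have h7 := abs_le.1 (key d t)
  have h8 : ip t (fourier d) = ip d (fourier t) := by rw [ip_comm, ip_fourier_left]
  have h9 := abs_le.1 h3
  rw [h8] at e2
  change nsq m ≤ nsq d at h4
  change nsq t ≤ _ at h5
  linarith [h6.1, h7.1, h9.1]

/-- Convexity of the exponential between `-2x` and `0`, with weight `min 1 v`. -/
theorem min_mul_one_sub_exp_le {v x : ℝ} (hv : 0 ≤ v) (hx : 0 ≤ x) :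
    min 1 v * (1 - Real.exp (-2 * x)) ≤ 1 - Real.exp (-(8 * v) * x) := by
  set u := min 1 v
  have hu0 : 0 ≤ u := le_min zero_le_one hv
  have hu1 : u ≤ 1 := min_le_left _ _
  have huv : u ≤ v := min_le_right _ _
  have h1 : Real.exp (-(8 * v) * x) ≤ Real.exp (u * (-2 * x)) :=
    Real.exp_le_exp.2 (by nlinarith [mul_nonneg hv hx, mul_le_mul_of_nonneg_right huv hx])
  have h2 := convexOn_exp.2 (Set.mem_univ (-2 * x)) (Set.mem_univ 0) hu0 (sub_nonneg.2 hu1)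
    (by ring)
  simp only [smul_eq_mul, mul_zero, add_zero, Real.exp_zero, mul_one] at h2
  linarith

theorem one_sub_prod_le_sum {ι : Type*} (s : Finset ι) (t : ι → ℝ) (h0 : ∀ i, 0 ≤ t i)
    (h1 : ∀ i, t i ≤ 1) : 1 - ∏ i ∈ s, t i ≤ ∑ i ∈ s, (1 - t i) := by
  classical
  induction s using Finset.induction_on with
  | empty => simp
  | insert a s ha ih =>
    rw [Finset.prod_insert ha, Finset.sum_insert ha]
    have hp : ∏ i ∈ s, t i ≤ 1 := Finset.prod_le_one (fun i _ => h0 i) fun i _ => h1 i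
    nlinarith [h0 a, h1 a]

/-- The energy drops at a rate given by the difference coordinate. -/
theorem exists_energy_le_uncertainty (M : ℕ) (hM : 1 ≤ M) : ∃ C : ℝ, 1 ≤ C ∧ ∀ {v : ℝ≥0}, 0 < v →
    ∀ (η : Fin M → ℂ) (l : List (Fin M)), l ≠ [] → (∀ j, j ∈ l) → l.length = M →
    ∀ {F : Fin 3 → GSpace M}, IsFourierSymm F →
    min 1 (min (v : ℝ) (v * normSqSum η)) * energy F ≤ C * (energy F - energy (evolve v η l F)) := by
  -- Inserting the uncertainty bound, the energy is at most `42` defects, `40` times the norm of `F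
  -- 0` and `160` times the tail. The drop controls the defect with `16/5 ≤ 4`, and after
  -- multiplication by the rate the norm of `F 0` with `2 M 2^M` and the tail with `M 2^M`.
  refine ⟨(2 + 10 * 4) * 4 + (10 * 16 + 10 * 8) * (M * 2 ^ M), ?_, ?_⟩
  · have : (0 : ℝ) ≤ (10 * 16 + 10 * 8) * (M * 2 ^ M) := by positivity
    linarith
  intro v hv η l hne hall hlen F hF
  obtain ⟨h1, h2, h3⟩ := layer_bounds v η l hF
  have hv' : (0 : ℝ) < v := by exact_mod_cast hv
  have hη := normSqSum_nonneg η
  set δ := energy F - energy (evolve v η l F)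
  have hδ : 0 ≤ δ := sub_nonneg.2 h1
  set μ := min 1 (min (v : ℝ) (v * normSqSum η))
  have hμ0 : 0 ≤ μ := le_min zero_le_one (le_min hv'.le (by positivity))
  have hμ1 : μ ≤ 1 := min_le_left _ _
  have hμv : μ ≤ min 1 (v : ℝ) := le_min hμ1 ((min_le_right _ _).trans (min_le_left _ _))
  have hμη : μ ≤ min 1 (v * normSqSum η) :=
    le_min hμ1 ((min_le_right _ _).trans (min_le_right _ _))
  rw [hlen] at h3
  have hB : μ * quad tailWeight (F 1) ≤ M * (2 ^ M * δ) := by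
    have hpt : ∀ ζ : Fin M → ℂ, μ * tailWeight ζ ≤ ∑ j, lossWeight v j ζ := by
      intro ζ
      have e1 : tailWeight ζ ≤ ∑ j, (1 - Real.exp (-2 * ‖ζ j‖ ^ 2)) := by
        rw [tailWeight, exp_neg_mul_normSqSum]
        exact one_sub_prod_le_sum _ _ (fun j => Real.exp_nonneg _) fun j => by
          rw [Real.exp_le_one_iff]; nlinarith [sq_nonneg ‖ζ j‖]
      refine (mul_le_mul hμv e1 (isWeight_tailWeight.nonneg ζ) (le_min zero_le_one hv'.le)).trans ?_
      rw [Finset.mul_sum]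
      exact Finset.sum_le_sum fun j _ => min_mul_one_sub_exp_le hv'.le (sq_nonneg _)
    have e2 : μ * quad tailWeight (F 1) ≤ ∑ j, quad (lossWeight v j) (F 1) := by
      simp only [quad]
      rw [← integral_const_mul, ← integral_finsetSum _ fun j _ =>
        (isWeight_lossWeight v j).integrable (F 1)]
      refine integral_mono ((isWeight_tailWeight.integrable (F 1)).const_mul μ)
        (integrable_finsetSum _ fun j _ => (isWeight_lossWeight v j).integrable (F 1)) fun ζ => ?_
      simp only []
      rw [← Finset.sum_mul, ← mul_assoc]
      exact mul_le_mul_of_nonneg_right (hpt ζ) (sq_nonneg _)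
    refine e2.trans ((Finset.sum_le_sum fun j _ => (h3 j (hall j)).1).trans_eq ?_)
    simp
  have hS : μ * nsq (F 0) ≤ 2 * (M * (2 ^ M * δ)) := by
    have e1 : min 1 (v * normSqSum η) / 2 ≤ ∑ j, (1 - Real.exp (-(2 * v) * ‖η j‖ ^ 2)) := by
      have e2 := half_min_le_one_sub_exp (by positivity : 0 ≤ 2 * v * normSqSum η)
      have e3 : min 1 (v * normSqSum η) ≤ min 1 (2 * v * normSqSum η) :=
        min_le_min le_rfl (by nlinarith [mul_nonneg hv'.le hη])
      have e4 : 1 - Real.exp (-(2 * v * normSqSum η)) ≤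
          ∑ j, (1 - Real.exp (-(2 * v) * ‖η j‖ ^ 2)) := by
        rw [← neg_mul, exp_neg_mul_normSqSum]
        exact one_sub_prod_le_sum _ _ (fun j => Real.exp_nonneg _) fun j => by
          have := (one_sub_exp_mem v ‖η j‖).1
          linarith
      linarith
    have e5 := mul_le_mul_of_nonneg_right e1 (nsq_nonneg (F 0))
    rw [Finset.sum_mul] at e5
    have e6 := e5.trans ((Finset.sum_le_sum fun j _ => (h3 j (hall j)).2).trans_eq
      (by simp : ∑ j : Fin M, 2 ^ M * δ = M * (2 ^ M * δ)))
    have e7 := mul_le_mul_of_nonneg_right hμη (nsq_nonneg (F 0))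
    linarith
  have h4 := energy_le_of_isFourierSymm hF
  have h5 := nsq_le_uncertainty hM hF
  have h6 := h2 hne
  have hq := nsq_nonneg (defect F)
  have hq' := mul_le_mul_of_nonneg_right hμ1 hq
  have h7 : energy F ≤ (2 + 10 * 4) * nsq (defect F) + 10 * 4 * nsq (F 0) +
      10 * 16 * quad tailWeight (F 1) := by linarith
  have h8 := mul_le_mul_of_nonneg_left h7 hμ0
  have h9 : μ * ((2 + 10 * 4) * nsq (defect F) + 10 * 4 * nsq (F 0) +
      10 * 16 * quad tailWeight (F 1)) = (2 + 10 * 4) * (μ * nsq (defect F)) +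
      10 * 4 * (μ * nsq (F 0)) + 10 * 16 * (μ * quad tailWeight (F 1)) := by ring
  rw [h9] at h8
  linarith

end Uncertainty

/-! ### Decay of the energy over many layers -/

section Sequences

/-- A sequence growing geometrically up to `v` and linearly beyond. -/
def growth (κ v : ℝ) : ℕ → ℝ
  | 0 => 1
  | n + 1 => growth κ v n + κ * min (growth κ v n) v

variable {κ v : ℝ}

theorem growth_pos (hκ : 0 < κ) (hv : 0 < v) (n : ℕ) : 0 < growth κ v n := by
  induction n with
  | zero => exact one_pos
  | succ n ih =>
    have : 0 < min (growth κ v n) v := lt_min ih hv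
    rw [growth]; positivity

theorem growth_mono (hκ : 0 < κ) (hv : 0 < v) : Monotone (growth κ v) :=
  monotone_nat_of_le_succ fun n => by
    have : 0 < min (growth κ v n) v := lt_min (growth_pos hκ hv n) hv
    rw [growth]
    exact le_add_of_nonneg_right (by positivity)

theorem min_pow_le_growth (hκ : 0 < κ) (hv : 0 < v) (n : ℕ) :
    min ((1 + κ) ^ n) v ≤ growth κ v n := by
  induction n with
  | zero => simp [growth]
  | succ n ih =>
    rcases le_total v (growth κ v n) with h | h
    · exact (min_le_right _ _).trans (h.trans (growth_mono hκ hv n.le_succ))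
    · rw [growth, min_eq_left h]
      have hpow : 0 < (1 + κ) ^ n := by positivity
      rcases le_total ((1 + κ) ^ n) v with h' | h'
      · rw [min_eq_left h'] at ih
        refine (min_le_left _ _).trans ?_
        rw [pow_succ]
        nlinarith
      · rw [min_eq_right h'] at ih
        refine (min_le_right _ _).trans (ih.trans ?_)
        exact le_add_of_nonneg_right (mul_pos hκ (growth_pos hκ hv n)).le

theorem min_le_growth_add (hκ : 0 < κ) (hv : 0 < v) (n k : ℕ) :
    min ((1 + κ) ^ n) (k * (κ * v)) ≤ growth κ v (n + k) := by
  have h := min_pow_le_growth hκ hv n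
  rcases le_total ((1 + κ) ^ n) v with h' | h'
  · rw [min_eq_left h'] at h
    exact (min_le_left _ _).trans (h.trans (growth_mono hκ hv (Nat.le_add_right _ _)))
  · rw [min_eq_right h'] at h
    refine (min_le_right _ _).trans ?_
    have : ∀ k : ℕ, v + k * (κ * v) ≤ growth κ v (n + k) := by
      intro k
      induction k with
      | zero => simpa using h
      | succ k ih =>
        rw [← add_assoc, growth, min_eq_right]
        · push_cast; linarith
        · exact h.trans (growth_mono hκ hv (Nat.le_add_right _ _))
    exact le_trans (by linarith) (this k)

/-- Algebraic decay from a Nash inequality. -/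
theorem le_div_growth_pow {W : ℕ → ℝ} {C : ℝ} {M : ℕ} (hM : 1 ≤ M) (hC : 1 ≤ C) (hv : 0 < v)
    (hanti : ∀ n, W (n + 1) ≤ W n) (h0 : W 0 ≤ 2 * C)
    (hW : ∀ n (ρ : ℝ), 0 < ρ → W n ≤ C * (ρ ^ M + (W n - W (n + 1)) / min 1 (v * ρ))) (n : ℕ) :
    W n ≤ 2 * C / growth (1 / (4 * C * M)) v n ^ M := by
  have hM' : (1 : ℝ) ≤ M := by exact_mod_cast hM
  have hC0 : 0 < C := by linarith
  set κ : ℝ := 1 / (4 * C * M)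
  have hκ : 0 < κ := by positivity
  have hCM : 1 ≤ C * M := by nlinarith
  have hκ1 : κ ≤ 1 := by
    rw [div_le_one (by positivity)]; nlinarith
  induction n with
  | zero => simpa [growth] using h0
  | succ n ih =>
    by_contra! hlt
    have hz := growth_pos hκ hv n
    have hz' := growth_pos hκ hv (n + 1)
    have hrec : growth κ v (n + 1) = growth κ v n + κ * min (growth κ v n) v := rfl
    set z := growth κ v n
    set z' := growth κ v (n + 1)
    -- With `ρ = 1 / z'` the term `C ρ^M` is half of the claimed bound at `n + 1`. If that bound
    -- failed, this term would be less than `W n / 2`, and the drop would have to account for the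
    -- other half.
    have hN := hW n (1 / z') (by positivity)
    set μ := min 1 (v * (1 / z'))
    have hμ : 0 < μ := lt_min one_pos (by positivity)
    have hμ1 : μ ≤ 1 := min_le_left _ _
    have e1 : C * (1 / z') ^ M = (2 * C / z' ^ M) / 2 := by
      rw [div_pow, one_pow]; ring
    have h2 := hanti n
    have h3 : W n < W n / 2 + C * ((W n - W (n + 1)) / μ) := by
      rw [mul_add, e1] at hN; linarith
    have h4 : W n * (μ / (2 * C)) < W n - W (n + 1) := by
      have : W n / 2 < C * (W n - W (n + 1)) / μ := by rw [mul_div_assoc]; linarith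
      rw [lt_div_iff₀ hμ] at this
      rw [← mul_div_assoc, div_lt_iff₀ (by positivity)]
      linarith
    set y := μ / (2 * C)
    have hy0 : 0 < y := by positivity
    have hy1 : y ≤ 1 := by
      rw [div_le_one (by positivity)]; linarith
    have h5 : W (n + 1) < 2 * C / z ^ M * (1 - y) := by
      have := mul_le_mul_of_nonneg_right ih (sub_nonneg.2 hy1)
      linarith
    have hmin : min z v ≤ z * (2 * μ) := by
      have hz2 : z' ≤ 2 * z := by
        have : κ * min z v ≤ 1 * z :=
          mul_le_mul hκ1 (min_le_left _ _) (le_min hz.le hv.le) zero_le_one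
        linarith
      rcases le_total 1 (v * (1 / z')) with hc | hc
      · have : μ = 1 := min_eq_left hc
        rw [this]
        exact (min_le_left _ _).trans (by linarith)
      · have : μ = v * (1 / z') := min_eq_right hc
        rw [this]
        refine (min_le_right _ _).trans ?_
        have e : z * (2 * (v * (1 / z'))) = v * (2 * z) / z' := by ring
        rw [e, le_div_iff₀ hz']
        exact mul_le_mul_of_nonneg_left hz2 hv.le
    have h6 : z' ≤ z * (1 + 2 * κ * μ) := by
      have := mul_le_mul_of_nonneg_left hmin hκ.le
      rw [hrec]; nlinarith
    -- The value `κ = 1 / (4CM)` makes `M · 2κμ` equal to `y`, so the growth factor is at most `e^y`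
    -- and is cancelled by `1 - y ≤ e^(-y)`.
    have h7 : z' ^ M * (1 - y) ≤ z ^ M := by
      have e2 : (M : ℝ) * (2 * κ * μ) = y := by
        simp only [κ, y]; field_simp; ring
      calc z' ^ M * (1 - y) ≤ (z * (1 + 2 * κ * μ)) ^ M * (1 - y) := by
            refine mul_le_mul_of_nonneg_right ?_ (sub_nonneg.2 hy1)
            exact pow_le_pow_left₀ hz'.le h6 M
        _ ≤ (z * Real.exp (2 * κ * μ)) ^ M * Real.exp (-y) := by
            have a1 := Real.add_one_le_exp (2 * κ * μ)
            have a2 := Real.add_one_le_exp (-y)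
            have a3 : 0 ≤ 1 - y := sub_nonneg.2 hy1
            refine mul_le_mul (pow_le_pow_left₀ (by positivity) ?_ M) (by linarith) a3
              (by positivity)
            exact mul_le_mul_of_nonneg_left (by linarith) hz.le
        _ = z ^ M := by
            rw [mul_pow, ← Real.exp_nat_mul, e2, mul_assoc, ← Real.exp_add, add_neg_cancel,
              Real.exp_zero, mul_one]
    have h8 : 2 * C / z ^ M * (1 - y) ≤ 2 * C / z' ^ M := by
      rw [div_mul_eq_mul_div, div_le_div_iff₀ (by positivity) (by positivity)]
      nlinarith
    linarith

/-- Exponential decay. -/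
theorem le_mul_exp_of_drop {W : ℕ → ℝ} {C μ : ℝ} (hC : 0 < C) (hμ : μ ≤ C)
    (hW0 : ∀ n, 0 ≤ W n) (h : ∀ n, μ * W n ≤ C * (W n - W (n + 1))) (n k : ℕ) :
    W (n + k) ≤ W n * Real.exp (-(k * μ / C)) := by
  induction k with
  | zero => simp
  | succ k ih =>
    have h1 : W (n + k + 1) ≤ W (n + k) * (1 - μ / C) := by
      have h2 := h (n + k)
      have : μ / C * W (n + k) ≤ W (n + k) - W (n + k + 1) := by
        rw [div_mul_eq_mul_div, div_le_iff₀ hC]; linarith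
      linarith
    have h2 : 0 ≤ 1 - μ / C := by
      rw [sub_nonneg, div_le_one hC]; exact hμ
    have h3 := Real.add_one_le_exp (-(μ / C))
    calc W (n + (k + 1)) ≤ W (n + k) * (1 - μ / C) := h1
      _ ≤ W n * Real.exp (-(k * μ / C)) * Real.exp (-(μ / C)) :=
        mul_le_mul ih (by linarith) h2 ((hW0 _).trans ih)
      _ = W n * Real.exp (-((k + 1 : ℕ) * μ / C)) := by
        rw [mul_assoc, ← Real.exp_add]
        congr 2; push_cast; ring

end Sequences

/-! ### Deep circuits: energy after many layers -/

section Deep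

variable {M : ℕ}

theorem energy_initial (η : Fin M → ℂ) :
    energy (initial η) = Real.exp (-(1 / 2) * normSqSum η) * (Real.pi / 2) ^ M := by
  have e : energy (initial η) = nsq (Finsupp.single (0 : GIdx M) (Real.exp (-normSqSum η / 4))) := by
    simp [energy, initial, nsq]
  rw [e, nsq_eq_ip, ip_single_single, ← Real.exp_add]
  congr 1
  · congr 1; ring
  · norm_num [div_pow]

theorem energy_evolve_le {F : Fin 3 → GSpace M} (h : IsFourierSymm F) (v : ℝ≥0) (η : Fin M → ℂ)
    (l : List (Fin M)) : energy (evolve v η l F) ≤ energy F := (layer_bounds v η l h).1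

/-- Repetitions of a layer. -/
def layers (pre lay : List (Fin M)) (k : ℕ) : List (Fin M) :=
  pre ++ (List.replicate k lay).flatten

theorem layers_succ (pre lay : List (Fin M)) (k : ℕ) :
    layers pre lay (k + 1) = layers pre lay k ++ lay := by
  simp [layers, List.replicate_succ']

/-- The energy of the triple that the initial one has become after many layers. -/
theorem exists_energy_layers_le (hM : 1 ≤ M) : ∃ A c K : ℝ, 0 < A ∧ 0 < c ∧ 0 < K ∧
    ∀ {v : ℝ≥0} {E : ℝ} {n : ℕ}, 0 < v → 1 ≤ E → E / 16 ≤ n * v → A * Real.log E ≤ n →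
    A * Real.log E ≤ E / 16 → ∀ (η : Fin M → ℂ) (pre lay : List (Fin M)), lay ≠ [] →
    (∀ j, j ∈ lay) → lay.length = M → ∀ k, 3 * n ≤ k →
    energy (evolve v η (layers pre lay k) (initial η)) ≤ K *
      (1 / E ^ (2 * M) * Real.exp (-(1 / 2) * normSqSum η) +
        1 / E ^ M * Real.exp (-(c * E) * normSqSum η)) := by
  obtain ⟨C₁, hC₁, hN⟩ := exists_energy_le_nash M
  obtain ⟨C₂, hC₂, hU⟩ := exists_energy_le_uncertainty M hM
  set P : ℝ := (Real.pi / 2) ^ M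
  have hP : 0 < P := by positivity
  set C := C₁ + C₂ + P
  have hC : 1 ≤ C := by simp only [C]; linarith
  have hC0 : 0 < C := by linarith
  have hM' : (1 : ℝ) ≤ M := by exact_mod_cast hM
  set κ : ℝ := 1 / (4 * C * M)
  have hκ : 0 < κ := by positivity
  have hκ1 : κ ≤ 1 := by
    rw [div_le_one (by positivity)]; nlinarith
  have hlogκ : 0 < Real.log (1 + κ) := Real.log_pos (by linarith)
  set D : ℝ := 2 * C * (16 / κ) ^ M
  have hD : 0 < D := by positivity
  -- The first summand of `A` makes `exp(-n / C) ≤ E^(-M)`, the second makes `(1 + κ)^n ≥ E`. The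
  -- rate `c` comes from `n v ≥ E / 16`.
  refine ⟨M * C + 1 / Real.log (1 + κ), 1 / (16 * C), P + D * Real.exp (1 / 2), by positivity,
    by positivity, by positivity, ?_⟩
  intro v E n hv hE hnv hAn hAE η pre lay hne hall hlen k hk
  have hv' : (0 : ℝ) < v := by exact_mod_cast hv
  have hE0 : 0 < E := by linarith
  have hlogE : 0 ≤ Real.log E := Real.log_nonneg hE
  set W : ℕ → ℝ := fun k => energy (evolve v η (layers pre lay k) (initial η))
  have hsymm : ∀ k, IsFourierSymm (evolve v η (layers pre lay k) (initial η)) := fun k =>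
    (isFourierSymm_initial η).evolve v η _
  have hstep : ∀ k, evolve v η lay (evolve v η (layers pre lay k) (initial η)) =
      evolve v η (layers pre lay (k + 1)) (initial η) := fun k => by
    rw [layers_succ, evolve_append]
  have hW0 : ∀ k, 0 ≤ W k := fun k => energy_nonneg _
  have hanti : ∀ k, W (k + 1) ≤ W k := fun k => by
    simp only [W]
    rw [← hstep]; exact energy_evolve_le (hsymm k) v η lay
  have hinit : W 0 ≤ P * Real.exp (-(1 / 2) * normSqSum η) := by
    refine (energy_evolve_le (isFourierSymm_initial η) v η _).trans_eq ?_
    rw [energy_initial, mul_comm]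
  have hη := normSqSum_nonneg η
  have hinit' : W 0 ≤ 2 * C := by
    have : Real.exp (-(1 / 2) * normSqSum η) ≤ 1 := by
      rw [Real.exp_le_one_iff]; linarith
    have h2 : P * Real.exp (-(1 / 2) * normSqSum η) ≤ P := mul_le_of_le_one_right hP.le this
    simp only [C]; linarith
  have hnash : ∀ k (ρ : ℝ), 0 < ρ →
      W k ≤ C * (ρ ^ M + (W k - W (k + 1)) / min 1 (v * ρ)) := by
    intro k ρ hρ
    have h := hN hv η lay hne hall hlen (hsymm k) (fun ζ => abs_ev_evolve_le hv _ η ζ 1) hρ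
    rw [hstep] at h
    refine h.trans (mul_le_mul_of_nonneg_right (by simp only [C]; linarith) ?_)
    have h1 : 0 ≤ W k - W (k + 1) := sub_nonneg.2 (hanti k)
    have h2 : 0 < min 1 (v * ρ) := lt_min one_pos (by positivity)
    exact add_nonneg (by positivity) (div_nonneg h1 h2.le)
  set μ := min 1 (min (v : ℝ) (v * normSqSum η))
  have hunc : ∀ k, μ * W k ≤ C * (W k - W (k + 1)) := by
    intro k
    have h := hU hv η lay hne hall hlen (hsymm k)
    rw [hstep] at h
    refine h.trans (mul_le_mul_of_nonneg_right (by simp only [C]; linarith) ?_)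
    exact sub_nonneg.2 (hanti k)
  have hdec := le_mul_exp_of_drop hC0 ((min_le_left _ _).trans hC) hW0 hunc
  have hMC : M * C * Real.log E ≤ n ∧ M * C * Real.log E ≤ E / 16 := by
    have : M * C * Real.log E ≤ (M * C + 1 / Real.log (1 + κ)) * Real.log E :=
      mul_le_mul_of_nonneg_right (by simp; positivity) hlogE
    exact ⟨this.trans hAn, this.trans hAE⟩
  have hexp : ∀ x : ℝ, M * C * Real.log E ≤ x → Real.exp (-(x / C)) ≤ 1 / E ^ M := by
    intro x hx
    have : M * Real.log E ≤ x / C := by rw [le_div_iff₀ hC0]; linarith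
    calc Real.exp (-(x / C)) ≤ Real.exp (-(M * Real.log E)) := Real.exp_le_exp.2 (by linarith)
      _ = 1 / E ^ M := by
        rw [Real.exp_neg, Real.exp_nat_mul, Real.exp_log hE0, one_div]
  have hWk : W k ≤ W (3 * n) := antitone_nat_of_succ_le hanti hk
  refine hWk.trans ?_
  have hsq : (1 / E ^ M) * (1 / E ^ M) = 1 / E ^ (2 * M) := by
    rw [div_mul_div_comm, ← pow_add]; ring_nf
  have hEM : 0 < 1 / E ^ M := by positivity
  have hpos2 : 0 < 1 / E ^ (2 * M) := by positivity
  set g := Real.exp (-(1 / 2) * normSqSum η)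
  have hg : 0 < g := Real.exp_pos _
  have hg2 : 0 < Real.exp (-(1 / (16 * C) * E) * normSqSum η) := Real.exp_pos _
  -- For `|η| ≥ 1` the decay rate is `min 1 v` throughout: each of three runs of `n` layers gains
  -- `E^(-M)`, of which two are needed, and the initial energy supplies the Gaussian in `η`. For
  -- `|η| ≤ 1` the Nash inequality gains `E^(-M)` in `2n` layers, and the last `n` layers decay
  -- exponentially at a rate depending on `η`.
  rcases le_total 1 (normSqSum η) with hcase | hcase
  · have hμ : μ = min 1 (v : ℝ) := by
      simp only [μ]
      rw [min_eq_left (a := (v : ℝ))]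
      nlinarith
    have h1 := hdec 0 (3 * n)
    rw [zero_add] at h1
    have h2 : M * C * Real.log E ≤ n * μ := by
      rw [hμ, mul_min_of_nonneg _ _ (Nat.cast_nonneg n), mul_one]
      exact le_min hMC.1 (hMC.2.trans hnv)
    have h3 : Real.exp (-((3 * n : ℕ) * μ / C)) ≤ 1 / E ^ (2 * M) := by
      have h4 := hexp _ h2
      have h5 : Real.exp (-(n * μ / C)) ≤ 1 := by
        rw [Real.exp_le_one_iff, neg_nonpos]
        have : 0 ≤ M * C * Real.log E := by positivity
        exact div_nonneg (this.trans h2) hC0.le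
      have e : Real.exp (-((3 * n : ℕ) * μ / C)) = Real.exp (-(n * μ / C)) *
          (Real.exp (-(n * μ / C)) * Real.exp (-(n * μ / C))) := by
        rw [← Real.exp_add, ← Real.exp_add]; congr 1; push_cast; ring
      rw [e, ← hsq]
      have h6 := Real.exp_pos (-(n * μ / C))
      refine (mul_le_of_le_one_left (by positivity) h5).trans ?_
      exact mul_le_mul h4 h4 h6.le hEM.le
    calc W (3 * n) ≤ P * g * (1 / E ^ (2 * M)) :=
          h1.trans (mul_le_mul hinit h3 (Real.exp_nonneg _) (by positivity))
      _ = P * (1 / E ^ (2 * M) * g) := by ring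
      _ ≤ _ := by
        refine mul_le_mul (le_add_of_nonneg_right (by positivity))
          (le_add_of_nonneg_right (by positivity)) (by positivity) (by positivity)
  · have hμ : μ = min 1 (v * normSqSum η) := by
      simp only [μ]
      rw [min_eq_right (a := (v : ℝ))]
      nlinarith
    have h1 : W (2 * n) ≤ D * (1 / E ^ M) := by
      have h2 := le_div_growth_pow hM hC hv' hanti hinit' hnash (2 * n)
      have h3 := min_le_growth_add hκ hv' n n
      rw [← two_mul] at h3
      have h4 : κ * E / 16 ≤ growth κ v (2 * n) := by
        refine le_trans (le_min ?_ ?_) h3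
        · have : Real.log E ≤ n * Real.log (1 + κ) := by
            have h5 : 1 / Real.log (1 + κ) * Real.log E ≤ n := by
              refine le_trans ?_ hAn
              exact mul_le_mul_of_nonneg_right (le_add_of_nonneg_left (by positivity)) hlogE
            rw [one_div_mul_eq_div, div_le_iff₀ hlogκ] at h5
            exact h5
          have h6 := Real.exp_le_exp.2 this
          rw [Real.exp_log hE0, Real.exp_nat_mul, Real.exp_log (by linarith)] at h6
          refine le_trans ?_ h6
          nlinarith
        · have := mul_le_mul_of_nonneg_left hnv hκ.le
          linarith
      refine h2.trans ?_
      calc 2 * C / growth κ v (2 * n) ^ M ≤ 2 * C / (κ * E / 16) ^ M := by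
            refine div_le_div_of_nonneg_left (by positivity) (by positivity) ?_
            exact pow_le_pow_left₀ (by positivity) h4 M
        _ = D * (1 / E ^ M) := by
            simp only [D]
            rw [div_pow, div_pow, mul_pow]
            field_simp
    have h2 := hdec (2 * n) n
    have e : 2 * n + n = 3 * n := by ring
    rw [e] at h2
    have h3 : Real.exp (-(n * μ / C)) ≤ 1 / E ^ M +
        Real.exp (-(1 / (16 * C) * E) * normSqSum η) := by
      rcases le_total 1 (v * normSqSum η) with hc | hc
      · rw [hμ, min_eq_left hc, mul_one]
        have := hexp n hMC.1
        linarith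
      · rw [hμ, min_eq_right hc]
        refine le_trans (Real.exp_le_exp.2 ?_) (le_add_of_nonneg_left hEM.le)
        have h4 := mul_le_mul_of_nonneg_right hnv hη
        have h5 : 1 / (16 * C) * E * normSqSum η = E / 16 * normSqSum η / C := by
          field_simp
        rw [neg_mul, h5, neg_le_neg_iff]
        refine div_le_div_of_nonneg_right ?_ hC0.le
        linarith
    -- For `|η| ≤ 1` the Gaussian `g` is bounded below and may be inserted, so that both cases end
    -- in the same function integrable in `η`.
    have hge : 1 ≤ Real.exp (1 / 2) * g := by
      rw [← Real.exp_add, Real.one_le_exp_iff]; linarith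
    have h4 : W (3 * n) ≤ D * (1 / E ^ M) *
        (1 / E ^ M + Real.exp (-(1 / (16 * C) * E) * normSqSum η)) :=
      h2.trans (mul_le_mul h1 h3 (Real.exp_nonneg _) (by positivity))
    have hexp1 : (1 : ℝ) ≤ Real.exp (1 / 2) := Real.one_le_exp (by norm_num)
    set b := Real.exp (-(1 / (16 * C) * E) * normSqSum η)
    calc W (3 * n) ≤ D * (1 / E ^ (2 * M) * 1 + 1 / E ^ M * b * 1) := by
          rw [← hsq]; refine h4.trans_eq (by ring)
      _ ≤ D * (1 / E ^ (2 * M) * (Real.exp (1 / 2) * g) +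
          1 / E ^ M * b * Real.exp (1 / 2)) := by gcongr
      _ = D * Real.exp (1 / 2) * (1 / E ^ (2 * M) * g + 1 / E ^ M * b) := by ring
      _ ≤ _ := by
        refine mul_le_mul_of_nonneg_right (le_add_of_nonneg_left hP.le) (by positivity)

end Deep

/-! ### Cutting the circuit in the middle -/

section Splitting

variable {M : ℕ}

/-- The inner product of triples. -/
def tripleIp (F G : Fin 3 → GSpace M) : ℝ := ip (F 0) (G 0) + ip (F 1) (G 1) + ip (F 2) (G 2)

theorem abs_tripleIp_le (F G : Fin 3 → GSpace M) :
    |tripleIp F G| ≤ (energy F + energy G) / 2 := by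
  have h0 := abs_ip_le (F 0) (G 0)
  have h1 := abs_ip_le (F 1) (G 1)
  have h2 := abs_ip_le (F 2) (G 2)
  refine (abs_add_three _ _ _).trans ?_
  unfold energy
  linarith

theorem tripleIp_rotate (F G : Fin 3 → GSpace M) :
    tripleIp (rotate F) G = tripleIp F (rotate G) := by
  obtain ⟨h0, h1, h2⟩ := rotate_eq F
  obtain ⟨k0, k1, k2⟩ := rotate_eq G
  simp only [tripleIp, h0, h1, h2, k0, k1, k2, defect, ip_add_left, ip_add_right, ip_smul_left,
    ip_smul_right]
  ring

theorem tripleIp_damp (v : ℝ≥0) (η : Fin M → ℂ) (j : Fin M) (F G : Fin 3 → GSpace M) :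
    tripleIp (damp v η j F) G = tripleIp F (damp v η j G) := by
  simp only [tripleIp, damp, Matrix.cons_val_zero, Matrix.cons_val_one, Matrix.cons_val_two,
    Matrix.head_cons, Matrix.tail_cons, ip_smul_left, ip_smul_right,
    ip_mult_left, ip_conv_left]

/-- Rotations and dampings are self-adjoint, so moving the blocks to the other side reverses their
order. The rotation in front compensates for the asymmetry of a block: rotations and dampings then
alternate with a rotation at both ends. -/
theorem tripleIp_rotate_evolve (v : ℝ≥0) (η : Fin M → ℂ) (l : List (Fin M))
    (F G : Fin 3 → GSpace M) : tripleIp (rotate F) (evolve v η l G) =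
      tripleIp (rotate (evolve v η l.reverse F)) G := by
  induction l generalizing G with
  | nil => rfl
  | cons j l ih =>
    rw [evolve_cons, ih, List.reverse_cons, evolve_concat, tripleIp_rotate (damp _ _ _ _),
      tripleIp_damp]

theorem damp_initial (v : ℝ≥0) (η : Fin M → ℂ) (j : Fin M) :
    tripleIp (damp v η j (initial η)) = fun G =>
      Real.exp (-v * ‖η j‖ ^ 2) * tripleIp (initial η) G := by
  funext G
  simp [tripleIp, damp, initial, ip_zero_left, ip_smul_left, -Finsupp.smul_single]

/-- The correlation of the final with the initial triple is bounded by the energies reached from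
both ends of the circuit. -/
theorem abs_integral_evolve_le_energy (v : ℝ≥0) (η : Fin M → ℂ) (l₁ l₂ : List (Fin M))
    (j : Fin M) :
    |∫ ζ, ev ζ (initial η 0) * ev ζ (evolve v η (l₁ ++ (l₂ ++ [j])) (initial η) 0)| ≤
      (energy (evolve v η l₁ (initial η)) + energy (evolve v η l₂.reverse (initial η))) / 2 := by
  have e1 : ∫ ζ, ev ζ (initial η 0) * ev ζ (evolve v η (l₁ ++ (l₂ ++ [j])) (initial η) 0) =
      tripleIp (initial η) (evolve v η (l₁ ++ (l₂ ++ [j])) (initial η)) := by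
    have h1 : initial η 1 = 0 := rfl
    have h2 : initial η 2 = 0 := rfl
    rw [tripleIp, h1, h2, ip_zero_left, ip_zero_left, add_zero, add_zero, ip]
  -- The damping of the very last block is moved onto the initial triple, where it is a scalar of
  -- size at most one; the rotation left behind is the one required for reversing the second half.
  rw [e1, evolve_append, evolve_concat, ← tripleIp_damp, damp_initial]
  simp only []
  rw [← tripleIp_rotate, tripleIp_rotate_evolve, abs_mul, abs_of_nonneg (Real.exp_nonneg _)]
  have h1 : Real.exp (-v * ‖η j‖ ^ 2) ≤ 1 := by
    rw [Real.exp_le_one_iff, neg_mul]; exact neg_nonpos.2 (by positivity)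
  refine (mul_le_of_le_one_left (abs_nonneg _) h1).trans ((abs_tripleIp_le _ _).trans ?_)
  have h2 := energy_rotate (evolve v η l₂.reverse (initial η))
  have h3 := nsq_nonneg (defect (evolve v η l₂.reverse (initial η)))
  linarith

theorem modeList_eq (L M : ℕ) :
    modeList L M = (List.replicate L (List.finRange M)).flatten := by
  have h : ∀ l : List (Fin L), (l ×ˢ List.finRange M).map Prod.snd =
      (List.replicate l.length (List.finRange M)).flatten := by
    intro l
    induction l with
    | nil => simp
    | cons a l ih =>
      rw [List.product_cons, List.map_append, ih, List.length_cons, List.replicate_succ,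
        List.flatten_cons, List.map_map]
      congr 1
      simp [Function.comp_def]
  have := h (List.finRange L)
  rw [List.length_finRange] at this
  exact this

/-- The upper bound for deep circuits. -/
theorem IsPureGaussian.integral_cost_sq_le_deep (hM : 1 ≤ M) : ∃ A : ℝ, 0 < A ∧
    ∀ {ψ : Wave M}, IsPureGaussian ψ → ∃ b : ℝ, 0 < b ∧ ∀ (L : ℕ) (E : ℝ), 1 ≤ E →
      A * Real.log E ≤ E → A * Real.log E ≤ L → 8 ≤ L →
      ∫ x : Params L M, cost ψ x ^ 2 ∂(ensemble E L M) ≤ b / E ^ (2 * M) := by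
  obtain ⟨A, c, K, hA, hc, hK, h⟩ := exists_energy_layers_le hM
  -- The factor `16` is lost in `n = L / 8` with rounding, since only `n ≥ L / 16` is guaranteed.
  refine ⟨16 * A, by positivity, fun {ψ} hψ => ?_⟩
  obtain ⟨C, hC, hcost⟩ := hψ.integral_cost_sq_le
  refine ⟨C * (K * ((Real.pi / (1 / 2)) ^ M + (Real.pi / c) ^ M)), by positivity,
    fun L E hE hAE hAL hL => ?_⟩
  have hE0 : 0 < E := by linarith
  have hL' : (0 : ℝ) < L := by exact_mod_cast (by omega : 0 < L)
  have hv0 : 0 < E / L := by positivity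
  obtain ⟨v, hv⟩ : ∃ v : ℝ≥0, (v : ℝ) = E / L := ⟨⟨E / L, hv0.le⟩, rfl⟩
  have hvpos : 0 < v := by rw [← NNReal.coe_pos, hv]; exact hv0
  have hvL : v * (L : ℝ) = E := by rw [hv]; field_simp
  -- Each half must contain `3n` full layers, and one layer is cut to remove its last block: `6n + 1
  -- ≤ L` holds because `L ≥ 8`.
  obtain ⟨n, hn⟩ : ∃ n, n = L / 8 := ⟨_, rfl⟩
  have hn16 : (L : ℝ) ≤ 16 * n := by exact_mod_cast (by omega : L ≤ 16 * n)
  have hnv : E / 16 ≤ n * v := by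
    have hv' : (0 : ℝ) ≤ v := v.2
    nlinarith
  have hE' : ∀ η (pre lay : List (Fin M)), lay ≠ [] → (∀ j, j ∈ lay) → lay.length = M →
      ∀ k, 3 * n ≤ k → energy (evolve v η (layers pre lay k) (initial η)) ≤ K *
      (1 / E ^ (2 * M) * Real.exp (-(1 / 2) * normSqSum η) +
        1 / E ^ M * Real.exp (-(c * E) * normSqSum η)) :=
    h hvpos hE hnv (by linarith) (by linarith)
  obtain ⟨lay, j, hlay⟩ : ∃ lay j, List.finRange M = lay ++ [j] := by
    have : List.finRange M ≠ [] := by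
      rw [Ne, List.finRange_eq_nil_iff]; omega
    exact ⟨_, _, (List.dropLast_append_getLast this).symm⟩
  obtain ⟨k, hk, hLk⟩ : ∃ k, 3 * n ≤ k ∧ L = 3 * n + (k + 1) := ⟨L - 3 * n - 1, by omega, by omega⟩
  -- The final layer is split as `lay ++ [j]`. Read backwards, the second half starts with the
  -- incomplete layer `lay.reverse`, which the prefix of `layers` accommodates.
  have hlist : modeList L M = layers [] (List.finRange M) (3 * n) ++
      (((List.replicate k (List.finRange M)).flatten ++ lay) ++ [j]) := by
    rw [modeList_eq, hLk, List.replicate_add, List.flatten_append, List.replicate_succ',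
      List.flatten_append, List.flatten_singleton, layers, List.nil_append]
    nth_rw 3 [hlay]
    simp
  have hrev : ((List.replicate k (List.finRange M)).flatten ++ lay).reverse =
      layers lay.reverse (List.finRange M).reverse k := by
    rw [List.reverse_append, layers, List.reverse_flatten, List.map_replicate,
      List.reverse_replicate]
  have hne : List.finRange M ≠ [] := by rw [hlay]; simp
  have hB : ∀ η, |∫ ζ, ev ζ (initial η 0) * ev ζ (evolve v η (modeList L M) (initial η) 0)| ≤ K *
      (1 / E ^ (2 * M) * Real.exp (-(1 / 2) * normSqSum η) +
        1 / E ^ M * Real.exp (-(c * E) * normSqSum η)) := by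
    intro η
    rw [hlist]
    refine (abs_integral_evolve_le_energy v η _ _ j).trans ?_
    rw [hrev]
    have h1 := hE' η [] (List.finRange M) hne (fun j => List.mem_finRange j)
      (List.length_finRange) (3 * n) le_rfl
    have h2 := hE' η lay.reverse (List.finRange M).reverse (by simpa using hne)
      (fun j => by simp) (by simp) k hk
    linarith
  have i1 : Integrable fun η : Fin M → ℂ => 1 / E ^ (2 * M) * Real.exp (-(1 / 2) * normSqSum η) :=
    (integrable_exp_neg_mul_normSqSum (by norm_num)).const_mul _
  have i2 : Integrable fun η : Fin M → ℂ => 1 / E ^ M * Real.exp (-(c * E) * normSqSum η) :=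
    (integrable_exp_neg_mul_normSqSum (by positivity)).const_mul _
  -- Integrating over `η`, the first term keeps `E^(-2M)`, while the narrow Gaussian of the second
  -- supplies the missing `E^(-M)`.
  have hfin := hcost L v (by omega) hvpos ((i1.add i2).const_mul K) hB
  rw [hvL, integral_const_mul, integral_add' i1 i2, integral_const_mul, integral_const_mul,
    integral_exp_neg_mul_normSqSum (by norm_num),
    integral_exp_neg_mul_normSqSum (by positivity)] at hfin
  refine hfin.trans_eq ?_
  have e : E ^ (2 * M) = E ^ M * E ^ M := by rw [← pow_add]; ring_nf
  rw [e, div_pow _ (c * E), mul_pow, div_pow _ c]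
  field_simp

end Splitting

/-! ### Lower bounds for the variance -/

section Variance

variable {M : ℕ}

theorem IsPureGaussian.le_variance_grad {ψ : Wave M} (hψ : IsPureGaussian ψ) (hM : 1 ≤ M) :
    ∃ a : ℝ, 0 < a ∧ ∀ (L : ℕ) (E : ℝ), 1 ≤ L → 1 ≤ E → ∀ k : Block L M,
      a * (3 / 4) ^ (M * L) / E ^ M ≤ variance (grad ψ k) (ensemble E L M) ∧
      a / E ^ (2 * M) ≤ variance (grad ψ k) (ensemble E L M) := by
  obtain ⟨c, a, hc, ha, h⟩ := hψ.le_integral_cost_sq hM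
  -- The factor `192` is the comparison of cost and gradient; the power of `1 + a` comes from `1 +
  -- aE ≤ (1 + a)E` for `E ≥ 1`.
  refine ⟨c / (192 * (1 + a) ^ (2 * M)), by positivity, fun L E hL hE k => ?_⟩
  have hE0 : 0 < E := by linarith
  obtain ⟨h1, h2⟩ := h L E hL hE0
  have h3 := QumodeVQC.integral_cost_sq_le hψ.1 hψ.2.1 k E
  have hinv : ((1 + a) * E)⁻¹ ≤ (1 + a * E)⁻¹ := inv_anti₀ (by positivity) (by nlinarith)
  have hpow : ∀ n : ℕ, n ≤ 2 * M →
      1 / ((1 + a) ^ (2 * M) * E ^ n) ≤ ((1 + a * E)⁻¹) ^ n := by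
    intro n hn
    refine le_trans ?_ (pow_le_pow_left₀ (by positivity) hinv n)
    rw [inv_pow, mul_pow, one_div]
    refine inv_anti₀ (by positivity) ?_
    exact mul_le_mul_of_nonneg_right (pow_le_pow_right₀ (by linarith) hn) (by positivity)
  constructor
  · have h4 := mul_le_mul_of_nonneg_left (hpow M (by omega))
      (by positivity : 0 ≤ c * (3 / 4) ^ (M * L))
    have e : c / (192 * (1 + a) ^ (2 * M)) * (3 / 4) ^ (M * L) / E ^ M =
        c * (3 / 4) ^ (M * L) * (1 / ((1 + a) ^ (2 * M) * E ^ M)) / 192 := by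
      field_simp
    rw [e]
    linarith
  · have h4 := mul_le_mul_of_nonneg_left (hpow (2 * M) le_rfl) hc.le
    have e : c / (192 * (1 + a) ^ (2 * M)) / E ^ (2 * M) =
        c * (1 / ((1 + a) ^ (2 * M) * E ^ (2 * M))) / 192 := by
      field_simp
    rw [e]
    linarith

end Variance

end QumodeVQC

end

/-! ### The variance of the gradient for shallow and deep circuits -/

open QumodeVQC
theorem theorem3 (M : ℕ) (hM : 1 ≤ M) :
    ∃ c₁ c₂ : ℝ, 0 < c₁ ∧ 0 < c₂ ∧ ∀ ψ : Wave M, IsPureGaussian ψ →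
      -- the gradient exists, is square-integrable, and has mean zero
      (∀ (L : ℕ) (E : ℝ), 1 ≤ L → 0 < E → ∀ k : Block L M,
        (∀ x : Params L M, Differentiable ℝ (costAlong ψ k x)) ∧
        MemLp (grad ψ k) 2 (ensemble E L M) ∧
        ∫ x, grad ψ k x ∂(ensemble E L M) = 0) ∧
      -- shallow circuits, uniformly in the depth
      (∃ a b E₀ : ℝ, 0 < a ∧ 0 < b ∧ 0 < E₀ ∧ ∀ (E : ℝ) (L : ℕ), E₀ ≤ E → 1 ≤ L →
        (L : ℝ) ≤ c₁ * Real.log E → ∀ k : Block L M,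
          a * (3 / 4) ^ (M * L) / E ^ M ≤ variance (grad ψ k) (ensemble E L M) ∧
          variance (grad ψ k) (ensemble E L M) ≤
            b * (3 / 4) ^ (M * L) / E ^ M) ∧
      -- in particular, at every fixed depth
      (∀ (L : ℕ), 1 ≤ L → ∀ k : Block L M,
        (fun E : ℝ => variance (grad ψ k) (ensemble E L M))
          =Θ[Filter.atTop] fun E : ℝ => 1 / E ^ M) ∧
      -- deep circuits, uniformly in the depth
      (∃ a b E₀ : ℝ, 0 < a ∧ 0 < b ∧ 0 < E₀ ∧ ∀ (E : ℝ) (L : ℕ), E₀ ≤ E →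
        c₂ * Real.log E ≤ (L : ℝ) → ∀ k : Block L M,
          a / E ^ (2 * M) ≤ variance (grad ψ k) (ensemble E L M) ∧
          variance (grad ψ k) (ensemble E L M) ≤ b / E ^ (2 * M)) := by
  obtain ⟨A, hA, hdeep⟩ := IsPureGaussian.integral_cost_sq_le_deep hM
  have hc₁ : (0 : ℝ) < 1 / (M + 2) := by positivity
  refine ⟨1 / (M + 2), A, hc₁, hA, fun ψ hψ => ?_⟩
  obtain ⟨a, ha, hlow⟩ := hψ.le_variance_grad hM
  obtain ⟨b, hb, hshallow⟩ := hψ.integral_cost_sq_le_shallow hM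
  obtain ⟨d, hd, hup⟩ := hdeep hψ
  have hsh : ∀ (E : ℝ) (L : ℕ), 1 ≤ E → 1 ≤ L → (L : ℝ) ≤ 1 / (M + 2) * Real.log E →
      ∀ k : Block L M, a * (3 / 4) ^ (M * L) / E ^ M ≤ variance (grad ψ k) (ensemble E L M) ∧
        variance (grad ψ k) (ensemble E L M) ≤ b * (3 / 4) ^ (M * L) / E ^ M := by
    intro E L hE hL hlog k
    refine ⟨(hlow L E hL hE k).1, (variance_grad_le hψ.1 hψ.2.1 k E).trans ?_⟩
    refine hshallow L E hL hE ?_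
    rw [one_div_mul_eq_div, le_div_iff₀ (by positivity)] at hlog
    linarith
  refine ⟨fun L E _ _ k => ⟨fun x t => (hasDerivAt_costAlong hψ.1 k x t).differentiableAt,
    memLp_grad hψ.1 hψ.2.1 k E, integral_grad hψ.1 hψ.2.1 k E⟩, ⟨a, b, 1, ha, hb, one_pos, hsh⟩,
    fun L hL k => ?_, ?_⟩
  · have hev : ∀ᶠ E : ℝ in Filter.atTop, a * (3 / 4) ^ (M * L) / E ^ M ≤
        variance (grad ψ k) (ensemble E L M) ∧
        variance (grad ψ k) (ensemble E L M) ≤ b * (3 / 4) ^ (M * L) / E ^ M := by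
      -- A fixed depth eventually satisfies the logarithmic condition, and `(3/4)^(ML)` is then a
      -- constant.
      have hlog := (Real.tendsto_log_atTop.const_mul_atTop hc₁).eventually_ge_atTop (L : ℝ)
      filter_upwards [hlog, Filter.eventually_ge_atTop 1] with E h1 h2
      exact hsh E L h2 hL h1 k
    have hpos : 0 < a * (3 / 4 : ℝ) ^ (M * L) := by positivity
    constructor
    · refine Asymptotics.IsBigO.of_bound (b * (3 / 4) ^ (M * L)) ?_
      filter_upwards [hev, Filter.eventually_ge_atTop 1] with E h1 h2
      have hE : 0 < E := by linarith
      rw [Real.norm_of_nonneg (variance_nonneg _ _), Real.norm_of_nonneg (by positivity),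
        mul_one_div]
      exact h1.2
    · refine Asymptotics.IsBigO.of_bound (a * (3 / 4) ^ (M * L))⁻¹ ?_
      filter_upwards [hev, Filter.eventually_ge_atTop 1] with E h1 h2
      have hE : 0 < E := by linarith
      rw [Real.norm_of_nonneg (variance_nonneg _ _), Real.norm_of_nonneg (by positivity),
        le_inv_mul_iff₀ hpos, mul_one_div]
      exact h1.1
  · have h1 : ∀ᶠ E : ℝ in Filter.atTop, A * Real.log E ≤ E := by
      have := Real.isLittleO_log_id_atTop.def (c := A⁻¹) (by positivity)
      filter_upwards [this, Filter.eventually_ge_atTop 1] with E h1 h2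
      rw [Real.norm_of_nonneg (Real.log_nonneg h2), id, Real.norm_of_nonneg (by linarith),
        le_inv_mul_iff₀ hA] at h1
      exact h1
    -- Forces `L ≥ 8` from the depth condition alone; `h1` supplies the requirement that `A log E`
    -- not exceed `E`.
    have h2 := (Real.tendsto_log_atTop.const_mul_atTop hA).eventually_ge_atTop 8
    obtain ⟨E₀, hE₀⟩ := Filter.eventually_atTop.1
      (h1.and (h2.and (Filter.eventually_ge_atTop (1 : ℝ))))
    refine ⟨a, d, max E₀ 1, ha, hd, by positivity, fun E L hE hL k => ?_⟩
    obtain ⟨h3, h4, h5⟩ := hE₀ E ((le_max_left _ _).trans hE)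
    have hL8 : 8 ≤ L := by exact_mod_cast h4.trans hL
    exact ⟨(hlow L E (by omega) h5 k).2,
      (variance_grad_le hψ.1 hψ.2.1 k E).trans (hup L E h5 h3 hL hL8)⟩
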